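/- Let $\Omega_n=\{|r-\mathbf R_n|<R_n\}\subset\mathbb R^3$ ($n=1,\dots,N$, $R_n>0$) be non-overlapping balls with boundary spheres $\Gamma_n$, let $\Omega^{I}=\mathbb R^3\setminus\bigcup_n\overline{\Omega_n}$, and write $r_n=r-\mathbf R_n$. Let $V(r)=\sum_n v_n(|r_n|)\in L^2(\mathbb R^3)$ with $v_n$ real, smooth on $(0,R_n)$, and $v_n=0$ on $(R_n,\infty)$. Let $Y_{\ell m}$ ($|m|\le\ell$) be the real orthonormal spherical harmonics, $j_\ell,n_\ell$ the spherical Bessel and Neumann functions, $h_\ell=j_\ell+i\,n_\ell$; for $z<0$ let $\sqrt z=i\sqrt{|z|}$ and $H_{\ell m}(x;z)=h_\ell(\sqrt z|x|)Y_{\ell m}(x/|x|)$. For $\chi$ a non-trivial solution, bounded near $0$, of $\chi''+\frac2r\chi'-\frac{\ell(\ell+1)}{r^2}\chi-v_n\chi+z\chi=0$ on $(0,R_n)$, put $$t^n_\ell(z)=\frac{\sqrt z\,\chi(R_n)\,j_\ell'(\sqrt zR_n)-\chi'(R_n)\,j_\ell(\sqrt zR_n)}{\chi'(R_n)\,h_\ell(\sqrt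 zR_n)-\sqrt z\,\chi(R_n)\,h_\ell'(\sqrt zR_n)}$$ with $\chi'(R_n)$ the left-hand derivative ($\chi$ is unique up to a factor, so $t^n_\ell$ does not depend on the choice). Let $\chi^n_\ell(\cdot;z)$ be this solution normalized such that it is continued in a $C^1$ way to $r\ge R_n$ by $j_\ell(\sqrt zr)+t^n_\ell(z)h_\ell(\sqrt zr)$, and let $\zeta^n_{\ell m}(r_n;z)=\chi^n_\ell(|r_n|;z)\,Y_{\ell m}(r_n/|r_n|)$ in $\Omega_n$. For $n\neq n'$ let $$g^{nn'}_{\ell m,\ell'm'}(z)=4\pi\sum_{\ell''\ge 0}\sum_{|m''|\le\ell''}i^{\ell-\ell'-\ell''}\Big(\int_{S^2}Y_{\ell m}Y_{\ell'm'}Y_{\ell''m''}\Big)H_{\ell''m''}(\mathbf R_{n'}-\mathbf R_n;z),$$ and let $g^{nn}_{\ell m,\ell'm'}=0$. For $L\ge0$ let $S(z)$ be the matrix, indexed by the triples $(n,\ell,m)$ with $1\le n\le N$, $\ell\le L$, $|m|\le\ell$, with entries $S_{n\ell m,n'\ell'm'}(z)=\delta_{nn'}\delta_{\ell\ell'}\delta_{mm'}-t^{n'}_{\ell'}(z)\,g^{nn'}_{\ell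 m,\ell'm'}(z)$. We say that $E_L$ solves the truncated KKR secular equation if $\det S(E_L)=0$. Let $H^\delta(\mathbb R^3)$ be the space of $v\in L^2(\mathbb R^3)$ with $v|_{\Omega^I}\in H^1(\Omega^I)$ and $v|_{\Omega_n}\in H^1(\Omega_n)$ for all $n$. A function $f$ with traces $f^{+},f^{-}$ on $\Gamma_n$ from inside and outside $\Omega_n$ is called weakly continuous through $\Gamma_n$ if $\int_{S^2}(f^+-f^-)Y_{\ell m}=0$ for all $\ell\le L$, $|m|\le\ell$. Let $\mathcal W_L(z)$ be the set of $\psi\in H^\delta(\mathbb R^3)$ such that, for some complex coefficients $\tilde c,\bar c$, $\psi=\sum_{n}\sum_{\ell\le L,|m|\le\ell}\tilde c_{n\ell m}H_{\ell m}(r_n;z)$ in $\Omega^I$ and $\psi=\sum_{\ell\le L,|m|\le\ell}\bar c_{n\ell m}\zeta^n_{\ell m}(r_n;z)$ in $\Omega_n$ for each $n$, and such that $\psi$ and its radial derivative $\partial\psi/\partial r_n$ (with respect to $\mathbf R_n$) are weakly continuous through $\Gamma_n$, for $n=1,\dots,N$. Let $E_L<0$ be such that the denominator of $t^n_\ell(E_L)$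 is non-zero for all $n$ and all $\ell\le L$. Then $E_L$ solves the truncated KKR secular equation if and only if $\mathcal W_L(E_L)\setminus\{0\}\ne\emptyset$. Moreover, if $E_L$ solves the truncated KKR secular equation, then $\mathcal W_L(E_L)$ is the set of all $u\in H^\delta(\mathbb R^3)$ for which there are coefficients $a=(a^n_{\ell m})$ with $S(E_L)a=0$ such that $u=\sum_{\ell\le L,|m|\le\ell}a^n_{\ell m}\zeta^n_{\ell m}(r_n;E_L)$ in $\Omega_n$ for each $n$ and $u=\sum_{n}\sum_{\ell\le L,|m|\le\ell}t^n_\ell(E_L)\,a^n_{\ell m}H_{\ell m}(r_n;E_L)$ in $\Omega^I$. -/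

import Mathlib

open MeasureTheory Filter Topology

open scoped ContDiff ENNReal

noncomputable section

namespace KKR

/-- Euclidean three-space. -/
abbrev E3 : Type := EuclideanSpace ℝ (Fin 3)

/-! ### Special functions -/

/-- The direction `x / |x|` of a non-zero vector. -/
def direction (x : E3) : E3 := ‖x‖⁻¹ • x

/-- Integration of a function on the unit sphere `S²` with respect to the surface measure
(total mass `4π`). -/
def sphereIntegral (f : E3 → ℂ) : ℂ :=
  ∫ θ : Metric.sphere (0 : E3) 1, f (θ : E3) ∂((volume : Measure E3).toSphere)

/-- The Legendre polynomial `P_ℓ` (Rodrigues' formula). -/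
def legendrePoly (ℓ : ℕ) : Polynomial ℝ :=
  Polynomial.C ((2 ^ ℓ * (ℓ.factorial : ℝ))⁻¹) *
    Polynomial.derivative^[ℓ] ((Polynomial.X ^ 2 - 1) ^ ℓ)

/-- The azimuthal factor `sin^{|m|} ϑ · (√2 cos mφ, 1, √2 sin |m|φ)` for `m > 0`, `m = 0`, `m < 0`,
written in Cartesian coordinates, where `sin ϑ e^{iφ} = x + i y`. -/
def azimuthal (m : ℤ) (x : E3) : ℝ :=
  if 0 < m then Real.sqrt 2 * (((x 0 : ℂ) + Complex.I * (x 1 : ℂ)) ^ m.natAbs).re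
  else if m = 0 then 1
  else Real.sqrt 2 * (((x 0 : ℂ) + Complex.I * (x 1 : ℂ)) ^ m.natAbs).im

/-- The real orthonormal spherical harmonic `Y_{ℓm}`, `|m| ≤ ℓ`, as a function of a unit vector `x`:
the associated Legendre function is `P_ℓ^{|m|}(cos ϑ) = sin^{|m|} ϑ · P_ℓ^{(|m|)}(cos ϑ)`, with
`cos ϑ = x 2`. -/
def sphericalHarmonic (ℓ : ℕ) (m : ℤ) (x : E3) : ℝ :=
  Real.sqrt ((2 * ℓ + 1) / (4 * Real.pi) *
      (((ℓ - m.natAbs).factorial : ℝ) / ((ℓ + m.natAbs).factorial : ℝ))) *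
    (Polynomial.derivative^[m.natAbs] (legendrePoly ℓ)).eval (x 2) * azimuthal m x

/-- `(-x)^ℓ ((1/x) d/dx)^ℓ f (x)`, for `x ≠ 0`. -/
def rayleigh (f : ℂ → ℂ) (ℓ : ℕ) (x : ℂ) : ℂ :=
  (-x) ^ ℓ * ((fun (g : ℂ → ℂ) (y : ℂ) => deriv g y / y)^[ℓ] f) x

/-- Spherical Bessel function `j_ℓ` (Rayleigh's formula). -/
def sphericalBessel (ℓ : ℕ) : ℂ → ℂ := rayleigh (fun x => Complex.sin x / x) ℓ

/-- Spherical Neumann function `n_ℓ` (Rayleigh's formula). -/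
def sphericalNeumann (ℓ : ℕ) : ℂ → ℂ := rayleigh (fun x => -(Complex.cos x / x)) ℓ

/-- Spherical Hankel function `h_ℓ = j_ℓ + i n_ℓ`. -/
def sphericalHankel (ℓ : ℕ) (x : ℂ) : ℂ := sphericalBessel ℓ x + Complex.I * sphericalNeumann ℓ x

/-- `√z = i √|z|` for an energy `z < 0`. -/
def energyRoot (z : ℝ) : ℂ := Complex.I * (Real.sqrt |z| : ℂ)

/-- `H_{ℓm}(x; z) = h_ℓ(√z |x|) Y_{ℓm}(x/|x|)`. -/
def hankelWave (ℓ : ℕ) (m : ℤ) (z : ℝ) (x : E3) : ℂ :=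
  sphericalHankel ℓ (energyRoot z * (‖x‖ : ℂ)) * (sphericalHarmonic ℓ m (direction x) : ℂ)

/-- The Gaunt coefficient `∫_{S²} Y_{ℓm} Y_{ℓ'm'} Y_{ℓ''m''}`. -/
def gaunt (ℓ : ℕ) (m : ℤ) (ℓ' : ℕ) (m' : ℤ) (ℓ'' : ℕ) (m'' : ℤ) : ℂ :=
  sphereIntegral fun θ =>
    ((sphericalHarmonic ℓ m θ * sphericalHarmonic ℓ' m' θ * sphericalHarmonic ℓ'' m'' θ : ℝ) : ℂ)

/-- The structure constant for the displacement `d ≠ 0`. Only finitely many terms of the series are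
non-zero, since the Gaunt coefficients vanish for `ℓ'' > ℓ + ℓ'`. -/
def structureConstant (ℓ : ℕ) (m : ℤ) (ℓ' : ℕ) (m' : ℤ) (z : ℝ) (d : E3) : ℂ :=
  4 * (Real.pi : ℂ) * ∑' ℓ'' : ℕ, ∑ m'' ∈ Finset.Icc (-(ℓ'' : ℤ)) (ℓ'' : ℤ),
    Complex.I ^ ((ℓ : ℤ) - (ℓ' : ℤ) - (ℓ'' : ℤ)) * gaunt ℓ m ℓ' m' ℓ'' m'' *
      hankelWave ℓ'' m'' z d

/-! ### Single-site scattering -/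

/-- `χ` is a non-trivial solution of the radial Schrödinger equation
`χ'' + (2/r) χ' - ℓ(ℓ+1)/r² χ - v χ + z χ = 0` on `0 < r < R`, continuously differentiable up to
`r = R`, and regular at the origin (the second solution behaves like `r^{-ℓ-1}`). -/
structure IsRegularRadialSolution (v : ℝ → ℝ) (R : ℝ) (ℓ : ℕ) (z : ℝ) (χ : ℝ → ℂ) : Prop where
  contDiffOn : ContDiffOn ℝ 1 χ (Set.Ioc 0 R)
  differentiableAt_deriv : ∀ r ∈ Set.Ioo 0 R, DifferentiableAt ℝ (deriv χ) r
  equation : ∀ r ∈ Set.Ioo 0 R,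
    deriv (deriv χ) r + 2 / (r : ℂ) * deriv χ r - (ℓ : ℂ) * (ℓ + 1) / (r : ℂ) ^ 2 * χ r
      - (v r : ℂ) * χ r + (z : ℂ) * χ r = 0
  bounded : ∃ C : ℝ, ∀ r ∈ Set.Ioc 0 R, ‖χ r‖ ≤ C
  nontrivial : ∃ r ∈ Set.Ioc 0 R, χ r ≠ 0

/-- The left-hand derivative `χ'(R)`. -/
def leftDeriv (χ : ℝ → ℂ) (R : ℝ) : ℂ := derivWithin χ (Set.Iic R) R

/-- The regular solution of the radial Schrödinger equation, which is unique up to a non-zero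
factor. -/
def regularSolution (v : ℝ → ℝ) (R : ℝ) (ℓ : ℕ) (z : ℝ) : ℝ → ℂ :=
  Classical.epsilon (IsRegularRadialSolution v R ℓ z)

/-- The numerator `√z χ(R) j_ℓ'(√z R) - χ'(R) j_ℓ(√z R)` of the `t`-matrix. -/
def tNumerator (v : ℝ → ℝ) (R : ℝ) (ℓ : ℕ) (z : ℝ) : ℂ :=
  energyRoot z * regularSolution v R ℓ z R * deriv (sphericalBessel ℓ) (energyRoot z * R)
    - leftDeriv (regularSolution v R ℓ z) R * sphericalBessel ℓ (energyRoot z * R)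

/-- The denominator `χ'(R) h_ℓ(√z R) - √z χ(R) h_ℓ'(√z R)` of the `t`-matrix. If `χ` is continued to
`r > R` by `a j_ℓ(√z r) + b h_ℓ(√z r)`, then it is a non-zero multiple of `a`. -/
def tDenominator (v : ℝ → ℝ) (R : ℝ) (ℓ : ℕ) (z : ℝ) : ℂ :=
  leftDeriv (regularSolution v R ℓ z) R * sphericalHankel ℓ (energyRoot z * R)
    - energyRoot z * regularSolution v R ℓ z R * deriv (sphericalHankel ℓ) (energyRoot z * R)

/-- The `t`-matrix `t_ℓ(z) = b / a`, meaningful if the denominator does not vanish. -/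
def tMatrix (v : ℝ → ℝ) (R : ℝ) (ℓ : ℕ) (z : ℝ) : ℂ :=
  tNumerator v R ℓ z / tDenominator v R ℓ z

/-- `χ` is the regular solution normalised so that `χ(R) = j_ℓ(√z R) + t_ℓ(z) h_ℓ(√z R)`, that is,
`a = 1`. If `χ(R) ≠ 0`, the condition on the slope follows from the one on the value and the
definition of `t_ℓ`; it fixes the normalisation also in the case `χ(R) = 0`. -/
structure IsNormalizedRadialSolution (v : ℝ → ℝ) (R : ℝ) (ℓ : ℕ) (z : ℝ) (χ : ℝ → ℂ) : Prop where
  regular : IsRegularRadialSolution v R ℓ z χ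
  value : χ R = sphericalBessel ℓ (energyRoot z * R)
    + tMatrix v R ℓ z * sphericalHankel ℓ (energyRoot z * R)
  slope : leftDeriv χ R = energyRoot z * (deriv (sphericalBessel ℓ) (energyRoot z * R)
    + tMatrix v R ℓ z * deriv (sphericalHankel ℓ) (energyRoot z * R))

/-- The normalised radial function `χ_ℓ(r; z)`. -/
def normalizedSolution (v : ℝ → ℝ) (R : ℝ) (ℓ : ℕ) (z : ℝ) : ℝ → ℂ :=
  Classical.epsilon (IsNormalizedRadialSolution v R ℓ z)

/-! ### Muffin-tin systems -/

/-- `N` non-overlapping atomic spheres carrying spherically symmetric potentials, with total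
potential `V(x) = ∑ₙ vₙ(|x - Rₙ|)`. -/
structure MuffinTin (N : ℕ) where
  /-- the atomic positions -/
  center : Fin N → E3
  /-- the radii of the atomic spheres -/
  radius : Fin N → ℝ
  /-- the radial site potentials -/
  pot : Fin N → ℝ → ℝ
  radius_pos : ∀ n, 0 < radius n
  nonoverlapping : ∀ n n', n ≠ n' → radius n + radius n' ≤ dist (center n) (center n')
  pot_smooth : ∀ n, ContDiffOn ℝ ∞ (pot n) (Set.Ioo 0 (radius n))
  pot_support : ∀ n r, radius n < r → pot n r = 0
  pot_memLp : MemLp (fun x : E3 => ∑ n, pot n ‖x - center n‖) 2 volume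

/-- The pairs `(ℓ, m)` with `ℓ ≤ L` and `|m| ≤ ℓ`. -/
abbrev AngIdx (L : ℕ) : Type := (ℓ : Fin (L + 1)) × ↥(Finset.Icc (-(ℓ : ℤ)) (ℓ : ℤ))

namespace MuffinTin

variable {N : ℕ} (T : MuffinTin N)

/-- The atomic sphere `Ωₙ` (an open ball). -/
def atom (n : Fin N) : Set E3 := Metric.ball (T.center n) (T.radius n)

/-- The interstitial region `Ω^I` (an open set). -/
def interstitial : Set E3 := {x | ∀ n, T.radius n < dist x (T.center n)}

/-- `t^n_ℓ(z)`. -/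
def t (n : Fin N) (ℓ : ℕ) (z : ℝ) : ℂ := tMatrix (T.pot n) (T.radius n) ℓ z

/-- `ζ^n_{ℓm}(x - Rₙ; z) = χ^n_ℓ(|x - Rₙ|; z) Y_{ℓm}`, as a function of `x ∈ Ωₙ`. -/
def zeta (n : Fin N) (ℓ : ℕ) (m : ℤ) (z : ℝ) (x : E3) : ℂ :=
  normalizedSolution (T.pot n) (T.radius n) ℓ z ‖x - T.center n‖ *
    (sphericalHarmonic ℓ m (direction (x - T.center n)) : ℂ)

/-- The structure constants `g^{nn'}_{ℓm,ℓ'm'}(z)`, which are `0` for `n = n'`. -/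
def g (n n' : Fin N) (ℓ : ℕ) (m : ℤ) (ℓ' : ℕ) (m' : ℤ) (z : ℝ) : ℂ :=
  if n = n' then 0 else structureConstant ℓ m ℓ' m' z (T.center n' - T.center n)

/-- The truncated KKR matrix
`S_{nℓm,n'ℓ'm'}(z) = δ_{nn'} δ_{ℓℓ'} δ_{mm'} - t^{n'}_{ℓ'}(z) g^{nn'}_{ℓm,ℓ'm'}(z)`. -/
def kkrMatrix (L : ℕ) (z : ℝ) : Matrix (Fin N × AngIdx L) (Fin N × AngIdx L) ℂ :=
  fun p q => (if p = q then 1 else 0)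
    - T.t q.1 q.2.1 z * T.g p.1 q.1 p.2.1 p.2.2 q.2.1 q.2.2 z

/-- `z` solves the truncated KKR secular equation `Det S(z) = 0`. -/
def SolvesKKR (L : ℕ) (z : ℝ) : Prop := (T.kkrMatrix L z).det = 0

end MuffinTin

/-! ### Broken Sobolev space, traces and weak continuity -/

/-- `h` is the weak `i`-th partial derivative of `f` in the open set `U`. -/
def HasWeakPartialOn (U : Set E3) (i : Fin 3) (f h : E3 → ℂ) : Prop :=
  ∀ φ : E3 → ℝ, ContDiff ℝ ∞ φ → HasCompactSupport φ → tsupport φ ⊆ U →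
    ∫ x, f x * ((fderiv ℝ φ x (EuclideanSpace.single i 1) : ℝ) : ℂ) = -∫ x, h x * (φ x : ℂ)

/-- The surface function `w ∈ L²(S²)` is the trace, taken from within the region `A`, of `f` on the
sphere with centre `c` and radius `R`: the mean square deviation of `f` from the radially constant
extension of `w` over the part of a thin shell that lies in `A` tends to zero. -/
def HasTraceFrom (A : Set E3) (c : E3) (R : ℝ) (f w : E3 → ℂ) : Prop :=
  MemLp (fun θ : Metric.sphere (0 : E3) 1 => w (θ : E3)) 2 ((volume : Measure E3).toSphere) ∧
  Tendsto (fun ε : ℝ => (∫⁻ x in A ∩ {x | |‖x - c‖ - R| < ε}, ‖f x - w (direction (x - c))‖ₑ ^ 2)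
      / ENNReal.ofReal ε) (𝓝[>] 0) (𝓝 0)

namespace MuffinTin

variable {N : ℕ} (T : MuffinTin N)

/-- `G ∈ L²` is the gradient of `f` in the sense of weak derivatives in `Ω^I` and in each `Ωₙ`. -/
def IsBrokenGradient (f : E3 → ℂ) (G : E3 → Fin 3 → ℂ) : Prop :=
  ∀ i, MemLp (fun x => G x i) 2 volume ∧
    HasWeakPartialOn T.interstitial i f (fun x => G x i) ∧
    ∀ n, HasWeakPartialOn (T.atom n) i f (fun x => G x i)

/-- The broken Sobolev space `H^δ(ℝ³)`. -/
def brokenH1 : Set (Lp ℂ 2 (volume : Measure E3)) := {ψ | ∃ G, T.IsBrokenGradient ψ G}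

/-- The radial derivative `∂/∂rₙ` with respect to the `n`-th site, of a function with gradient
`G`. -/
def radialDeriv (n : Fin N) (G : E3 → Fin 3 → ℂ) (x : E3) : ℂ :=
  ∑ i, (direction (x - T.center n) i : ℂ) * G x i

/-- `f` is weakly continuous through the surface of the `n`-th atomic sphere: the jump of its traces
from the inside and from the outside is orthogonal to all `Y_{ℓm}` with `ℓ ≤ L`. -/
def IsWeaklyContinuous (L : ℕ) (n : Fin N) (f : E3 → ℂ) : Prop :=
  ∃ wIn wOut : E3 → ℂ,
    HasTraceFrom (T.atom n) (T.center n) (T.radius n) f wIn ∧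
    HasTraceFrom T.interstitial (T.center n) (T.radius n) f wOut ∧
    ∀ ℓ ≤ L, ∀ m ∈ Finset.Icc (-(ℓ : ℤ)) (ℓ : ℤ),
      sphereIntegral (fun θ => (wIn θ - wOut θ) * (sphericalHarmonic ℓ m θ : ℂ)) = 0

/-- `f` equals `∑ₙ ∑_{ℓ ≤ L} b^n_{ℓm} H_{ℓm}(x - Rₙ; z)` almost everywhere in `Ω^I`. -/
def InterstitialExpansion (L : ℕ) (z : ℝ) (b : Fin N × AngIdx L → ℂ) (f : E3 → ℂ) : Prop :=
  ∀ᵐ x ∂volume.restrict T.interstitial,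
    f x = ∑ p : Fin N × AngIdx L, b p * hankelWave p.2.1 p.2.2 z (x - T.center p.1)

/-- `f` equals `∑_{ℓ ≤ L} a^n_{ℓm} ζ^n_{ℓm}(x - Rₙ; z)` almost everywhere in `Ωₙ`, for each `n`. -/
def AtomicExpansion (L : ℕ) (z : ℝ) (a : Fin N × AngIdx L → ℂ) (f : E3 → ℂ) : Prop :=
  ∀ n, ∀ᵐ x ∂volume.restrict (T.atom n),
    f x = ∑ q : AngIdx L, a (n, q) * T.zeta n q.1 q.2 z x

/-- The space `W_L(z)`. -/
def weakSpace (L : ℕ) (z : ℝ) : Set (Lp ℂ 2 (volume : Measure E3)) :=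
  {ψ | (∃ b, T.InterstitialExpansion L z b ψ) ∧ (∃ a, T.AtomicExpansion L z a ψ) ∧
    (∀ n, T.IsWeaklyContinuous L n ψ) ∧
    ∃ G, T.IsBrokenGradient ψ G ∧ ∀ n, T.IsWeaklyContinuous L n (T.radialDeriv n G)}

/-- The set of KKR wave functions in `H^δ(ℝ³)`: the interior coefficients solve `S(z) a = 0` and the
interstitial ones are `b^n_{ℓm} = t^n_ℓ(z) a^n_{ℓm}`. -/
def waveFunctions (L : ℕ) (z : ℝ) : Set (Lp ℂ 2 (volume : Measure E3)) :=
  {u | u ∈ T.brokenH1 ∧ ∃ a : Fin N × AngIdx L → ℂ, (T.kkrMatrix L z).mulVec a = 0 ∧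
    T.AtomicExpansion L z a u ∧
    T.InterstitialExpansion L z (fun p => T.t p.1 p.2.1 z * a p) u}

end MuffinTin

end KKR

end

set_option linter.unusedSimpArgs false
set_option linter.unusedVariables false

noncomputable section

namespace KKR

/-! A function in the weak space is given by its coefficients `a` inside the atoms and `b` in the
interstitial region, so that weak continuity through the spheres is a finite linear system for `(a,
b)`. On the `n`-th sphere the inner trace has `(ℓ, m)`-component `a χ(R)`. In the outer trace the
waves centred at the site itself contribute `b h_ℓ(√E R)`. The waves centred at the other sites are
regular near the `n`-th ball, and by the addition theorem their component is `(∑ g b) j_ℓ(√E R)`.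
Radial derivatives give the same relation with derivatives of `χ`, `h_ℓ` and `j_ℓ`. Since `χ` is
normalised to continue as `j_ℓ + t h_ℓ`, and the Wronskian of `j_ℓ` and `h_ℓ` does not vanish,
equality of values and slopes is equivalent to `a = ∑ g b` and `b = t a`, that is, to `S(E) a = 0`
and `b = t a` (`matching_iff`, `isWeaklyContinuous_and_iff`). This identifies the two function
spaces, whether or not the determinant vanishes. The function determines `a`, by orthonormality of
the harmonics and non-triviality of `χ`, and `a = 0` forces `b = 0`; hence a non-zero function
exists exactly if `S(E)` has a kernel.

The addition theorem (`integral_hankelWave_mul`) rests on two facts about solutions of `Δf = κ² f`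
with `κ = √|E|`. First, the component of `f` along a harmonic polynomial `P` of degree `ℓ`, on the
sphere of radius `r` about `0`, is a constant times `j_ℓ(iκr)` times `(P(∇) f)(0)`
(`integral_harmonic_smul`); this follows by induction from the divergence theorem on spheres.
Second, `H_{ℓm}` is a constant times `Y(∇) h_0(iκ|x|)`, where `Y` is the solid harmonic
(`hankelWave_eq_hankelField`). The component of a shifted wave is therefore the product of two solid
harmonics, applied as a differential operator to `h_0`. Expanding this product in solid harmonics
times powers of `|x|²`, with `|∇|²` acting as `κ²`, produces the Gaunt coefficients and hence the
structure constants. Orthonormality of the explicit `Y_{ℓm}` and the decomposition of homogeneous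
polynomials (`mem_solidSpan`) are derived from Rodrigues' formula.

The analytic input is as follows. A regular radial solution exists because `V ∈ L²` makes `t v(t)`
integrable, which is enough for a Volterra equation (`exists_isRegularRadialSolution`). Its
derivative is `O(1/r)`, so the waves inside the atoms have square-integrable weak gradients despite
the puncture at the nucleus, and outgoing waves decay exponentially. Finally, traces and weak
gradients are unique, also when spheres touch, so weak continuity may be tested on the explicit
traces (`isWeaklyContinuous_iff`). -/

/-- The unit sphere of `E3`. -/
abbrev Sph : Type := Metric.sphere (0 : E3) 1

/-- The surface measure of the unit sphere. -/
abbrev surf : Measure Sph := (volume : Measure E3).toSphere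

/-! ### Polar coordinates and the divergence theorem on spheres. -/

theorem finrank_E3 : Module.finrank ℝ E3 = 3 := by simp

theorem norm_sph (θ : Sph) : ‖(θ : E3)‖ = 1 := by simp

theorem norm_smul_sph {r : ℝ} (hr : 0 < r) (θ : Sph) : ‖r • (θ : E3)‖ = r := by
  rw [norm_smul, norm_sph, mul_one, Real.norm_of_nonneg hr.le]

theorem direction_smul_sph {r : ℝ} (hr : 0 < r) (θ : Sph) : direction (r • (θ : E3)) = θ := by
  rw [direction, norm_smul_sph hr, smul_smul, inv_mul_cancel₀ hr.ne', one_smul]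

theorem norm_smul_direction (x : E3) : ‖x‖ • direction x = x := by
  by_cases hx : x = 0
  · simp [hx]
  · rw [direction, smul_smul, mul_inv_cancel₀ (norm_ne_zero_iff.2 hx), one_smul]

theorem norm_direction {x : E3} (hx : x ≠ 0) : ‖direction x‖ = 1 := by
  rw [direction, norm_smul, norm_inv, norm_norm, inv_mul_cancel₀ (norm_ne_zero_iff.2 hx)]

theorem integral_polar {f : E3 → ℂ} (hf : Integrable f) :
    ∫ x, f x = ∫ r in Set.Ioi (0 : ℝ), (r : ℂ) ^ 2 * ∫ θ : Sph, f (r • (θ : E3)) ∂surf := by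
  have hmp := (volume : Measure E3).measurePreserving_homeomorphUnitSphereProd
  have hme := (homeomorphUnitSphereProd E3).measurableEmbedding
  have hs : MeasurableSet ({(0 : E3)}ᶜ : Set E3) := (measurableSet_singleton _).compl
  let g : Sph × Set.Ioi (0 : ℝ) → ℂ := fun p => f ((p.2 : ℝ) • (p.1 : E3))
  have hg : ∀ x : ({(0 : E3)}ᶜ : Set E3), g (homeomorphUnitSphereProd E3 x) = f x := by
    intro x
    have h := homeomorphUnitSphereProd_symm_apply_coe E3 (homeomorphUnitSphereProd E3 x)
    simp only [g, ← h, Homeomorph.symm_apply_apply]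
  have hgi : Integrable g (surf.prod (Measure.volumeIoiPow (Module.finrank ℝ E3 - 1))) := by
    rw [← hmp.integrable_comp_emb hme]
    have : g ∘ (homeomorphUnitSphereProd E3) = f ∘ Subtype.val := funext hg
    rw [this]
    exact (integrableOn_iff_comap_subtypeVal hs).1 hf.integrableOn
  calc ∫ x, f x = ∫ x : ({(0 : E3)}ᶜ : Set E3), f (x : E3) ∂(volume.comap ((↑) : ({(0 : E3)}ᶜ : Set E3) → E3)) := by
        rw [integral_subtype_comap hs f, restrict_compl_singleton]
    _ = ∫ p, g p ∂(surf.prod (Measure.volumeIoiPow (Module.finrank ℝ E3 - 1))) := by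
        rw [← hmp.integral_comp hme]
        exact integral_congr_ae (Eventually.of_forall fun x => (hg x).symm)
    _ = ∫ r : Set.Ioi (0 : ℝ), ∫ θ : Sph, g (θ, r) ∂surf
          ∂(Measure.volumeIoiPow (Module.finrank ℝ E3 - 1)) := integral_prod_symm _ hgi
    _ = _ := by
        simp only [Measure.volumeIoiPow, ENNReal.ofReal, finrank_E3]
        rw [integral_withDensity_eq_integral_smul
            ((measurable_subtype_coe.pow_const _).real_toNNReal)]
        rw [integral_subtype_comap measurableSet_Ioi
          (fun a : ℝ => Real.toNNReal (a ^ (3 - 1)) • ∫ θ : Sph, f (a • (θ : E3)) ∂surf)]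
        refine setIntegral_congr_fun measurableSet_Ioi fun x hx => ?_
        simp only [NNReal.smul_def, Real.coe_toNNReal _ (pow_nonneg (le_of_lt hx) _)]
        rw [Complex.real_smul]
        norm_num

theorem lintegral_polar {f : E3 → ℝ≥0∞} (hf : Measurable f) :
    ∫⁻ x, f x = ∫⁻ r in Set.Ioi (0 : ℝ),
      ENNReal.ofReal (r ^ 2) * ∫⁻ θ : Sph, f (r • (θ : E3)) ∂surf := by
  have hmp := (volume : Measure E3).measurePreserving_homeomorphUnitSphereProd
  have hme := (homeomorphUnitSphereProd E3).measurableEmbedding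
  have hs : MeasurableSet ({(0 : E3)}ᶜ : Set E3) := (measurableSet_singleton _).compl
  let g : Sph × Set.Ioi (0 : ℝ) → ℝ≥0∞ := fun p => f ((p.2 : ℝ) • (p.1 : E3))
  have hgm : Measurable g := hf.comp (by fun_prop)
  have hg : ∀ x : ({(0 : E3)}ᶜ : Set E3), g (homeomorphUnitSphereProd E3 x) = f x := by
    intro x
    have h := homeomorphUnitSphereProd_symm_apply_coe E3 (homeomorphUnitSphereProd E3 x)
    simp only [g, ← h, Homeomorph.symm_apply_apply]
  have hm2 : Measurable fun r : ℝ => ∫⁻ θ : Sph, f (r • (θ : E3)) ∂surf := by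
    refine Measurable.lintegral_prod_right' (f := fun p : ℝ × Sph => f (p.1 • (p.2 : E3))) ?_
    exact hf.comp (by fun_prop)
  calc ∫⁻ x, f x = ∫⁻ x : ({(0 : E3)}ᶜ : Set E3), f (x : E3) ∂(volume.comap ((↑) : ({(0 : E3)}ᶜ : Set E3) → E3)) := by
        rw [lintegral_subtype_comap hs f, restrict_compl_singleton]
    _ = ∫⁻ p, g p ∂(surf.prod (Measure.volumeIoiPow (Module.finrank ℝ E3 - 1))) := by
        rw [← hmp.lintegral_comp hgm]
        exact lintegral_congr fun x => (hg x).symm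
    _ = ∫⁻ r : Set.Ioi (0 : ℝ), ∫⁻ θ : Sph, g (θ, r) ∂surf
          ∂(Measure.volumeIoiPow (Module.finrank ℝ E3 - 1)) :=
        lintegral_prod_symm _ hgm.aemeasurable
    _ = _ := by
        simp only [Measure.volumeIoiPow, finrank_E3]
        rw [lintegral_withDensity_eq_lintegral_mul _ (by fun_prop)
          (g := fun r : Set.Ioi (0 : ℝ) => ∫⁻ θ : Sph, g (θ, r) ∂surf)
          (hm2.comp measurable_subtype_coe)]
        exact lintegral_subtype_comap measurableSet_Ioi
          (fun a : ℝ => ENNReal.ofReal (a ^ (3 - 1)) * ∫⁻ θ : Sph, f (a • (θ : E3)) ∂surf)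

theorem continuousOn_integral_sphere {s : Set ℝ} {F : ℝ → Sph → ℂ}
    (hF : ContinuousOn (Function.uncurry F) (s ×ˢ Set.univ)) :
    ContinuousOn (fun r => ∫ θ, F r θ ∂surf) s :=
  continuousOn_integral_of_compact_support isCompact_univ hF (by simp)

theorem hasDerivAt_integral_sphere {a b : ℝ} {F F' : ℝ → Sph → ℂ}
    (hF : ∀ r ∈ Set.Ioo a b, ∀ θ, HasDerivAt (fun s => F s θ) (F' r θ) r)
    (hc : ∀ r ∈ Set.Ioo a b, Continuous (F r))
    (hc' : ContinuousOn (Function.uncurry F') (Set.Ioo a b ×ˢ Set.univ)) {r : ℝ}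
    (hr : r ∈ Set.Ioo a b) :
    HasDerivAt (fun s => ∫ θ, F s θ ∂surf) (∫ θ, F' r θ ∂surf) r := by
  obtain ⟨a', ha', har⟩ := exists_between hr.1
  obtain ⟨b', hrb, hb'⟩ := exists_between hr.2
  have hsub : Set.Icc a' b' ⊆ Set.Ioo a b := fun x hx => ⟨ha'.trans_le hx.1, hx.2.trans_lt hb'⟩
  have hK : IsCompact (Set.Icc a' b' ×ˢ (Set.univ : Set Sph)) := isCompact_Icc.prod isCompact_univ
  obtain ⟨C, hC⟩ := hK.exists_bound_of_continuousOn
    (hc'.mono (Set.prod_mono hsub subset_rfl))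
  have hcr : ∀ s ∈ Set.Ioo a b, Continuous (F' s) := by
    intro s hs
    have := hc'.comp_continuous (f := fun θ : Sph => (s, θ)) (by fun_prop) (fun θ => ⟨hs, trivial⟩)
    exact this
  refine (hasDerivAt_integral_of_dominated_loc_of_deriv_le (bound := fun _ => C)
    (s := Set.Icc a' b') (Icc_mem_nhds har hrb) ?_ ?_ ?_ ?_ (integrable_const _) ?_).2
  · filter_upwards [Ioo_mem_nhds hr.1 hr.2] with s hs
    exact (hc s hs).aestronglyMeasurable
  · exact (hc r hr).integrable_of_hasCompactSupport (HasCompactSupport.of_compactSpace _)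
  · exact (hcr r hr).aestronglyMeasurable
  · exact Eventually.of_forall fun θ s hs => hC (s, θ) ⟨hs, trivial⟩
  · exact Eventually.of_forall fun θ s hs => hF s (hsub hs) θ


theorem continuous_smul_of_tsupport_subset {X : Type*} [TopologicalSpace X]
    {U : Set X} (hU : IsOpen U) {φ : X → ℝ} (hφ : Continuous φ)
    (hsub : tsupport φ ⊆ U) {h : X → ℂ} (hh : ContinuousOn h U) :
    Continuous (fun x => φ x • h x) :=
  (hφ.continuousOn.smul hh).continuous_of_tsupport_subset hU
    ((tsupport_smul_subset_left φ h).trans hsub)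

theorem integrable_smul_of_tsupport_subset {X : Type*} [TopologicalSpace X] [MeasurableSpace X]
    [OpensMeasurableSpace X] {μ : Measure X} [IsFiniteMeasureOnCompacts μ]
    {U : Set X} (hU : IsOpen U) {φ : X → ℝ} (hφ : Continuous φ) (hc : HasCompactSupport φ)
    (hsub : tsupport φ ⊆ U) {h : X → ℂ} (hh : ContinuousOn h U) :
    Integrable (fun x => φ x • h x) μ :=
  (continuous_smul_of_tsupport_subset hU hφ hsub hh).integrable_of_hasCompactSupport hc.smul_right

/-- The function `f` is only `C¹` on `U`, but each product with `φ` or its derivative is continuous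
with compact support in `U`, so integration by parts on the whole space applies without boundary
terms. -/
theorem integral_smul_fderiv_eq_neg {U : Set E3} (hU : IsOpen U) {φ : E3 → ℝ}
    (hφ : ContDiff ℝ 1 φ) (hc : HasCompactSupport φ) (hsub : tsupport φ ⊆ U) {f : E3 → ℂ}
    (hf : ContDiffOn ℝ 1 f U) (v : E3) :
    ∫ x, φ x • fderiv ℝ f x v = -∫ x, fderiv ℝ φ x v • f x := by
  have hφ' : Continuous fun x => fderiv ℝ φ x v :=
    (hφ.continuous_fderiv one_ne_zero).clm_apply continuous_const
  have hsub' : tsupport (fun x => fderiv ℝ φ x v) ⊆ tsupport φ := tsupport_fderiv_apply_subset ℝ v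
  refine integral_smul_fderiv_eq_neg_fderiv_smul_of_integrable ?_ ?_ ?_ ?_ ?_
  · exact integrable_smul_of_tsupport_subset hU hφ' (hc.fderiv_apply (𝕜 := ℝ) v)
      (hsub'.trans hsub) hf.continuousOn
  · exact integrable_smul_of_tsupport_subset hU hφ.continuous hc hsub
      ((hf.continuousOn_fderiv_of_isOpen hU le_rfl).clm_apply continuousOn_const)
  · exact integrable_smul_of_tsupport_subset hU hφ.continuous hc hsub hf.continuousOn
  · exact fun x _ => (hφ.differentiable one_ne_zero) x
  · exact fun x hx => (hf.differentiableOn one_ne_zero).differentiableAt (hU.mem_nhds (hsub hx))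

/-- The open shell `a < |x| < b`. -/
def shell (a b : ℝ) : Set E3 := {x | a < ‖x‖ ∧ ‖x‖ < b}

theorem isOpen_shell (a b : ℝ) : IsOpen (shell a b) :=
  (isOpen_lt continuous_const continuous_norm).inter (isOpen_lt continuous_norm continuous_const)

theorem smul_sph_mem_shell {a b : ℝ} (ha : 0 ≤ a) {r : ℝ} (hr : r ∈ Set.Ioo a b) (θ : Sph) :
    r • (θ : E3) ∈ shell a b := by
  rw [shell, Set.mem_ofPred_eq, norm_smul_sph (ha.trans_lt hr.1)]
  exact hr

theorem continuousOn_comp_smul_sph {a b : ℝ} (ha : 0 ≤ a) {f : E3 → ℂ}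
    (hf : ContinuousOn f (shell a b)) :
    ContinuousOn (fun p : ℝ × Sph => f (p.1 • (p.2 : E3))) (Set.Ioo a b ×ˢ Set.univ) :=
  hf.comp (by fun_prop) fun p hp => smul_sph_mem_shell ha hp.1 p.2

theorem continuous_comp_smul_sph {a b : ℝ} (ha : 0 ≤ a) {f : E3 → ℂ}
    (hf : ContinuousOn f (shell a b)) {r : ℝ} (hr : r ∈ Set.Ioo a b) :
    Continuous (fun θ : Sph => f (r • (θ : E3))) :=
  hf.comp_continuous (by fun_prop) fun θ => smul_sph_mem_shell ha hr θ

theorem continuousOn_fderiv_comp_smul_sph {a b : ℝ} (ha : 0 ≤ a) {f : E3 → ℂ}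
    (hf : ContDiffOn ℝ 1 f (shell a b)) :
    ContinuousOn (fun p : ℝ × Sph => fderiv ℝ f (p.1 • (p.2 : E3)) (p.2 : E3))
      (Set.Ioo a b ×ˢ Set.univ) := by
  refine ContinuousOn.clm_apply ?_ (by fun_prop)
  exact (hf.continuousOn_fderiv_of_isOpen (isOpen_shell a b) le_rfl).comp (by fun_prop)
    fun p hp => smul_sph_mem_shell ha hp.1 p.2

theorem hasDerivAt_integral_comp_smul {a b : ℝ} (ha : 0 ≤ a) {f : E3 → ℂ}
    (hf : ContDiffOn ℝ 1 f (shell a b)) {g : Sph → ℂ} (hg : Continuous g) {r : ℝ}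
    (hr : r ∈ Set.Ioo a b) :
    HasDerivAt (fun s : ℝ => ∫ θ : Sph, g θ * f (s • (θ : E3)) ∂surf)
      (∫ θ : Sph, g θ * fderiv ℝ f (r • (θ : E3)) (θ : E3) ∂surf) r := by
  refine hasDerivAt_integral_sphere (F := fun s θ => g θ * f (s • (θ : E3)))
    (F' := fun s θ => g θ * fderiv ℝ f (s • (θ : E3)) (θ : E3)) ?_ ?_ ?_ hr
  · intro s hs θ
    have h1 : HasFDerivAt f (fderiv ℝ f (s • (θ : E3))) (s • (θ : E3)) :=
      ((hf.differentiableOn one_ne_zero).differentiableAt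
        ((isOpen_shell a b).mem_nhds (smul_sph_mem_shell ha hs θ))).hasFDerivAt
    have h2 : HasDerivAt (fun s : ℝ => s • (θ : E3)) (θ : E3) s := by
      simpa using (hasDerivAt_id s).smul_const (θ : E3)
    exact (h1.comp_hasDerivAt s h2).const_mul _
  · exact fun s hs => hg.mul (continuous_comp_smul_sph ha hf.continuousOn hs)
  · exact (hg.comp continuous_snd).continuousOn.mul (continuousOn_fderiv_comp_smul_sph ha hf)

/-- The norm is not differentiable at the origin, but the support of `η` stays away from `0`, so the
composition vanishes in a neighbourhood of it. -/
theorem contDiff_comp_norm {a b : ℝ} (ha : 0 ≤ a) {η : ℝ → ℝ} (hη : ContDiff ℝ ∞ η)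
    (hsub : tsupport η ⊆ Set.Ioo a b) : ContDiff ℝ 1 (fun x : E3 => η ‖x‖) := by
  rw [contDiff_iff_contDiffAt]
  intro x
  by_cases hx : x = 0
  · have h0 : (0 : ℝ) ∉ tsupport η := fun h => absurd (hsub h).1 (not_lt.2 ha)
    have h1 : (fun x : E3 => η ‖x‖) =ᶠ[𝓝 x] fun _ => 0 := by
      have h2 : ∀ᶠ t in 𝓝 (0 : ℝ), η t = 0 := notMem_tsupport_iff_eventuallyEq.1 h0
      have h3 : Tendsto (fun x : E3 => ‖x‖) (𝓝 x) (𝓝 0) := by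
        rw [hx]; simpa using (continuous_norm (E := E3)).tendsto 0
      exact h3.eventually h2
    exact contDiffAt_const.congr_of_eventuallyEq h1
  · exact (hη.of_le (by exact_mod_cast le_top)).contDiffAt.comp x (contDiffAt_norm ℝ hx)

/-- The divergence theorem on spheres, in differential form. -/
theorem hasDerivAt_sq_mul_integral_coord {a b : ℝ} (ha : 0 ≤ a) {f : E3 → ℂ}
    (hf : ContDiffOn ℝ 1 f (shell a b)) (i : Fin 3) {r : ℝ} (hr : r ∈ Set.Ioo a b) :
    HasDerivAt (fun s : ℝ => (s : ℂ) ^ 2 * ∫ θ : Sph, ((θ : E3) i : ℂ) * f (s • (θ : E3)) ∂surf)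
      ((r : ℂ) ^ 2 * ∫ θ : Sph, fderiv ℝ f (r • (θ : E3)) (EuclideanSpace.single i 1) ∂surf) r := by
  have hgc : Continuous fun θ : Sph => ((θ : E3) i : ℂ) := by fun_prop
  set A : ℝ → ℂ := fun s => ∫ θ : Sph, ((θ : E3) i : ℂ) * f (s • (θ : E3)) ∂surf with hA
  set A' : ℝ → ℂ := fun s =>
    ∫ θ : Sph, ((θ : E3) i : ℂ) * fderiv ℝ f (s • (θ : E3)) (θ : E3) ∂surf with hA'
  set D : ℝ → ℂ := fun s =>
    ∫ θ : Sph, fderiv ℝ f (s • (θ : E3)) (EuclideanSpace.single i 1) ∂surf with hD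
  have hAd : ∀ s ∈ Set.Ioo a b, HasDerivAt A (A' s) s := fun s hs =>
    hasDerivAt_integral_comp_smul ha hf hgc hs
  have hAc : ContinuousOn A (Set.Ioo a b) := fun s hs =>
    (hAd s hs).continuousAt.continuousWithinAt
  have hfd : ContinuousOn (fun x => fderiv ℝ f x (EuclideanSpace.single i 1)) (shell a b) :=
    (hf.continuousOn_fderiv_of_isOpen (isOpen_shell a b) le_rfl).clm_apply continuousOn_const
  have hA'c : ContinuousOn A' (Set.Ioo a b) := continuousOn_integral_sphere
    ((hgc.comp continuous_snd).continuousOn.mul (continuousOn_fderiv_comp_smul_sph ha hf))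
  have hDc : ContinuousOn D (Set.Ioo a b) :=
    continuousOn_integral_sphere (continuousOn_comp_smul_sph ha hfd)
  set B : ℝ → ℂ := fun s => (s : ℂ) ^ 2 * A s with hB
  set B' : ℝ → ℂ := fun s => 2 * (s : ℂ) * A s + (s : ℂ) ^ 2 * A' s with hB'
  have hBd : ∀ s ∈ Set.Ioo a b, HasDerivAt B (B' s) s := by
    intro s hs
    have h1 : HasDerivAt (fun s : ℝ => (s : ℂ) ^ 2) (2 * (s : ℂ)) s := by
      have h := (hasDerivAt_id s).ofReal_comp.pow 2
      simp only [id, Nat.cast_ofNat, Nat.add_one_sub_one, pow_one, Complex.ofReal_one,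
        mul_one] at h
      exact h
    exact h1.mul (hAd s hs)
  have hofc : ∀ n : ℕ, ContinuousOn (fun s : ℝ => (s : ℂ) ^ n) (Set.Ioo a b) := fun n => by fun_prop
  have hB'c : ContinuousOn B' (Set.Ioo a b) :=
    ((continuousOn_const.mul (by fun_prop)).mul hAc).add ((hofc 2).mul hA'c)
  have hBc : ContinuousOn B (Set.Ioo a b) := (hofc 2).mul hAc
  have hGc : ContinuousOn (fun s : ℝ => (s : ℂ) ^ 2 * D s) (Set.Ioo a b) := (hofc 2).mul hDc
  -- Tested against a radial function: the partial derivative `∂ᵢf` is integrated by parts against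
  -- `η(|x|)` in space, both sides are written in polar coordinates, and a second integration by
  -- parts in the radius moves the derivative from `η` to `B`.
  have key : ∀ η : ℝ → ℝ, ContDiff ℝ ∞ η → HasCompactSupport η → tsupport η ⊆ Set.Ioo a b →
      ∫ s, η s • (B' s - (s : ℂ) ^ 2 * D s) = 0 := by
    intro η hη hηc hsub
    have hφ : ContDiff ℝ 1 (fun x : E3 => η ‖x‖) := contDiff_comp_norm ha hη hsub
    have hts : tsupport (fun x : E3 => η ‖x‖) ⊆ norm ⁻¹' tsupport η :=
      tsupport_comp_subset_preimage η continuous_norm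
    have hφs : tsupport (fun x : E3 => η ‖x‖) ⊆ shell a b := fun x hx => hsub (hts hx)
    have hφc : HasCompactSupport (fun x : E3 => η ‖x‖) := by
      refine HasCompactSupport.of_support_subset_isCompact (isCompact_closedBall (0 : E3) b) ?_
      intro x hx
      rw [mem_closedBall_zero_iff]
      exact (hsub (subset_tsupport η hx)).2.le
    have hη1 : ∀ s, HasDerivAt η (deriv η s) s := fun s =>
      ((hη.differentiable (by simp)) s).hasDerivAt
    have hη'c : Continuous (deriv η) := hη.continuous_deriv (by simp)
    have hibp := integral_smul_fderiv_eq_neg (isOpen_shell a b) hφ hφc hφs hf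
      (EuclideanSpace.single i 1)
    have hφ'c : Continuous fun x => fderiv ℝ (fun x : E3 => η ‖x‖) x (EuclideanSpace.single i 1) :=
      (hφ.continuous_fderiv one_ne_zero).clm_apply continuous_const
    have hφ's : tsupport (fun x => fderiv ℝ (fun x : E3 => η ‖x‖) x (EuclideanSpace.single i 1)) ⊆
      tsupport (fun x : E3 => η ‖x‖) := tsupport_fderiv_apply_subset ℝ _
    rw [integral_polar (integrable_smul_of_tsupport_subset (isOpen_shell a b) hφ.continuous hφc hφs
        hfd),
      integral_polar (integrable_smul_of_tsupport_subset (isOpen_shell a b) hφ'c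
        (hφc.fderiv_apply (𝕜 := ℝ) _) (hφ's.trans hφs) hf.continuousOn)] at hibp
    -- The gradient of `η(|x|)` at `sθ` is `η'(s) θ`; this is where the weight `θᵢ` comes from.
    have hfd0 : ∀ s : ℝ, 0 < s → ∀ θ : Sph,
        fderiv ℝ (fun x : E3 => η ‖x‖) (s • (θ : E3)) (EuclideanSpace.single i 1)
          = deriv η s * (θ : E3) i := by
      intro s hs θ
      have hne : s • (θ : E3) ≠ 0 := by
        rw [← norm_ne_zero_iff, norm_smul_sph hs]; exact hs.ne'
      have h1 : HasFDerivAt (fun x : E3 => ‖x‖) (‖s • (θ : E3)‖⁻¹ • innerSL ℝ (s • (θ : E3)))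
          (s • (θ : E3)) := by
        have h2 := (hasStrictFDerivAt_norm_sq (s • (θ : E3))).hasFDerivAt.sqrt
          (pow_ne_zero 2 (norm_ne_zero_iff.2 hne))
        simp only [Real.sqrt_sq (norm_nonneg _)] at h2
        refine h2.congr_fderiv ?_
        rw [← Nat.cast_smul_eq_nsmul ℝ, smul_smul]
        congr 1
        field_simp
        norm_num
      have h3 := (hη1 ‖s • (θ : E3)‖).comp_hasFDerivAt (s • (θ : E3)) h1
      rw [show (fun x : E3 => η ‖x‖) = η ∘ fun x : E3 => ‖x‖ from rfl, h3.fderiv]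
      rw [norm_smul_sph hs]
      have hs' : s ≠ 0 := hs.ne'
      simp [EuclideanSpace.inner_single_right, hs']
    have e1 : ∫ s in Set.Ioi (0 : ℝ), (s : ℂ) ^ 2 * ∫ θ : Sph, η ‖s • (θ : E3)‖ •
        fderiv ℝ f (s • (θ : E3)) (EuclideanSpace.single i 1) ∂surf
        = ∫ s, η s • ((s : ℂ) ^ 2 * D s) := by
      rw [← setIntegral_eq_integral_of_forall_compl_eq_zero (s := Set.Ioi (0 : ℝ))
        (f := fun s => η s • ((s : ℂ) ^ 2 * D s))]
      · refine setIntegral_congr_fun measurableSet_Ioi fun s hs => ?_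
        have hs' : (0 : ℝ) < s := hs
        simp only [norm_smul_sph hs', hD, Complex.real_smul, integral_const_mul]
        ring
      · intro s hs
        rw [image_eq_zero_of_notMem_tsupport (fun h => hs (ha.trans_lt (hsub h).1)), zero_smul]
    have e2 : ∫ s in Set.Ioi (0 : ℝ), (s : ℂ) ^ 2 * ∫ θ : Sph,
        fderiv ℝ (fun x : E3 => η ‖x‖) (s • (θ : E3)) (EuclideanSpace.single i 1) •
        f (s • (θ : E3)) ∂surf
        = ∫ s, deriv η s • B s := by
      rw [← setIntegral_eq_integral_of_forall_compl_eq_zero (s := Set.Ioi (0 : ℝ))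
        (f := fun s => deriv η s • B s)]
      · refine setIntegral_congr_fun measurableSet_Ioi fun s hs => ?_
        have hs' : (0 : ℝ) < s := hs
        simp only [hfd0 s hs', hB, hA, Complex.real_smul, Complex.ofReal_mul, mul_assoc,
          integral_const_mul]
        ring
      · intro s hs
        have : s ∉ tsupport (deriv η) := fun h =>
          hs (ha.trans_lt (hsub (tsupport_deriv_subset h)).1)
        rw [image_eq_zero_of_notMem_tsupport this, zero_smul]
    rw [e1, e2] at hibp
    have hopen : IsOpen (Set.Ioo a b) := isOpen_Ioo
    have i1 : Integrable fun s => η s • B' s :=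
      integrable_smul_of_tsupport_subset hopen hη.continuous hηc hsub hB'c
    have i2 : Integrable fun s => η s • ((s : ℂ) ^ 2 * D s) :=
      integrable_smul_of_tsupport_subset hopen hη.continuous hηc hsub hGc
    have i3 : Integrable fun s => deriv η s • B s :=
      integrable_smul_of_tsupport_subset hopen hη'c hηc.deriv
        (tsupport_deriv_subset.trans hsub) hBc
    have i4 : Integrable fun s => η s • B s :=
      integrable_smul_of_tsupport_subset hopen hη.continuous hηc hsub hBc
    have hibp2 : ∫ s, ((η s : ℝ) : ℂ) * B' s = -∫ s, ((deriv η s : ℝ) : ℂ) * B s := by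
      refine integral_mul_deriv_eq_deriv_mul_of_integrable ?_ ?_ ?_ ?_ ?_
      · exact fun s _ => (hη1 s).ofReal_comp
      · intro s hs
        refine hBd s (hsub ?_)
        refine closure_mono ?_ hs
        intro t ht
        simpa using ht
      · exact i1
      · exact i3
      · exact i4
    simp only [smul_sub]
    rw [integral_sub i1 i2, hibp]
    simp only [Complex.real_smul] at hibp2 ⊢
    rw [hibp2]
    ring
  -- By the fundamental lemma of the calculus of variations the two densities agree almost
  -- everywhere, and by continuity everywhere on the interval.
  have hae := isOpen_Ioo.ae_eq_zero_of_integral_contDiff_smul_eq_zero (μ := volume)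
    ((hB'c.sub hGc).locallyIntegrableOn measurableSet_Ioo) key
  have hEq : Set.EqOn (fun s => B' s - (s : ℂ) ^ 2 * D s) (fun _ => 0) (Set.Ioo a b) := by
    refine Measure.eqOn_open_of_ae_eq (μ := volume) ?_ isOpen_Ioo (hB'c.sub hGc) continuousOn_const
    exact (ae_restrict_iff' measurableSet_Ioo).2 hae
  have h0 : B' r = (r : ℂ) ^ 2 * D r := sub_eq_zero.1 (hEq hr)
  rw [← h0]
  exact hBd r hr

/-! ### Polynomials, their integrals over the unit sphere, and the Laplacian. -/

open MvPolynomial in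
/-- Evaluation of a complex polynomial in three variables at a point of `E3`. -/
def evalAt (x : E3) : MvPolynomial (Fin 3) ℂ →ₐ[ℂ] ℂ := aeval fun i => (x i : ℂ)

section Poly

open MvPolynomial

/-- Complex polynomials in three variables. -/
abbrev Poly3 : Type := MvPolynomial (Fin 3) ℂ

@[simp] theorem evalAt_X (x : E3) (i : Fin 3) : evalAt x (X i) = (x i : ℂ) := by simp [evalAt]

@[simp] theorem evalAt_C (x : E3) (c : ℂ) : evalAt x (C c) = c := by simp [evalAt]

theorem hasFDerivAt_evalAt (P : Poly3) (x : E3) :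
    HasFDerivAt (fun y => evalAt y P) (∑ i, evalAt x (pderiv i P) •
      (Complex.ofRealCLM.comp (EuclideanSpace.proj i : E3 →L[ℝ] ℝ))) x := by
  induction P using MvPolynomial.induction_on with
  | C a =>
    simp only [evalAt_C]
    refine (hasFDerivAt_const (𝕜 := ℝ) a x).congr_fderiv ?_
    ext v
    simp
  | add p q hp hq =>
    simp only [map_add]
    refine (hp.add hq).congr_fderiv ?_
    ext v
    simp [Fin.sum_univ_three]
    ring
  | mul_X p j hp =>
    have hX : HasFDerivAt (fun y : E3 => evalAt y (X j : Poly3))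
        (Complex.ofRealCLM.comp (EuclideanSpace.proj j : E3 →L[ℝ] ℝ)) x := by
      simp only [evalAt_X]
      exact (Complex.ofRealCLM.comp (EuclideanSpace.proj j : E3 →L[ℝ] ℝ)).hasFDerivAt
    have h := hp.mul hX
    simp only [map_mul]
    refine h.congr_fderiv ?_
    ext v
    fin_cases j <;> simp [Fin.sum_univ_three] <;> ring

theorem fderiv_evalAt (P : Poly3) (x v : E3) :
    fderiv ℝ (fun y => evalAt y P) x v = ∑ i, evalAt x (pderiv i P) * (v i : ℂ) := by
  rw [(hasFDerivAt_evalAt P x).fderiv]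
  simp

theorem fderiv_evalAt_single (P : Poly3) (x : E3) (i : Fin 3) :
    fderiv ℝ (fun y => evalAt y P) x (EuclideanSpace.single i 1) = evalAt x (pderiv i P) := by
  rw [fderiv_evalAt, Finset.sum_eq_single i]
  · simp
  · intro b _ hb; simp [hb]
  · simp

theorem contDiff_evalAt (P : Poly3) {n : WithTop ℕ∞} : ContDiff ℝ n fun y => evalAt y P := by
  induction P using MvPolynomial.induction_on with
  | C a => simpa using contDiff_const
  | add p q hp hq => simpa using hp.add hq
  | mul_X p j hp =>
    simp only [map_mul, evalAt_X]
    exact hp.mul (Complex.ofRealCLM.comp (EuclideanSpace.proj j : E3 →L[ℝ] ℝ)).contDiff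

theorem continuous_evalAt (P : Poly3) : Continuous fun y => evalAt y P :=
  (contDiff_evalAt P (n := 0)).continuous

theorem evalAt_smul {P : Poly3} {k : ℕ} (hP : P.IsHomogeneous k) (r : ℝ) (x : E3) :
    evalAt (r • x) P = (r : ℂ) ^ k * evalAt x P := by
  simp only [evalAt, aeval_def, eval₂_eq', Finset.mul_sum]
  refine Finset.sum_congr rfl fun d hd => ?_
  have h1 : ∑ i, d i = k := by
    rw [hP.degree_eq_sum_deg_support hd, ← Finsupp.degree_apply, Finsupp.degree_eq_sum]
  simp only [PiLp.smul_apply, smul_eq_mul, Complex.ofReal_mul, mul_pow, Finset.prod_mul_distrib,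
    Finset.prod_pow_eq_pow_sum, h1]
  ring

theorem evalAt_eq_direction {P : Poly3} {k : ℕ} (hP : P.IsHomogeneous k) (x : E3) :
    evalAt x P = (‖x‖ : ℂ) ^ k * evalAt (direction x) P := by
  rw [← evalAt_smul hP, norm_smul_direction]

/-- The integral of a polynomial over the unit sphere. -/
def sphI : Poly3 →ₗ[ℂ] ℂ where
  toFun P := ∫ θ : Sph, evalAt θ P ∂surf
  map_add' P Q := by
    simp only [map_add]
    exact integral_add
      (((continuous_evalAt P).comp continuous_subtype_val).integrable_of_hasCompactSupport
        (HasCompactSupport.of_compactSpace _))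
      (((continuous_evalAt Q).comp continuous_subtype_val).integrable_of_hasCompactSupport
        (HasCompactSupport.of_compactSpace _))
  map_smul' c P := by
    simp only [map_smul, smul_eq_mul, RingHom.id_apply, integral_const_mul]

theorem sphI_apply (P : Poly3) : sphI P = ∫ θ : Sph, evalAt θ P ∂surf := rfl

theorem sphI_congr {P Q : Poly3} (h : ∀ θ : Sph, evalAt θ P = evalAt θ Q) : sphI P = sphI Q := by
  simp only [sphI_apply, h]

theorem surf_univ : surf.real Set.univ = 4 * Real.pi := by
  rw [Measure.toSphere_real_apply_univ, measureReal_def, EuclideanSpace.volume_ball_fin_three,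
    finrank_E3]
  rw [ENNReal.ofReal_one, one_pow, one_mul, ENNReal.toReal_ofReal (by positivity)]
  push_cast; ring

theorem sphI_one : sphI 1 = 4 * Real.pi := by
  rw [sphI_apply]
  simp only [map_one, integral_const, surf_univ, Complex.real_smul]
  push_cast; ring

/-- By homogeneity the function differentiated in the divergence theorem is `s^(k+2)` times a
constant, and its derivative at `s = 1` gives the factor `k + 2`. This recursion determines all
moments of the sphere. -/
theorem sphI_X_mul {P : Poly3} {k : ℕ} (hP : P.IsHomogeneous k) (i : Fin 3) :
    ((k : ℂ) + 2) * sphI (X i * P) = sphI (pderiv i P) := by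
  have h := hasDerivAt_sq_mul_integral_coord (a := 0) (b := 2) le_rfl
    (f := fun y => evalAt y P) (contDiff_evalAt P).contDiffOn i (r := 1) (by norm_num)
  simp only [fderiv_evalAt_single, one_smul, Complex.ofReal_one, one_pow, one_mul] at h
  have h2 : HasDerivAt (fun s : ℝ => (s : ℂ) ^ (k + 2) * sphI (X i * P))
      (((k : ℂ) + 2) * sphI (X i * P)) 1 := by
    have h3 := (((hasDerivAt_id (1 : ℝ)).ofReal_comp).pow (k + 2)).mul_const (sphI (X i * P))
    simp only [id, Complex.ofReal_one, mul_one, one_pow] at h3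
    refine h3.congr_deriv ?_
    push_cast; ring
  have h4 : (fun s : ℝ => (s : ℂ) ^ 2 * ∫ θ : Sph, ((θ : E3) i : ℂ) * evalAt (s • (θ : E3)) P ∂surf)
      = fun s : ℝ => (s : ℂ) ^ (k + 2) * sphI (X i * P) := by
    funext s
    simp only [evalAt_smul hP, sphI_apply, map_mul, evalAt_X, pow_add, mul_assoc]
    rw [mul_left_comm, ← integral_const_mul, ← integral_const_mul, ← integral_const_mul]
    refine integral_congr_ae (Eventually.of_forall fun θ => ?_)
    simp only
    ring
  rw [h4] at h
  exact h2.unique h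

/-- Rotation invariance of the surface measure in infinitesimal form. For `i ≠ j` and homogeneous
`P`, both sides are the same multiple of the integral of `XᵢXⱼP`, once the factor `Xᵢ` and once the
factor `Xⱼ` being removed by the moment recursion. -/
theorem sphI_rot (P : Poly3) (i j : Fin 3) :
    sphI (X j * pderiv i P) = sphI (X i * pderiv j P) := by
  induction P using MvPolynomial.induction_on' with
  | add p q hp hq => simp only [map_add, mul_add, hp, hq]
  | monomial s c =>
    have hs : (monomial s c : Poly3).IsHomogeneous s.degree := isHomogeneous_monomial c rfl
    have e1 := sphI_X_mul ((isHomogeneous_X ℂ j).mul hs) i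
    have e2 := sphI_X_mul ((isHomogeneous_X ℂ i).mul hs) j
    rw [mul_left_comm] at e1
    simp only [pderiv_mul, map_add, pderiv_X] at e1 e2
    by_cases hij : i = j
    · subst hij; rfl
    · simp only [Pi.single_apply, hij, Ne.symm hij, if_false, zero_mul, map_zero, zero_add] at e1 e2
      rw [← e1, ← e2]

/-- The sum of squares of the variables. -/
def rho : Poly3 := ∑ i, X i ^ 2

theorem rho_eq : rho = X 0 ^ 2 + X 1 ^ 2 + X 2 ^ 2 := by simp [rho, Fin.sum_univ_three]

theorem evalAt_rho (x : E3) : evalAt x rho = (‖x‖ : ℂ) ^ 2 := by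
  have h := EuclideanSpace.norm_sq_eq x
  simp only [Real.norm_eq_abs, sq_abs] at h
  rw [← Complex.ofReal_pow, h]
  simp [rho, map_sum]

theorem evalAt_rho_sph (θ : Sph) : evalAt θ rho = 1 := by simp [evalAt_rho]

theorem isHomogeneous_rho : rho.IsHomogeneous 2 :=
  IsHomogeneous.sum _ _ _ fun i _ => isHomogeneous_X_pow i 2

/-- The Laplacian on polynomials. -/
def lap : Poly3 →ₗ[ℂ] Poly3 :=
  ∑ i, (pderiv i).toLinearMap ∘ₗ (pderiv i : Derivation ℂ Poly3 Poly3).toLinearMap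

theorem lap_apply (P : Poly3) : lap P = ∑ i, pderiv i (pderiv i P) := by
  simp [lap, LinearMap.sum_apply]

theorem pderiv_comm (i j : Fin 3) (P : Poly3) :
    pderiv i (pderiv j P) = pderiv j (pderiv i P) := by
  ext m
  simp only [coeff_pderiv]
  by_cases h : i = j
  · subst h; rfl
  · simp [h, Ne.symm h, add_right_comm]
    ring

theorem lap_pderiv (i : Fin 3) (P : Poly3) : lap (pderiv i P) = pderiv i (lap P) := by
  simp only [lap_apply, map_sum]
  refine Finset.sum_congr rfl fun j _ => ?_
  rw [pderiv_comm j i, pderiv_comm j i]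

theorem lap_X_mul (i : Fin 3) (P : Poly3) : lap (X i * P) = X i * lap P + 2 * pderiv i P := by
  simp only [lap_apply, pderiv_mul, map_add, Finset.sum_add_distrib, Finset.mul_sum, pderiv_X,
    Pi.single_apply]
  fin_cases i <;> simp [Fin.sum_univ_three] <;> ring

theorem IsHomogeneous_lap {P : Poly3} {k : ℕ} (hP : P.IsHomogeneous k) :
    (lap P).IsHomogeneous (k - 2) := by
  rw [lap_apply]
  refine IsHomogeneous.sum _ _ _ fun i _ => ?_
  have := (hP.pderiv (i := i)).pderiv (i := i)
  rwa [Nat.sub_sub] at this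

end Poly

/-! ### Legendre polynomials: differential equation, coefficients, orthogonality. -/

section Legendre

open Polynomial

/-- The `M`-th derivative of the Legendre polynomial. -/
def assocLegendre (ℓ M : ℕ) : ℝ[X] := derivative^[M] (legendrePoly ℓ)

theorem assocLegendre_succ (ℓ M : ℕ) :
    assocLegendre ℓ (M + 1) = derivative (assocLegendre ℓ M) := by
  rw [assocLegendre, Function.iterate_succ_apply']; rfl

theorem assocLegendre_eq (ℓ M : ℕ) : assocLegendre ℓ M =
    C ((2 ^ ℓ * (ℓ.factorial : ℝ))⁻¹) * derivative^[M + ℓ] ((X ^ 2 - 1) ^ ℓ) := by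
  rw [assocLegendre, legendrePoly, iterate_derivative_C_mul, Function.iterate_add_apply]

/-- The power `y = (x² - 1)^ℓ` satisfies `(x² - 1) y' = 2ℓ x y`. Differentiating once gives the case
`s = 0`, and each further derivative raises `s` by one. -/
theorem rodrigues_ode (ℓ s : ℕ) :
    (X ^ 2 - 1) * derivative^[s + 2] ((X ^ 2 - 1 : ℝ[X]) ^ ℓ)
      + 2 * ((s : ℝ[X]) + 1 - (ℓ : ℝ[X])) * X * derivative^[s + 1] ((X ^ 2 - 1 : ℝ[X]) ^ ℓ)
      + ((s : ℝ[X]) + 1) * ((s : ℝ[X]) - 2 * (ℓ : ℝ[X])) * derivative^[s] ((X ^ 2 - 1 : ℝ[X]) ^ ℓ) = 0 := by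
  induction s with
  | zero =>
    have h : (X ^ 2 - 1) * derivative ((X ^ 2 - 1 : ℝ[X]) ^ ℓ)
        = 2 * (ℓ : ℝ[X]) * X * (X ^ 2 - 1) ^ ℓ := by
      cases ℓ with
      | zero => simp
      | succ n =>
        rw [derivative_pow_succ]
        simp only [derivative_sub, derivative_one, derivative_X_sq, sub_zero, map_add, map_natCast,
          map_one, map_ofNat]
        push_cast
        ring
    generalize (X ^ 2 - 1 : ℝ[X]) ^ ℓ = y at h ⊢
    have h2 := congrArg derivative h
    simp only [derivative_mul, derivative_sub, derivative_one, derivative_X, derivative_ofNat,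
      derivative_natCast, derivative_X_sq, sub_zero, zero_mul, mul_zero, zero_add, mul_one, derivative_pow,
      Nat.cast_ofNat, Nat.add_one_sub_one, pow_one, map_ofNat] at h2
    simp only [Function.iterate_succ, Function.iterate_zero, Function.comp_apply, id]
    simp only [derivative_mul, derivative_sub, derivative_one, derivative_X, derivative_ofNat,
      derivative_natCast, derivative_X_sq, sub_zero, zero_mul, mul_zero, zero_add, mul_one, derivative_pow,
      Nat.cast_ofNat, Nat.add_one_sub_one, pow_one, map_ofNat, Nat.cast_zero] at h2 ⊢
    linear_combination h2
  | succ s ih =>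
    have h2 := congrArg derivative ih
    simp only [derivative_mul, derivative_add, derivative_sub, derivative_one, derivative_X,
      derivative_ofNat, derivative_natCast, sub_zero, zero_mul, mul_zero, zero_add, mul_one,
      derivative_X_pow, Nat.cast_ofNat, Nat.add_one_sub_one, pow_one, map_ofNat, add_zero,
      ← Function.iterate_succ_apply' derivative, derivative_zero] at h2
    push_cast
    simp only [Nat.succ_eq_add_one, add_assoc, Nat.reduceAdd] at h2 ⊢
    linear_combination h2

theorem assocLegendre_ode (ℓ M : ℕ) :
    (1 - X ^ 2) * derivative (derivative (assocLegendre ℓ M))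
      - 2 * ((M : ℝ[X]) + 1) * X * derivative (assocLegendre ℓ M)
      + ((ℓ : ℝ[X]) - (M : ℝ[X])) * ((ℓ : ℝ[X]) + (M : ℝ[X]) + 1) * assocLegendre ℓ M = 0 := by
  have h := rodrigues_ode ℓ (M + ℓ)
  simp only [assocLegendre_eq, derivative_mul, derivative_C, zero_mul, zero_add,
    ← Function.iterate_succ_apply' derivative]
  push_cast at h
  linear_combination (-C ((2 ^ ℓ * (ℓ.factorial : ℝ))⁻¹)) * h

theorem natDegree_rodrigues (ℓ : ℕ) : ((X ^ 2 - 1 : ℝ[X]) ^ ℓ).natDegree = 2 * ℓ := by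
  rw [natDegree_pow, show (X ^ 2 - 1 : ℝ[X]) = X ^ 2 - C 1 by simp, natDegree_X_pow_sub_C, mul_comm]

theorem monic_rodrigues (ℓ : ℕ) : ((X ^ 2 - 1 : ℝ[X]) ^ ℓ).Monic := by
  rw [show (X ^ 2 - 1 : ℝ[X]) = X ^ 2 - C 1 by simp]
  exact (monic_X_pow_sub_C 1 two_ne_zero).pow ℓ

theorem assocLegendre_coeff (ℓ M m : ℕ) : (assocLegendre ℓ M).coeff m =
    (2 ^ ℓ * (ℓ.factorial : ℝ))⁻¹ * ((m + (M + ℓ)).descFactorial (M + ℓ) *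
      ((X ^ 2 - 1 : ℝ[X]) ^ ℓ).coeff (m + (M + ℓ))) := by
  rw [assocLegendre_eq, coeff_C_mul, coeff_iterate_derivative, nsmul_eq_mul]

theorem assocLegendre_coeff_of_lt {ℓ M m : ℕ} (h : ℓ < m + M) :
    (assocLegendre ℓ M).coeff m = 0 := by
  rw [assocLegendre_coeff, coeff_eq_zero_of_natDegree_lt, mul_zero, mul_zero]
  rw [natDegree_rodrigues]; omega

theorem assocLegendre_coeff_top {ℓ M : ℕ} (h : M ≤ ℓ) : (assocLegendre ℓ M).coeff (ℓ - M) =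
    (2 ^ ℓ * (ℓ.factorial : ℝ))⁻¹ * (2 * ℓ).descFactorial (M + ℓ) := by
  have h1 : ℓ - M + (M + ℓ) = 2 * ℓ := by omega
  have h2 := (monic_rodrigues ℓ).coeff_natDegree
  rw [natDegree_rodrigues] at h2
  rw [assocLegendre_coeff, h1, h2, mul_one]

theorem assocLegendre_coeff_top_ne_zero {ℓ M : ℕ} (h : M ≤ ℓ) :
    (assocLegendre ℓ M).coeff (ℓ - M) ≠ 0 := by
  rw [assocLegendre_coeff_top h]
  have : (2 * ℓ).descFactorial (M + ℓ) ≠ 0 := by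
    rw [Ne, Nat.descFactorial_eq_zero_iff_lt]; omega
  positivity

theorem assocLegendre_self (ℓ : ℕ) :
    assocLegendre ℓ ℓ = C ((2 ^ ℓ * (ℓ.factorial : ℝ))⁻¹ * (2 * ℓ).factorial) := by
  ext m
  rcases Nat.eq_zero_or_pos m with rfl | hm
  · have h := assocLegendre_coeff_top (le_refl ℓ)
    rw [Nat.sub_self, ← two_mul, Nat.descFactorial_self] at h
    rw [h, coeff_C_zero]
  · rw [assocLegendre_coeff_of_lt (by omega), coeff_C_of_ne_zero hm.ne']

/-- The coefficient recurrence of the associated Legendre equation. -/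
theorem assocLegendre_coeff_rec (ℓ M k : ℕ) :
    ((k : ℝ) + 2) * (k + 1) * (assocLegendre ℓ M).coeff (k + 2)
      + ((ℓ : ℝ) - M - k) * (ℓ + M + k + 1) * (assocLegendre ℓ M).coeff k = 0 := by
  have h := congrArg (fun p : ℝ[X] => p.coeff k) (assocLegendre_ode ℓ M)
  have e1 : (1 - X ^ 2) * derivative (derivative (assocLegendre ℓ M))
      - 2 * ((M : ℝ[X]) + 1) * X * derivative (assocLegendre ℓ M)
      + ((ℓ : ℝ[X]) - (M : ℝ[X])) * ((ℓ : ℝ[X]) + (M : ℝ[X]) + 1) * assocLegendre ℓ M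
      = derivative (derivative (assocLegendre ℓ M))
        - X ^ 2 * derivative (derivative (assocLegendre ℓ M))
      - C (2 * ((M : ℝ) + 1)) * (X * derivative (assocLegendre ℓ M))
      + C (((ℓ : ℝ) - M) * (ℓ + M + 1)) * assocLegendre ℓ M := by
    simp only [map_mul, map_sub, map_add, map_natCast, map_one, map_ofNat]
    ring
  simp only [e1, coeff_add, coeff_sub, coeff_C_mul, coeff_zero] at h
  have e2 : (X * derivative (assocLegendre ℓ M)).coeff k = k * (assocLegendre ℓ M).coeff k := by
    cases k with
    | zero => simp
    | succ k => rw [coeff_X_mul, coeff_derivative]; push_cast; ring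
  have e3 : (X ^ 2 * derivative (derivative (assocLegendre ℓ M))).coeff k
      = k * (k - 1) * (assocLegendre ℓ M).coeff k := by
    rcases k with _ | _ | k
    · simp [coeff_X_pow_mul']
    · simp [coeff_X_pow_mul']
    · rw [coeff_X_pow_mul, coeff_derivative, coeff_derivative]; push_cast; ring
  rw [e2, e3, coeff_derivative, coeff_derivative] at h
  push_cast at h
  linear_combination h

/-- Integration over `[-1, 1]`. -/
def segInt : ℝ[X] →ₗ[ℝ] ℝ where
  toFun p := ∫ x in (-1 : ℝ)..1, p.eval x
  map_add' p q := by
    simp only [eval_add]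
    exact intervalIntegral.integral_add (p.continuous.intervalIntegrable _ _)
      (q.continuous.intervalIntegrable _ _)
  map_smul' c p := by simp

theorem segInt_derivative (p : ℝ[X]) : segInt (derivative p) = p.eval 1 - p.eval (-1) :=
  intervalIntegral.integral_eq_sub_of_hasDerivAt (fun x _ => p.hasDerivAt x)
    ((derivative p).continuous.intervalIntegrable _ _)

theorem segInt_one : segInt 1 = 2 := by
  have h := segInt_derivative X
  norm_num [derivative_X] at h
  exact h

theorem segInt_X_pow (k : ℕ) : ((k : ℝ) + 1) * segInt (X ^ k) = 1 - (-1) ^ (k + 1) := by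
  have h := segInt_derivative (X ^ (k + 1))
  rw [derivative_X_pow, Nat.add_sub_cancel, ← smul_eq_C_mul, map_smul] at h
  simpa using h

/-- The polynomial `x (1 - x²)^(n+1)` vanishes at both ends, so its derivative has integral zero. -/
theorem segInt_one_sub_sq_pow_succ (n : ℕ) :
    (2 * (n : ℝ) + 3) * segInt ((1 - X ^ 2) ^ (n + 1))
      = (2 * n + 2) * segInt ((1 - X ^ 2) ^ n) := by
  have h := segInt_derivative (X * (1 - X ^ 2) ^ (n + 1))
  have e : derivative (X * (1 - X ^ 2 : ℝ[X]) ^ (n + 1))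
      = (2 * (n : ℝ) + 3) • (1 - X ^ 2) ^ (n + 1) - (2 * (n : ℝ) + 2) • (1 - X ^ 2) ^ n := by
    simp only [derivative_mul, derivative_X, derivative_pow, derivative_sub, derivative_one,
      smul_eq_C_mul, map_add, map_mul, map_natCast, map_ofNat, Nat.add_sub_cancel, Nat.cast_add,
      Nat.cast_one, map_one, Nat.cast_ofNat]
    ring
  rw [e, map_sub, map_smul, map_smul] at h
  simp at h
  linarith

theorem segInt_one_sub_sq_pow (n : ℕ) :
    ((2 * n + 1).factorial : ℝ) * segInt ((1 - X ^ 2) ^ n) = 2 * 4 ^ n * (n.factorial : ℝ) ^ 2 := by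
  induction n with
  | zero => simp [segInt_one]
  | succ n ih =>
    have h := segInt_one_sub_sq_pow_succ n
    have e : ((2 * (n + 1) + 1).factorial : ℝ)
        = (2 * n + 3) * ((2 * n + 2) * ((2 * n + 1).factorial : ℝ)) := by
      rw [show 2 * (n + 1) + 1 = (2 * n + 1 + 1) + 1 by ring, Nat.factorial_succ, Nat.factorial_succ]
      push_cast; ring
    rw [e, Nat.factorial_succ n]
    generalize ((2 * n + 1).factorial : ℝ) = F at ih ⊢
    push_cast
    linear_combination (2 * (n : ℝ) + 2) * F * h +
      (2 * (n : ℝ) + 2) ^ 2 * ih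

/-- The weighted inner product of associated Legendre functions. -/
def legendreInner (M ℓ ℓ' : ℕ) : ℝ :=
  segInt ((1 - X ^ 2) ^ M * assocLegendre ℓ M * assocLegendre ℓ' M)

theorem legendreInner_comm (M ℓ ℓ' : ℕ) : legendreInner M ℓ ℓ' = legendreInner M ℓ' ℓ := by
  rw [legendreInner, legendreInner, mul_assoc, mul_assoc, mul_comm (assocLegendre ℓ M)]

/-- The derivative of `(1 - x²)^(M+1) P_ℓ^(M+1) P_ℓ'^(M)` integrates to zero, and the differential
equation for `P_ℓ^(M)` rewrites the part in which the first two factors are differentiated. -/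
theorem legendreInner_succ (M ℓ ℓ' : ℕ) :
    legendreInner (M + 1) ℓ ℓ' = ((ℓ : ℝ) - M) * (ℓ + M + 1) * legendreInner M ℓ ℓ' := by
  have h := segInt_derivative
    ((1 - X ^ 2) ^ (M + 1) * derivative (assocLegendre ℓ M) * assocLegendre ℓ' M)
  have e : derivative
      ((1 - X ^ 2) ^ (M + 1) * derivative (assocLegendre ℓ M) * assocLegendre ℓ' M)
      = (1 - X ^ 2) ^ (M + 1) * assocLegendre ℓ (M + 1) * assocLegendre ℓ' (M + 1)
        - (((ℓ : ℝ) - M) * (ℓ + M + 1)) •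
          ((1 - X ^ 2) ^ M * assocLegendre ℓ M * assocLegendre ℓ' M) := by
    have h2 := assocLegendre_ode ℓ M
    simp only [assocLegendre_succ, derivative_mul, derivative_pow, derivative_sub, derivative_one,
      smul_eq_C_mul, map_add, map_sub, map_mul, map_natCast, Nat.add_sub_cancel, Nat.cast_add,
      Nat.cast_one, map_one, derivative_X, Nat.cast_ofNat, map_ofNat]
    linear_combination (1 - X ^ 2) ^ M * assocLegendre ℓ' M * h2
  rw [e, map_sub, map_smul] at h
  simp only [eval_mul, eval_pow, eval_sub, eval_one, eval_X] at h
  norm_num at h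
  rw [legendreInner, legendreInner]
  linarith

/-- The raising factor depends on `ℓ` alone while the inner product is symmetric. The factors for
`ℓ` and `ℓ'` differ by `(ℓ - ℓ')(ℓ + ℓ' + 1)`, which is non-zero. -/
theorem legendreInner_of_ne {M ℓ ℓ' : ℕ} (h : ℓ ≠ ℓ') : legendreInner M ℓ ℓ' = 0 := by
  have h1 := legendreInner_succ M ℓ ℓ'
  have h2 := legendreInner_succ M ℓ' ℓ
  rw [legendreInner_comm, h1, legendreInner_comm M ℓ' ℓ] at h2
  have h3 : ((ℓ : ℝ) - ℓ') * (ℓ + ℓ' + 1) * legendreInner M ℓ ℓ' = 0 := by linear_combination h2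
  have h4 : ((ℓ : ℝ) - ℓ') ≠ 0 := sub_ne_zero.2 (by exact_mod_cast h)
  have h5 : (ℓ : ℝ) + ℓ' + 1 ≠ 0 := by positivity
  simpa [h4, h5] using h3

theorem legendreInner_self_aux {ℓ M : ℕ} (h : M ≤ ℓ) :
    ((ℓ - M).factorial : ℝ) * legendreInner M ℓ ℓ
      = ((ℓ + M).factorial : ℝ) * legendreInner 0 ℓ ℓ := by
  induction M with
  | zero => simp
  | succ M ih =>
    have h1 := ih (by omega)
    have e1 : ((ℓ - M).factorial : ℝ) = ((ℓ : ℝ) - M) * ((ℓ - (M + 1)).factorial : ℝ) := by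
      rw [show ℓ - M = (ℓ - (M + 1)) + 1 by omega, Nat.factorial_succ]
      push_cast [Nat.cast_sub h]; ring
    rw [legendreInner_succ, show ℓ + (M + 1) = (ℓ + M) + 1 by ring, Nat.factorial_succ]
    rw [e1] at h1
    push_cast
    linear_combination ((ℓ : ℝ) + M + 1) * h1

/-- The raising formula links all orders `M ≤ ℓ`. At `M = ℓ` the derivative of the Legendre
polynomial is constant, so only the integral of `(1 - x²)^ℓ` is needed. -/
theorem legendreInner_self {ℓ M : ℕ} (h : M ≤ ℓ) :
    (2 * (ℓ : ℝ) + 1) * ((ℓ - M).factorial : ℝ) * legendreInner M ℓ ℓ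
      = 2 * ((ℓ + M).factorial : ℝ) := by
  have h1 := legendreInner_self_aux (le_refl ℓ)
  have h2 : legendreInner ℓ ℓ ℓ = ((2 ^ ℓ * (ℓ.factorial : ℝ))⁻¹ * (2 * ℓ).factorial) ^ 2 *
      segInt ((1 - X ^ 2) ^ ℓ) := by
    rw [legendreInner, assocLegendre_self, mul_assoc, ← C_mul, mul_comm, ← smul_eq_C_mul, map_smul,
      smul_eq_mul]
    ring
  have h3 := segInt_one_sub_sq_pow ℓ
  rw [Nat.factorial_succ] at h3
  push_cast at h3
  rw [Nat.sub_self, Nat.factorial_zero, ← two_mul, h2] at h1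
  have hf : ((2 * ℓ).factorial : ℝ) ≠ 0 := by positivity
  have hf2 : (ℓ.factorial : ℝ) ≠ 0 := by positivity
  have h4 : (4 : ℝ) ^ ℓ = 2 ^ ℓ * 2 ^ ℓ := by rw [← mul_pow]; norm_num
  rw [h4] at h3
  have h5 : (2 * (ℓ : ℝ) + 1) * legendreInner 0 ℓ ℓ = 2 := by
    field_simp at h1
    have h6 : ((2 * ℓ).factorial : ℝ) * ((2 * (ℓ : ℝ) + 1) * segInt ((1 - X ^ 2) ^ ℓ)) =
      2 * (2 ^ ℓ * 2 ^ ℓ) * (ℓ.factorial : ℝ) ^ 2 := by linarith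
    have h7 : (2 ^ ℓ * 2 ^ ℓ) * (ℓ.factorial : ℝ) ^ 2 ≠ 0 := by positivity
    apply mul_left_cancel₀ h7
    linear_combination (-(2 * (ℓ : ℝ) + 1)) * h1 + h6
  linear_combination (2 * (ℓ : ℝ) + 1) * legendreInner_self_aux h + ((ℓ + M).factorial : ℝ) * h5

end Legendre

/-! ### Orthonormality of the real spherical harmonics. -/

section Solid

open MvPolynomial

/-- A real one-variable polynomial in the third coordinate. -/
def inZ : Polynomial ℝ →ₐ[ℝ] Poly3 := Polynomial.aeval (X 2)

theorem evalAt_inZ (x : E3) (q : Polynomial ℝ) :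
    evalAt x (inZ q) = ((q.eval (x 2) : ℝ) : ℂ) := by
  have h : evalAt x (inZ q) = Polynomial.aeval ((x 2 : ℝ) : ℂ) q := by
    have h1 := Polynomial.aeval_algHom_apply ((evalAt x).restrictScalars ℝ) (X 2) q
    simpa [inZ] using h1.symm
  rw [h, ← Complex.coe_algebraMap, Polynomial.aeval_algebraMap_apply]
  simp

theorem pderiv_inZ (i : Fin 3) (hi : i ≠ 2) (q : Polynomial ℝ) : pderiv i (inZ q) = 0 := by
  induction q using Polynomial.induction_on' with
  | add p q hp hq => rw [map_add, map_add, hp, hq, add_zero]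
  | monomial n a =>
    rw [← Polynomial.C_mul_X_pow_eq_monomial, inZ]
    simp only [map_mul, map_pow, Polynomial.aeval_C, Polynomial.aeval_X]
    rw [IsScalarTower.algebraMap_apply ℝ ℂ Poly3, MvPolynomial.algebraMap_eq, pderiv_C_mul,
      pderiv_pow, pderiv_X_of_ne hi.symm]
    simp

/-- Archimedes' theorem: the height is uniformly distributed on the sphere. Both families of moments
satisfy the same two-step recursion and agree for `k = 0` and `k = 1`. -/
theorem sphI_X_two_pow (k : ℕ) :
    sphI (X 2 ^ k) = 2 * Real.pi * (segInt (Polynomial.X ^ k) : ℂ) := by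
  have hrec : ∀ k : ℕ, ((k : ℂ) + 2) * sphI (X 2 ^ (k + 1)) = k * sphI (X 2 ^ (k - 1)) := by
    intro k
    have h := sphI_X_mul (isHomogeneous_X_pow (R := ℂ) (2 : Fin 3) k) 2
    rw [← pow_succ', pderiv_pow, pderiv_X_self, mul_one, ← nsmul_eq_mul, map_nsmul,
      nsmul_eq_mul] at h
    exact h
  have hseg : ∀ k : ℕ, ((k : ℂ) + 1) * (segInt (Polynomial.X ^ k) : ℂ) = 1 - (-1) ^ (k + 1) := by
    intro k
    exact_mod_cast congrArg (fun t : ℝ => (t : ℂ)) (segInt_X_pow k)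
  induction k using Nat.strong_induction_on with
  | _ k ih =>
    rcases k with _ | _ | k
    · simp [sphI_one, segInt_one]; ring
    · have h1 := hrec 0
      have h2 := hseg 1
      norm_num at h1 h2
      rw [zero_add, pow_one, pow_one, h1, h2]; simp
    · have h1 := hrec (k + 1)
      have h2 := hseg k
      have h3 := hseg (k + 2)
      have h0 := ih k (by omega)
      rw [Nat.add_sub_cancel, h0] at h1
      have hk : (k : ℂ) + 3 ≠ 0 := by exact_mod_cast (by omega : k + 3 ≠ 0)
      apply mul_left_cancel₀ hk
      push_cast at h1 h3
      have h4 : (-1 : ℂ) ^ (k + 2 + 1) = (-1) ^ (k + 1) := by ring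
      rw [h4, ← h2] at h3
      rw [show k + 1 + 1 = k + 2 by ring] at h1 ⊢
      linear_combination h1 - 2 * Real.pi * h3

theorem sphI_inZ (q : Polynomial ℝ) : sphI (inZ q) = 2 * Real.pi * (segInt q : ℂ) := by
  induction q using Polynomial.induction_on' with
  | add p q hp hq => rw [map_add, map_add, map_add, hp, hq]; push_cast; ring
  | monomial n a =>
    rw [← Polynomial.C_mul_X_pow_eq_monomial, ← Polynomial.smul_eq_C_mul, map_smul,
      ← algebraMap_smul ℂ a (inZ (Polynomial.X ^ n)), map_smul, map_smul, inZ, map_pow,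
      Polynomial.aeval_X, sphI_X_two_pow]
    simp
    ring

/-- `x + i y`. -/
def wPlus : Poly3 := X 0 + C Complex.I * X 1

/-- `x - i y`. -/
def wMinus : Poly3 := X 0 - C Complex.I * X 1

theorem C_I_mul_C_I : (C Complex.I : Poly3) * C Complex.I = -1 := by
  rw [← C_mul, Complex.I_mul_I]; simp

theorem wPlus_mul_wMinus : wPlus * wMinus = rho - X 2 ^ 2 := by
  rw [wPlus, wMinus, rho_eq]
  linear_combination (-(X 1 : Poly3) ^ 2) * C_I_mul_C_I

theorem pderiv_wPlus (i : Fin 3) : pderiv i wPlus = C (![1, Complex.I, 0] i) := by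
  fin_cases i <;> simp [wPlus]

theorem pderiv_wMinus (i : Fin 3) : pderiv i wMinus = C (![1, -Complex.I, 0] i) := by
  fin_cases i <;> simp [wMinus]

theorem isHomogeneous_wPlus : wPlus.IsHomogeneous 1 :=
  (isHomogeneous_X _ _).add (isHomogeneous_C_mul_X _ _)

theorem isHomogeneous_wMinus : wMinus.IsHomogeneous 1 :=
  (isHomogeneous_X _ _).sub (isHomogeneous_C_mul_X _ _)

/-- The generator `D` of rotations about the third axis annihilates functions of `z` and has `x ±
iy` as eigenvectors with eigenvalues `±i`. The polynomial is thus an eigenvector with the non-zero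
eigenvalue `(a - b) i`, whereas images of `D` integrate to zero. -/
theorem sphI_inZ_mul_of_ne (q : Polynomial ℝ) {a b : ℕ} (h : a ≠ b) :
    sphI (inZ q * wPlus ^ a * wMinus ^ b) = 0 := by
  set D : Derivation ℂ Poly3 Poly3 := (X 0 : Poly3) • pderiv 1 - (X 1 : Poly3) • pderiv 0 with hD
  have hp : D wPlus = C Complex.I * wPlus := by
    simp only [hD, Derivation.sub_apply, Derivation.smul_apply, pderiv_wPlus, smul_eq_mul]
    simp [wPlus]
    linear_combination (-(X 1 : Poly3)) * C_I_mul_C_I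
  have hm : D wMinus = -(C Complex.I * wMinus) := by
    simp only [hD, Derivation.sub_apply, Derivation.smul_apply, pderiv_wMinus, smul_eq_mul]
    simp [wMinus]
    linear_combination (-(X 1 : Poly3)) * C_I_mul_C_I
  have hz : D (inZ q) = 0 := by
    simp [hD, Derivation.sub_apply, Derivation.smul_apply, pderiv_inZ]
  have hpa : ∀ a : ℕ, D (wPlus ^ a) = C (a * Complex.I) * wPlus ^ a := by
    intro a
    induction a with
    | zero => simp
    | succ n ih =>
      rw [pow_succ, Derivation.leibniz, ih, hp]
      simp only [smul_eq_mul, Nat.cast_add, Nat.cast_one, add_mul, one_mul, C_add]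
      ring
  have hmb : ∀ a : ℕ, D (wMinus ^ a) = -(C (a * Complex.I) * wMinus ^ a) := by
    intro a
    induction a with
    | zero => simp
    | succ n ih =>
      rw [pow_succ, Derivation.leibniz, ih, hm]
      simp only [smul_eq_mul, Nat.cast_add, Nat.cast_one, add_mul, one_mul, C_add]
      ring
  have hall : D (inZ q * wPlus ^ a * wMinus ^ b)
      = (((a : ℂ) - b) * Complex.I) • (inZ q * wPlus ^ a * wMinus ^ b) := by
    rw [Derivation.leibniz, Derivation.leibniz, hz, hpa, hmb, smul_eq_C_mul]
    simp only [smul_eq_mul, sub_mul, C_sub]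
    ring
  have h0 : sphI (D (inZ q * wPlus ^ a * wMinus ^ b)) = 0 := by
    simp only [hD, Derivation.sub_apply, Derivation.smul_apply, smul_eq_mul, map_sub]
    rw [sphI_rot, sub_self]
  rw [hall, map_smul, smul_eq_mul] at h0
  have : ((a : ℂ) - b) * Complex.I ≠ 0 :=
    mul_ne_zero (sub_ne_zero.2 (by exact_mod_cast h)) Complex.I_ne_zero
  exact (mul_eq_zero.1 h0).resolve_left this

theorem sphI_inZ_mul_self (q : Polynomial ℝ) (a : ℕ) :
    sphI (inZ q * wPlus ^ a * wMinus ^ a)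
      = 2 * Real.pi * (segInt ((1 - Polynomial.X ^ 2) ^ a * q) : ℂ) := by
  rw [← sphI_inZ]
  refine sphI_congr fun θ => ?_
  rw [mul_assoc, ← mul_pow, wPlus_mul_wMinus]
  simp only [map_mul, map_pow, map_sub, evalAt_rho_sph, evalAt_X, evalAt_inZ, Polynomial.eval_pow,
    Polynomial.eval_sub, Polynomial.eval_one, Polynomial.eval_X, Complex.ofReal_pow,
    Complex.ofReal_sub, Complex.ofReal_one]
  ring

/-- The coefficient of `(x + i y)^|m|` in the azimuthal factor. -/
def azA (m : ℤ) : ℂ :=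
  if 0 < m then (Real.sqrt 2 : ℂ) / 2 else if m = 0 then 1 / 2
    else -(Complex.I * (Real.sqrt 2 : ℂ) / 2)

/-- The coefficient of `(x - i y)^|m|` in the azimuthal factor. -/
def azB (m : ℤ) : ℂ :=
  if 0 < m then (Real.sqrt 2 : ℂ) / 2 else if m = 0 then 1 / 2
    else Complex.I * (Real.sqrt 2 : ℂ) / 2

/-- The azimuthal factor as a polynomial. -/
def azPoly (m : ℤ) : Poly3 := C (azA m) * wPlus ^ m.natAbs + C (azB m) * wMinus ^ m.natAbs

theorem evalAt_wPlus (x : E3) : evalAt x wPlus = (x 0 : ℂ) + Complex.I * (x 1 : ℂ) := by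
  simp [wPlus]

theorem evalAt_wMinus (x : E3) :
    evalAt x wMinus = (starRingEnd ℂ) ((x 0 : ℂ) + Complex.I * (x 1 : ℂ)) := by
  simp [wMinus]; ring

theorem evalAt_azPoly (m : ℤ) (x : E3) : evalAt x (azPoly m) = (azimuthal m x : ℂ) := by
  rw [azPoly, map_add, map_mul, map_mul, map_pow, map_pow, evalAt_C, evalAt_C, evalAt_wPlus,
    evalAt_wMinus, ← map_pow (starRingEnd ℂ), azimuthal, azA, azB]
  set u := ((x 0 : ℂ) + Complex.I * (x 1 : ℂ)) ^ m.natAbs with hu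
  split_ifs with h1 h2
  · rw [← mul_add, Complex.add_conj]; push_cast; ring
  · subst h2; simp at hu; rw [hu]; simp; norm_num
  · have h := Complex.sub_conj u
    push_cast at h ⊢
    linear_combination (-(Complex.I * (Real.sqrt 2 : ℂ) / 2)) * h
      - (Real.sqrt 2 : ℂ) * (u.im : ℂ) * Complex.I_mul_I

/-- Written in powers of `x + iy` and `x - iy`, the product has four terms, and only those with
equal exponents survive the integration over the azimuth. -/
theorem sphI_az_mul_az (q : Polynomial ℝ) (m m' : ℤ) :
    sphI (inZ q * azPoly m * azPoly m') = if m = m' then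
      2 * Real.pi * (segInt ((1 - Polynomial.X ^ 2) ^ m.natAbs * q) : ℂ) else 0 := by
  set M := m.natAbs
  set M' := m'.natAbs
  have e : inZ q * azPoly m * azPoly m' =
      (azA m * azA m') • (inZ q * wPlus ^ (M + M') * wMinus ^ 0)
      + (azB m * azB m') • (inZ q * wPlus ^ 0 * wMinus ^ (M + M'))
      + (azA m * azB m') • (inZ q * wPlus ^ M * wMinus ^ M')
      + (azB m * azA m') • (inZ q * wPlus ^ M' * wMinus ^ M) := by
    simp only [smul_eq_C_mul, C_mul, azPoly, pow_add]; ring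
  rw [e]
  simp only [map_add, map_smul, smul_eq_mul]
  have h2 : (Real.sqrt 2 : ℂ) * (Real.sqrt 2 : ℂ) = 2 := by
    rw [← Complex.ofReal_mul, Real.mul_self_sqrt (by norm_num)]; norm_num
  by_cases hM : M = M'
  · rw [hM]
    -- For `m = m' = 0` the powers are all trivial and none of the four terms drops out; the
    -- coefficients `1/2` of `azA` and `azB` make them add up to one.
    rcases Nat.eq_zero_or_pos M' with h0 | hpos
    · have hm : m = 0 := Int.natAbs_eq_zero.1 (hM.trans h0)
      have hm' : m' = 0 := Int.natAbs_eq_zero.1 h0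
      rw [h0, hm, hm']
      simp only [add_zero, sphI_inZ_mul_self, azA, azB, lt_irrefl, if_false, if_true]
      ring
    · rw [sphI_inZ_mul_of_ne q (by omega : M' + M' ≠ 0),
        sphI_inZ_mul_of_ne q (by omega : 0 ≠ M' + M'), sphI_inZ_mul_self]
      have hm0 : m ≠ 0 := fun h => by simp [M, h] at hM; omega
      have hm0' : m' ≠ 0 := fun h => by simp [M', h] at hpos
      rcases lt_or_gt_of_ne hm0 with hn | hn <;> rcases lt_or_gt_of_ne hm0' with hn' | hn'
      · have : m = m' := by omega
        subst this
        simp only [azA, azB, hm0, not_lt.2 hn.le, if_true, if_false]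
        linear_combination (Real.pi * (segInt ((1 - Polynomial.X ^ 2) ^ M' * q) : ℂ)) *
          (-(Complex.I * Complex.I) * h2 - 2 * Complex.I_mul_I)
      · have : m ≠ m' := by omega
        simp only [azA, azB, hm0, not_lt.2 hn.le, hn', this, if_true, if_false]
        ring
      · have : m ≠ m' := by omega
        simp only [azA, azB, hm0', not_lt.2 hn'.le, hn, this, if_true, if_false]
        ring
      · have : m = m' := by omega
        subst this
        simp only [azA, azB, hn, if_true]
        linear_combination (Real.pi * (segInt ((1 - Polynomial.X ^ 2) ^ M' * q) : ℂ)) * h2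
  · have hne : m ≠ m' := fun h => hM (by simp [M, M', h])
    rw [sphI_inZ_mul_of_ne q (by omega : M + M' ≠ 0), sphI_inZ_mul_of_ne q (by omega : 0 ≠ M + M'),
      sphI_inZ_mul_of_ne q hM, sphI_inZ_mul_of_ne q (Ne.symm hM), if_neg hne]
    ring

/-- The normalisation constant of `Y_{ℓm}`. -/
def normY (ℓ : ℕ) (m : ℤ) : ℝ := Real.sqrt ((2 * ℓ + 1) / (4 * Real.pi) *
      (((ℓ - m.natAbs).factorial : ℝ) / ((ℓ + m.natAbs).factorial : ℝ)))

theorem normY_pos (ℓ : ℕ) (m : ℤ) : 0 < normY ℓ m := by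
  refine Real.sqrt_pos.2 ?_
  have := Real.pi_pos
  positivity

/-- A polynomial that agrees with `Y_{ℓm}` on the unit sphere. -/
def polyY (ℓ : ℕ) (m : ℤ) : Poly3 :=
  C (normY ℓ m : ℂ) * inZ (assocLegendre ℓ m.natAbs) * azPoly m

theorem evalAt_polyY (ℓ : ℕ) (m : ℤ) (x : E3) :
    evalAt x (polyY ℓ m) = (sphericalHarmonic ℓ m x : ℂ) := by
  simp only [polyY, map_mul, evalAt_C, evalAt_inZ, evalAt_azPoly, sphericalHarmonic, normY,
    assocLegendre]
  push_cast; ring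

theorem sphI_polyY_mul {ℓ : ℕ} {m : ℤ} (hm : m.natAbs ≤ ℓ) (ℓ' : ℕ) (m' : ℤ) :
    sphI (polyY ℓ m * polyY ℓ' m') = if ℓ = ℓ' ∧ m = m' then 1 else 0 := by
  by_cases hmm : m = m'
  · subst hmm
    have e : polyY ℓ m * polyY ℓ' m = ((normY ℓ m : ℂ) * (normY ℓ' m : ℂ)) •
        (inZ (assocLegendre ℓ m.natAbs * assocLegendre ℓ' m.natAbs) * azPoly m * azPoly m) := by
      rw [smul_eq_C_mul, C_mul, polyY, polyY, map_mul]; ring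
    rw [e, map_smul, sphI_az_mul_az, if_pos rfl, ← mul_assoc, ← legendreInner]
    by_cases hl : ℓ = ℓ'
    · subst hl
      rw [if_pos ⟨rfl, rfl⟩]
      have h1 := legendreInner_self hm
      have h2 : normY ℓ m * normY ℓ m = _ := Real.mul_self_sqrt (by positivity)
      rw [smul_eq_mul, ← Complex.ofReal_mul, h2]
      have hp := Real.pi_pos.ne'
      have hf : ((ℓ + m.natAbs).factorial : ℝ) ≠ 0 := by positivity
      have h3 : (2 * (ℓ : ℝ) + 1) / (4 * Real.pi) * (((ℓ - m.natAbs).factorial : ℝ) /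
        ((ℓ + m.natAbs).factorial : ℝ)) * (2 * Real.pi * legendreInner m.natAbs ℓ ℓ) = 1 := by
        field_simp
        linear_combination 2 * h1
      exact_mod_cast h3
    · rw [legendreInner_of_ne hl, if_neg (fun h => hl h.1)]
      simp
  · have e : polyY ℓ m * polyY ℓ' m' = ((normY ℓ m : ℂ) * (normY ℓ' m' : ℂ)) •
        (inZ (assocLegendre ℓ m.natAbs * assocLegendre ℓ' m'.natAbs) * azPoly m * azPoly m') := by
      rw [smul_eq_C_mul, C_mul, polyY, polyY, map_mul]; ring
    rw [e, map_smul, sphI_az_mul_az, if_neg hmm, smul_zero, if_neg (fun h => hmm h.2)]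

end Solid

/-! ### Solid harmonics and the decomposition of homogeneous polynomials. -/

section Solid

open MvPolynomial

/-- The product rule leaves a term `4 ∑ xᵢ∂ᵢQ`, which is `4dQ` by Euler's identity; the remaining
`6Q` is `Q` times the Laplacian of `|x|²`. -/
theorem lap_rho_mul {Q : Poly3} {d : ℕ} (hQ : Q.IsHomogeneous d) :
    lap (rho * Q) = rho * lap Q + C (4 * (d : ℂ) + 6) * Q := by
  have he := hQ.sum_X_mul_pderiv
  rw [Fin.sum_univ_three, nsmul_eq_mul] at he
  have h : ∀ i : Fin 3, lap (X i ^ 2 * Q) = X i ^ 2 * lap Q + 4 * (X i * pderiv i Q) + 2 * Q := by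
    intro i
    rw [pow_two, mul_assoc, lap_X_mul, lap_X_mul, pderiv_mul, pderiv_X_self]
    ring
  rw [rho_eq, add_mul, add_mul, map_add, map_add, h, h, h]
  simp only [C_add, C_mul, map_natCast, map_ofNat]
  linear_combination 4 * he

theorem lap_rho_pow_succ_mul {Q : Poly3} {d : ℕ} (hQ : Q.IsHomogeneous d) (j : ℕ) :
    lap (rho ^ (j + 1) * Q) = rho ^ (j + 1) * lap Q +
      C (2 * ((j : ℂ) + 1) * (2 * (j + 1) + 1 + 2 * d)) * (rho ^ j * Q) := by
  induction j with
  | zero =>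
    rw [zero_add, pow_one, lap_rho_mul hQ, pow_zero, one_mul]
    congr 3; push_cast; ring
  | succ j ih =>
    have hj : (rho ^ (j + 1) * Q).IsHomogeneous (2 * (j + 1) + d) :=
      (isHomogeneous_rho.pow (j + 1)).mul hQ
    rw [pow_succ', mul_assoc, lap_rho_mul hj, ih]
    simp only [C_add, C_mul, map_natCast, map_ofNat, Nat.cast_add, Nat.cast_mul, Nat.cast_one,
      Nat.cast_ofNat, map_one]
    ring

theorem lap_X_two_pow_mul {W : Poly3} (hz : pderiv 2 W = 0) (hl : lap W = 0) (k : ℕ) :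
    lap (X 2 ^ (k + 2) * W) = C (((k : ℂ) + 2) * (k + 1)) * (X 2 ^ k * W) := by
  have hd : ∀ k : ℕ, pderiv 2 (X 2 ^ (k + 1) * W) = C ((k : ℂ) + 1) * (X 2 ^ k * W) := by
    intro k
    rw [pderiv_mul, hz, pderiv_pow, pderiv_X_self]
    simp only [C_add, map_natCast, map_one, Nat.add_sub_cancel, Nat.cast_add, Nat.cast_one]
    ring
  induction k with
  | zero =>
    rw [zero_add, pow_two, mul_assoc, lap_X_mul, lap_X_mul, hl, hz, pderiv_mul, hz, pderiv_X_self]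
    simp only [Nat.cast_zero, zero_add, mul_one, pow_zero, one_mul, mul_zero, add_zero, map_ofNat]
  | succ k ih =>
    rw [show k + 1 + 2 = (k + 2) + 1 by ring, pow_succ', mul_assoc, lap_X_mul, ih, hd (k + 1)]
    simp only [C_add, C_mul, map_natCast, map_one, map_ofNat, Nat.cast_add, Nat.cast_one]
    ring

/-- The homogenisation of the `M`-th derivative of the Legendre polynomial. -/
def homogLegendre (ℓ M : ℕ) : Poly3 := ∑ j ∈ Finset.range ((ℓ - M) / 2 + 1),
  C ((assocLegendre ℓ M).coeff (ℓ - M - 2 * j) : ℂ) * (rho ^ j * X 2 ^ (ℓ - M - 2 * j))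

theorem isHomogeneous_homogLegendre (ℓ M : ℕ) : (homogLegendre ℓ M).IsHomogeneous (ℓ - M) := by
  refine IsHomogeneous.sum _ _ _ fun j hj => ?_
  have hj' : 2 * j ≤ ℓ - M := by
    have := Finset.mem_range.1 hj; omega
  have h := ((isHomogeneous_rho.pow j).mul
    (isHomogeneous_X_pow (R := ℂ) (2 : Fin 3) (ℓ - M - 2 * j)))
  rw [show 2 * j + (ℓ - M - 2 * j) = ℓ - M by omega] at h
  exact h.C_mul _

/-- In the `j`-th summand the Laplacian acts on the power of `z` times `W`, giving `A j`, or lowers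
the power of `|x|²`, giving `B j`. The coefficient recurrence of the Legendre equation says
precisely that `A j` cancels `B (j + 1)`. -/
theorem lap_homogLegendre_mul {ℓ M : ℕ} (hM : M ≤ ℓ) {W : Poly3} (hz : pderiv 2 W = 0)
    (hl : lap W = 0) (hW : W.IsHomogeneous M) : lap (homogLegendre ℓ M * W) = 0 := by
  set n := ℓ - M with hn
  set c : ℕ → ℂ := fun k => ((assocLegendre ℓ M).coeff k : ℂ) with hc
  let A : ℕ → Poly3 := fun j => C (c (n - 2 * j)) * (rho ^ j * lap (X 2 ^ (n - 2 * j) * W))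
  let B : ℕ → Poly3 := fun j => C (c (n - 2 * j) * (2 * (j : ℂ) *
    (2 * j + 1 + 2 * ((n - 2 * j : ℕ) + M)))) * (rho ^ (j - 1) * (X 2 ^ (n - 2 * j) * W))
  have hAB : lap (homogLegendre ℓ M * W) = ∑ j ∈ Finset.range (n / 2 + 1), (A j + B j) := by
    rw [homogLegendre, Finset.sum_mul, map_sum]
    refine Finset.sum_congr rfl fun j _ => ?_
    have hQ : (X 2 ^ (n - 2 * j) * W).IsHomogeneous (n - 2 * j + M) :=
      (isHomogeneous_X_pow (R := ℂ) (2 : Fin 3) _).mul hW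
    rw [mul_assoc, mul_assoc, ← smul_eq_C_mul, map_smul, smul_eq_C_mul]
    rcases j with _ | j
    · simp [A, B, c, ← hn]
    · rw [lap_rho_pow_succ_mul hQ]
      have e : (2 * ((j + 1 : ℕ) : ℂ) * (2 * ((j + 1 : ℕ) : ℂ) + 1 +
          2 * ((n - 2 * (j + 1) : ℕ) + M))) =
          2 * ((j : ℂ) + 1) * (2 * (j + 1) + 1 + 2 * ((n - 2 * (j + 1) + M : ℕ) : ℂ)) := by
        push_cast; ring
      simp only [A, B, Nat.add_sub_cancel]
      rw [e]
      generalize 2 * ((j : ℂ) + 1) * (2 * (j + 1) + 1 + 2 * ((n - 2 * (j + 1) + M : ℕ) : ℂ)) = α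
      simp only [c, ← hn, C_mul]
      ring
  -- The last summand contains `z` to the power `0` or `1`, and both `W` and `zW` are harmonic,
  -- since `W` is harmonic and independent of `z`.
  have hend : A (n / 2) = 0 := by
    have h1 : n - 2 * (n / 2) = 0 ∨ n - 2 * (n / 2) = 1 := by omega
    rcases h1 with h1 | h1 <;> simp only [A, h1]
    · simp [hl]
    · rw [pow_one, lap_X_mul, hl, hz]; simp
  have hstart : B 0 = 0 := by simp [B]
  have hstep : ∀ j ∈ Finset.range (n / 2), A j + B (j + 1) = 0 := by
    intro j hj
    have hj' := Finset.mem_range.1 hj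
    obtain ⟨k, hk⟩ : ∃ k, n = k + 2 * j + 2 := ⟨n - (2 * j + 2), by omega⟩
    have e1 : n - 2 * j = k + 2 := by omega
    have e2 : n - 2 * (j + 1) = k := by omega
    have hrec : ((k : ℂ) + 2) * (k + 1) * c (k + 2) + ((ℓ : ℂ) - M - k) * (ℓ + M + k + 1) * c k
        = 0 := by
      simp only [hc]
      exact_mod_cast congrArg (fun t : ℝ => (t : ℂ)) (assocLegendre_coeff_rec ℓ M k)
    have hℓ : (ℓ : ℂ) = k + 2 * j + 2 + M := by
      have : ℓ = k + 2 * j + 2 + M := by omega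
      rw [this]; push_cast; ring
    simp only [A, B, e1, e2, lap_X_two_pow_mul hz hl, Nat.add_sub_cancel]
    rw [hℓ] at hrec
    have := congrArg (C : ℂ → Poly3) hrec
    simp only [C_add, C_mul, C_sub, map_natCast, map_one, map_ofNat, Nat.cast_add, Nat.cast_one,
      map_zero] at this ⊢
    linear_combination (rho ^ j * (X 2 ^ k * W)) * this
  rw [hAB, Finset.sum_add_distrib, Finset.sum_range_succ, hend, add_zero,
    Finset.sum_range_succ', hstart, add_zero, ← Finset.sum_add_distrib]
  exact Finset.sum_eq_zero hstep

/-- Parity of the Legendre polynomials. The coefficient one place above the top degree vanishes, and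
the two-step recurrence carries this zero downwards, since its factor `ℓ - M - k` does not vanish
below the top degree. -/
theorem assocLegendre_coeff_odd {ℓ M : ℕ} (j : ℕ) (hj : 2 * j + 1 ≤ ℓ - M) :
    (assocLegendre ℓ M).coeff (ℓ - M - (2 * j + 1)) = 0 := by
  have key : ∀ k, k + 1 ≤ ℓ - M → (assocLegendre ℓ M).coeff (k + 2) = 0 →
      (assocLegendre ℓ M).coeff k = 0 := by
    intro k hk h0
    have h := assocLegendre_coeff_rec ℓ M k
    rw [h0, mul_zero, zero_add] at h
    have h1 : (ℓ : ℝ) - M - k ≠ 0 := by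
      have : ((M + k + 1 : ℕ) : ℝ) ≤ ℓ := by exact_mod_cast (by omega : M + k + 1 ≤ ℓ)
      push_cast at this
      intro h; linarith
    have h2 : (ℓ : ℝ) + M + k + 1 ≠ 0 := by positivity
    exact (mul_eq_zero.1 h).resolve_left (mul_ne_zero h1 h2)
  induction j with
  | zero =>
    refine key _ (by omega) (assocLegendre_coeff_of_lt (by omega))
  | succ j ih =>
    refine key _ (by omega) ?_
    have h := ih (by omega)
    rwa [show ℓ - M - (2 * (j + 1) + 1) + 2 = ℓ - M - (2 * j + 1) by omega]

/-- On the sphere `|x|² = 1`, so the homogenisation collapses to the sum over every second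
coefficient; the omitted ones vanish by parity. -/
theorem evalAt_homogLegendre_sph (ℓ M : ℕ) (hM : M ≤ ℓ) (θ : Sph) :
    evalAt θ (homogLegendre ℓ M) = evalAt θ (inZ (assocLegendre ℓ M)) := by
  set n := ℓ - M with hn
  have hdeg : (assocLegendre ℓ M).natDegree < n + 1 := by
    refine Nat.lt_succ_of_le (Polynomial.natDegree_le_iff_coeff_eq_zero.2 fun N hN => ?_)
    exact assocLegendre_coeff_of_lt (by omega)
  rw [evalAt_inZ, Polynomial.eval_eq_sum_range' hdeg]
  let f : ℕ → ℂ := fun i => ((assocLegendre ℓ M).coeff (n - i) : ℂ) * ((θ : E3) 2 : ℂ) ^ (n - i)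
  have h1 : evalAt θ (homogLegendre ℓ M) = ∑ j ∈ Finset.range (n / 2 + 1), f (2 * j) := by
    rw [homogLegendre, map_sum]
    refine Finset.sum_congr rfl fun j _ => ?_
    simp [f, evalAt_rho_sph, ← hn]
  have h2 : ∑ j ∈ Finset.range (n / 2 + 1), f (2 * j) = ∑ i ∈ Finset.range (n + 1), f i := by
    rw [← Finset.sum_image (f := f) (g := fun j => 2 * j)
      (s := Finset.range (n / 2 + 1)) (fun a _ b _ h => by simpa using h)]
    refine Finset.sum_subset ?_ ?_
    · intro i hi
      obtain ⟨j, hj, rfl⟩ := Finset.mem_image.1 hi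
      have := Finset.mem_range.1 hj
      exact Finset.mem_range.2 (by omega)
    · intro i hi hi'
      have hi2 := Finset.mem_range.1 hi
      obtain ⟨j, rfl | rfl⟩ := Nat.even_or_odd' i
      · exact absurd (Finset.mem_image.2 ⟨j, Finset.mem_range.2 (by omega), rfl⟩) hi'
      · simp [f, hn, assocLegendre_coeff_odd (ℓ := ℓ) (M := M) j (by omega)]
  rw [h1, h2, ← Finset.sum_range_reflect]
  push_cast
  refine Finset.sum_congr rfl fun i hi => ?_
  have := Finset.mem_range.1 hi
  simp only [f]
  rw [show n - (n - i) = i by omega]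

/-- The solid harmonic `|x|^ℓ Y_{ℓm}(x / |x|)`. -/
def solidY (ℓ : ℕ) (m : ℤ) : Poly3 := C (normY ℓ m : ℂ) * (homogLegendre ℓ m.natAbs * azPoly m)

theorem isHomogeneous_azPoly (m : ℤ) : (azPoly m).IsHomogeneous m.natAbs := by
  have h1 := isHomogeneous_wPlus.pow m.natAbs
  have h2 := isHomogeneous_wMinus.pow m.natAbs
  rw [one_mul] at h1 h2
  exact (h1.C_mul _).add (h2.C_mul _)

theorem isHomogeneous_solidY {ℓ : ℕ} {m : ℤ} (hm : m.natAbs ≤ ℓ) :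
    (solidY ℓ m).IsHomogeneous ℓ := by
  have h := ((isHomogeneous_homogLegendre ℓ m.natAbs).mul (isHomogeneous_azPoly m)).C_mul
    (normY ℓ m : ℂ)
  rwa [Nat.sub_add_cancel hm] at h

theorem pderiv_two_azPoly (m : ℤ) : pderiv 2 (azPoly m) = 0 := by
  simp [azPoly, pderiv_pow, pderiv_wPlus, pderiv_wMinus]

/-- The powers of `x ± iy` are holomorphic or antiholomorphic in `x + iy`, hence harmonic;
algebraically this is `1 + i² = 0`. -/
theorem lap_azPoly (m : ℤ) : lap (azPoly m) = 0 := by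
  have hI : (C Complex.I : Poly3) ^ 2 = -1 := by rw [pow_two, C_I_mul_C_I]
  rw [azPoly]
  generalize azA m = α
  generalize azB m = β
  generalize m.natAbs = M
  simp only [lap_apply, Fin.sum_univ_three, map_add, pderiv_C_mul, pderiv_pow,
    pderiv_wPlus, pderiv_wMinus, pderiv_mul, pderiv_C]
  simp
  linear_combination (C α * M * (((M - 1 : ℕ) : Poly3) * wPlus ^ (M - 1 - 1))
    + C β * M * (((M - 1 : ℕ) : Poly3) * wMinus ^ (M - 1 - 1))) * hI

theorem lap_solidY {ℓ : ℕ} {m : ℤ} (hm : m.natAbs ≤ ℓ) : lap (solidY ℓ m) = 0 := by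
  rw [solidY, ← smul_eq_C_mul, map_smul, lap_homogLegendre_mul hm (pderiv_two_azPoly m)
    (lap_azPoly m) (isHomogeneous_azPoly m), smul_zero]

theorem evalAt_solidY_sph {ℓ : ℕ} {m : ℤ} (hm : m.natAbs ≤ ℓ) (θ : Sph) :
    evalAt θ (solidY ℓ m) = (sphericalHarmonic ℓ m θ : ℂ) := by
  rw [← evalAt_polyY, solidY, polyY]
  simp only [map_mul, evalAt_homogLegendre_sph ℓ _ hm]
  ring

theorem evalAt_solidY {ℓ : ℕ} {m : ℤ} (hm : m.natAbs ≤ ℓ) {x : E3} (hx : x ≠ 0) :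
    evalAt x (solidY ℓ m) = (‖x‖ : ℂ) ^ ℓ * (sphericalHarmonic ℓ m (direction x) : ℂ) := by
  rw [evalAt_eq_direction (isHomogeneous_solidY hm)]
  have hd : direction x ∈ Metric.sphere (0 : E3) 1 := by simp [norm_direction hx]
  rw [evalAt_solidY_sph hm ⟨direction x, hd⟩]

/-- The orthonormality of the spherical harmonics. -/
theorem integral_sphericalHarmonic_mul {ℓ : ℕ} {m : ℤ} (hm : m.natAbs ≤ ℓ) (ℓ' : ℕ) (m' : ℤ) :
    ∫ θ : Sph, (sphericalHarmonic ℓ m θ : ℂ) * (sphericalHarmonic ℓ' m' θ : ℂ) ∂surf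
      = if ℓ = ℓ' ∧ m = m' then 1 else 0 := by
  rw [← sphI_polyY_mul hm, sphI_apply]
  simp only [map_mul, evalAt_polyY]

/-- The span of the solid harmonics times powers of `|x|²` of total degree `D`. -/
def solidSpan (D : ℕ) : Submodule ℂ Poly3 := Submodule.span ℂ
  {P | ∃ (j ℓ : ℕ) (m : ℤ), m.natAbs ≤ ℓ ∧ 2 * j + ℓ = D ∧ P = rho ^ j * solidY ℓ m}

theorem rho_mul_mem_solidSpan {D : ℕ} {P : Poly3} (hP : P ∈ solidSpan D) :
    rho * P ∈ solidSpan (D + 2) := by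
  induction hP using Submodule.span_induction with
  | mem P h =>
    obtain ⟨j, ℓ, m, hm, hD, rfl⟩ := h
    exact Submodule.subset_span ⟨j + 1, ℓ, m, hm, by omega, by rw [pow_succ']; ring⟩
  | zero => simp
  | add P Q _ _ hP hQ => rw [mul_add]; exact add_mem hP hQ
  | smul c P _ hP => rw [mul_smul_comm]; exact Submodule.smul_mem _ c hP

theorem rho_pow_mul_mem_solidSpan {D : ℕ} {P : Poly3} (hP : P ∈ solidSpan D) (j : ℕ) :
    rho ^ j * P ∈ solidSpan (D + 2 * j) := by
  induction j with
  | zero => simpa using hP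
  | succ j ih =>
    rw [pow_succ', mul_assoc]
    exact rho_mul_mem_solidSpan ih

theorem solidY_mem_solidSpan {ℓ : ℕ} {m : ℤ} (hm : m.natAbs ≤ ℓ) :
    solidY ℓ m ∈ solidSpan ℓ :=
  Submodule.subset_span ⟨0, ℓ, m, hm, by omega, by simp⟩

theorem homogLegendre_mul_az_mem {ℓ : ℕ} {m : ℤ} (hm : m.natAbs ≤ ℓ) :
    homogLegendre ℓ m.natAbs * azPoly m ∈ solidSpan ℓ := by
  have h := Submodule.smul_mem _ ((normY ℓ m : ℂ)⁻¹) (solidY_mem_solidSpan hm)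
  rw [solidY, ← smul_eq_C_mul, smul_smul, inv_mul_cancel₀
    (by exact_mod_cast (normY_pos ℓ m).ne'), one_smul] at h
  exact h

theorem azPoly_zero : azPoly 0 = 1 := by
  have hhalf : (C (1 / 2 : ℂ) : Poly3) * 2 = 1 := by
    rw [← map_ofNat (C : ℂ →+* Poly3) 2, ← C_mul]; norm_num
  simp only [azPoly, azA, azB, lt_irrefl, if_false, if_true, Int.natAbs_zero, pow_zero]
  linear_combination hhalf

theorem wPow_eq (M : ℕ) : wPlus ^ M ∈ Submodule.span ℂ {azPoly M, azPoly (-M)} ∧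
    wMinus ^ M ∈ Submodule.span ℂ {azPoly M, azPoly (-M)} := by
  have h2 : (Real.sqrt 2 : ℂ) * (Real.sqrt 2 : ℂ) = 2 := by
    rw [← Complex.ofReal_mul, Real.mul_self_sqrt (by norm_num)]; norm_num
  have hC : (C (Real.sqrt 2 : ℂ) : Poly3) * C (Real.sqrt 2 : ℂ) = 2 := by
    rw [← C_mul, h2, map_ofNat]
  have hhalf : (C (1 / 2 : ℂ) : Poly3) * 2 = 1 := by
    rw [← map_ofNat (C : ℂ →+* Poly3) 2, ← C_mul]; norm_num
  rw [Submodule.mem_span_pair, Submodule.mem_span_pair]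
  rcases Nat.eq_zero_or_pos M with rfl | hM
  · refine ⟨⟨1, 0, ?_⟩, ⟨1, 0, ?_⟩⟩ <;>
    · simp only [Nat.cast_zero, azPoly_zero, one_smul, zero_smul, add_zero, pow_zero]
  · have hp : (0 : ℤ) < M := by exact_mod_cast hM
    have hn : ¬ (0 : ℤ) < -M := by omega
    have hn0 : (-(M : ℤ)) ≠ 0 := by omega
    have e1 : azPoly M = C (Real.sqrt 2 : ℂ) * (C (1 / 2) * (wPlus ^ M + wMinus ^ M)) := by
      simp only [azPoly, azA, azB, hp, if_true, Int.natAbs_natCast, div_eq_mul_inv, C_mul, one_mul]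
      ring
    have e2 : azPoly (-M) = C (Real.sqrt 2 : ℂ) * (C (1 / 2) * C Complex.I *
        (wMinus ^ M - wPlus ^ M)) := by
      simp only [azPoly, azA, azB, hn, hn0, if_false, Int.natAbs_neg, Int.natAbs_natCast,
        div_eq_mul_inv, C_mul, C_neg, one_mul]
      ring
    have hI := C_I_mul_C_I
    refine ⟨⟨(1 / 2) * (Real.sqrt 2 : ℂ), (1 / 2) * (Real.sqrt 2 : ℂ) * Complex.I, ?_⟩,
      ⟨(1 / 2) * (Real.sqrt 2 : ℂ), -((1 / 2) * (Real.sqrt 2 : ℂ) * Complex.I), ?_⟩⟩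
    · rw [e1, e2, smul_eq_C_mul, smul_eq_C_mul]
      simp only [C_mul]
      linear_combination (C (1/2 : ℂ) * C (1/2) * ((wPlus ^ M + wMinus ^ M) +
        C Complex.I * C Complex.I * (wMinus ^ M - wPlus ^ M))) * hC
        + 2 * C (1/2 : ℂ) * C (1/2) * (wMinus ^ M - wPlus ^ M) * hI
        + (2 * C (1/2 : ℂ) + 1) * wPlus ^ M * hhalf
    · rw [e1, e2, smul_eq_C_mul, smul_eq_C_mul]
      simp only [C_mul, C_neg]
      linear_combination (C (1/2 : ℂ) * C (1/2) * ((wPlus ^ M + wMinus ^ M) -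
        C Complex.I * C Complex.I * (wMinus ^ M - wPlus ^ M))) * hC
        - 2 * C (1/2 : ℂ) * C (1/2) * (wMinus ^ M - wPlus ^ M) * hI
        + (2 * C (1/2 : ℂ) + 1) * wMinus ^ M * hhalf

theorem homogLegendre_mul_mem {ℓ M : ℕ} (hM : M ≤ ℓ) {W : Poly3}
    (hW : W ∈ Submodule.span ℂ {azPoly M, azPoly (-M)}) : homogLegendre ℓ M * W ∈ solidSpan ℓ := by
  obtain ⟨a, b, rfl⟩ := Submodule.mem_span_pair.1 hW
  rw [mul_add, mul_smul_comm, mul_smul_comm]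
  have h1 := homogLegendre_mul_az_mem (ℓ := ℓ) (m := (M : ℤ)) (by simpa using hM)
  have h2 := homogLegendre_mul_az_mem (ℓ := ℓ) (m := -(M : ℤ)) (by simpa using hM)
  simp only [Int.natAbs_neg, Int.natAbs_natCast] at h1 h2
  exact add_mem (Submodule.smul_mem _ _ h1) (Submodule.smul_mem _ _ h2)

/-- In the homogenised Legendre polynomial of degree `k` the summand without a factor `|x|²` is a
non-zero multiple of `z^k`. All others contain `|x|²` and a lower power of `z`, so strong induction
on `k` applies. -/
theorem X_two_pow_mul_mem {M : ℕ} {W : Poly3}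
    (hW : W ∈ Submodule.span ℂ {azPoly M, azPoly (-M)}) (k : ℕ) :
    X 2 ^ k * W ∈ solidSpan (k + M) := by
  induction k using Nat.strong_induction_on with
  | _ k ih =>
    have h := homogLegendre_mul_mem (ℓ := k + M) (by omega) hW
    rw [homogLegendre, Nat.add_sub_cancel, Finset.sum_range_succ', add_mul, Finset.sum_mul] at h
    have h1 : ∑ j ∈ Finset.range (k / 2),
        C ((assocLegendre (k + M) M).coeff (k - 2 * (j + 1)) : ℂ) *
          (rho ^ (j + 1) * X 2 ^ (k - 2 * (j + 1))) * W ∈ solidSpan (k + M) := by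
      refine Submodule.sum_mem _ fun j hj => ?_
      have hj' := Finset.mem_range.1 hj
      have h2 := rho_pow_mul_mem_solidSpan (ih (k - 2 * (j + 1)) (by omega)) (j + 1)
      rw [show k - 2 * (j + 1) + M + 2 * (j + 1) = k + M by omega] at h2
      rw [mul_assoc, mul_assoc, ← smul_eq_C_mul]
      exact Submodule.smul_mem _ _ h2
    have h3 := (Submodule.add_mem_iff_right _ h1).1 h
    have hc : ((assocLegendre (k + M) M).coeff k : ℂ) ≠ 0 := by
      have := assocLegendre_coeff_top_ne_zero (ℓ := k + M) (M := M) (by omega)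
      rw [Nat.add_sub_cancel] at this
      exact_mod_cast this
    simp only [mul_zero, Nat.sub_zero, pow_zero, one_mul] at h3
    rw [mul_assoc, ← smul_eq_C_mul] at h3
    exact (Submodule.smul_mem_iff _ hc).1 h3

/-- A factor `(x + iy)(x - iy)` equals `|x|² - z²`. Using this repeatedly removes one of the two
conjugate variables, which is the case treated before. -/
theorem X_two_pow_mul_w_mem (k a b : ℕ) :
    X 2 ^ k * (wPlus ^ a * wMinus ^ b) ∈ solidSpan (k + a + b) := by
  induction a generalizing k b with
  | zero => simpa using X_two_pow_mul_mem (wPow_eq b).2 k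
  | succ a ih =>
    rcases b with _ | b
    · simpa using X_two_pow_mul_mem (wPow_eq (a + 1)).1 k
    · have e : X 2 ^ k * (wPlus ^ (a + 1) * wMinus ^ (b + 1)) =
          rho * (X 2 ^ k * (wPlus ^ a * wMinus ^ b)) - X 2 ^ (k + 2) * (wPlus ^ a * wMinus ^ b) := by
        linear_combination (X 2 ^ k * (wPlus ^ a * wMinus ^ b)) * wPlus_mul_wMinus
      rw [e]
      have h1 := rho_mul_mem_solidSpan (ih k b)
      have h2 := ih (k + 2) b
      rw [show k + a + b + 2 = k + (a + 1) + (b + 1) by ring] at h1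
      rw [show k + 2 + a + b = k + (a + 1) + (b + 1) by ring] at h2
      exact sub_mem h1 h2

/-- The span of the monomials in `z`, `x + iy`, `x - iy` of degree `D`. -/
def wSpan (D : ℕ) : Submodule ℂ Poly3 := Submodule.span ℂ
  {P | ∃ k a b : ℕ, k + a + b = D ∧ P = X 2 ^ k * (wPlus ^ a * wMinus ^ b)}

theorem wSpan_le (D : ℕ) : wSpan D ≤ solidSpan D := by
  refine Submodule.span_le.2 ?_
  rintro P ⟨k, a, b, rfl, rfl⟩
  exact X_two_pow_mul_w_mem k a b

theorem X_mul_mem_wSpan (i : Fin 3) {D : ℕ} {P : Poly3} (hP : P ∈ wSpan D) :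
    X i * P ∈ wSpan (D + 1) := by
  have hx : (X 0 : Poly3) = C (1 / 2) * (wPlus + wMinus) := by
    have : (C (1 / 2 : ℂ) : Poly3) * 2 = 1 := by
      rw [← map_ofNat (C : ℂ →+* Poly3) 2, ← C_mul]; norm_num
    rw [wPlus, wMinus]
    linear_combination (-(X 0 : Poly3)) * this
  have hy : (X 1 : Poly3) = C (Complex.I / 2) * (wMinus - wPlus) := by
    have : (C (Complex.I / 2) : Poly3) * (2 * C Complex.I) = -1 := by
      rw [← map_ofNat (C : ℂ →+* Poly3) 2, ← C_mul, ← C_mul,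
        show Complex.I / 2 * (2 * Complex.I) = Complex.I * Complex.I by ring, C_mul, C_I_mul_C_I]
    rw [wPlus, wMinus]
    linear_combination (X 1 : Poly3) * this
  induction hP using Submodule.span_induction with
  | mem P h =>
    obtain ⟨k, a, b, rfl, rfl⟩ := h
    have hp : X 2 ^ k * (wPlus ^ (a + 1) * wMinus ^ b) ∈ wSpan (k + a + b + 1) :=
      Submodule.subset_span ⟨k, a + 1, b, by ring, rfl⟩
    have hm : X 2 ^ k * (wPlus ^ a * wMinus ^ (b + 1)) ∈ wSpan (k + a + b + 1) :=
      Submodule.subset_span ⟨k, a, b + 1, by ring, rfl⟩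
    fin_cases i
    · have e : (X 0 : Poly3) * (X 2 ^ k * (wPlus ^ a * wMinus ^ b)) =
          (1 / 2 : ℂ) • (X 2 ^ k * (wPlus ^ (a + 1) * wMinus ^ b)
            + X 2 ^ k * (wPlus ^ a * wMinus ^ (b + 1))) := by
        rw [smul_eq_C_mul]
        linear_combination (X 2 ^ k * (wPlus ^ a * wMinus ^ b)) * hx
      change (X 0 : Poly3) * _ ∈ _
      rw [e]
      exact Submodule.smul_mem _ _ (add_mem hp hm)
    · have e : (X 1 : Poly3) * (X 2 ^ k * (wPlus ^ a * wMinus ^ b)) =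
          (Complex.I / 2 : ℂ) • (X 2 ^ k * (wPlus ^ a * wMinus ^ (b + 1))
            - X 2 ^ k * (wPlus ^ (a + 1) * wMinus ^ b)) := by
        rw [smul_eq_C_mul]
        linear_combination (X 2 ^ k * (wPlus ^ a * wMinus ^ b)) * hy
      change (X 1 : Poly3) * _ ∈ _
      rw [e]
      exact Submodule.smul_mem _ _ (sub_mem hm hp)
    · exact Submodule.subset_span ⟨k + 1, a, b, by ring, by
        change (X 2 : Poly3) * _ = _
        ring⟩
  | zero => simp
  | add P Q _ _ hP hQ => rw [mul_add]; exact add_mem hP hQ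
  | smul c P _ hP => rw [mul_smul_comm]; exact Submodule.smul_mem _ c hP

theorem X_pow_mul_mem_wSpan (i : Fin 3) {D : ℕ} {P : Poly3} (hP : P ∈ wSpan D) (n : ℕ) :
    X i ^ n * P ∈ wSpan (D + n) := by
  induction n with
  | zero => simpa using hP
  | succ n ih => rw [pow_succ', mul_assoc]; exact X_mul_mem_wSpan i ih

/-- The classical decomposition into powers of `|x|²` times harmonic polynomials. The coordinates
are linear combinations of `z`, `x + iy` and `x - iy`, so it suffices to treat monomials in these.
-/
theorem mem_solidSpan {P : Poly3} {D : ℕ} (hP : P.IsHomogeneous D) : P ∈ solidSpan D := by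
  refine wSpan_le D ?_
  rw [P.as_sum]
  refine Submodule.sum_mem _ fun s hs => ?_
  have hdeg : s 0 + s 1 + s 2 = D := by
    rw [hP.degree_eq_sum_deg_support hs, ← Finsupp.degree_apply, Finsupp.degree_eq_sum,
      Fin.sum_univ_three]
  have h1 : (1 : Poly3) ∈ wSpan 0 := Submodule.subset_span ⟨0, 0, 0, rfl, by simp⟩
  have h := X_pow_mul_mem_wSpan 0 (X_pow_mul_mem_wSpan 1 (X_pow_mul_mem_wSpan 2 h1 (s 2)) (s 1))
    (s 0)
  rw [monomial_eq, Finsupp.prod_fintype _ _ (by simp), Fin.prod_univ_three, ← smul_eq_C_mul]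
  refine Submodule.smul_mem _ _ ?_
  rw [show 0 + s 2 + s 1 + s 0 = D by omega] at h
  convert h using 1
  ring

/-- In the decomposition of `P` only harmonics of degrees `D, D - 2, D - 4, …` occur, and on the
sphere these are orthogonal to every other degree. For a product of two solid harmonics this is the
selection rule for Gaunt coefficients. -/
theorem sphI_mul_polyY_eq_zero {P : Poly3} {D : ℕ} (hP : P.IsHomogeneous D) {ℓ : ℕ} {m : ℤ}
    (h : ∀ j : ℕ, 2 * j + ℓ ≠ D) : sphI (P * polyY ℓ m) = 0 := by
  have hP' := mem_solidSpan hP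
  clear hP
  induction hP' using Submodule.span_induction with
  | mem P hP =>
    obtain ⟨j, ℓ', m', hm', hD, rfl⟩ := hP
    have e : sphI (rho ^ j * solidY ℓ' m' * polyY ℓ m) = sphI (polyY ℓ' m' * polyY ℓ m) :=
      sphI_congr fun θ => by
        simp only [map_mul, map_pow, evalAt_rho_sph, one_pow, one_mul, evalAt_solidY_sph hm',
          evalAt_polyY]
    rw [e, sphI_polyY_mul hm', if_neg]
    rintro ⟨rfl, -⟩
    exact h j hD
  | zero => simp
  | add P Q _ _ hP hQ => rw [add_mul, map_add, hP, hQ, add_zero]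
  | smul c P _ hP => rw [smul_mul_assoc, map_smul, hP, smul_zero]

/-- The expansion of a homogeneous polynomial in solid harmonics, under a functional on which
`|x|²` acts as the scalar `c`. -/
theorem map_eq_sum_solidY {P : Poly3} {D : ℕ} (hP : P.IsHomogeneous D) (Φ : Poly3 →ₗ[ℂ] ℂ) {c : ℂ}
    (hΦ : ∀ Q, Φ (rho * Q) = c ^ 2 * Φ Q) :
    Φ P = ∑ ℓ ∈ Finset.range (D + 1), ∑ m ∈ Finset.Icc (-(ℓ : ℤ)) ℓ,
      sphI (P * polyY ℓ m) * (c ^ (D - ℓ) * Φ (solidY ℓ m)) := by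
  have hP' := mem_solidSpan hP
  clear hP
  have hpow : ∀ (j : ℕ) (Q : Poly3), Φ (rho ^ j * Q) = c ^ (2 * j) * Φ Q := by
    intro j Q
    induction j with
    | zero => simp
    | succ j ih => rw [pow_succ', mul_assoc, hΦ, ih]; ring
  induction hP' using Submodule.span_induction with
  | mem P hP =>
    obtain ⟨j, ℓ', m', hm', hD, rfl⟩ := hP
    have e : ∀ ℓ m, sphI (rho ^ j * solidY ℓ' m' * polyY ℓ m) = if ℓ' = ℓ ∧ m' = m then 1 else 0 := by
      intro ℓ m
      rw [← sphI_polyY_mul hm']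
      exact sphI_congr fun θ => by
        simp only [map_mul, map_pow, evalAt_rho_sph, one_pow, one_mul, evalAt_solidY_sph hm',
          evalAt_polyY]
    rw [Finset.sum_eq_single ℓ', Finset.sum_eq_single m']
    · rw [e, if_pos ⟨rfl, rfl⟩, hpow, one_mul, show D - ℓ' = 2 * j by omega]
    · intro m _ hm
      rw [e, if_neg (fun h => hm h.2.symm), zero_mul]
    · intro h
      exact absurd (Finset.mem_Icc.2 (by omega)) h
    · intro ℓ _ hℓ
      refine Finset.sum_eq_zero fun m _ => ?_
      rw [e, if_neg (fun h => hℓ h.1.symm), zero_mul]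
    · intro h
      exact absurd (Finset.mem_range.2 (by omega)) h
  | zero => simp
  | add P Q _ _ hP hQ =>
    simp only [map_add, add_mul, Finset.sum_add_distrib]
    rw [hP, hQ]
  | smul a P _ hP =>
    simp only [map_smul, smul_mul_assoc, smul_eq_mul, mul_assoc, ← Finset.mul_sum]
    rw [hP]

end Solid

/-! ### Spherical Bessel and Hankel functions of complex argument. -/

section SpecialFunctions

/-- `((1/y) d/dy)^k f`. -/
def rayIter (f : ℂ → ℂ) (k : ℕ) : ℂ → ℂ := (fun (g : ℂ → ℂ) (y : ℂ) => deriv g y / y)^[k] f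

theorem rayIter_zero (f : ℂ → ℂ) : rayIter f 0 = f := rfl

theorem rayIter_succ (f : ℂ → ℂ) (k : ℕ) (y : ℂ) :
    rayIter f (k + 1) y = deriv (rayIter f k) y / y := by
  rw [rayIter, Function.iterate_succ_apply', ← rayIter]

theorem rayleigh_eq (f : ℂ → ℂ) (ℓ : ℕ) (x : ℂ) : rayleigh f ℓ x = (-x) ^ ℓ * rayIter f ℓ x := rfl

theorem isOpen_compl_zero : IsOpen ({0}ᶜ : Set ℂ) := isOpen_compl_singleton

theorem differentiableOn_rayIter {f : ℂ → ℂ} (hf : DifferentiableOn ℂ f {0}ᶜ) (k : ℕ) :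
    DifferentiableOn ℂ (rayIter f k) {0}ᶜ := by
  induction k with
  | zero => exact hf
  | succ k ih =>
    refine ((ih.deriv isOpen_compl_zero).div differentiableOn_id fun x hx => hx).congr ?_
    intro x _
    rw [rayIter_succ]; rfl

theorem hasDerivAt_rayIter {f : ℂ → ℂ} (hf : DifferentiableOn ℂ f {0}ᶜ) (k : ℕ) {y : ℂ}
    (hy : y ≠ 0) : HasDerivAt (rayIter f k) (y * rayIter f (k + 1) y) y := by
  rw [rayIter_succ, mul_div_cancel₀ _ hy]
  exact ((differentiableOn_rayIter hf k).differentiableAt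
    (isOpen_compl_zero.mem_nhds hy)).hasDerivAt

theorem hasDerivAt_rayleigh {f : ℂ → ℂ} (hf : DifferentiableOn ℂ f {0}ᶜ) (ℓ : ℕ) {x : ℂ}
    (hx : x ≠ 0) :
    HasDerivAt (rayleigh f ℓ) (ℓ / x * rayleigh f ℓ x - rayleigh f (ℓ + 1) x) x := by
  have h := ((hasDerivAt_neg x).pow ℓ).mul (hasDerivAt_rayIter hf ℓ hx)
  refine h.congr_deriv ?_
  simp only [rayleigh_eq, Pi.pow_apply]
  rcases ℓ with _ | ℓ
  · simp
  · simp only [Nat.add_sub_cancel]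
    field_simp
    ring

/-- Two functions that agree off the origin have the same iterates off the origin. -/
theorem rayIter_congr {f g : ℂ → ℂ} (h : ∀ y ≠ 0, f y = g y) (k : ℕ) :
    ∀ y ≠ 0, rayIter f k y = rayIter g k y := by
  induction k with
  | zero => exact h
  | succ k ih =>
    intro y hy
    rw [rayIter_succ, rayIter_succ]
    congr 1
    exact Filter.EventuallyEq.deriv_eq
      (by filter_upwards [isOpen_compl_zero.mem_nhds hy] with x hx using ih x hx)

theorem rayIter_add_mul {f g : ℂ → ℂ} (hf : DifferentiableOn ℂ f {0}ᶜ)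
    (hg : DifferentiableOn ℂ g {0}ᶜ) (c : ℂ) (k : ℕ) :
    ∀ y ≠ 0, rayIter (fun x => f x + c * g x) k y = rayIter f k y + c * rayIter g k y := by
  induction k with
  | zero => intro y _; rfl
  | succ k ih =>
    intro y hy
    have h : HasDerivAt (rayIter (fun x => f x + c * g x) k)
        (y * rayIter f (k + 1) y + c * (y * rayIter g (k + 1) y)) y := by
      refine ((hasDerivAt_rayIter hf k hy).add
        ((hasDerivAt_rayIter hg k hy).const_mul c)).congr_of_eventuallyEq ?_
      filter_upwards [isOpen_compl_zero.mem_nhds hy] with x hx using ih x hx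
    rw [rayIter_succ, h.deriv]
    field_simp

/-- The spherical Bessel equation of order zero propagates to a three-term recurrence. -/
theorem rayIter_recurrence {f : ℂ → ℂ} (hf : DifferentiableOn ℂ f {0}ᶜ)
    (h0 : ∀ y ≠ 0, y ^ 2 * rayIter f 2 y + 3 * rayIter f 1 y + f y = 0) (k : ℕ) :
    ∀ y ≠ 0, y ^ 2 * rayIter f (k + 2) y + (2 * k + 3) * rayIter f (k + 1) y
      + rayIter f k y = 0 := by
  induction k with
  | zero => intro y hy; simpa [rayIter_zero] using h0 y hy
  | succ k ih =>
    intro y hy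
    have h1 := (((hasDerivAt_id y).pow 2).mul (hasDerivAt_rayIter hf (k + 2) hy)).add
      ((hasDerivAt_rayIter hf (k + 1) hy).const_mul (2 * (k : ℂ) + 3)) |>.add
      (hasDerivAt_rayIter hf k hy)
    have h2 := h1.unique ((hasDerivAt_const y (0 : ℂ)).congr_of_eventuallyEq
      (by filter_upwards [isOpen_compl_zero.mem_nhds hy] with x hx using ih x hx))
    simp only [id, Pi.pow_apply] at h2
    apply mul_left_cancel₀ hy
    push_cast at h2 ⊢
    linear_combination h2

/-- `h_0 (y) = -i e^{iy} / y`. -/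
def hankelZero (y : ℂ) : ℂ := -Complex.I * Complex.exp (Complex.I * y) / y

theorem differentiableOn_hankelZero : DifferentiableOn ℂ hankelZero {0}ᶜ := by
  unfold hankelZero
  refine DifferentiableOn.div ?_ differentiableOn_id fun x hx => hx
  fun_prop

theorem differentiableOn_sin_div : DifferentiableOn ℂ (fun x => Complex.sin x / x) {0}ᶜ :=
  DifferentiableOn.div (by fun_prop) differentiableOn_id fun _ hx => hx

theorem differentiableOn_cos_div : DifferentiableOn ℂ (fun x => -(Complex.cos x / x)) {0}ᶜ :=
  (DifferentiableOn.div (by fun_prop) differentiableOn_id fun _ hx => hx).neg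

theorem sphericalHankel_eq (ℓ : ℕ) {x : ℂ} (hx : x ≠ 0) :
    sphericalHankel ℓ x = rayleigh hankelZero ℓ x := by
  rw [sphericalHankel, sphericalBessel, sphericalNeumann, rayleigh_eq, rayleigh_eq, rayleigh_eq,
    rayIter_congr (f := hankelZero) (g := fun x => Complex.sin x / x + Complex.I * (-(Complex.cos x / x))) _ ℓ x hx,
    rayIter_add_mul differentiableOn_sin_div differentiableOn_cos_div _ _ _ hx]
  · ring
  · intro y hy
    rw [hankelZero, mul_comm Complex.I y, Complex.exp_mul_I]
    field_simp
    linear_combination -Complex.sin y * Complex.I_sq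

/-- If `f' = g / y - f / y` and `g' = -y f` off the origin, then `f` solves the Bessel equation. -/
theorem besselZero_equation {f g : ℂ → ℂ} (hf : ∀ y ≠ 0, HasDerivAt f (g y / y - f y / y) y)
    (hg : ∀ y ≠ 0, HasDerivAt g (-(y * f y)) y) (y : ℂ) (hy : y ≠ 0) :
    y ^ 2 * rayIter f 2 y + 3 * rayIter f 1 y + f y = 0 := by
  have h1 : ∀ y ≠ 0, rayIter f 1 y = g y / y ^ 2 - f y / y ^ 2 := fun y hy => by
    rw [rayIter_succ, rayIter_zero, (hf y hy).deriv]; field_simp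
  have hsq := (hasDerivAt_id y).pow 2
  have h2 : HasDerivAt (rayIter f 1) _ y :=
    (((hg y hy).div hsq (by simpa using hy)).sub
      ((hf y hy).div hsq (by simpa using hy))).congr_of_eventuallyEq
      (by filter_upwards [isOpen_compl_zero.mem_nhds hy] with x hx using h1 x hx)
  rw [h1 y hy, rayIter_succ, h2.deriv]
  simp only [Pi.pow_apply, id]
  field_simp
  ring

theorem hankelZero_equation (y : ℂ) (hy : y ≠ 0) :
    y ^ 2 * rayIter hankelZero 2 y + 3 * rayIter hankelZero 1 y + hankelZero y = 0 := by
  have he : ∀ y : ℂ, HasDerivAt (fun y => Complex.exp (Complex.I * y))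
      (Complex.I * Complex.exp (Complex.I * y)) y := fun y => by
    simpa [mul_comm] using ((hasDerivAt_id y).const_mul Complex.I).cexp
  refine besselZero_equation (g := fun y => Complex.exp (Complex.I * y)) (fun y hy => ?_)
    (fun y hy => ?_) y hy
  · have h := ((he y).const_mul (-Complex.I)).div (hasDerivAt_id y) hy
    refine HasDerivAt.congr_deriv (f := hankelZero) h ?_
    simp only [hankelZero, id]
    field_simp
    linear_combination (-y) * Complex.I_sq
  · refine (he y).congr_deriv ?_
    rw [hankelZero]
    field_simp

theorem sinDiv_equation (y : ℂ) (hy : y ≠ 0) :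
    y ^ 2 * rayIter (fun x => Complex.sin x / x) 2 y + 3 * rayIter (fun x => Complex.sin x / x) 1 y
      + Complex.sin y / y = 0 := by
  refine besselZero_equation (g := Complex.cos) (fun y hy => ?_) (fun y hy => ?_) y hy
  · refine ((Complex.hasDerivAt_sin y).div (hasDerivAt_id y) hy).congr_deriv ?_
    simp only [id]
    field_simp
  · refine (Complex.hasDerivAt_cos y).congr_deriv ?_
    field_simp

/-- Obtained from the index-raising derivative formula `hasDerivAt_rayleigh` by eliminating the
function of index `ℓ + 2` with the three-term recurrence. Comparing the two formulas for one
derivative gives the recurrence back for `j_ℓ` and `h_ℓ` alike. -/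
theorem rayleigh_lowering {f : ℂ → ℂ} (hf : DifferentiableOn ℂ f {0}ᶜ)
    (h0 : ∀ y ≠ 0, y ^ 2 * rayIter f 2 y + 3 * rayIter f 1 y + f y = 0) (ℓ : ℕ) {x : ℂ}
    (hx : x ≠ 0) :
    HasDerivAt (rayleigh f (ℓ + 1)) (rayleigh f ℓ x - (ℓ + 2) / x * rayleigh f (ℓ + 1) x) x := by
  refine (hasDerivAt_rayleigh hf (ℓ + 1) hx).congr_deriv ?_
  have h := rayIter_recurrence hf h0 ℓ x hx
  simp only [rayleigh_eq, pow_succ]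
  push_cast
  field_simp
  linear_combination (-(-x) ^ ℓ) * h

theorem hasDerivAt_sphericalBessel (ℓ : ℕ) {x : ℂ} (hx : x ≠ 0) :
    HasDerivAt (sphericalBessel ℓ) (ℓ / x * sphericalBessel ℓ x - sphericalBessel (ℓ + 1) x) x :=
  hasDerivAt_rayleigh differentiableOn_sin_div ℓ hx

theorem hasDerivAt_sphericalBessel_succ (ℓ : ℕ) {x : ℂ} (hx : x ≠ 0) :
    HasDerivAt (sphericalBessel (ℓ + 1))
      (sphericalBessel ℓ x - (ℓ + 2) / x * sphericalBessel (ℓ + 1) x) x :=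
  rayleigh_lowering differentiableOn_sin_div sinDiv_equation ℓ hx

theorem hasDerivAt_sphericalHankel (ℓ : ℕ) {x : ℂ} (hx : x ≠ 0) :
    HasDerivAt (sphericalHankel ℓ) (ℓ / x * sphericalHankel ℓ x - sphericalHankel (ℓ + 1) x) x := by
  rw [sphericalHankel_eq _ hx, sphericalHankel_eq _ hx]
  refine (hasDerivAt_rayleigh differentiableOn_hankelZero ℓ hx).congr_of_eventuallyEq ?_
  filter_upwards [isOpen_compl_zero.mem_nhds hx] with y hy using sphericalHankel_eq ℓ hy

theorem hasDerivAt_sphericalHankel_succ (ℓ : ℕ) {x : ℂ} (hx : x ≠ 0) :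
    HasDerivAt (sphericalHankel (ℓ + 1))
      (sphericalHankel ℓ x - (ℓ + 2) / x * sphericalHankel (ℓ + 1) x) x := by
  rw [sphericalHankel_eq _ hx, sphericalHankel_eq _ hx]
  refine (rayleigh_lowering differentiableOn_hankelZero hankelZero_equation ℓ
    hx).congr_of_eventuallyEq ?_
  filter_upwards [isOpen_compl_zero.mem_nhds hx] with y hy using sphericalHankel_eq _ hy

/-- Because `j_ℓ` and `h_ℓ` obey the same three-term recurrence, the cross product does not depend
on `ℓ`. For `ℓ = 0` it is computed from the elementary expressions, where `sin² + cos² = 1` enters.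
-/
theorem sphericalBessel_mul_hankel_sub (ℓ : ℕ) {x : ℂ} (hx : x ≠ 0) :
    sphericalBessel (ℓ + 1) x * sphericalHankel ℓ x
      - sphericalBessel ℓ x * sphericalHankel (ℓ + 1) x = Complex.I / x ^ 2 := by
  induction ℓ with
  | zero =>
    have h1 : ∀ y : ℂ, y ≠ 0 → sphericalBessel 1 y = Complex.sin y / y ^ 2 - Complex.cos y / y :=
      fun y hy => by
        have h0 : HasDerivAt (sphericalBessel 0) _ y :=
          ((Complex.hasDerivAt_sin y).div (hasDerivAt_id y) hy).congr_of_eventuallyEq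
            (Eventually.of_forall fun y => by simp [sphericalBessel, rayleigh])
        have h := (hasDerivAt_sphericalBessel 0 hy).unique h0
        simp only [Nat.cast_zero, zero_div, zero_mul, zero_add, id, zero_sub] at h
        rw [neg_eq_iff_eq_neg.1 h]
        field_simp
        ring
    have h2 : ∀ y : ℂ, y ≠ 0 → sphericalHankel 1 y =
        -Complex.I * Complex.exp (Complex.I * y) / y ^ 2 - Complex.exp (Complex.I * y) / y :=
      fun y hy => by
        have he : HasDerivAt (fun y => Complex.exp (Complex.I * y))
            (Complex.I * Complex.exp (Complex.I * y)) y := by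
          simpa [mul_comm] using ((hasDerivAt_id y).const_mul Complex.I).cexp
        have h0 : HasDerivAt (rayleigh hankelZero 0) _ y :=
          ((he.const_mul (-Complex.I)).div (hasDerivAt_id y) hy).congr_of_eventuallyEq
            (Eventually.of_forall fun y => by simp [hankelZero, rayleigh])
        have h := (hasDerivAt_rayleigh differentiableOn_hankelZero 0 hy).unique h0
        simp only [Nat.cast_zero, zero_div, zero_mul, zero_add, id, zero_sub] at h
        rw [sphericalHankel_eq _ hy, neg_eq_iff_eq_neg.1 h]
        field_simp
        linear_combination (y) * Complex.I_sq
    rw [zero_add, h1 x hx, h2 x hx, sphericalHankel_eq _ hx]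
    have e0 : sphericalBessel 0 x = Complex.sin x / x := by simp [sphericalBessel, rayleigh]
    have e1 : rayleigh hankelZero 0 x = -Complex.I * Complex.exp (Complex.I * x) / x := by
      simp [rayleigh, hankelZero]
    have e2 : Complex.exp (Complex.I * x) = Complex.cos x + Complex.sin x * Complex.I := by
      rw [mul_comm, Complex.exp_mul_I]
    rw [e0, e1, e2]
    field_simp
    linear_combination x * Complex.I * Complex.sin_sq_add_cos_sq x +
      x * (Complex.cos x * Complex.sin x) * Complex.I_sq
  | succ ℓ ih =>
    have h1 := (hasDerivAt_sphericalBessel (ℓ + 1) hx).unique (hasDerivAt_sphericalBessel_succ ℓ hx)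
    have h2 := (hasDerivAt_sphericalHankel (ℓ + 1) hx).unique (hasDerivAt_sphericalHankel_succ ℓ hx)
    rw [← ih]
    linear_combination (-sphericalHankel (ℓ + 1) x) * h1 + sphericalBessel (ℓ + 1) x * h2

/-- The Wronskian of `j_ℓ` and `h_ℓ`. -/
theorem wronskian_bessel_hankel (ℓ : ℕ) {x : ℂ} (hx : x ≠ 0) :
    sphericalBessel ℓ x * deriv (sphericalHankel ℓ) x
      - deriv (sphericalBessel ℓ) x * sphericalHankel ℓ x = Complex.I / x ^ 2 := by
  rw [(hasDerivAt_sphericalBessel ℓ hx).deriv, (hasDerivAt_sphericalHankel ℓ hx).deriv,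
    ← sphericalBessel_mul_hankel_sub ℓ hx]
  ring

theorem wronskian_ne_zero (ℓ : ℕ) {x : ℂ} (hx : x ≠ 0) :
    sphericalBessel ℓ x * deriv (sphericalHankel ℓ) x
      - deriv (sphericalBessel ℓ) x * sphericalHankel ℓ x ≠ 0 := by
  rw [wronskian_bessel_hankel ℓ hx]
  exact div_ne_zero Complex.I_ne_zero (pow_ne_zero _ hx)

/-- The iterates of `sin y / y` extend to entire functions. -/
theorem exists_differentiable_rayIter_sinDiv (k : ℕ) : ∃ G : ℂ → ℂ, Differentiable ℂ G ∧
    (∀ y, G (-y) = G y) ∧ ∀ y ≠ 0, rayIter (fun x => Complex.sin x / x) k y = G y := by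
  -- An odd entire function vanishes at `0`, so division by `y` leaves an even entire function. As
  -- the derivative of an even function is odd, the property reproduces itself under `(1/y) d/dy`.
  have key : ∀ g : ℂ → ℂ, Differentiable ℂ g → (∀ y, g (-y) = -g y) → ∃ G : ℂ → ℂ,
      Differentiable ℂ G ∧ (∀ y, G (-y) = G y) ∧ ∀ y ≠ 0, g y / y = G y := by
    intro g hg ho
    have h0 : g 0 = 0 := by
      have := ho 0
      rw [neg_zero] at this
      linear_combination this / 2
    have he : ∀ y ≠ 0, g y / y = dslope g 0 y := fun y hy => by
      rw [dslope_of_ne _ hy, slope_def_field, h0, sub_zero, sub_zero]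
    refine ⟨dslope g 0, ?_, fun y => ?_, he⟩
    · rw [← differentiableOn_univ]
      exact (Complex.differentiableOn_dslope univ_mem).2 hg.differentiableOn
    · by_cases hy : y = 0
      · rw [hy, neg_zero]
      · rw [← he y hy, ← he (-y) (neg_ne_zero.2 hy), ho, neg_div_neg_eq]
  induction k with
  | zero => exact key Complex.sin Complex.differentiable_sin Complex.sin_neg
  | succ k ih =>
    obtain ⟨G, hG, hev, hFG⟩ := ih
    obtain ⟨H, hH, hHe, hHG⟩ := key (deriv G)
      (fun x => (hG.differentiableOn.deriv isOpen_univ).differentiableAt univ_mem) (fun y => by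
        have h1 : HasDerivAt (fun y => G (-y)) (deriv G (-y) * -1) y :=
          (hG (-y)).hasDerivAt.comp y (hasDerivAt_neg y)
        have h2 : (fun y => G (-y)) = G := funext hev
        rw [h2] at h1
        rw [h1.deriv]; ring)
    refine ⟨H, hH, hHe, fun y hy => ?_⟩
    rw [rayIter_succ, ← hHG y hy]
    congr 1
    exact Filter.EventuallyEq.deriv_eq
      (by filter_upwards [isOpen_compl_zero.mem_nhds hy] with x hx using hFG x hx)

theorem tendsto_pow_mul_sphericalBessel (ℓ : ℕ) {c : ℂ} (hc : c ≠ 0) :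
    Tendsto (fun r : ℝ => (r : ℂ) ^ (ℓ + 1) * sphericalBessel ℓ (c * r)) (𝓝[>] 0) (𝓝 0) := by
  obtain ⟨G, hG, -, hFG⟩ := exists_differentiable_rayIter_sinDiv ℓ
  have h : Tendsto (fun r : ℝ => (r : ℂ) ^ (ℓ + 1) * ((-(c * r)) ^ ℓ * G (c * r))) (𝓝 0)
      (𝓝 0) := by
    have hcont : Continuous fun r : ℝ => (r : ℂ) ^ (ℓ + 1) * ((-(c * r)) ^ ℓ * G (c * r)) := by
      have := hG.continuous
      fun_prop
    simpa using hcont.tendsto 0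
  refine (h.mono_left nhdsWithin_le_nhds).congr' ?_
  filter_upwards [self_mem_nhdsWithin] with r hr
  rw [sphericalBessel, rayleigh_eq, hFG _ (mul_ne_zero hc (Complex.ofReal_ne_zero.2 (ne_of_gt hr)))]

/-- Products of `e^{iy}` and a polynomial in `1/y` are stable under `(1/y) d/dy`. At `y = iκr` the
exponential becomes `e^{-κr}`, which is the source of all decay estimates. -/
theorem exists_poly_rayIter_hankelZero (k : ℕ) : ∃ p : Polynomial ℂ, ∀ y ≠ 0,
    rayIter hankelZero k y = Complex.exp (Complex.I * y) * p.eval y⁻¹ := by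
  induction k with
  | zero =>
    refine ⟨Polynomial.C (-Complex.I) * Polynomial.X, fun y _ => ?_⟩
    simp only [rayIter_zero, hankelZero, Polynomial.eval_mul, Polynomial.eval_C, Polynomial.eval_X]
    ring
  | succ k ih =>
    obtain ⟨p, hp⟩ := ih
    refine ⟨Polynomial.X * (Polynomial.C Complex.I * p - Polynomial.X ^ 2 *
      Polynomial.derivative p), fun y hy => ?_⟩
    have he : HasDerivAt (fun y => Complex.exp (Complex.I * y))
        (Complex.I * Complex.exp (Complex.I * y)) y := by
      simpa [mul_comm] using ((hasDerivAt_id y).const_mul Complex.I).cexp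
    have h1 := he.mul ((p.hasDerivAt y⁻¹).comp y (hasDerivAt_inv hy))
    have h2 : HasDerivAt (rayIter hankelZero k) _ y := h1.congr_of_eventuallyEq
      (by filter_upwards [isOpen_compl_zero.mem_nhds hy] with x hx using hp x hx)
    rw [rayIter_succ, h2.deriv]
    simp only [Polynomial.eval_mul, Polynomial.eval_C, Polynomial.eval_X, Polynomial.eval_sub,
      Polynomial.eval_pow, Function.comp]
    field_simp
    ring

end SpecialFunctions

/-! ### Hankel functions on the imaginary axis. -/

section HankelRadial

variable {κ : ℝ}

/-- `((1/y) d/dy)^k h_0 (y)` at `y = iκr`. -/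
def hankelRadial (κ : ℝ) (k : ℕ) (r : ℝ) : ℂ := rayIter hankelZero k (Complex.I * (κ : ℂ) * (r : ℂ))

theorem I_mul_ne_zero (hκ : 0 < κ) {r : ℝ} (hr : r ≠ 0) : Complex.I * (κ : ℂ) * (r : ℂ) ≠ 0 :=
  mul_ne_zero (mul_ne_zero Complex.I_ne_zero (Complex.ofReal_ne_zero.2 hκ.ne'))
    (Complex.ofReal_ne_zero.2 hr)

theorem hasDerivAt_I_mul (κ r : ℝ) :
    HasDerivAt (fun r : ℝ => Complex.I * (κ : ℂ) * (r : ℂ)) (Complex.I * (κ : ℂ)) r := by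
  simpa using (Complex.ofRealCLM.hasDerivAt (x := r)).const_mul (Complex.I * (κ : ℂ))

theorem hasDerivAt_hankelRadial (hκ : 0 < κ) (k : ℕ) {r : ℝ} (hr : r ≠ 0) :
    HasDerivAt (hankelRadial κ k) (-(κ : ℂ) ^ 2 * r * hankelRadial κ (k + 1) r) r := by
  have h := (hasDerivAt_rayIter differentiableOn_hankelZero k (I_mul_ne_zero hκ hr)).comp_of_eq r
    (hasDerivAt_I_mul κ r) rfl
  refine h.congr_deriv ?_
  rw [hankelRadial]
  linear_combination ((κ : ℂ) ^ 2 * r * rayIter hankelZero (k + 1) (Complex.I * κ * r)) *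
    Complex.I_sq

theorem hankelRadial_recurrence (hκ : 0 < κ) (k : ℕ) {r : ℝ} (hr : r ≠ 0) :
    -(κ : ℂ) ^ 2 * (r : ℂ) ^ 2 * hankelRadial κ (k + 2) r
      + (2 * k + 3) * hankelRadial κ (k + 1) r + hankelRadial κ k r = 0 := by
  have h := rayIter_recurrence differentiableOn_hankelZero hankelZero_equation k _
    (I_mul_ne_zero hκ hr)
  simp only [hankelRadial]
  linear_combination h - ((κ : ℂ) ^ 2 * r ^ 2 * rayIter hankelZero (k + 2) (Complex.I * κ * r)) *
    Complex.I_sq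

theorem sphericalHankel_radial (hκ : 0 < κ) (ℓ : ℕ) {r : ℝ} (hr : r ≠ 0) :
    sphericalHankel ℓ (Complex.I * κ * r) = (-(Complex.I * κ * r)) ^ ℓ * hankelRadial κ ℓ r :=
  sphericalHankel_eq ℓ (I_mul_ne_zero hκ hr)

theorem contDiffOn_hankelRadial (hκ : 0 < κ) (k : ℕ) :
    ContDiffOn ℝ ∞ (hankelRadial κ k) {0}ᶜ := by
  have h1 : ContDiffOn ℝ ∞ (rayIter hankelZero k) {0}ᶜ :=
    ((differentiableOn_rayIter differentiableOn_hankelZero k).contDiffOn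
      isOpen_compl_zero).restrict_scalars ℝ
  have h2 : ContDiff ℝ ∞ (fun r : ℝ => Complex.I * (κ : ℂ) * (r : ℂ)) :=
    contDiff_const.mul Complex.ofRealCLM.contDiff
  exact h1.comp h2.contDiffOn fun r hr => I_mul_ne_zero hκ hr

/-- Exponential decay. -/
theorem exists_norm_hankelRadial_le (hκ : 0 < κ) (k : ℕ) {δ : ℝ} (hδ : 0 < δ) :
    ∃ C, ∀ r ≥ δ, ‖hankelRadial κ k r‖ ≤ C * Real.exp (-(κ * r)) := by
  obtain ⟨p, hp⟩ := exists_poly_rayIter_hankelZero k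
  obtain ⟨C, hC⟩ := (isCompact_closedBall (0 : ℂ) ((κ * δ)⁻¹)).exists_bound_of_continuousOn
    p.continuous.continuousOn
  refine ⟨C, fun r hr => ?_⟩
  have hr0 : 0 < r := hδ.trans_le hr
  rw [hankelRadial, hp _ (I_mul_ne_zero hκ hr0.ne'), norm_mul, mul_comm]
  refine mul_le_mul (hC _ ?_) ?_ (norm_nonneg _) ((norm_nonneg _).trans (hC 0 (by simp; positivity)))
  · rw [mem_closedBall_zero_iff, norm_inv, norm_mul, norm_mul, Complex.norm_I, one_mul,
      Complex.norm_of_nonneg hκ.le, Complex.norm_of_nonneg hr0.le]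
    gcongr
  · rw [Complex.norm_exp]
    have : (Complex.I * (Complex.I * (κ : ℂ) * (r : ℂ))) = ((-(κ * r) : ℝ) : ℂ) := by
      push_cast
      linear_combination ((κ : ℂ) * r) * Complex.I_sq
    rw [this, Complex.ofReal_re]

end HankelRadial

/-! ### Spherical components of solutions of `Δf = κ² f`. -/

section DerivativeSystem

open MvPolynomial

/-- The real-linear form with coefficients `g`. -/
def coordForm (g : Fin 3 → ℂ) : E3 →L[ℝ] ℂ :=
  ∑ i, (EuclideanSpace.proj i : E3 →L[ℝ] ℝ).smulRight (g i)

theorem coordForm_apply (g : Fin 3 → ℂ) (v : E3) : coordForm g v = ∑ i, (v i : ℂ) * g i := by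
  simp [coordForm, ContinuousLinearMap.sum_apply]

theorem coordForm_single (g : Fin 3 → ℂ) (i : Fin 3) :
    coordForm g (EuclideanSpace.single i 1) = g i := by
  rw [coordForm_apply, Finset.sum_eq_single i] <;> simp +contextual [Pi.single_apply]

theorem continuousOn_coordForm {U : Set E3} {g : E3 → Fin 3 → ℂ}
    (hg : ∀ i, ContinuousOn (fun x => g x i) U) : ContinuousOn (fun x => coordForm (g x)) U := by
  unfold coordForm
  refine continuousOn_finsetSum _ fun i _ => ?_
  have h : Continuous fun z : ℂ => (EuclideanSpace.proj i : E3 →L[ℝ] ℝ).smulRight z :=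
    (ContinuousLinearMap.smulRightL ℝ E3 ℂ (EuclideanSpace.proj i)).continuous
  exact h.comp_continuousOn (hg i)

theorem contDiffOn_one_of_coordForm {U : Set E3} (hU : IsOpen U) {f : E3 → ℂ}
    {g : E3 → Fin 3 → ℂ} (hf : ∀ x ∈ U, HasFDerivAt f (coordForm (g x)) x)
    (hg : ∀ i, ContinuousOn (fun x => g x i) U) : ContDiffOn ℝ 1 f U := by
  rw [show (1 : WithTop ℕ∞) = 0 + 1 from rfl, contDiffOn_succ_iff_fderiv_of_isOpen hU]
  refine ⟨fun x hx => (hf x hx).differentiableAt.differentiableWithinAt, by simp, ?_⟩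
  rw [contDiffOn_zero]
  exact (continuousOn_coordForm hg).congr fun x hx => (hf x hx).fderiv

/-- A family of functions on `U`, closed under differentiation, which consists of the derivatives of
one solution of `Δf = κ² f`. -/
structure IsDerivSystem (κ : ℝ) (U : Set E3) (D : Poly3 →ₗ[ℂ] (E3 → ℂ)) : Prop where
  isOpen : IsOpen U
  hasFDerivAt : ∀ P, ∀ x ∈ U, HasFDerivAt (D P) (coordForm fun i => D (X i * P) x) x
  map_rho : ∀ P, ∀ x ∈ U, D (rho * P) x = (κ : ℂ) ^ 2 * D P x

namespace IsDerivSystem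

variable {κ : ℝ} {U : Set E3} {D : Poly3 →ₗ[ℂ] (E3 → ℂ)}

theorem continuousOn (h : IsDerivSystem κ U D) (P : Poly3) : ContinuousOn (D P) U :=
  fun x hx => (h.hasFDerivAt P x hx).continuousAt.continuousWithinAt

theorem contDiffOn (h : IsDerivSystem κ U D) (P : Poly3) : ContDiffOn ℝ 1 (D P) U :=
  contDiffOn_one_of_coordForm h.isOpen (g := fun x i => D (X i * P) x)
    (h.hasFDerivAt P) fun i => h.continuousOn (X i * P)

theorem shift (h : IsDerivSystem κ U D) (d : E3) :
    IsDerivSystem κ ((fun x => x - d) ⁻¹' U) ((LinearMap.funLeft ℂ ℂ fun x : E3 => x - d) ∘ₗ D) where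
  isOpen := h.isOpen.preimage (by fun_prop)
  hasFDerivAt P x hx := by
    have := (h.hasFDerivAt P (x - d) hx).comp x ((hasFDerivAt_id x).sub_const d)
    exact this
  map_rho P x hx := h.map_rho P _ hx

variable {b : ℝ}

theorem shell_subset_ball : shell 0 b ⊆ Metric.ball (0 : E3) b := fun x hx => by
  simpa using hx.2

theorem hasDerivAt_integral_sq_coord (h : IsDerivSystem κ U D) (hb : Metric.ball 0 b ⊆ U)
    (P Q : Poly3) (i : Fin 3) {r : ℝ} (hr : r ∈ Set.Ioo 0 b) :
    HasDerivAt (fun s : ℝ => (s : ℂ) ^ 2 *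
        ∫ θ : Sph, ((θ : E3) i : ℂ) * (evalAt (s • (θ : E3)) P * D Q (s • (θ : E3))) ∂surf)
      ((r : ℂ) ^ 2 * ∫ θ : Sph, (evalAt (r • (θ : E3)) (pderiv i P) * D Q (r • (θ : E3)) +
        evalAt (r • (θ : E3)) P * D (X i * Q) (r • (θ : E3))) ∂surf) r := by
  have hs := (shell_subset_ball (b := b)).trans hb
  have hf : ContDiffOn ℝ 1 (fun x => evalAt x P * D Q x) (shell 0 b) :=
    (contDiff_evalAt P).contDiffOn.mul ((h.contDiffOn Q).mono hs)
  refine (hasDerivAt_sq_mul_integral_coord le_rfl hf i hr).congr_deriv ?_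
  congr 1
  refine integral_congr_ae (Eventually.of_forall fun θ => ?_)
  have hx : r • (θ : E3) ∈ U := hs (smul_sph_mem_shell le_rfl hr θ)
  have h1 := ((contDiff_evalAt P (n := 1)).differentiable (by norm_num)
    (r • (θ : E3))).hasFDerivAt.mul (h.hasFDerivAt Q _ hx)
  beta_reduce
  rw [show (fun x => evalAt x P * D Q x) = (fun y => evalAt y P) * D Q from rfl, h1.fderiv]
  simp only [ContinuousLinearMap.add_apply, ContinuousLinearMap.smul_apply, coordForm_single,
    smul_eq_mul, fderiv_evalAt_single]
  ring

theorem integrable_comp_smul (h : IsDerivSystem κ U D) (hb : Metric.ball 0 b ⊆ U)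
    (P Q : Poly3) {r : ℝ} (hr : r ∈ Set.Ioo 0 b) :
    Integrable (fun θ : Sph => evalAt (r • (θ : E3)) P * D Q (r • (θ : E3))) surf := by
  have hs := (shell_subset_ball (b := b)).trans hb
  have hc : ContinuousOn (fun x => evalAt x P * D Q x) (shell 0 b) :=
    (continuous_evalAt P).continuousOn.mul ((h.continuousOn Q).mono hs)
  exact (continuous_comp_smul_sph le_rfl hc hr).integrable_of_hasCompactSupport
    (HasCompactSupport.of_compactSpace _)

theorem continuousAt_integral_smul {f : E3 → ℂ} (hb : 0 < b)
    (hf : ContinuousOn f (Metric.ball 0 b)) {g : Sph → ℂ} (hg : Continuous g) :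
    Tendsto (fun r : ℝ => ∫ θ : Sph, g θ * f (r • (θ : E3)) ∂surf) (𝓝[>] 0)
      (𝓝 (∫ θ : Sph, g θ * f 0 ∂surf)) := by
  have h : ContinuousOn (fun r : ℝ => ∫ θ : Sph, g θ * f (r • (θ : E3)) ∂surf)
      (Set.Ioo (-b) b) := by
    refine continuousOn_integral_sphere (F := fun r θ => g θ * f (r • (θ : E3))) ?_
    refine ContinuousOn.mul (by fun_prop) (hf.comp (by fun_prop) ?_)
    rintro ⟨r, θ⟩ ⟨hr, -⟩
    simp only [mem_ball_zero_iff, norm_smul, norm_sph, mul_one, Real.norm_eq_abs]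
    exact abs_lt.2 hr
  have h0 := (h.continuousAt (Ioo_mem_nhds (neg_lt_zero.2 hb) hb)).tendsto
  simp only [zero_smul] at h0
  exact h0.mono_left nhdsWithin_le_nhds

end IsDerivSystem

theorem eq_of_hasDerivAt_zero_of_tendsto {b : ℝ} {f : ℝ → ℂ} {c : ℂ}
    (hf : ∀ r ∈ Set.Ioo 0 b, HasDerivAt f 0 r) (hlim : Tendsto f (𝓝[>] 0) (𝓝 c)) {r : ℝ}
    (hr : r ∈ Set.Ioo 0 b) : f r = c := by
  have hconst : ∀ s ∈ Set.Ioo 0 b, f s = f r := fun s hs =>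
    isOpen_Ioo.is_const_of_deriv_eq_zero isPreconnected_Ioo
      (fun t ht => (hf t ht).differentiableAt.differentiableWithinAt)
      (fun t ht => (hf t ht).deriv) hs hr
  refine tendsto_nhds_unique (tendsto_const_nhds.congr' ?_) hlim
  filter_upwards [Ioo_mem_nhdsGT (hr.1.trans hr.2)] with s hs using (hconst s hs).symm

namespace IsDerivSystem

variable {κ : ℝ} {U : Set E3} {D : Poly3 →ₗ[ℂ] (E3 → ℂ)} {b : ℝ}

/-- The mean value property for solutions of `Δf = κ² f`. -/
theorem integral_smul (h : IsDerivSystem κ U D) (hκ : 0 < κ) (hb : Metric.ball 0 b ⊆ U)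
    (Q : Poly3) {r : ℝ} (hr : r ∈ Set.Ioo 0 b) :
    ∫ θ : Sph, D Q (r • (θ : E3)) ∂surf =
      4 * Real.pi * sphericalBessel 0 (Complex.I * κ * r) * D Q 0 := by
  have hb0 : 0 < b := hr.1.trans hr.2
  have hs := (shell_subset_ball (b := b)).trans hb
  set M : ℝ → ℂ := fun s => ∫ θ : Sph, D Q (s • (θ : E3)) ∂surf with hM
  set K : ℝ → ℂ := fun s => ∑ i, ∫ θ : Sph, ((θ : E3) i : ℂ) * D (X i * Q) (s • (θ : E3)) ∂surf
    with hK
  have hint : ∀ i : Fin 3, ∀ s ∈ Set.Ioo 0 b,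
      Integrable (fun θ : Sph => ((θ : E3) i : ℂ) * D (X i * Q) (s • (θ : E3))) surf :=
    fun i s hs' => Continuous.integrable_of_hasCompactSupport
      ((by fun_prop : Continuous fun θ : Sph => ((θ : E3) i : ℂ)).mul (continuous_comp_smul_sph
        le_rfl ((h.continuousOn (X i * Q)).mono hs) hs')) (HasCompactSupport.of_compactSpace _)
  -- The mean `M` over the sphere of radius `s` has as derivative the integrated radial derivative
  -- `K`, and `s² K` has derivative `κ² s² M` by the divergence theorem, because the divergence of
  -- the gradient is `κ² f`.
  have hM' : ∀ s ∈ Set.Ioo 0 b, HasDerivAt M (K s) s := by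
    intro s hs'
    have h1 := hasDerivAt_integral_comp_smul le_rfl ((h.contDiffOn Q).mono hs)
      (g := fun _ => 1) continuous_const hs'
    simp only [one_mul] at h1
    refine h1.congr_deriv ?_
    rw [hK]
    beta_reduce
    rw [← integral_finsetSum _ fun i _ => hint i s hs']
    refine integral_congr_ae (Eventually.of_forall fun θ => ?_)
    beta_reduce
    rw [(h.hasFDerivAt Q _ (hs (smul_sph_mem_shell le_rfl hs' θ))).fderiv, coordForm_apply]
  have hK' : ∀ s ∈ Set.Ioo 0 b,
      HasDerivAt (fun s : ℝ => (s : ℂ) ^ 2 * K s) ((s : ℂ) ^ 2 * ((κ : ℂ) ^ 2 * M s)) s := by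
    intro s hs'
    have h1 := HasDerivAt.fun_sum (u := Finset.univ) fun i _ =>
      hasDerivAt_sq_mul_integral_coord le_rfl ((h.contDiffOn (X i * Q)).mono hs) i hs'
    have e : (fun s : ℝ => (s : ℂ) ^ 2 * K s) = fun s : ℝ => ∑ i, (s : ℂ) ^ 2 *
        ∫ θ : Sph, ((θ : E3) i : ℂ) * D (X i * Q) (s • (θ : E3)) ∂surf := by
      funext s; rw [hK, Finset.mul_sum]
    rw [e]
    refine h1.congr_deriv ?_
    rw [← Finset.mul_sum, hM]
    beta_reduce
    rw [← integral_const_mul, ← integral_finsetSum]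
    · congr 1
      refine integral_congr_ae (Eventually.of_forall fun θ => ?_)
      beta_reduce
      have hx := hs (smul_sph_mem_shell le_rfl hs' θ)
      rw [← h.map_rho Q _ hx, rho, Finset.sum_mul, map_sum, Finset.sum_apply]
      refine Finset.sum_congr rfl fun i _ => ?_
      rw [(h.hasFDerivAt (X i * Q) _ hx).fderiv, coordForm_single, ← mul_assoc, sq]
    · intro i _
      refine Continuous.integrable_of_hasCompactSupport ?_ (HasCompactSupport.of_compactSpace _)
      have h2 : ContinuousOn (fun x => fderiv ℝ (D (X i * Q)) x (EuclideanSpace.single i 1))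
          (shell 0 b) := by
        refine ((h.continuousOn (X i * (X i * Q))).mono hs).congr fun x hx => ?_
        rw [(h.hasFDerivAt (X i * Q) x (hs hx)).fderiv, coordForm_single]
      exact continuous_comp_smul_sph le_rfl h2 hs'
  have hK'' : ∀ s ∈ Set.Ioo 0 b, HasDerivAt K ((κ : ℂ) ^ 2 * M s - 2 / s * K s) s := by
    intro s hs'
    have hs0 : (s : ℂ) ≠ 0 := Complex.ofReal_ne_zero.2 hs'.1.ne'
    have hd : HasDerivAt (fun s : ℝ => (s : ℂ)) 1 s := Complex.ofRealCLM.hasDerivAt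
    refine (((hK' s hs').div (hd.pow 2) (pow_ne_zero 2 hs0)).congr_of_eventuallyEq
      (f₁ := K) ?_).congr_deriv ?_
    · filter_upwards [isOpen_Ioo.mem_nhds hs'] with t ht
      have ht0 : (t : ℂ) ≠ 0 := Complex.ofReal_ne_zero.2 ht.1.ne'
      simp only [Pi.div_apply, Pi.pow_apply]
      field_simp
    · simp only [Pi.pow_apply]
      field_simp
      ring
  have hlimM : Tendsto M (𝓝[>] 0) (𝓝 (4 * Real.pi * D Q 0)) := by
    have h1 := continuousAt_integral_smul hb0 ((h.continuousOn Q).mono hb)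
      (g := fun _ => 1) continuous_const
    simp only [one_mul, integral_const, surf_univ] at h1
    simpa [hM] using h1
  have hlimK : ∃ k, Tendsto K (𝓝[>] 0) (𝓝 k) := by
    refine ⟨_, tendsto_finsetSum _ fun i _ => continuousAt_integral_smul hb0
      ((h.continuousOn (X i * Q)).mono hb)
      (g := fun θ : Sph => ((θ : E3) i : ℂ)) (by fun_prop)⟩
  obtain ⟨k, hlimK⟩ := hlimK
  -- With `u = sM` the two relations amount to `u'' = κ² u`. Hence `e^{-εs}(u' + εu)` is constant
  -- for `ε = ±κ`, and its limit at `0` is the value `M(0) = 4π f(0)`. The two cases together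
  -- determine `u`.
  have key : ∀ ε : ℂ, ε ^ 2 = (κ : ℂ) ^ 2 →
      Complex.exp (-(ε * r)) * (M r + r * K r + ε * (r * M r)) = 4 * Real.pi * D Q 0 := by
    intro ε hε
    refine eq_of_hasDerivAt_zero_of_tendsto (b := b) (f := fun s : ℝ =>
      Complex.exp (-(ε * s)) * (M s + s * K s + ε * (s * M s))) (fun s hs' => ?_) ?_ hr
    · have hd : HasDerivAt (fun s : ℝ => (s : ℂ)) 1 s := Complex.ofRealCLM.hasDerivAt
      have hs0 : (s : ℂ) ≠ 0 := Complex.ofReal_ne_zero.2 hs'.1.ne'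
      have h1 := ((hd.const_mul ε).neg.cexp).mul (((hM' s hs').add (hd.mul (hK'' s hs'))).add
        ((hd.mul (hM' s hs')).const_mul ε))
      refine h1.congr_deriv ?_
      simp only [Pi.mul_apply, Pi.add_apply, Pi.neg_apply]
      field_simp
      linear_combination (-Complex.exp (-(ε * s)) * (s : ℂ) * M s) * hε
    · have hid : Tendsto (fun s : ℝ => (s : ℂ)) (𝓝[>] 0) (𝓝 0) := by
        have := (Complex.continuous_ofReal.tendsto 0).mono_left
          (nhdsWithin_le_nhds (s := Set.Ioi (0 : ℝ)))
        simpa using this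
      have he : Tendsto (fun s : ℝ => Complex.exp (-(ε * s))) (𝓝[>] 0) (𝓝 1) := by
        have := (Complex.continuous_exp.tendsto _).comp ((hid.const_mul ε).neg)
        simpa [Function.comp_def] using this
      have := he.mul ((hlimM.add (hid.mul hlimK)).add ((hid.mul hlimM).const_mul ε))
      simpa using this
  have h1 := key κ rfl
  have h2 := key (-κ) (by ring)
  have hr0 : (r : ℂ) ≠ 0 := Complex.ofReal_ne_zero.2 hr.1.ne'
  have hκ0 : (κ : ℂ) ≠ 0 := Complex.ofReal_ne_zero.2 hκ.ne'
  have h3 : sphericalBessel 0 (Complex.I * κ * r) =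
      (Complex.exp (κ * r) - Complex.exp (-(κ * r))) / (2 * (κ * r)) := by
    have e : Complex.I * κ * r = (κ * r) * Complex.I := by ring
    simp only [sphericalBessel, rayleigh, pow_zero, one_mul, Function.iterate_zero, id]
    rw [e, Complex.sin_mul_I, Complex.sinh]
    field_simp
  have e1 : Complex.exp (κ * r) * Complex.exp (-(κ * r)) = 1 := by
    rw [← Complex.exp_add, add_neg_cancel, Complex.exp_zero]
  rw [neg_mul, neg_neg] at h2
  rw [h3]
  field_simp
  linear_combination Complex.exp (κ * r) * h1 - Complex.exp (-(κ * r)) * h2 -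
    (2 * r * κ * M r) * e1

/-- The radial dependence of a harmonic component is fixed by the equation, and the amplitude is a
derivative at the centre. Induction on the degree: Euler's identity writes `P` through the `xᵢ∂ᵢP`,
and the divergence theorem expresses the derivative of `s^{n+2}` times the component by components
along the polynomials `∂ᵢP` of one degree less, the term with `ΔP` being zero. The function `s^{n+2}
j_{n+1}(iκs)` obeys the same first-order relation, and both vanish at `s = 0`. -/
theorem integral_harmonic_smul (hκ : 0 < κ) (hU : IsDerivSystem κ U D)
    (hb : Metric.ball 0 b ⊆ U) (ℓ : ℕ) {P : Poly3} (hP : P.IsHomogeneous ℓ) (hl : lap P = 0)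
    (Q : Poly3) {r : ℝ} (hr : r ∈ Set.Ioo 0 b) :
    ∫ θ : Sph, evalAt θ P * D Q (r • (θ : E3)) ∂surf =
      4 * Real.pi / (Complex.I * κ) ^ ℓ * sphericalBessel ℓ (Complex.I * κ * r) * D (P * Q) 0 := by
  have hκ0 : Complex.I * (κ : ℂ) ≠ 0 :=
    mul_ne_zero Complex.I_ne_zero (Complex.ofReal_ne_zero.2 hκ.ne')
  induction ℓ generalizing P Q r with
  | zero =>
    obtain ⟨c, rfl⟩ : ∃ c, P = C c :=
      ⟨_, totalDegree_eq_zero_iff_eq_C.1 ((totalDegree_zero_iff_isHomogeneous _).2 hP)⟩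
    simp only [evalAt_C]
    rw [integral_const_mul, hU.integral_smul hκ hb Q hr, ← smul_eq_C_mul, map_smul]
    simp only [Pi.smul_apply, smul_eq_mul]
    ring
  | succ n ih =>
    have hb0 : 0 < b := hr.1.trans hr.2
    have heul : ∑ i, X i * pderiv i P = ((n : ℂ) + 1) • P := by
      rw [hP.sum_X_mul_pderiv]
      simp [add_smul, Nat.cast_smul_eq_nsmul]
    have hn : (n : ℂ) + 1 ≠ 0 := Nat.cast_add_one_ne_zero n
    set c : ℂ := D (P * Q) 0 with hc
    set M : ℝ → ℂ := fun s => ∫ θ : Sph, evalAt θ P * D Q (s • (θ : E3)) ∂surf with hM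
    have hcont : ∀ (P' Q' : Poly3), ∀ s ∈ Set.Ioo 0 b,
        Integrable (fun θ : Sph => evalAt θ P' * D Q' (s • (θ : E3))) surf := fun P' Q' s hs' =>
      Continuous.integrable_of_hasCompactSupport (((continuous_evalAt P').comp
        continuous_subtype_val).mul (continuous_comp_smul_sph le_rfl
        ((hU.continuousOn Q').mono ((shell_subset_ball (b := b)).trans hb)) hs'))
        (HasCompactSupport.of_compactSpace _)
    have hd : ∀ s ∈ Set.Ioo 0 b, HasDerivAt (fun s : ℝ => (s : ℂ) ^ (n + 2) * M s)
        ((s : ℂ) ^ (n + 2) * (4 * Real.pi / (Complex.I * κ) ^ n *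
          sphericalBessel n (Complex.I * κ * s) * c)) s := by
      intro s hs'
      have h1 := (HasDerivAt.fun_sum (u := Finset.univ) fun i _ =>
        hU.hasDerivAt_integral_sq_coord hb (pderiv i P) Q i hs').const_mul ((n : ℂ) + 1)⁻¹
      refine (h1.congr_of_eventuallyEq ?_).congr_deriv ?_
      · filter_upwards [isOpen_Ioo.mem_nhds hs'] with t ht
        have e : ∀ i : Fin 3, ∫ θ : Sph, ((θ : E3) i : ℂ) * (evalAt (t • (θ : E3)) (pderiv i P) *
            D Q (t • (θ : E3))) ∂surf =
            (t : ℂ) ^ n * ∫ θ : Sph, evalAt θ (X i * pderiv i P) * D Q (t • (θ : E3)) ∂surf := by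
          intro i
          rw [← integral_const_mul]
          refine integral_congr_ae (Eventually.of_forall fun θ => ?_)
          beta_reduce
          rw [evalAt_smul (hP.pderiv (i := i)), map_mul, evalAt_X, Nat.add_sub_cancel]
          ring
        simp only [e]
        rw [← Finset.mul_sum, ← Finset.mul_sum, ← integral_finsetSum _ fun i _ => hcont _ _ t ht]
        simp only [← Finset.sum_mul, ← map_sum]
        rw [heul]
        simp only [map_smul, smul_eq_mul, mul_assoc]
        rw [integral_const_mul, hM]
        field_simp
        ring
      · have e : ∀ i : Fin 3, ∫ θ : Sph, (evalAt (s • (θ : E3)) (pderiv i (pderiv i P)) *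
            D Q (s • (θ : E3)) + evalAt (s • (θ : E3)) (pderiv i P) *
              D (X i * Q) (s • (θ : E3))) ∂surf =
            (∫ θ : Sph, evalAt (s • (θ : E3)) (pderiv i (pderiv i P)) * D Q (s • (θ : E3)) ∂surf) +
              (s : ℂ) ^ n * (4 * Real.pi / (Complex.I * κ) ^ n *
              sphericalBessel n (Complex.I * κ * s) * D (pderiv i P * (X i * Q)) 0) := by
          intro i
          rw [integral_add (hU.integrable_comp_smul hb _ _ hs') (hU.integrable_comp_smul hb _ _ hs'),
            ← ih (hP.pderiv (i := i)) (by rw [lap_pderiv, hl, map_zero]) (X i * Q) hs',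
            ← integral_const_mul]
          congr 1
          refine integral_congr_ae (Eventually.of_forall fun θ => ?_)
          beta_reduce
          rw [evalAt_smul (hP.pderiv (i := i)), Nat.add_sub_cancel]
          ring
        simp only [e]
        rw [← Finset.mul_sum, Finset.sum_add_distrib, ← integral_finsetSum _ fun i _ =>
          hU.integrable_comp_smul hb _ _ hs']
        simp only [← Finset.sum_mul, ← map_sum, ← lap_apply, hl, map_zero, zero_mul,
          integral_zero, zero_add, ← Finset.mul_sum, ← Finset.sum_apply]
        rw [show ∑ i, pderiv i P * (X i * Q) = ((n : ℂ) + 1) • (P * Q) by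
          rw [← smul_mul_assoc, ← heul, Finset.sum_mul]
          exact Finset.sum_congr rfl fun i _ => by ring, map_smul, Pi.smul_apply, smul_eq_mul, ← hc]
        field_simp
        ring
    have hj : ∀ s ∈ Set.Ioo 0 b, HasDerivAt (fun s : ℝ => (s : ℂ) ^ (n + 2) *
        sphericalBessel (n + 1) (Complex.I * κ * s))
        (Complex.I * κ * ((s : ℂ) ^ (n + 2) * sphericalBessel n (Complex.I * κ * s))) s := by
      intro s hs'
      have hs0 : (s : ℂ) ≠ 0 := Complex.ofReal_ne_zero.2 hs'.1.ne'
      have hκ1 : (κ : ℂ) ≠ 0 := Complex.ofReal_ne_zero.2 hκ.ne'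
      have hd' : HasDerivAt (fun s : ℝ => (s : ℂ)) 1 s := Complex.ofRealCLM.hasDerivAt
      have h1 := (hasDerivAt_sphericalBessel_succ n (I_mul_ne_zero hκ hs'.1.ne')).comp_of_eq s
        (hasDerivAt_I_mul κ s) rfl
      refine ((hd'.pow (n + 2)).mul h1).congr_deriv ?_
      simp only [Pi.pow_apply, Function.comp, Nat.add_sub_cancel, show n + 2 - 1 = n + 1 from rfl]
      push_cast
      field_simp
      ring
    have hlim : Tendsto (fun s : ℝ => (s : ℂ) ^ (n + 2) * M s) (𝓝[>] 0) (𝓝 0) := by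
      have hM0 := continuousAt_integral_smul hb0 ((hU.continuousOn Q).mono hb)
        (g := fun θ : Sph => evalAt θ P) ((continuous_evalAt P).comp continuous_subtype_val)
      have hid : Tendsto (fun s : ℝ => (s : ℂ) ^ (n + 2)) (𝓝[>] 0) (𝓝 0) := by
        have := ((show Continuous fun s : ℝ => (s : ℂ) ^ (n + 2) by fun_prop).tendsto 0).mono_left
          (nhdsWithin_le_nhds (s := Set.Ioi (0 : ℝ)))
        simpa using this
      simpa using hid.mul hM0
    -- The difference of the two sides, multiplied by `s^{n+2}`, has derivative zero, and its limit
    -- at the origin fixes the constant as zero.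
    have h0 := eq_of_hasDerivAt_zero_of_tendsto (b := b) (c := 0)
      (f := fun s : ℝ => (s : ℂ) ^ (n + 2) * M s - 4 * Real.pi / (Complex.I * κ) ^ (n + 1) * c *
        ((s : ℂ) ^ (n + 2) * sphericalBessel (n + 1) (Complex.I * κ * s)))
      (fun s hs' => by
        refine ((hd s hs').sub ((hj s hs').const_mul _)).congr_deriv ?_
        field_simp
        ring)
      (by simpa using hlim.sub ((tendsto_pow_mul_sphericalBessel (n + 1) hκ0).const_mul
        (4 * Real.pi / (Complex.I * κ) ^ (n + 1) * c))) hr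
    have hr0 : (r : ℂ) ^ (n + 2) ≠ 0 := pow_ne_zero _ (Complex.ofReal_ne_zero.2 hr.1.ne')
    apply mul_left_cancel₀ hr0
    linear_combination h0

end IsDerivSystem

end DerivativeSystem

/-! ### Derivatives of the fundamental outgoing wave. -/

section HankelField

open MvPolynomial

variable {κ : ℝ}

/-- `((1/r) d/dr)^k h_0 (iκr)`. -/
def radialIter (κ : ℝ) (k : ℕ) (r : ℝ) : ℂ := (-(κ : ℂ) ^ 2) ^ k * hankelRadial κ k r

theorem hasDerivAt_radialIter (hκ : 0 < κ) (k : ℕ) {r : ℝ} (hr : r ≠ 0) :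
    HasDerivAt (radialIter κ k) (r * radialIter κ (k + 1) r) r := by
  refine ((hasDerivAt_hankelRadial hκ k hr).const_mul _).congr_deriv ?_
  rw [radialIter]
  ring

theorem hasFDerivAt_norm {x : E3} (hx : x ≠ 0) :
    HasFDerivAt (fun x : E3 => ‖x‖) (‖x‖⁻¹ • innerSL ℝ x) x := by
  have h0 : (‖x‖ ^ 2 : ℝ) ≠ 0 := by positivity
  have h := ((hasStrictFDerivAt_norm_sq x).hasFDerivAt).sqrt h0
  simp only [Real.sqrt_sq (norm_nonneg _)] at h
  refine h.congr_fderiv ?_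
  ext v
  simp
  field_simp

/-- The chain rule for a function of the norm. -/
theorem hasFDerivAt_comp_norm {f : ℝ → ℂ} {f' : ℂ} {x : E3} (hx : x ≠ 0)
    (hf : HasDerivAt f f' ‖x‖) :
    HasFDerivAt (fun x : E3 => f ‖x‖) (coordForm fun i => f' * (x i / ‖x‖ : ℝ)) x := by
  refine (hf.hasFDerivAt.comp x (hasFDerivAt_norm hx)).congr_fderiv ?_
  ext v
  rw [coordForm_apply]
  simp [PiLp.inner_apply, Fin.sum_univ_three]
  ring

theorem hasFDerivAt_radialIter (hκ : 0 < κ) (k : ℕ) {x : E3} (hx : x ≠ 0) :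
    HasFDerivAt (fun x : E3 => radialIter κ k ‖x‖)
      (coordForm fun i => x i * radialIter κ (k + 1) ‖x‖) x := by
  have hx' : ‖x‖ ≠ 0 := norm_ne_zero_iff.2 hx
  refine (hasFDerivAt_comp_norm hx (hasDerivAt_radialIter hκ k hx')).congr_fderiv ?_
  congr 1
  funext i
  have : (‖x‖ : ℂ) ≠ 0 := Complex.ofReal_ne_zero.2 hx'
  push_cast
  field_simp

/-- The derivative `P(∇)` of `h_0 (iκ|x|)` for `P` homogeneous of degree `n`. -/
def homogField (κ : ℝ) (n : ℕ) : Poly3 →ₗ[ℂ] (E3 → ℂ) where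
  toFun P x := ∑ j ∈ Finset.range (n + 1),
    radialIter κ (n - j) ‖x‖ * (2 ^ j * (j.factorial : ℂ))⁻¹ * evalAt x ((lap ^ j) P)
  map_add' P Q := by
    funext x
    simp only [map_add, mul_add, Finset.sum_add_distrib, Pi.add_apply]
  map_smul' c P := by
    funext x
    simp only [map_smul, Finset.mul_sum, Pi.smul_apply, smul_eq_mul, RingHom.id_apply]
    exact Finset.sum_congr rfl fun j _ => by ring

/-- `P ↦ P(∇) h_0 (iκ|x|)`. -/
def hankelField (κ : ℝ) : Poly3 →ₗ[ℂ] (E3 → ℂ) :=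
  (basisMonomials (Fin 3) ℂ).constr ℂ fun s => homogField κ s.degree (monomial s 1)

theorem hankelField_of_isHomogeneous {P : Poly3} {n : ℕ} (hP : P.IsHomogeneous n) :
    hankelField κ P = homogField κ n P := by
  have h1 : ∀ s, hankelField κ (monomial s 1) = homogField κ s.degree (monomial s 1) := fun s => by
    have := (basisMonomials (Fin 3) ℂ).constr_basis ℂ
      (fun s => homogField κ s.degree (monomial s 1)) s
    rwa [coe_basisMonomials] at this
  conv_lhs => rw [P.as_sum]
  conv_rhs => rw [P.as_sum]
  rw [map_sum, map_sum]
  refine Finset.sum_congr rfl fun s hs => ?_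
  have hd : s.degree = n := by
    rw [← hP (mem_support_iff.1 hs), Finsupp.degree_eq_weight_one]; rfl
  rw [show monomial s (coeff s P) = coeff s P • monomial s (1 : ℂ) by simp [smul_monomial],
    map_smul, map_smul, h1, hd]

theorem lap_pow_eq_zero {P : Poly3} {n : ℕ} (hP : P.IsHomogeneous n) {j : ℕ} (hj : n < 2 * j) :
    (lap ^ j) P = 0 := by
  induction j generalizing n P with
  | zero => omega
  | succ j ih =>
    rw [pow_succ, Module.End.mul_apply]
    by_cases hn : n < 2
    · have h0 : lap P = 0 := by
        rw [lap_apply]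
        refine Finset.sum_eq_zero fun i _ => ?_
        have h1 : (pderiv i P).IsHomogeneous 0 := by
          have := hP.pderiv (i := i)
          rwa [show n - 1 = 0 by omega] at this
        rw [totalDegree_eq_zero_iff_eq_C.1 ((totalDegree_zero_iff_isHomogeneous _).2 h1), pderiv_C]
      rw [h0, map_zero]
    · exact ih (IsHomogeneous_lap hP) (by omega)

theorem lap_pow_X_mul (i : Fin 3) (P : Poly3) (j : ℕ) :
    (lap ^ (j + 1)) (X i * P) = X i * (lap ^ (j + 1)) P +
      (2 * ((j : ℂ) + 1)) • pderiv i ((lap ^ j) P) := by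
  have hc : ∀ k, lap (pderiv i ((lap ^ k) P)) = pderiv i ((lap ^ (k + 1)) P) := fun k => by
    rw [lap_pderiv, pow_succ', Module.End.mul_apply]
  induction j with
  | zero =>
    simp only [zero_add, pow_one, pow_zero, Module.End.one_apply, lap_X_mul, Nat.cast_zero, mul_one,
      smul_eq_C_mul, map_ofNat]
  | succ j ih =>
    rw [pow_succ' lap (j + 1), Module.End.mul_apply, ih, map_add, map_smul, hc, lap_X_mul,
      ← Module.End.mul_apply, ← pow_succ', smul_eq_C_mul, smul_eq_C_mul]
    push_cast
    simp only [C_mul, C_add, C_1, map_ofNat]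
    ring

/-- The induction step of Hobson's formula for `P(∇) f(|x|)`. Differentiating the radial factor
gives `xᵢ` times the next radial iterate, differentiating the polynomial gives `∂ᵢΔ^jP`; these are
the two terms into which `Δ^j(xᵢP)` splits by the commutator `lap_pow_X_mul`. -/
theorem hasFDerivAt_homogField (hκ : 0 < κ) {P : Poly3} {n : ℕ} (hP : P.IsHomogeneous n) {x : E3}
    (hx : x ≠ 0) :
    HasFDerivAt (homogField κ n P) (coordForm fun i => homogField κ (n + 1) (X i * P) x) x := by
  have h1 := HasFDerivAt.fun_sum (u := Finset.range (n + 1)) fun j _ =>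
    ((hasFDerivAt_radialIter hκ (n - j) hx).mul_const ((2 ^ j * (j.factorial : ℂ))⁻¹)).mul
      (((contDiff_evalAt ((lap ^ j) P) (n := 1)).differentiable (by norm_num) x).hasFDerivAt)
  refine HasFDerivAt.congr_fderiv (f := homogField κ n P) h1 ?_
  ext v
  rw [coordForm_apply]
  simp only [ContinuousLinearMap.sum_apply, ContinuousLinearMap.add_apply,
    ContinuousLinearMap.smul_apply, fderiv_evalAt, coordForm_apply, smul_eq_mul]
  have e : ∀ i, homogField κ (n + 1) (X i * P) x = ∑ j ∈ Finset.range (n + 1),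
      (x i * radialIter κ (n - j + 1) ‖x‖ * (2 ^ j * (j.factorial : ℂ))⁻¹ *
        evalAt x ((lap ^ j) P) + radialIter κ (n - j) ‖x‖ * (2 ^ j * (j.factorial : ℂ))⁻¹ *
        evalAt x (pderiv i ((lap ^ j) P))) := by
    intro i
    have h2 : homogField κ (n + 1) (X i * P) x = ∑ j ∈ Finset.range (n + 2),
      radialIter κ (n + 1 - j) ‖x‖ * (2 ^ j * (j.factorial : ℂ))⁻¹ *
        evalAt x ((lap ^ j) (X i * P)) := rfl
    rw [h2, Finset.sum_range_succ', Finset.sum_add_distrib]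
    have h3 : ∀ j ∈ Finset.range (n + 1), radialIter κ (n + 1 - (j + 1)) ‖x‖ *
        (2 ^ (j + 1) * ((j + 1).factorial : ℂ))⁻¹ * evalAt x ((lap ^ (j + 1)) (X i * P)) =
        x i * radialIter κ (n + 1 - (j + 1)) ‖x‖ * (2 ^ (j + 1) * ((j + 1).factorial : ℂ))⁻¹ *
          evalAt x ((lap ^ (j + 1)) P) +
        radialIter κ (n - j) ‖x‖ * (2 ^ j * (j.factorial : ℂ))⁻¹ *
          evalAt x (pderiv i ((lap ^ j) P)) := by
      intro j _
      have hf : (j.factorial : ℂ) ≠ 0 := Nat.cast_ne_zero.2 j.factorial_ne_zero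
      have hj : (j : ℂ) + 1 ≠ 0 := Nat.cast_add_one_ne_zero j
      rw [lap_pow_X_mul, Nat.add_sub_add_right, Nat.factorial_succ, map_add, map_mul, evalAt_X,
        map_smul, smul_eq_mul]
      push_cast
      field_simp
      ring
    rw [Finset.sum_congr rfl h3, Finset.sum_add_distrib, add_right_comm]
    congr 1
    have h4 : ∀ j ∈ Finset.range (n + 1), x i * radialIter κ (n - j + 1) ‖x‖ *
        (2 ^ j * (j.factorial : ℂ))⁻¹ * evalAt x ((lap ^ j) P) =
        x i * radialIter κ (n + 1 - j) ‖x‖ * (2 ^ j * (j.factorial : ℂ))⁻¹ *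
          evalAt x ((lap ^ j) P) := by
      intro j hj
      rw [show n - j + 1 = n + 1 - j by have := Finset.mem_range.1 hj; omega]
    rw [Finset.sum_congr rfl h4]
    -- The range of summation grows by one with the degree; the additional summand contains `Δ^{n+1}
    -- P`, which is zero for degree `n`.
    have h5 := Finset.sum_range_succ' (fun j => x i * radialIter κ (n + 1 - j) ‖x‖ *
      (2 ^ j * (j.factorial : ℂ))⁻¹ * evalAt x ((lap ^ j) P)) (n + 1)
    rw [Finset.sum_range_succ, lap_pow_eq_zero hP (by omega), map_zero, mul_zero, add_zero] at h5
    rw [h5]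
    simp
    ring
  simp only [e, Finset.mul_sum]
  rw [Finset.sum_comm]
  refine Finset.sum_congr rfl fun j _ => ?_
  simp only [Fin.sum_univ_three]
  ring

theorem hasFDerivAt_hankelField (hκ : 0 < κ) (P : Poly3) {x : E3} (hx : x ≠ 0) :
    HasFDerivAt (hankelField κ P) (coordForm fun i => hankelField κ (X i * P) x) x := by
  induction P using MvPolynomial.induction_on' with
  | monomial s c =>
    have h1 : (monomial s c : Poly3).IsHomogeneous s.degree := isHomogeneous_monomial c rfl
    have h2 : ∀ i, (X i * monomial s c : Poly3).IsHomogeneous (s.degree + 1) := fun i => by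
      rw [add_comm]; exact (isHomogeneous_X ℂ i).mul h1
    rw [hankelField_of_isHomogeneous h1]
    simp only [hankelField_of_isHomogeneous (h2 _)]
    exact hasFDerivAt_homogField hκ h1 hx
  | add P Q hP hQ =>
    rw [map_add]
    refine (hP.add hQ).congr_fderiv ?_
    ext v
    simp only [ContinuousLinearMap.add_apply, coordForm_apply, mul_add, map_add, Pi.add_apply,
      Finset.sum_add_distrib]

theorem lap_rho_mul_C (a : ℂ) : lap (rho * C a) = C (6 * a) := by
  rw [mul_comm, ← smul_eq_C_mul, map_smul, lap_apply, rho_eq]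
  have h2 : ∀ i, pderiv i (2 : Poly3) = 0 := fun i => by simpa using (pderiv i).map_natCast 2
  have h6 : (C 6 : Poly3) = 6 := map_ofNat C 6
  simp [Fin.sum_univ_three, pderiv_X, Pi.single_apply, smul_eq_C_mul, h2, h6]
  ring

theorem hankelField_rho_mul_C (hκ : 0 < κ) (a : ℂ) {x : E3} (hx : x ≠ 0) :
    hankelField κ (rho * C a) x = (κ : ℂ) ^ 2 * hankelField κ (C a) x := by
  have hr : ‖x‖ ≠ 0 := norm_ne_zero_iff.2 hx
  have h1 : (C a : Poly3).IsHomogeneous 0 := isHomogeneous_C _ a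
  have h2 : (rho * C a).IsHomogeneous 2 := by simpa using isHomogeneous_rho.mul h1
  have h4 : (lap ^ 2) (rho * C a) = 0 := by
    rw [pow_two, Module.End.mul_apply, lap_rho_mul_C]; simp [lap_apply]
  have e1 : homogField κ 0 (C a) x = ∑ j ∈ Finset.range 1,
    radialIter κ (0 - j) ‖x‖ * (2 ^ j * (j.factorial : ℂ))⁻¹ * evalAt x ((lap ^ j) (C a)) := rfl
  have e2 : homogField κ 2 (rho * C a) x = ∑ j ∈ Finset.range 3,
    radialIter κ (2 - j) ‖x‖ * (2 ^ j * (j.factorial : ℂ))⁻¹ *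
      evalAt x ((lap ^ j) (rho * C a)) := rfl
  rw [hankelField_of_isHomogeneous h1, hankelField_of_isHomogeneous h2, e1, e2,
    Finset.sum_range_succ, Finset.sum_range_succ, Finset.sum_range_succ, Finset.sum_range_zero,
    Finset.sum_range_succ, Finset.sum_range_zero, h4, pow_one lap, lap_rho_mul_C, pow_zero lap,
    Module.End.one_apply, Module.End.one_apply, map_mul, evalAt_rho, evalAt_C, evalAt_C, map_zero]
  have h := hankelRadial_recurrence hκ 0 hr
  simp only [radialIter, Nat.factorial, Nat.sub_zero, Nat.sub_self, Nat.cast_zero, zero_add] at h ⊢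
  norm_num at h ⊢
  linear_combination (-a * (κ : ℂ) ^ 2) * h

theorem hankelField_rho_mul_mul_X (hκ : 0 < κ) (Q : Poly3) (i : Fin 3) (hQ : ∀ x : E3, x ≠ 0 →
    hankelField κ (rho * Q) x = (κ : ℂ) ^ 2 * hankelField κ Q x) {x : E3} (hx : x ≠ 0) :
    hankelField κ (rho * (Q * X i)) x = (κ : ℂ) ^ 2 * hankelField κ (Q * X i) x := by
  have h1 := (hasFDerivAt_hankelField hκ (rho * Q) hx)
  have h2 := ((hasFDerivAt_hankelField hκ Q hx).const_mul ((κ : ℂ) ^ 2)).congr_of_eventuallyEq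
    (f₁ := hankelField κ (rho * Q))
    (by filter_upwards [isOpen_compl_singleton.mem_nhds hx] with y hy using hQ y hy)
  have h3 := congrArg (fun A : E3 →L[ℝ] ℂ => A (EuclideanSpace.single i 1)) (h1.unique h2)
  simp only [coordForm_single, ContinuousLinearMap.smul_apply, smul_eq_mul] at h3
  rw [mul_comm Q, ← h3, mul_left_comm]

/-- For constant `P` this is the equation `Δh_0 = κ² h_0` in radial form. Since it holds in the
whole punctured space it may be differentiated, and this passes it on from `Q` to `Q xᵢ`. -/
theorem hankelField_rho_mul (hκ : 0 < κ) (P : Poly3) :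
    ∀ x : E3, x ≠ 0 → hankelField κ (rho * P) x = (κ : ℂ) ^ 2 * hankelField κ P x := by
  induction P using MvPolynomial.induction_on with
  | C a => exact fun x hx => hankelField_rho_mul_C hκ a hx
  | add P Q hP hQ =>
    intro x hx
    rw [mul_add, map_add, map_add, Pi.add_apply, Pi.add_apply, hP x hx, hQ x hx]
    ring
  | mul_X Q i hQ => exact fun x hx => hankelField_rho_mul_mul_X hκ Q i hQ hx

theorem isDerivSystem_hankelField (hκ : 0 < κ) : IsDerivSystem κ {0}ᶜ (hankelField κ) where
  isOpen := isOpen_compl_singleton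
  hasFDerivAt P _ hx := hasFDerivAt_hankelField hκ P hx
  map_rho P := hankelField_rho_mul hκ P

/-- Hobson's formula for harmonic polynomials. -/
theorem hankelField_of_harmonic {P : Poly3} {n : ℕ} (hP : P.IsHomogeneous n) (hl : lap P = 0)
    (x : E3) : hankelField κ P x = radialIter κ n ‖x‖ * evalAt x P := by
  rw [hankelField_of_isHomogeneous hP]
  simp only [homogField, LinearMap.coe_mk, AddHom.coe_mk]
  rw [Finset.sum_range_succ', Finset.sum_eq_zero]
  · simp
  · intro j _
    rw [pow_succ lap, Module.End.mul_apply, hl, map_zero, map_zero, mul_zero]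

end HankelField

/-! ### The addition theorem for outgoing waves. -/

section AdditionTheorem

variable {E : ℝ} {ℓ : ℕ} {m : ℤ}

theorem sqrt_abs_pos (hE : E < 0) : 0 < Real.sqrt |E| := Real.sqrt_pos.2 (abs_pos.2 hE.ne)

theorem hankelWave_eq_evalAt (hE : E < 0) (hm : m.natAbs ≤ ℓ) {x : E3} (hx : x ≠ 0) :
    hankelWave ℓ m E x = (-(Complex.I * Real.sqrt |E|)) ^ ℓ *
      (hankelRadial (Real.sqrt |E|) ℓ ‖x‖ * evalAt x (solidY ℓ m)) := by
  rw [hankelWave, energyRoot, sphericalHankel_radial (sqrt_abs_pos hE) _ (norm_ne_zero_iff.2 hx),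
    evalAt_solidY hm hx, ← neg_mul, mul_pow]
  ring

/-- Hobson's formula has a single term for a harmonic polynomial. The constant is the quotient of
`(-iκ)^ℓ` from the definition of `h_ℓ` and `(-κ²)^ℓ` from the radial iterates. -/
theorem hankelWave_eq_hankelField (hE : E < 0) (hm : m.natAbs ≤ ℓ) {x : E3} (hx : x ≠ 0) :
    hankelWave ℓ m E x = (Complex.I / Real.sqrt |E|) ^ ℓ *
      hankelField (Real.sqrt |E|) (solidY ℓ m) x := by
  have hκ : (Real.sqrt |E| : ℂ) ≠ 0 := Complex.ofReal_ne_zero.2 (sqrt_abs_pos hE).ne'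
  rw [hankelWave_eq_evalAt hE hm hx,
    hankelField_of_harmonic (isHomogeneous_solidY hm) (lap_solidY hm), radialIter, mul_assoc,
    ← mul_assoc ((Complex.I / Real.sqrt |E|) ^ ℓ), ← mul_pow]
  congr 2
  field_simp

theorem hankelWave_neg (hE : E < 0) (hm : m.natAbs ≤ ℓ) {x : E3} (hx : x ≠ 0) :
    hankelWave ℓ m E (-x) = (-1) ^ ℓ * hankelWave ℓ m E x := by
  rw [hankelWave_eq_evalAt hE hm hx, hankelWave_eq_evalAt hE hm (neg_ne_zero.2 hx), norm_neg,
    show -x = (-1 : ℝ) • x by simp, evalAt_smul (isHomogeneous_solidY hm)]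
  push_cast
  ring

theorem gaunt_eq_sphI {ℓ' ℓ'' : ℕ} {m' m'' : ℤ} (hm : m.natAbs ≤ ℓ) (hm' : m'.natAbs ≤ ℓ') :
    gaunt ℓ m ℓ' m' ℓ'' m'' = sphI (solidY ℓ m * solidY ℓ' m' * polyY ℓ'' m'') := by
  rw [gaunt, sphereIntegral, sphI_apply]
  refine integral_congr_ae (Eventually.of_forall fun θ => ?_)
  beta_reduce
  rw [map_mul, map_mul, evalAt_solidY_sph hm, evalAt_solidY_sph hm', evalAt_polyY]
  push_cast
  rfl

theorem gaunt_eq_zero {ℓ' ℓ'' : ℕ} {m' m'' : ℤ} (hm : m.natAbs ≤ ℓ) (hm' : m'.natAbs ≤ ℓ')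
    (h : ∀ j : ℕ, 2 * j + ℓ'' ≠ ℓ + ℓ') : gaunt ℓ m ℓ' m' ℓ'' m'' = 0 := by
  rw [gaunt_eq_sphI hm hm']
  exact sphI_mul_polyY_eq_zero ((isHomogeneous_solidY hm).mul (isHomogeneous_solidY hm')) h

theorem natAbs_le_of_mem_Icc {ℓ : ℕ} {m : ℤ} (hm : m ∈ Finset.Icc (-(ℓ : ℤ)) ℓ) : m.natAbs ≤ ℓ := by
  have := Finset.mem_Icc.1 hm; omega

/-- The addition theorem: the spherical components of an outgoing wave with centre `d`. -/
theorem integral_hankelWave_mul (hE : E < 0) {ℓ' : ℕ} {m' : ℤ} (hm : m.natAbs ≤ ℓ)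
    (hm' : m'.natAbs ≤ ℓ') {d : E3} {r : ℝ} (hr : r ∈ Set.Ioo 0 ‖d‖) :
    ∫ θ : Sph, hankelWave ℓ' m' E (r • (θ : E3) - d) * sphericalHarmonic ℓ m θ ∂surf =
      structureConstant ℓ m ℓ' m' E d * sphericalBessel ℓ (energyRoot E * r) := by
  set κ := Real.sqrt |E| with hκdef
  have hκ : 0 < κ := sqrt_abs_pos hE
  have hκ0 : (κ : ℂ) ≠ 0 := Complex.ofReal_ne_zero.2 hκ.ne'
  have hd0 : d ≠ 0 := norm_pos_iff.1 (hr.1.trans hr.2)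
  have hsys := (isDerivSystem_hankelField hκ).shift d
  have hball : Metric.ball (0 : E3) ‖d‖ ⊆ (fun x => x - d) ⁻¹' {0}ᶜ := by
    intro x hx h0
    have : x = d := sub_eq_zero.1 h0
    simp [this] at hx
  -- The shifted wave solves the equation in the ball of radius `|d|` about the origin, so its
  -- component on a smaller sphere is given by a derivative at the origin, that is, by one of `h_0`
  -- at `-d`.
  have h1 := hsys.integral_harmonic_smul hκ hball ℓ (isHomogeneous_solidY hm) (lap_solidY hm)
    (solidY ℓ' m') hr
  have h2 : ∫ θ : Sph, hankelWave ℓ' m' E (r • (θ : E3) - d) * sphericalHarmonic ℓ m θ ∂surf =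
      (Complex.I / κ) ^ ℓ' * ∫ θ : Sph, evalAt θ (solidY ℓ m) *
        ((LinearMap.funLeft ℂ ℂ fun x : E3 => x - d) ∘ₗ hankelField κ) (solidY ℓ' m')
          (r • (θ : E3)) ∂surf := by
    rw [← integral_const_mul]
    refine integral_congr_ae (Eventually.of_forall fun θ => ?_)
    have hx : r • (θ : E3) - d ≠ 0 := hball (by
      rw [mem_ball_zero_iff, norm_smul_sph hr.1]; exact hr.2)
    beta_reduce
    rw [hankelWave_eq_hankelField hE hm' hx, evalAt_solidY_sph hm]
    simp only [LinearMap.comp_apply, LinearMap.funLeft_apply]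
    ring
  rw [h2, h1]
  -- The product of the two solid harmonics is expanded under the functional "apply as a
  -- differential operator and evaluate at `-d`", on which `|x|²` acts as `κ²`.
  have h3 := map_eq_sum_solidY ((isHomogeneous_solidY hm).mul (isHomogeneous_solidY hm'))
    ((LinearMap.proj (-d) : (E3 → ℂ) →ₗ[ℂ] ℂ) ∘ₗ hankelField κ) (c := (κ : ℂ))
    (fun Q => hankelField_rho_mul hκ Q _ (neg_ne_zero.2 hd0))
  simp only [LinearMap.comp_apply, LinearMap.proj_apply] at h3
  simp only [LinearMap.comp_apply, LinearMap.funLeft_apply, zero_sub]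
  rw [h3, structureConstant, tsum_eq_sum (s := Finset.range (ℓ + ℓ' + 1)), energyRoot, ← hκdef]
  · have key : ∀ ℓ'' ∈ Finset.range (ℓ + ℓ' + 1), ∀ m'' ∈ Finset.Icc (-(ℓ'' : ℤ)) ℓ'',
        (Complex.I / κ) ^ ℓ' / (Complex.I * κ) ^ ℓ *
          (sphI (solidY ℓ m * solidY ℓ' m' * polyY ℓ'' m'') *
            ((κ : ℂ) ^ (ℓ + ℓ' - ℓ'') * hankelField κ (solidY ℓ'' m'') (-d))) =
        Complex.I ^ ((ℓ : ℤ) - (ℓ' : ℤ) - (ℓ'' : ℤ)) * gaunt ℓ m ℓ' m' ℓ'' m'' *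
          hankelWave ℓ'' m'' E d := by
      intro ℓ'' _ m'' hm''
      rw [← gaunt_eq_sphI hm hm']
      -- Only degrees `ℓ''` with `ℓ + ℓ' - ℓ''` even and non-negative contribute. For these the sign
      -- `(-1)^{ℓ''}` from the evaluation at `-d` and the squared powers of `i` combine to one,
      -- leaving `i^{ℓ-ℓ'-ℓ''}`, and all powers of `κ` cancel.
      by_cases hpar : ∀ j : ℕ, 2 * j + ℓ'' ≠ ℓ + ℓ'
      · rw [gaunt_eq_zero hm hm' hpar]; ring
      push Not at hpar
      obtain ⟨j, hj⟩ := hpar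
      have hw := hankelWave_eq_hankelField hE (natAbs_le_of_mem_Icc hm'') (neg_ne_zero.2 hd0)
      rw [hankelWave_neg hE (natAbs_le_of_mem_Icc hm'') hd0, ← hκdef] at hw
      have hIκ : Complex.I / (κ : ℂ) ≠ 0 := div_ne_zero Complex.I_ne_zero hκ0
      have hF : hankelField κ (solidY ℓ'' m'') (-d) =
          ((Complex.I / κ) ^ ℓ'')⁻¹ * ((-1) ^ ℓ'' * hankelWave ℓ'' m'' E d) := by
        rw [hw, inv_mul_cancel_left₀ (pow_ne_zero _ hIκ)]
      rw [hF, show ℓ + ℓ' - ℓ'' = 2 * j by omega, zpow_sub₀ Complex.I_ne_zero,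
        zpow_sub₀ Complex.I_ne_zero, zpow_natCast, zpow_natCast, zpow_natCast]
      have hI : ∀ k : ℕ, Complex.I ^ k ≠ 0 := fun k => pow_ne_zero k Complex.I_ne_zero
      have hk : ∀ k : ℕ, (κ : ℂ) ^ k ≠ 0 := fun k => pow_ne_zero k hκ0
      have hI2 : ∀ k : ℕ, Complex.I ^ k * Complex.I ^ k = (-1) ^ k := fun k => by
        rw [← mul_pow, Complex.I_mul_I]
      have hsgn : ((-1 : ℂ)) ^ ℓ' * (-1) ^ ℓ'' = (-1) ^ ℓ := by
        have : ((-1 : ℂ)) ^ ℓ * (-1) ^ ℓ' = (-1) ^ ℓ'' := by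
          rw [← pow_add, ← hj, pow_add, pow_mul]; simp
        have h2 : ((-1 : ℂ)) ^ ℓ' * (-1) ^ ℓ' = 1 := by rw [← mul_pow]; simp
        rw [← this]
        linear_combination (-1 : ℂ) ^ ℓ * h2
      have hkk : (κ : ℂ) ^ (2 * j) * (κ : ℂ) ^ ℓ'' = (κ : ℂ) ^ ℓ * (κ : ℂ) ^ ℓ' := by
        rw [← pow_add, ← pow_add, hj]
      simp only [div_pow, mul_pow]
      have hIℓ := hI ℓ
      have hIℓ' := hI ℓ'
      have hIℓ'' := hI ℓ''
      have hkℓ := hk ℓ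
      have hkℓ' := hk ℓ'
      have hkℓ'' := hk ℓ''
      generalize gaunt ℓ m ℓ' m' ℓ'' m'' = G
      generalize hankelWave ℓ'' m'' E d = H
      have e : Complex.I ^ ℓ' / (κ : ℂ) ^ ℓ' / (Complex.I ^ ℓ * (κ : ℂ) ^ ℓ) *
          (G * ((κ : ℂ) ^ (2 * j) * ((Complex.I ^ ℓ'' / (κ : ℂ) ^ ℓ'')⁻¹ * ((-1) ^ ℓ'' * H)))) =
          (Complex.I ^ ℓ' * Complex.I ^ ℓ') * (-1) ^ ℓ'' / (Complex.I ^ ℓ * Complex.I ^ ℓ) *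
          ((κ : ℂ) ^ (2 * j) * (κ : ℂ) ^ ℓ'') / ((κ : ℂ) ^ ℓ * (κ : ℂ) ^ ℓ') *
          (Complex.I ^ ℓ / Complex.I ^ ℓ' / Complex.I ^ ℓ'' * G * H) := by
        field_simp
      rw [e, hI2, hI2, hsgn, hkk]
      field_simp
    have key2 : (Complex.I / κ) ^ ℓ' / (Complex.I * κ) ^ ℓ *
        (∑ ℓ'' ∈ Finset.range (ℓ + ℓ' + 1), ∑ m'' ∈ Finset.Icc (-(ℓ'' : ℤ)) ℓ'',
          sphI (solidY ℓ m * solidY ℓ' m' * polyY ℓ'' m'') *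
            ((κ : ℂ) ^ (ℓ + ℓ' - ℓ'') * hankelField κ (solidY ℓ'' m'') (-d))) =
        ∑ ℓ'' ∈ Finset.range (ℓ + ℓ' + 1), ∑ m'' ∈ Finset.Icc (-(ℓ'' : ℤ)) ℓ'',
          Complex.I ^ ((ℓ : ℤ) - (ℓ' : ℤ) - (ℓ'' : ℤ)) * gaunt ℓ m ℓ' m' ℓ'' m'' *
          hankelWave ℓ'' m'' E d := by
      rw [Finset.mul_sum]
      refine Finset.sum_congr rfl fun ℓ'' hℓ => ?_
      rw [Finset.mul_sum]
      exact Finset.sum_congr rfl fun m'' hm => key ℓ'' hℓ m'' hm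
    rw [← key2]
    ring
  · intro ℓ'' hℓ
    refine Finset.sum_eq_zero fun m'' _ => ?_
    rw [gaunt_eq_zero hm hm' fun j hj => hℓ (Finset.mem_range.2 (by omega))]
    ring

end AdditionTheorem

/-! ### A Volterra equation with integrable coefficient. -/

section Volterra

variable {q : ℝ → ℝ} {R : ℝ}

/-- The Volterra kernel `1 - (t/r)^n` for `t ≤ r`, continued by zero. -/
def volterraKernel (n : ℕ) (r t : ℝ) : ℝ := 1 - (t / max r t) ^ n

theorem volterraKernel_of_le {n : ℕ} {r t : ℝ} (ht : 0 < t) (h : r ≤ t) :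
    volterraKernel n r t = 0 := by
  rw [volterraKernel, max_eq_right h, div_self ht.ne', one_pow, sub_self]

theorem volterraKernel_of_ge {n : ℕ} {r t : ℝ} (h : t ≤ r) :
    volterraKernel n r t = 1 - (t / r) ^ n := by
  rw [volterraKernel, max_eq_left h]

theorem abs_volterraKernel_le {n : ℕ} {r t : ℝ} (ht : 0 < t) : |volterraKernel n r t| ≤ 1 := by
  have h1 : 0 ≤ t / max r t := by positivity
  have h2 : t / max r t ≤ 1 := div_le_one_of_le₀ (le_max_right _ _) (by positivity)
  have h3 := pow_le_one₀ (n := n) h1 h2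
  have h4 := pow_nonneg h1 n
  rw [volterraKernel, abs_le]
  constructor <;> linarith

theorem continuous_volterraKernel {n : ℕ} {t : ℝ} (ht : 0 < t) :
    Continuous fun r => volterraKernel n r t := by
  unfold volterraKernel
  refine continuous_const.sub (Continuous.pow (continuous_const.div (by fun_prop) fun r => ?_) n)
  exact (ht.trans_le (le_max_right r t)).ne'

theorem measurable_volterraKernel (n : ℕ) (r : ℝ) : Measurable fun t => volterraKernel n r t := by
  unfold volterraKernel
  fun_prop

theorem abs_volterraKernel_mul_le {n : ℕ} (hq0 : ∀ t ≤ 0, q t = 0) (r t a : ℝ) :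
    |volterraKernel n r t * (q t * a)| ≤ |q t| * |a| := by
  rcases le_or_gt t 0 with ht | ht
  · simp [hq0 t ht]
  · rw [abs_mul, ← abs_mul (q t)]
    exact mul_le_of_le_one_left (abs_nonneg _) (abs_volterraKernel_le ht)

theorem continuous_integral_volterraKernel (n : ℕ) (hq : Integrable q) (hq0 : ∀ t ≤ 0, q t = 0)
    {f : ℝ → ℝ} (hf : Continuous f) {C : ℝ} (hC : ∀ t, |f t| ≤ C) :
    Continuous fun r => ∫ t, volterraKernel n r t * (q t * f t) := by
  refine continuous_of_dominated (bound := fun t => |q t| * C) (fun r => ?_) (fun r => ?_)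
    (hq.abs.mul_const C) ?_
  · exact (measurable_volterraKernel n r).aestronglyMeasurable.mul
      (hq.aestronglyMeasurable.mul hf.aestronglyMeasurable)
  · refine Eventually.of_forall fun t => ?_
    rw [Real.norm_eq_abs]
    exact (abs_volterraKernel_mul_le hq0 r t (f t)).trans
      (mul_le_mul_of_nonneg_left (hC t) (abs_nonneg _))
  · refine Eventually.of_forall fun t => ?_
    rcases le_or_gt t 0 with ht | ht
    · simp only [hq0 t ht, zero_mul, mul_zero]
      exact continuous_const
    · exact (continuous_volterraKernel ht).mul continuous_const

/-- The integrand is the derivative of half the exponential wherever `q` is continuous, and the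
possible exceptions `0` and `R` do not matter for the fundamental theorem of calculus. -/
theorem integral_abs_mul_exp_primitive (hq : Integrable q)
    (hqc : ContinuousOn q (({0, R} : Set ℝ)ᶜ)) {r : ℝ} (hr : 0 ≤ r) :
    ∫ t in (0 : ℝ)..r, |q t| * Real.exp (2 * ∫ s in (0 : ℝ)..t, |q s|) =
      (Real.exp (2 * ∫ s in (0 : ℝ)..r, |q s|) - 1) / 2 := by
  set Φ : ℝ → ℝ := fun t => ∫ s in (0 : ℝ)..t, |q s| with hΦ
  have hc : Continuous Φ := intervalIntegral.continuous_primitive (fun a b =>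
    hq.abs.intervalIntegrable) 0
  have h := MeasureTheory.integral_eq_of_hasDerivAt_off_countable_of_le
    (fun t => Real.exp (2 * Φ t) / 2) (fun t => |q t| * Real.exp (2 * Φ t)) hr
    (Set.toFinite ({0, R} : Set ℝ)).countable (by fun_prop) (fun t ht => ?_) ?_
  · rw [h]
    simp [hΦ]
    ring
  · have hd : HasDerivAt Φ |q t| t := intervalIntegral.integral_hasDerivAt_right
      hq.abs.intervalIntegrable hq.abs.aestronglyMeasurable.stronglyMeasurableAtFilter
      ((hqc.continuousAt ((Set.toFinite ({0, R} : Set ℝ)).isClosed.isOpen_compl.mem_nhds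
        ht.2)).abs)
    refine ((hd.const_mul 2).exp.div_const 2).congr_deriv ?_
    ring
  · exact hq.abs.intervalIntegrable.mul_continuousOn (by fun_prop)

/-- A fixed point in a weighted supremum norm. With `Φ(r)` the integral of `|q|` over `(0, r)` and
the weight `e^{-2Φ}`, the integral operator has norm at most `1/2`, because `|q| e^{2Φ}` is the
derivative of `e^{2Φ}/2`. No smallness of `q` or of the interval is required. -/
theorem exists_volterra_solution {n : ℕ} (hn : 1 ≤ n) (hq : Integrable q)
    (hq0 : ∀ t ≤ 0, q t = 0) (hqc : ContinuousOn q (({0, R} : Set ℝ)ᶜ)) :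
    ∃ w : ℝ → ℝ, Continuous w ∧ (∃ C, ∀ r, |w r| ≤ C) ∧
      ∀ r, w r = 1 + (n : ℝ)⁻¹ * ∫ t, volterraKernel n r t * (q t * w t) := by
  set Φ : ℝ → ℝ := fun t => ∫ s in (0 : ℝ)..t, |q s| with hΦ
  have hc : Continuous Φ := intervalIntegral.continuous_primitive (fun a b =>
    hq.abs.intervalIntegrable) 0
  have hb : ∀ r, |Φ r| ≤ ∫ t, |q t| := fun r => by
    refine (Real.norm_eq_abs _).symm.trans_le
      ((intervalIntegral.norm_integral_le_integral_norm_uIoc).trans ?_)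
    simp only [Real.norm_eq_abs, abs_abs]
    exact setIntegral_le_integral hq.abs (Eventually.of_forall fun t => abs_nonneg _)
  set B : ℝ := ∫ t, |q t| with hB
  have hexp : ∀ r, Real.exp (2 * Φ r) ≤ Real.exp (2 * B) := fun r =>
    Real.exp_le_exp.2 (by linarith [(abs_le.1 (hb r)).2])
  have hexp' : ∀ r, Real.exp (-(2 * Φ r)) ≤ Real.exp (2 * B) := fun r =>
    Real.exp_le_exp.2 (by linarith [(abs_le.1 (hb r)).1])
  have hn1 : (n : ℝ)⁻¹ ≤ 1 := inv_le_one_of_one_le₀ (by exact_mod_cast hn)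
  have hn0 : 0 ≤ (n : ℝ)⁻¹ := by positivity
  have hg : ∀ f : BoundedContinuousFunction ℝ ℝ,
      Continuous (fun t => Real.exp (2 * Φ t) * f t) := fun f => by fun_prop
  have hgb : ∀ f : BoundedContinuousFunction ℝ ℝ, ∀ t,
      |Real.exp (2 * Φ t) * f t| ≤ Real.exp (2 * B) * ‖f‖ := fun f t => by
    rw [abs_mul, Real.abs_exp]
    exact mul_le_mul (hexp t) (f.norm_coe_le_norm t) (abs_nonneg _) (Real.exp_pos _).le
  have hint : ∀ f : BoundedContinuousFunction ℝ ℝ, ∀ r, Integrable fun t =>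
      volterraKernel n r t * (q t * (Real.exp (2 * Φ t) * f t)) := fun f r => by
    refine Integrable.mono' (hq.abs.mul_const (Real.exp (2 * B) * ‖f‖)) ?_ ?_
    · exact (measurable_volterraKernel n r).aestronglyMeasurable.mul
        (hq.aestronglyMeasurable.mul (hg f).aestronglyMeasurable)
    · refine Eventually.of_forall fun t => ?_
      exact (abs_volterraKernel_mul_le hq0 r t _).trans
        (mul_le_mul_of_nonneg_left (hgb f t) (abs_nonneg _))
  have hI : ∀ f : BoundedContinuousFunction ℝ ℝ, ∀ r,
      |∫ t, volterraKernel n r t * (q t * (Real.exp (2 * Φ t) * f t))| ≤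
        Real.exp (2 * Φ r) / 2 * ‖f‖ := by
    intro f r
    rcases le_or_gt r 0 with hr | hr
    · have : ∀ t, volterraKernel n r t * (q t * (Real.exp (2 * Φ t) * f t)) = 0 := fun t => by
        rcases le_or_gt t 0 with ht | ht
        · simp [hq0 t ht]
        · rw [volterraKernel_of_le ht (hr.trans ht.le), zero_mul]
      simp only [this, integral_zero, abs_zero]
      positivity
    · have h1 : Integrable (fun t => |q t| * Real.exp (2 * Φ t)) :=
        (hq.abs.mul_const (Real.exp (2 * B))).mono'
          (hq.abs.aestronglyMeasurable.mul (by fun_prop : Continuous fun t =>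
            Real.exp (2 * Φ t)).aestronglyMeasurable) (Eventually.of_forall fun t => by
          rw [norm_mul, Real.norm_eq_abs, abs_abs, Real.norm_eq_abs, Real.abs_exp]
          exact mul_le_mul_of_nonneg_left (hexp t) (abs_nonneg _))
      have h2 : ∀ t, |volterraKernel n r t * (q t * (Real.exp (2 * Φ t) * f t))| ≤
          (Set.Ioc 0 r).indicator (fun t => |q t| * Real.exp (2 * Φ t)) t * ‖f‖ := by
        intro t
        by_cases ht : t ∈ Set.Ioc 0 r
        · rw [Set.indicator_of_mem ht, mul_assoc]
          refine (abs_volterraKernel_mul_le hq0 r t _).trans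
            (mul_le_mul_of_nonneg_left ?_ (abs_nonneg _))
          rw [abs_mul, Real.abs_exp]
          exact mul_le_mul_of_nonneg_left (f.norm_coe_le_norm t) (Real.exp_pos _).le
        · rw [Set.indicator_of_notMem ht, zero_mul]
          rcases le_or_gt t 0 with ht' | ht'
          · simp [hq0 t ht']
          · rw [volterraKernel_of_le ht' (not_le.1 fun h => ht ⟨ht', h⟩).le, zero_mul, abs_zero]
      calc |∫ t, volterraKernel n r t * (q t * (Real.exp (2 * Φ t) * f t))|
          ≤ ∫ t, (Set.Ioc 0 r).indicator (fun t => |q t| * Real.exp (2 * Φ t)) t * ‖f‖ :=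
            (Real.norm_eq_abs _).symm.trans_le (norm_integral_le_of_norm_le
              ((h1.indicator measurableSet_Ioc).mul_const _) (Eventually.of_forall h2))
        _ = (Real.exp (2 * Φ r) - 1) / 2 * ‖f‖ := by
            rw [integral_mul_const, integral_indicator measurableSet_Ioc,
              ← intervalIntegral.integral_of_le hr.le,
              integral_abs_mul_exp_primitive hq hqc hr.le]
        _ ≤ Real.exp (2 * Φ r) / 2 * ‖f‖ :=
            mul_le_mul_of_nonneg_right (by linarith) (norm_nonneg _)
  have hcont : ∀ f : BoundedContinuousFunction ℝ ℝ, Continuous fun r =>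
      Real.exp (-(2 * Φ r)) * (1 + (n : ℝ)⁻¹ *
        ∫ t, volterraKernel n r t * (q t * (Real.exp (2 * Φ t) * f t))) := fun f => by
    have := continuous_integral_volterraKernel n hq hq0 (hg f) (hgb f)
    fun_prop
  -- The unknown is `f = e^{-2Φ} w`, a bounded continuous function on the whole line; the factor
  -- `e^{2Φ(r)}` in the bound `hI` is cancelled by the weight in front.
  let S : BoundedContinuousFunction ℝ ℝ → BoundedContinuousFunction ℝ ℝ := fun f =>
    BoundedContinuousFunction.ofNormedAddCommGroup _ (hcont f)
      (Real.exp (2 * B) * (1 + Real.exp (2 * B) / 2 * ‖f‖)) fun r => by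
        rw [norm_mul, Real.norm_eq_abs, Real.abs_exp]
        refine mul_le_mul (hexp' r) ?_ (norm_nonneg _) (Real.exp_pos _).le
        refine (norm_add_le _ _).trans ?_
        rw [norm_one, norm_mul, Real.norm_of_nonneg hn0]
        refine add_le_add le_rfl ((mul_le_of_le_one_left (norm_nonneg _) hn1).trans
          ((hI f r).trans ?_))
        exact mul_le_mul_of_nonneg_right (by linarith [hexp r]) (norm_nonneg _)
  have hS : ContractingWith 2⁻¹ S := by
    refine ⟨inv_lt_one_of_one_lt₀ one_lt_two, ?_⟩
    refine LipschitzWith.of_dist_le_mul fun f g => ?_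
    rw [dist_eq_norm, dist_eq_norm]
    refine (BoundedContinuousFunction.norm_le (by positivity)).2 fun r => ?_
    have e : (S f - S g) r = Real.exp (-(2 * Φ r)) * ((n : ℝ)⁻¹ *
        ∫ t, volterraKernel n r t * (q t * (Real.exp (2 * Φ t) * (f - g) t))) := by
      have e1 : ∀ t, volterraKernel n r t * (q t * (Real.exp (2 * Φ t) * (f - g) t)) =
        volterraKernel n r t * (q t * (Real.exp (2 * Φ t) * f t)) -
        volterraKernel n r t * (q t * (Real.exp (2 * Φ t) * g t)) := fun t => by
          rw [BoundedContinuousFunction.sub_apply]; ring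
      simp only [e1]
      rw [integral_sub (hint f r) (hint g r), BoundedContinuousFunction.sub_apply]
      simp only [S, BoundedContinuousFunction.coe_ofNormedAddCommGroup]
      ring
    rw [e, norm_mul, norm_mul, Real.norm_eq_abs, Real.abs_exp, Real.norm_of_nonneg hn0,
      Real.norm_eq_abs]
    calc Real.exp (-(2 * Φ r)) * ((n : ℝ)⁻¹ *
        |∫ t, volterraKernel n r t * (q t * (Real.exp (2 * Φ t) * (f - g) t))|)
        ≤ Real.exp (-(2 * Φ r)) * (1 * (Real.exp (2 * Φ r) / 2 * ‖f - g‖)) := by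
          gcongr
          exact hI (f - g) r
      _ = (2⁻¹ : NNReal) * ‖f - g‖ := by
          have : Real.exp (-(2 * Φ r)) * Real.exp (2 * Φ r) = 1 := by
            rw [← Real.exp_add, neg_add_cancel, Real.exp_zero]
          push_cast
          linear_combination (‖f - g‖ / 2) * this
  set f := hS.fixedPoint with hfdef
  have hfix : S f = f := hS.fixedPoint_isFixedPt
  refine ⟨fun t => Real.exp (2 * Φ t) * f t, hg f, ⟨_, hgb f⟩, fun r => ?_⟩
  have h1 : f r = Real.exp (-(2 * Φ r)) * (1 + (n : ℝ)⁻¹ *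
      ∫ t, volterraKernel n r t * (q t * (Real.exp (2 * Φ t) * f t))) := by
    conv_lhs => rw [← hfix]
    rfl
  have : Real.exp (2 * Φ r) * Real.exp (-(2 * Φ r)) = 1 := by
    rw [← Real.exp_add, add_neg_cancel, Real.exp_zero]
  beta_reduce
  nth_rw 1 [h1]
  rw [← mul_assoc, this, one_mul]

/-- Splitting the kernel separates the dependence on `r` from the integration variable, so that the
solution can be differentiated in `r`. -/
theorem integral_volterraKernel (n : ℕ) (hq : Integrable q) (hq0 : ∀ t ≤ 0, q t = 0)
    {w : ℝ → ℝ} (hw : Continuous w) {r : ℝ} (hr : 0 < r) :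
    ∫ t, volterraKernel n r t * (q t * w t) =
      (∫ t in (0 : ℝ)..r, q t * w t) - (r ^ n)⁻¹ * ∫ t in (0 : ℝ)..r, t ^ n * (q t * w t) := by
  have hi : IntervalIntegrable (fun t => q t * w t) volume 0 r :=
    hq.intervalIntegrable.mul_continuousOn hw.continuousOn
  have hi' : IntervalIntegrable (fun t => t ^ n * (q t * w t)) volume 0 r :=
    hi.continuousOn_mul (by fun_prop)
  have e : (fun t => volterraKernel n r t * (q t * w t)) = (Set.Ioc 0 r).indicator
      (fun t => q t * w t - (r ^ n)⁻¹ * (t ^ n * (q t * w t))) := by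
    funext t
    by_cases ht : t ∈ Set.Ioc 0 r
    · rw [Set.indicator_of_mem ht, volterraKernel_of_ge ht.2, div_pow]
      ring
    · rw [Set.indicator_of_notMem ht]
      rcases le_or_gt t 0 with ht' | ht'
      · simp [hq0 t ht']
      · rw [volterraKernel_of_le ht' (not_le.1 fun h => ht ⟨ht', h⟩).le, zero_mul]
  rw [e, integral_indicator measurableSet_Ioc, ← intervalIntegral.integral_of_le hr.le,
    intervalIntegral.integral_sub hi (hi'.const_mul _), intervalIntegral.integral_const_mul]

end Volterra

/-! ### The regular solution of the radial equation and its normalisation. -/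

section RadialSolution

variable {v : ℝ → ℝ} {R : ℝ} {ℓ : ℕ} {z : ℝ}

theorem contDiffOn_one_Ioc {f f' : ℝ → ℂ} (hf : ∀ r ∈ Set.Ioo 0 R, HasDerivAt f (f' r) r)
    (hR : HasDerivWithinAt f (f' R) (Set.Iic R) R) (hc : ContinuousOn f' (Set.Ioc 0 R)) :
    ContDiffOn ℝ 1 f (Set.Ioc 0 R) := by
  have h : ∀ r ∈ Set.Ioc 0 R, HasDerivWithinAt f (f' r) (Set.Ioc 0 R) r := by
    intro r hr
    rcases eq_or_lt_of_le hr.2 with rfl | h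
    · exact hR.mono fun x hx => hx.2
    · exact (hf r ⟨hr.1, h⟩).hasDerivWithinAt
  rw [show (1 : WithTop ℕ∞) = 0 + 1 from rfl, contDiffOn_succ_iff_derivWithin (uniqueDiffOn_Ioc 0 R)]
  refine ⟨fun r hr => (h r hr).differentiableWithinAt, by simp, contDiffOn_zero.2 ?_⟩
  exact hc.congr fun r hr => (h r hr).derivWithin (uniqueDiffOn_Ioc 0 R r hr)

/-- With `χ = r^ℓ w` the equation becomes `(r^{2ℓ+2} w')' = r^{2ℓ+2} (v - z) w`. Integrating twice
with `w(0) = 1` and exchanging the integrations gives the Volterra equation with `n = 2ℓ + 1` and `q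
= t (v(t) - z)`; this is why integrability of `t v(t)` suffices. Non-triviality comes from `w(0) =
1`. -/
theorem exists_isRegularRadialSolution (hR : 0 < R) (hv : ContinuousOn v (Set.Ioo 0 R))
    (hint : IntegrableOn (fun t => t * v t) (Set.Ioo 0 R)) (ℓ : ℕ) (z : ℝ) :
    ∃ χ, IsRegularRadialSolution v R ℓ z χ := by
  set q : ℝ → ℝ := (Set.Ioo 0 R).indicator fun t => t * (v t - z) with hqdef
  set n : ℕ := 2 * ℓ + 1 with hn
  have hq : Integrable q := by
    rw [hqdef, integrable_indicator_iff measurableSet_Ioo]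
    have h2 : IntegrableOn (fun t : ℝ => t * z) (Set.Ioo 0 R) :=
      ((by fun_prop : Continuous fun t : ℝ => t * z).integrableOn_Icc (a := 0) (b := R)).mono_set
        Set.Ioo_subset_Icc_self
    refine (hint.sub h2).congr (Eventually.of_forall fun t => ?_)
    simp only [Pi.sub_apply]
    ring
  have hq0 : ∀ t ≤ 0, q t = 0 := fun t ht =>
    Set.indicator_of_notMem (fun h => absurd h.1 (not_lt.2 ht)) _
  have hqin : ∀ t ∈ Set.Ioo 0 R, q t = t * (v t - z) := fun t ht => Set.indicator_of_mem ht _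
  have hqca : ∀ r ∈ Set.Ioo 0 R, ContinuousAt q r := fun r hr => by
    have h1 : ContinuousAt (fun t => t * (v t - z)) r :=
      continuousAt_id.mul ((hv.continuousAt (isOpen_Ioo.mem_nhds hr)).sub continuousAt_const)
    refine h1.congr ?_
    filter_upwards [isOpen_Ioo.mem_nhds hr] with t ht using (hqin t ht).symm
  have hqc : ContinuousOn q (({0, R} : Set ℝ)ᶜ) := by
    refine continuousOn_of_forall_continuousAt fun r hr => ?_
    by_cases h : r ∈ Set.Ioo 0 R
    · exact hqca r h
    · have h1 : r ∈ (Set.Icc 0 R)ᶜ := fun h' => by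
        simp only [Set.mem_compl_iff, Set.mem_insert_iff, Set.mem_singleton_iff, not_or] at hr
        exact h ⟨lt_of_le_of_ne h'.1 (Ne.symm hr.1), lt_of_le_of_ne h'.2 hr.2⟩
      refine (continuousAt_const (y := (0 : ℝ))).congr ?_
      filter_upwards [isClosed_Icc.isOpen_compl.mem_nhds h1] with t ht
      exact (Set.indicator_of_notMem (fun h => ht (Set.Ioo_subset_Icc_self h)) _).symm
  obtain ⟨w, hw, ⟨C, hC⟩, hweq⟩ := exists_volterra_solution (n := n) (by omega) hq hq0 hqc
  set J : ℝ → ℝ := fun r => ∫ t in (0 : ℝ)..r, t ^ n * (q t * w t) with hJ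
  have hii : ∀ a b : ℝ, IntervalIntegrable (fun t => q t * w t) volume a b := fun a b =>
    hq.intervalIntegrable.mul_continuousOn hw.continuousOn
  have hii' : ∀ a b : ℝ, IntervalIntegrable (fun t => t ^ n * (q t * w t)) volume a b :=
    fun a b => (hii a b).continuousOn_mul (by fun_prop)
  have hm : AEStronglyMeasurable (fun t => q t * w t) := hq.aestronglyMeasurable.mul
    hw.aestronglyMeasurable
  have hJc : Continuous J := intervalIntegral.continuous_primitive hii' 0
  have hI' : ∀ r ∈ Set.Ioo 0 R,
      HasDerivAt (fun r => ∫ t in (0 : ℝ)..r, q t * w t) (q r * w r) r := fun r hr =>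
    intervalIntegral.integral_hasDerivAt_right (hii 0 r) hm.stronglyMeasurableAtFilter
      ((hqca r hr).mul hw.continuousAt)
  have hJ' : ∀ r ∈ Set.Ioo 0 R, HasDerivAt J (r ^ n * (q r * w r)) r := fun r hr =>
    intervalIntegral.integral_hasDerivAt_right (hii' 0 r)
      (((by fun_prop : Continuous fun t : ℝ => t ^ n).aestronglyMeasurable.mul
        hm).stronglyMeasurableAtFilter)
      (((by fun_prop : Continuous fun t : ℝ => t ^ n).continuousAt).mul
        ((hqca r hr).mul hw.continuousAt))
  -- The contributions `q w` from differentiating the two upper limits cancel, and only the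
  -- derivative of `r^{-n}` remains.
  have hw' : ∀ r ∈ Set.Ioo 0 R, HasDerivAt w ((r ^ (n + 1))⁻¹ * J r) r := by
    intro r hr
    have hr0 : r ≠ 0 := hr.1.ne'
    have h1 := (((hI' r hr).sub (((hasDerivAt_id r).pow n).inv (pow_ne_zero n hr0) |>.mul
      (hJ' r hr))).const_mul ((n : ℝ)⁻¹)).const_add 1
    refine (h1.congr_of_eventuallyEq ?_).congr_deriv ?_
    · filter_upwards [isOpen_Ioo.mem_nhds hr] with s hs
      rw [hweq s, integral_volterraKernel n hq hq0 hw hs.1]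
      rfl
    · simp only [Pi.inv_apply, Pi.pow_apply, id, hn]
      push_cast
      field_simp
      ring
  set u : ℝ → ℝ := fun r => r ^ ℓ * w r with hu
  set u' : ℝ → ℝ := fun r => ℓ / r * u r + (r ^ (ℓ + 2))⁻¹ * J r with hu'
  have huc : Continuous u := by fun_prop
  have hu'c : ContinuousOn u' (Set.Ioi 0) := by
    have h0 : ∀ x ∈ Set.Ioi (0 : ℝ), x ≠ 0 := fun x hx => ne_of_gt hx
    refine ContinuousOn.add (ContinuousOn.mul (continuousOn_const.div continuousOn_id h0)
      huc.continuousOn) (ContinuousOn.mul (ContinuousOn.inv₀ (by fun_prop) fun x hx =>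
      pow_ne_zero _ (h0 x hx)) hJc.continuousOn)
  have hud : ∀ r ∈ Set.Ioo 0 R, HasDerivAt u (u' r) r := by
    intro r hr
    have hr0 : r ≠ 0 := hr.1.ne'
    refine (((hasDerivAt_id r).pow ℓ).mul (hw' r hr)).congr_deriv ?_
    simp only [Pi.pow_apply, id, hu', hu, hn]
    rcases ℓ with _ | k
    · simp
    · simp only [Nat.add_sub_cancel]
      field_simp
      ring
  have hudd : ∀ r ∈ Set.Ioo 0 R,
      HasDerivAt u' (-(2 / r * u' r) + ℓ * (ℓ + 1) / r ^ 2 * u r + (v r - z) * u r) r := by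
    intro r hr
    have hr0 : r ≠ 0 := hr.1.ne'
    have h1 := (((hasDerivAt_const r (ℓ : ℝ)).div (hasDerivAt_id r) hr0).mul (hud r hr)).add
      ((((hasDerivAt_id r).pow (ℓ + 2)).inv (pow_ne_zero _ hr0)).mul (hJ' r hr))
    refine HasDerivAt.congr_deriv (f := u') h1 ?_
    simp only [Pi.pow_apply, Pi.inv_apply, Pi.div_apply, id, hu', hqin r hr, hu, hn,
      show ℓ + 2 - 1 = ℓ + 1 from rfl]
    push_cast
    field_simp
    ring
  have hder : ∀ r ∈ Set.Ioo 0 R, HasDerivAt (fun r => (u r : ℂ)) (u' r : ℂ) r := fun r hr =>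
    (hud r hr).ofReal_comp
  have hderiv : ∀ r ∈ Set.Ioo 0 R, deriv (fun r => (u r : ℂ)) r = (u' r : ℂ) := fun r hr =>
    (hder r hr).deriv
  have hdd : ∀ r ∈ Set.Ioo 0 R, HasDerivAt (deriv fun r => (u r : ℂ))
      ((-(2 / r * u' r) + ℓ * (ℓ + 1) / r ^ 2 * u r + (v r - z) * u r : ℝ) : ℂ) r := fun r hr => by
    refine (hudd r hr).ofReal_comp.congr_of_eventuallyEq ?_
    filter_upwards [isOpen_Ioo.mem_nhds hr] with s hs using hderiv s hs
  have hcc : ContinuousOn (fun r => (u' r : ℂ)) (Set.Ioi 0) :=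
    Complex.continuous_ofReal.comp_continuousOn hu'c
  refine ⟨fun r => (u r : ℂ), ?_, fun r hr => (hdd r hr).differentiableAt, fun r hr => ?_, ?_, ?_⟩
  · refine contDiffOn_one_Ioc hder ?_ (hcc.mono fun x hx => hx.1)
    -- At `r = R` no regularity of the potential is known; the left derivative exists because `u` is
    -- continuous there and its derivative has a limit.
    refine hasDerivWithinAt_Iic_of_tendsto_deriv (s := Set.Ioo 0 R)
      (fun r hr => (hder r hr).differentiableAt.differentiableWithinAt)
      (Complex.continuous_ofReal.comp huc).continuousWithinAt (Ioo_mem_nhdsLT hR) ?_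
    refine Tendsto.congr' (f₁ := fun r => (u' r : ℂ)) ?_ ?_
    · filter_upwards [Ioo_mem_nhdsLT hR] with s hs using (hderiv s hs).symm
    · exact ((hcc.continuousAt (Ioi_mem_nhds hR)).tendsto).mono_left nhdsWithin_le_nhds
  · have hr0 : (r : ℂ) ≠ 0 := Complex.ofReal_ne_zero.2 hr.1.ne'
    rw [(hdd r hr).deriv, hderiv r hr]
    push_cast
    ring
  · refine ⟨R ^ ℓ * C, fun r hr => ?_⟩
    rw [Complex.norm_real, hu, Real.norm_eq_abs, abs_mul, abs_pow, abs_of_pos hr.1]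
    exact mul_le_mul (pow_le_pow_left₀ hr.1.le hr.2 _) (hC r) (abs_nonneg _) (by positivity)
  · have hw0 : w 0 = 1 := by
      rw [hweq 0]
      have : ∀ t, volterraKernel n 0 t * (q t * w t) = 0 := fun t => by
        rcases le_or_gt t 0 with ht | ht
        · simp [hq0 t ht]
        · rw [volterraKernel_of_le ht ht.le, zero_mul]
      simp [this]
    have h1 : ∀ᶠ r in 𝓝[>] (0 : ℝ), 0 < w r :=
      (hw.tendsto 0).mono_left nhdsWithin_le_nhds |>.eventually
        (lt_mem_nhds (by rw [hw0]; exact one_pos))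
    obtain ⟨r, hr, hrw⟩ := (Filter.Eventually.and (Ioc_mem_nhdsGT hR : Set.Ioc 0 R ∈ 𝓝[>] (0:ℝ)) h1).exists
    exact ⟨r, hr, Complex.ofReal_ne_zero.2 (mul_pos (pow_pos hr.1 ℓ) hrw).ne'⟩

theorem IsRegularRadialSolution.const_mul {χ : ℝ → ℂ} (h : IsRegularRadialSolution v R ℓ z χ)
    {c : ℂ} (hc : c ≠ 0) : IsRegularRadialSolution v R ℓ z (fun r => c * χ r) := by
  have hd : deriv (fun r => c * χ r) = fun r => c * deriv χ r := by
    funext r; exact deriv_const_mul_field c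
  refine ⟨contDiffOn_const.mul h.contDiffOn, fun r hr => ?_, fun r hr => ?_, ?_, ?_⟩
  · rw [hd]
    exact (h.differentiableAt_deriv r hr).const_mul c
  · rw [hd, deriv_const_mul_field]
    linear_combination c * h.equation r hr
  · obtain ⟨C, hC⟩ := h.bounded
    refine ⟨‖c‖ * C, fun r hr => ?_⟩
    rw [norm_mul]
    exact mul_le_mul_of_nonneg_left (hC r hr) (norm_nonneg _)
  · obtain ⟨r, hr, h0⟩ := h.nontrivial
    exact ⟨r, hr, mul_ne_zero hc h0⟩

theorem energyRoot_mul_ne_zero (hz : z < 0) (hR : 0 < R) : energyRoot z * (R : ℂ) ≠ 0 :=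
  I_mul_ne_zero (sqrt_abs_pos hz) hR.ne'

theorem energyRoot_ne_zero (hz : z < 0) : energyRoot z ≠ 0 :=
  mul_ne_zero Complex.I_ne_zero (Complex.ofReal_ne_zero.2 (sqrt_abs_pos hz).ne')

theorem isRegularRadialSolution_regularSolution (hR : 0 < R) (hv : ContinuousOn v (Set.Ioo 0 R))
    (hint : IntegrableOn (fun t => t * v t) (Set.Ioo 0 R)) (ℓ : ℕ) (z : ℝ) :
    IsRegularRadialSolution v R ℓ z (regularSolution v R ℓ z) :=
  Classical.epsilon_spec (exists_isRegularRadialSolution hR hv hint ℓ z)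

/-- If the denominator of the `t`-matrix does not vanish, the normalised solution exists. -/
theorem isNormalizedRadialSolution_normalizedSolution (hz : z < 0) (hR : 0 < R)
    (hv : ContinuousOn v (Set.Ioo 0 R)) (hint : IntegrableOn (fun t => t * v t) (Set.Ioo 0 R))
    (hden : tDenominator v R ℓ z ≠ 0) :
    IsNormalizedRadialSolution v R ℓ z (normalizedSolution v R ℓ z) := by
  refine Classical.epsilon_spec (p := IsNormalizedRadialSolution v R ℓ z) ?_
  have hreg := isRegularRadialSolution_regularSolution hR hv hint ℓ z
  have he := energyRoot_ne_zero hz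
  have hwr := wronskian_ne_zero ℓ (energyRoot_mul_ne_zero hz hR)
  set X := regularSolution v R ℓ z R with hX
  set X' := leftDeriv (regularSolution v R ℓ z) R with hX'
  set e := energyRoot z with hedef
  set W := sphericalBessel ℓ (e * R) * deriv (sphericalHankel ℓ) (e * R)
      - deriv (sphericalBessel ℓ) (e * R) * sphericalHankel ℓ (e * R) with hW
  -- By Cramer's rule the coefficient of `j_ℓ` in the continuation of the unnormalised solution is
  -- the denominator of the `t`-matrix divided by `-√z` times the Wronskian; the factor is its
  -- reciprocal.
  refine ⟨fun r => (-(e * W) / tDenominator v R ℓ z) * regularSolution v R ℓ z r,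
    hreg.const_mul (div_ne_zero (neg_ne_zero.2 (mul_ne_zero he hwr)) hden), ?_, ?_⟩
  · rw [tMatrix]
    field_simp
    rw [tNumerator, tDenominator, ← hX, ← hX', ← hedef, hW]
    ring
  · have hl : leftDeriv (fun r => (-(e * W) / tDenominator v R ℓ z) * regularSolution v R ℓ z r) R =
        (-(e * W) / tDenominator v R ℓ z) * X' := derivWithin_const_mul_field _
    rw [hl, tMatrix]
    field_simp
    rw [tNumerator, tDenominator, ← hX, ← hX', ← hedef, hW]
    ring

/-- The derivative of a bounded solution is `O(1/r)`. -/
theorem IsRegularRadialSolution.exists_norm_deriv_le {χ : ℝ → ℂ}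
    (h : IsRegularRadialSolution v R ℓ z χ) (hv : ContinuousOn v (Set.Ioo 0 R))
    (hint : IntegrableOn (fun t => t * v t) (Set.Ioo 0 R)) :
    ∃ C, ∀ r ∈ Set.Ioo 0 R, ‖deriv χ r‖ ≤ C / r := by
  obtain ⟨C, hC⟩ := h.bounded
  have hdiff : ∀ r ∈ Set.Ioo 0 R, HasDerivAt χ (deriv χ r) r := fun r hr =>
    ((h.contDiffOn.differentiableOn (by norm_num) r ⟨hr.1, hr.2.le⟩).differentiableAt
      (Ioc_mem_nhds hr.1 hr.2)).hasDerivAt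
  set B : ℝ := ∫ t in Set.Ioo 0 R, |t * v t| with hB
  set K : ℝ := C * (ℓ * (ℓ + 1) + R ^ 2 * |z| + B) with hK
  -- The radial equation in divergence form. Its right-hand side is integrable because `r v(r)` is.
  have hsq : ∀ r ∈ Set.Ioo 0 R, HasDerivAt (fun r : ℝ => (r : ℂ) ^ 2 * deriv χ r)
      (((ℓ * (ℓ + 1) : ℝ) + (r : ℂ) ^ 2 * (v r - z)) * χ r) r := by
    intro r hr
    have hr0 : (r : ℂ) ≠ 0 := Complex.ofReal_ne_zero.2 hr.1.ne'
    have hd : HasDerivAt (fun s : ℝ => (s : ℂ)) 1 r := Complex.ofRealCLM.hasDerivAt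
    refine ((hd.pow 2).mul (h.differentiableAt_deriv r hr).hasDerivAt).congr_deriv ?_
    have := h.equation r hr
    simp only [Pi.pow_apply]
    field_simp at this
    push_cast
    linear_combination this
  -- Integration shows that `s² χ'(s)` stays within `K r` of its value at `r` for all `s ≤ r`; one
  -- factor `t ≤ r` is split off from `t² v(t)`.
  have hosc : ∀ r ∈ Set.Ioo 0 R, ∀ s ∈ Set.Ioc 0 r,
      ‖(r : ℂ) ^ 2 * deriv χ r - (s : ℂ) ^ 2 * deriv χ s‖ ≤ K * r := by
    intro r hr s hs
    have hsub : Set.Icc s r ⊆ Set.Ioo 0 R := fun t ht =>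
      ⟨hs.1.trans_le ht.1, ht.2.trans_lt hr.2⟩
    have hCn : 0 ≤ C := (norm_nonneg _).trans (hC r ⟨hr.1, hr.2.le⟩)
    have hcont : ContinuousOn (fun t : ℝ => (((ℓ * (ℓ + 1) : ℝ) + (t : ℂ) ^ 2 * (v t - z)) * χ t))
        (Set.Icc s r) := by
      refine ContinuousOn.mul (continuousOn_const.add (ContinuousOn.mul (by fun_prop)
        ((Complex.continuous_ofReal.comp_continuousOn (hv.mono hsub)).sub continuousOn_const)))
        fun t ht => (hdiff t (hsub ht)).continuousAt.continuousWithinAt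
    rw [← intervalIntegral.integral_eq_sub_of_hasDerivAt (a := s) (b := r)
      (f := fun r : ℝ => (r : ℂ) ^ 2 * deriv χ r)
      (fun t ht => hsq t (hsub (by rwa [Set.uIcc_of_le hs.2] at ht)))
      (hcont.mono (by rw [Set.uIcc_of_le hs.2])).intervalIntegrable,
      intervalIntegral.integral_of_le hs.2]
    have hioc : Set.Ioc s r ⊆ Set.Ioo 0 R := Set.Ioc_subset_Icc_self.trans hsub
    have hb : ∀ t ∈ Set.Ioc s r, ‖(((ℓ * (ℓ + 1) : ℝ) + (t : ℂ) ^ 2 * (v t - z)) * χ t)‖ ≤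
        C * (ℓ * (ℓ + 1) + R ^ 2 * |z|) + C * r * |t * v t| := by
      intro t ht
      have ht0 := hioc ht
      rw [norm_mul, mul_comm]
      have e1 : ((ℓ * (ℓ + 1) : ℝ) : ℂ) + (t : ℂ) ^ 2 * (v t - z) =
          ((ℓ * (ℓ + 1) + t * (t * v t) - t ^ 2 * z : ℝ) : ℂ) := by push_cast; ring
      rw [e1, Complex.norm_real, Real.norm_eq_abs]
      have h1 : |(ℓ : ℝ) * (ℓ + 1) + t * (t * v t) - t ^ 2 * z| ≤
          ℓ * (ℓ + 1) + r * |t * v t| + R ^ 2 * |z| := by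
        refine (abs_sub _ _).trans (add_le_add ((abs_add_le _ _).trans (add_le_add ?_ ?_)) ?_)
        · rw [abs_of_nonneg (by positivity)]
        · rw [abs_mul, abs_of_pos ht0.1]
          exact mul_le_mul_of_nonneg_right ht.2 (abs_nonneg _)
        · rw [abs_mul, abs_pow, abs_of_pos ht0.1]
          exact mul_le_mul_of_nonneg_right (pow_le_pow_left₀ ht0.1.le ht0.2.le 2) (abs_nonneg _)
      calc ‖χ t‖ * |(ℓ : ℝ) * (ℓ + 1) + t * (t * v t) - t ^ 2 * z|
          ≤ C * (ℓ * (ℓ + 1) + r * |t * v t| + R ^ 2 * |z|) :=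
            mul_le_mul (hC t ⟨ht0.1, ht0.2.le⟩) h1 (abs_nonneg _) hCn
        _ = _ := by ring
    have hia : IntegrableOn (fun t => |t * v t|) (Set.Ioc s r) := (hint.mono_set hioc).abs
    have hic : IntegrableOn (fun _ : ℝ => C * (ℓ * (ℓ + 1) + R ^ 2 * |z|)) (Set.Ioc s r) :=
      integrableOn_const (by simp)
    refine (norm_integral_le_of_norm_le (hic.add (hia.const_mul (C * r)))
      ((ae_restrict_iff' measurableSet_Ioc).2 (Eventually.of_forall hb))).trans ?_
    rw [integral_add' hic (hia.const_mul (C * r)), integral_const_mul (C * r), setIntegral_const,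
      Measure.real, Real.volume_Ioc, ENNReal.toReal_ofReal (by linarith [hs.2]), smul_eq_mul]
    have h2 : ∫ t in Set.Ioc s r, |t * v t| ≤ B :=
      setIntegral_mono_set hint.abs (Eventually.of_forall fun t => abs_nonneg _)
        hioc.eventuallyLE
    calc (r - s) * (C * (ℓ * (ℓ + 1) + R ^ 2 * |z|)) + C * r * ∫ t in Set.Ioc s r, |t * v t|
        ≤ r * (C * (ℓ * (ℓ + 1) + R ^ 2 * |z|)) + C * r * B := by
          refine add_le_add (mul_le_mul_of_nonneg_right (by linarith [hs.1]) (by positivity))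
            (mul_le_mul_of_nonneg_left h2 (mul_nonneg hCn hr.1.le))
      _ = K * r := by rw [hK]; ring
  refine ⟨2 * K + 2 * C, fun r hr => ?_⟩
  rw [le_div_iff₀ hr.1]
  have hr0 : (r : ℂ) ≠ 0 := Complex.ofReal_ne_zero.2 hr.1.ne'
  -- Since `s² χ'(s)` is nearly constant on `[r/2, r]`, adding `r² χ'(r)/s` to `χ(s)` removes the
  -- main part of its slope. The mean value inequality then leaves `r χ'(r)` within `2K` of `χ(r) -
  -- χ(r/2)`, which is bounded.
  have hmv := (convex_Icc (r / 2) r).norm_image_sub_le_of_norm_hasDerivWithin_le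
    (f := fun s : ℝ => χ s + (r : ℂ) ^ 2 * deriv χ r * (s : ℂ)⁻¹)
    (f' := fun s : ℝ => deriv χ s + (r : ℂ) ^ 2 * deriv χ r * (-1 / (s : ℂ) ^ 2)) (C := 4 * K / r)
    (fun s hs => by
      have hs0 : 0 < s := (half_pos hr.1).trans_le hs.1
      have hd : HasDerivAt (fun s : ℝ => (s : ℂ)) 1 s := Complex.ofRealCLM.hasDerivAt
      exact ((hdiff s ⟨hs0, hs.2.trans_lt hr.2⟩).add
        ((hd.inv (Complex.ofReal_ne_zero.2 hs0.ne')).const_mul _)).hasDerivWithinAt)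
    (fun s hs => by
      have hs0 : 0 < s := (half_pos hr.1).trans_le hs.1
      have hs0' : (s : ℂ) ≠ 0 := Complex.ofReal_ne_zero.2 hs0.ne'
      have e1 : deriv χ s + (r : ℂ) ^ 2 * deriv χ r * (-1 / (s : ℂ) ^ 2) =
          -((r : ℂ) ^ 2 * deriv χ r - (s : ℂ) ^ 2 * deriv χ s) / (s : ℂ) ^ 2 := by
        field_simp
        ring
      have hKr := hosc r hr s ⟨hs0, hs.2⟩
      rw [e1, norm_div, norm_neg, norm_pow, Complex.norm_of_nonneg hs0.le]
      have hs2 : r ^ 2 / 4 ≤ s ^ 2 := by nlinarith [hs.1, hr.1]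
      calc ‖(r : ℂ) ^ 2 * deriv χ r - (s : ℂ) ^ 2 * deriv χ s‖ / s ^ 2
          ≤ K * r / (r ^ 2 / 4) := by
            have := hr.1
            exact div_le_div₀ ((norm_nonneg _).trans hKr) hKr (by positivity) hs2
        _ = 4 * K / r := by
            have := hr.1.ne'
            field_simp)
    (Set.left_mem_Icc.2 (by linarith [hr.1])) (Set.right_mem_Icc.2 (by linarith [hr.1]))
  have hr1 := hr.1
  have e2 : χ r + (r : ℂ) ^ 2 * deriv χ r * (r : ℂ)⁻¹ -
      (χ (r / 2) + (r : ℂ) ^ 2 * deriv χ r * ((r / 2 : ℝ) : ℂ)⁻¹) =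
      (χ r - χ (r / 2)) - r * deriv χ r := by
    push_cast
    field_simp
    ring
  have e3 : 4 * K / r * ‖r - r / 2‖ = 2 * K := by
    rw [Real.norm_of_nonneg (by linarith)]
    field_simp
    ring
  rw [e2, e3] at hmv
  have h1 := hC r ⟨hr.1, hr.2.le⟩
  have h2 := hC (r / 2) ⟨half_pos hr.1, by linarith [hr.2]⟩
  have h3 : ‖(r : ℂ) * deriv χ r‖ ≤ ‖χ r - χ (r / 2)‖ + ‖χ r - χ (r / 2) - r * deriv χ r‖ := by
    have := norm_sub_le (χ r - χ (r / 2)) (χ r - χ (r / 2) - r * deriv χ r)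
    rwa [sub_sub_cancel] at this
  have h4 := norm_sub_le (χ r) (χ (r / 2))
  rw [norm_mul, Complex.norm_of_nonneg hr.1.le, mul_comm] at h3
  linarith

end RadialSolution

/-! ### Products of a radial function and a spherical harmonic. -/

section RadialWave

variable {ℓ : ℕ} {m : ℤ}

/-- `χ(|x|) Y_{ℓm}(x/|x|)`. -/
def radialWave (χ : ℝ → ℂ) (ℓ : ℕ) (m : ℤ) (x : E3) : ℂ :=
  χ ‖x‖ * (sphericalHarmonic ℓ m (direction x) : ℂ)

theorem hankelWave_eq_radialWave (ℓ : ℕ) (m : ℤ) (z : ℝ) : hankelWave ℓ m z =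
    radialWave (fun r => sphericalHankel ℓ (energyRoot z * r)) ℓ m := rfl

theorem norm_direction_le (x : E3) : ‖direction x‖ ≤ 1 := by
  by_cases hx : x = 0
  · simp [hx, direction]
  · rw [norm_direction hx]

theorem contDiffOn_direction : ContDiffOn ℝ ∞ direction {0}ᶜ := by
  intro x hx
  have h : ContDiffAt ℝ ∞ (fun x : E3 => ‖x‖) x := contDiffAt_norm ℝ hx
  exact ((h.inv (norm_ne_zero_iff.2 hx)).smul contDiffAt_id).contDiffWithinAt

theorem direction_smul {r : ℝ} (hr : 0 < r) (x : E3) : direction (r • x) = direction x := by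
  rw [direction, direction, norm_smul, Real.norm_of_nonneg hr.le, smul_smul, mul_inv,
    mul_comm r⁻¹, mul_assoc, inv_mul_cancel₀ hr.ne', mul_one]

theorem contDiff_sphericalHarmonic (ℓ : ℕ) (m : ℤ) :
    ContDiff ℝ ∞ fun x : E3 => (sphericalHarmonic ℓ m x : ℂ) := by
  simp only [← evalAt_polyY]
  exact contDiff_evalAt _

theorem continuous_sphericalHarmonic_sph (ℓ : ℕ) (m : ℤ) :
    Continuous fun θ : Sph => (sphericalHarmonic ℓ m θ : ℂ) :=
  (contDiff_sphericalHarmonic ℓ m).continuous.comp continuous_subtype_val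

theorem contDiffOn_angular (ℓ : ℕ) (m : ℤ) :
    ContDiffOn ℝ ∞ (fun x : E3 => (sphericalHarmonic ℓ m (direction x) : ℂ)) {0}ᶜ :=
  (contDiff_sphericalHarmonic ℓ m).comp_contDiffOn contDiffOn_direction

theorem hasFDerivAt_angular {x : E3} (hx : x ≠ 0) :
    HasFDerivAt (fun x : E3 => (sphericalHarmonic ℓ m (direction x) : ℂ))
      (fderiv ℝ (fun x : E3 => (sphericalHarmonic ℓ m (direction x) : ℂ)) x) x :=
  (((contDiffOn_angular ℓ m).contDiffAt (isOpen_compl_singleton.mem_nhds hx)).differentiableAt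
    (by norm_num)).hasFDerivAt

/-- The angular factor is homogeneous of degree zero, so its gradient is homogeneous of degree `-1`,
and both bounds reduce to compactness of the unit ball and the unit sphere. -/
theorem exists_angular_bound (ℓ : ℕ) (m : ℤ) : ∃ C, 0 ≤ C ∧ ∀ x : E3,
    ‖(sphericalHarmonic ℓ m (direction x) : ℂ)‖ ≤ C ∧ (x ≠ 0 →
    ‖fderiv ℝ (fun x : E3 => (sphericalHarmonic ℓ m (direction x) : ℂ)) x‖ ≤ C / ‖x‖) := by
  obtain ⟨C₁, hC₁⟩ := (isCompact_closedBall (0 : E3) 1).exists_bound_of_continuousOn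
    (contDiff_sphericalHarmonic ℓ m).continuous.continuousOn
  have hcont : ContinuousOn
      (fderiv ℝ (fun x : E3 => (sphericalHarmonic ℓ m (direction x) : ℂ))) {0}ᶜ :=
    (contDiffOn_angular ℓ m).continuousOn_fderiv_of_isOpen isOpen_compl_singleton (by norm_num)
  obtain ⟨C₂, hC₂⟩ := (isCompact_sphere (0 : E3) 1).exists_bound_of_continuousOn
    (hcont.mono fun x hx h0 => by
      rw [Set.mem_singleton_iff] at h0
      rw [h0] at hx
      simp at hx)
  have hC₁0 : 0 ≤ C₁ := (norm_nonneg _).trans (hC₁ 0 (by simp))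
  refine ⟨max C₁ C₂, hC₁0.trans (le_max_left _ _), fun x => ⟨?_, fun hx => ?_⟩⟩
  · exact (hC₁ _ (mem_closedBall_zero_iff.2 (norm_direction_le x))).trans (le_max_left _ _)
  · have hr : 0 < ‖x‖ := norm_pos_iff.2 hx
    have hd0 : direction x ≠ 0 := by
      rw [← norm_pos_iff, norm_direction hx]; exact one_pos
    have h1 : (fun y : E3 => (sphericalHarmonic ℓ m (direction (‖x‖⁻¹ • y)) : ℂ)) =
        fun y : E3 => (sphericalHarmonic ℓ m (direction y) : ℂ) := by
      funext y; rw [direction_smul (inv_pos.2 hr)]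
    have h2 : HasFDerivAt (fun y : E3 => (sphericalHarmonic ℓ m (direction (‖x‖⁻¹ • y)) : ℂ))
        ((fderiv ℝ (fun x : E3 => (sphericalHarmonic ℓ m (direction x) : ℂ)) (direction x)).comp
          (‖x‖⁻¹ • ContinuousLinearMap.id ℝ E3)) x :=
      HasFDerivAt.comp x (f := fun y : E3 => ‖x‖⁻¹ • y) (hasFDerivAt_angular hd0)
        ((hasFDerivAt_id (𝕜 := ℝ) x).const_smul (‖x‖⁻¹ : ℝ) :)
    rw [h1] at h2
    rw [h2.fderiv, ContinuousLinearMap.comp_smul, ContinuousLinearMap.comp_id, norm_smul, norm_inv,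
      norm_norm, div_eq_inv_mul]
    exact mul_le_mul_of_nonneg_left ((hC₂ _ (by rw [mem_sphere_zero_iff_norm,
      norm_direction hx])).trans (le_max_right _ _)) (by positivity)

theorem hasFDerivAt_radialWave {χ : ℝ → ℂ} {χ' : ℂ} {x : E3} (hx : x ≠ 0)
    (hχ : HasDerivAt χ χ' ‖x‖) :
    HasFDerivAt (radialWave χ ℓ m)
      (χ ‖x‖ • fderiv ℝ (fun x : E3 => (sphericalHarmonic ℓ m (direction x) : ℂ)) x +
        (sphericalHarmonic ℓ m (direction x) : ℂ) • (‖x‖⁻¹ • innerSL ℝ x).smulRight χ') x := by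
  have h1 : HasFDerivAt (fun x : E3 => χ ‖x‖) ((‖x‖⁻¹ • innerSL ℝ x).smulRight χ') x := by
    refine (hχ.hasFDerivAt.comp x (hasFDerivAt_norm hx)).congr_fderiv ?_
    ext v
    simp [mul_assoc]
  exact h1.mul (hasFDerivAt_angular hx)

theorem exists_norm_fderiv_radialWave_le (ℓ : ℕ) (m : ℤ) : ∃ C, 0 ≤ C ∧ ∀ (χ : ℝ → ℂ) (x : E3),
    ‖radialWave χ ℓ m x‖ ≤ C * ‖χ ‖x‖‖ ∧ ∀ χ' : ℂ, x ≠ 0 → HasDerivAt χ χ' ‖x‖ →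
    ‖fderiv ℝ (radialWave χ ℓ m) x‖ ≤ C * (‖χ ‖x‖‖ / ‖x‖ + ‖χ'‖) := by
  obtain ⟨C, hC0, hC⟩ := exists_angular_bound ℓ m
  refine ⟨C, hC0, fun χ x => ⟨?_, fun χ' hx hχ => ?_⟩⟩
  · rw [radialWave, norm_mul, mul_comm]
    exact mul_le_mul_of_nonneg_right (hC x).1 (norm_nonneg _)
  · rw [(hasFDerivAt_radialWave hx hχ).fderiv]
    refine (norm_add_le _ _).trans ?_
    rw [norm_smul, norm_smul, mul_add]
    have hr : 0 < ‖x‖ := norm_pos_iff.2 hx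
    refine add_le_add ?_ ?_
    · calc ‖χ ‖x‖‖ * _ ≤ ‖χ ‖x‖‖ * (C / ‖x‖) :=
          mul_le_mul_of_nonneg_left ((hC x).2 hx) (norm_nonneg _)
        _ = _ := by ring
    · refine mul_le_mul (hC x).1 ?_ (norm_nonneg _) hC0
      rw [ContinuousLinearMap.norm_smulRight_apply, norm_smul, innerSL_apply_norm, norm_inv,
        norm_norm, inv_mul_cancel₀ hr.ne', one_mul]

theorem contDiffOn_radialWave {χ : ℝ → ℂ} {s : Set ℝ} (hs : s ⊆ Set.Ioi 0)
    (hχ : ContDiffOn ℝ 1 χ s) : ContDiffOn ℝ 1 (radialWave χ ℓ m) ((fun x : E3 => ‖x‖) ⁻¹' s) := by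
  have h0 : ∀ x ∈ (fun x : E3 => ‖x‖) ⁻¹' s, x ≠ 0 := fun x hx => norm_pos_iff.1 (hs hx)
  have hn : ContDiffOn ℝ 1 (fun x : E3 => ‖x‖) ((fun x : E3 => ‖x‖) ⁻¹' s) := fun x hx =>
    (contDiffAt_norm ℝ (h0 x hx)).contDiffWithinAt
  exact (hχ.comp hn fun x hx => hx).mul
    (((contDiffOn_angular ℓ m).of_le (by norm_num)).mono h0)

/-- The radial derivative of a radial wave. -/
theorem fderiv_radialWave_direction {χ : ℝ → ℂ} {χ' : ℂ} {x : E3} (hx : x ≠ 0)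
    (hχ : HasDerivAt χ χ' ‖x‖) :
    fderiv ℝ (radialWave χ ℓ m) x (direction x) = radialWave (fun _ => χ') ℓ m x := by
  have hr : 0 < ‖x‖ := norm_pos_iff.2 hx
  have hl : HasDerivAt (fun s : ℝ => s • direction x) (direction x) ‖x‖ := by
    simpa using (hasDerivAt_id ‖x‖).smul_const (direction x)
  have h1 := (hasFDerivAt_radialWave (ℓ := ℓ) (m := m) hx hχ)
  have h2 : HasDerivAt (fun s : ℝ => radialWave χ ℓ m (s • direction x))
      (fderiv ℝ (radialWave χ ℓ m) x (direction x)) ‖x‖ := by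
    refine HasFDerivAt.comp_hasDerivAt_of_eq ‖x‖ (f := fun s : ℝ => s • direction x)
      h1.differentiableAt.hasFDerivAt hl ?_
    rw [norm_smul_direction]
  have h3 : HasDerivAt (fun s : ℝ => radialWave χ ℓ m (s • direction x))
      (χ' * (sphericalHarmonic ℓ m (direction x) : ℂ)) ‖x‖ := by
    refine (hχ.mul_const _).congr_of_eventuallyEq ?_
    filter_upwards [lt_mem_nhds hr] with s hs
    have hdd : direction (direction x) = direction x := by
      rw [direction, norm_direction hx, inv_one, one_smul]
    rw [radialWave, direction_smul hs, hdd, norm_smul, norm_direction hx, mul_one,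
      Real.norm_of_nonneg (le_of_lt hs)]
  exact h2.unique h3

theorem radialWave_smul_sph (χ : ℝ → ℂ) (ℓ : ℕ) (m : ℤ) {r : ℝ} (hr : 0 < r) (θ : Sph) :
    radialWave χ ℓ m (r • (θ : E3)) = χ r * (sphericalHarmonic ℓ m θ : ℂ) := by
  rw [radialWave, direction_smul_sph hr, norm_smul_sph hr]

end RadialWave

/-! ### Decay of the outgoing waves. -/

section HankelBounds

variable {z : ℝ}

theorem exists_pow_mul_exp_le {κ : ℝ} (hκ : 0 < κ) (k : ℕ) :
    ∃ C, ∀ r ≥ 0, (1 + r) ^ k * Real.exp (-(κ * r)) ≤ C := by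
  refine ⟨k.factorial / κ ^ k * Real.exp κ, fun r hr => ?_⟩
  have h := Real.pow_div_factorial_le_exp (x := κ * (1 + r)) (by positivity) k
  rw [mul_add, mul_one, Real.exp_add] at h
  rw [Real.exp_neg, ← div_eq_mul_inv, div_le_iff₀ (Real.exp_pos _)]
  have hk : (0 : ℝ) < k.factorial := Nat.cast_pos.2 k.factorial_pos
  rw [div_le_iff₀ hk, ← mul_one_add, mul_pow] at h
  rw [div_mul_eq_mul_div, div_mul_eq_mul_div, le_div_iff₀ (by positivity)]
  linarith

/-- The exponential beats every power. The rate `(1 + r)^{-2}` is kept because it is square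
integrable in three dimensions, which is all that is needed later. -/
theorem exists_norm_sphericalHankel_le (hz : z < 0) (ℓ : ℕ) {δ : ℝ} (hδ : 0 < δ) :
    ∃ C, 0 ≤ C ∧ ∀ r ≥ δ, ‖sphericalHankel ℓ (energyRoot z * r)‖ ≤ C * ((1 + r) ^ 2)⁻¹ := by
  have hκ := sqrt_abs_pos hz
  obtain ⟨C₁, hC₁⟩ := exists_norm_hankelRadial_le hκ ℓ hδ
  obtain ⟨C₂, hC₂⟩ := exists_pow_mul_exp_le hκ (ℓ + 2)
  set κ := Real.sqrt |z|
  have hC₁0 : 0 ≤ C₁ := by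
    have := (norm_nonneg _).trans (hC₁ δ le_rfl)
    exact nonneg_of_mul_nonneg_left this (Real.exp_pos _)
  have hC₂0 : 0 ≤ C₂ := le_trans (by positivity) (hC₂ 0 le_rfl)
  refine ⟨κ ^ ℓ * (C₁ * C₂), by positivity, fun r hr => ?_⟩
  have hr0 : 0 < r := hδ.trans_le hr
  rw [energyRoot, sphericalHankel_radial hκ ℓ hr0.ne', norm_mul, norm_pow, norm_neg, norm_mul,
    norm_mul, Complex.norm_I, one_mul, Complex.norm_of_nonneg hκ.le, Complex.norm_of_nonneg hr0.le,
    mul_pow, mul_assoc, mul_assoc (κ ^ ℓ)]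
  refine mul_le_mul_of_nonneg_left ?_ (by positivity)
  rw [← div_eq_mul_inv, le_div_iff₀ (by positivity)]
  calc r ^ ℓ * ‖hankelRadial κ ℓ r‖ * (1 + r) ^ 2
      ≤ (1 + r) ^ ℓ * (C₁ * Real.exp (-(κ * r))) * (1 + r) ^ 2 := by
        gcongr
        · linarith
        · exact hC₁ r hr
    _ = C₁ * ((1 + r) ^ (ℓ + 2) * Real.exp (-(κ * r))) := by ring
    _ ≤ C₁ * C₂ := mul_le_mul_of_nonneg_left (hC₂ r hr0.le) hC₁0

/-- The derivative of `r ↦ h_ℓ(√z r)`. -/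
theorem hasDerivAt_hankel_radial (hz : z < 0) (ℓ : ℕ) {r : ℝ} (hr : 0 < r) :
    HasDerivAt (fun r : ℝ => sphericalHankel ℓ (energyRoot z * r))
      (energyRoot z * deriv (sphericalHankel ℓ) (energyRoot z * r)) r := by
  have h := (hasDerivAt_sphericalHankel ℓ (energyRoot_mul_ne_zero hz hr)).differentiableAt.hasDerivAt
  refine (h.comp_of_eq r (hasDerivAt_I_mul (Real.sqrt |z|) r) rfl).congr_deriv ?_
  rw [mul_comm, energyRoot]

theorem hasDerivAt_bessel_radial (hz : z < 0) (ℓ : ℕ) {r : ℝ} (hr : 0 < r) :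
    HasDerivAt (fun r : ℝ => sphericalBessel ℓ (energyRoot z * r))
      (energyRoot z * deriv (sphericalBessel ℓ) (energyRoot z * r)) r := by
  have h := (hasDerivAt_sphericalBessel ℓ (energyRoot_mul_ne_zero hz hr)).differentiableAt.hasDerivAt
  refine (h.comp_of_eq r (hasDerivAt_I_mul (Real.sqrt |z|) r) rfl).congr_deriv ?_
  rw [mul_comm, energyRoot]

theorem contDiffOn_hankel_radial (hz : z < 0) (ℓ : ℕ) :
    ContDiffOn ℝ 1 (fun r : ℝ => sphericalHankel ℓ (energyRoot z * r)) (Set.Ioi 0) := by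
  have hκ := sqrt_abs_pos hz
  have h1 : ContDiffOn ℝ 1 (fun r : ℝ => (-(Complex.I * Real.sqrt |z| * r)) ^ ℓ *
      hankelRadial (Real.sqrt |z|) ℓ r) (Set.Ioi 0) := by
    refine ContDiffOn.mul (ContDiff.contDiffOn ?_)
      (((contDiffOn_hankelRadial hκ ℓ).of_le (by norm_num)).mono fun r hr => ne_of_gt hr)
    exact (contDiff_const.mul Complex.ofRealCLM.contDiff).neg.pow ℓ
  exact h1.congr fun r hr => sphericalHankel_radial hκ ℓ (ne_of_gt hr)

theorem exists_norm_deriv_hankel_le (hz : z < 0) (ℓ : ℕ) {δ : ℝ} (hδ : 0 < δ) :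
    ∃ C, 0 ≤ C ∧ ∀ r ≥ δ, ‖energyRoot z * deriv (sphericalHankel ℓ) (energyRoot z * r)‖ ≤
      C * ((1 + r) ^ 2)⁻¹ := by
  obtain ⟨C₁, h₁0, h₁⟩ := exists_norm_sphericalHankel_le hz ℓ hδ
  obtain ⟨C₂, h₂0, h₂⟩ := exists_norm_sphericalHankel_le hz (ℓ + 1) hδ
  refine ⟨ℓ / δ * C₁ + ‖energyRoot z‖ * C₂, by positivity, fun r hr => ?_⟩
  have hr0 : 0 < r := hδ.trans_le hr
  have hrc : (r : ℂ) ≠ 0 := Complex.ofReal_ne_zero.2 hr0.ne'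
  have he := energyRoot_ne_zero hz
  rw [(hasDerivAt_sphericalHankel ℓ (energyRoot_mul_ne_zero hz hr0)).deriv]
  have e1 : energyRoot z * (ℓ / (energyRoot z * r) * sphericalHankel ℓ (energyRoot z * r) -
      sphericalHankel (ℓ + 1) (energyRoot z * r)) = ℓ / r * sphericalHankel ℓ (energyRoot z * r) -
      energyRoot z * sphericalHankel (ℓ + 1) (energyRoot z * r) := by
    field_simp
  rw [e1]
  refine (norm_sub_le _ _).trans ?_
  rw [norm_mul, norm_mul, norm_div, Complex.norm_natCast, Complex.norm_of_nonneg hr0.le, add_mul,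
    mul_assoc, mul_assoc]
  refine add_le_add (mul_le_mul ?_ (h₁ r hr) (norm_nonneg _) (by positivity))
    (mul_le_mul_of_nonneg_left (h₂ r hr) (norm_nonneg _))
  exact div_le_div_of_nonneg_left (Nat.cast_nonneg _) hδ hr

/-- Decay of the outgoing waves and of their gradients. -/
theorem exists_hankelWave_bound (hz : z < 0) (ℓ : ℕ) (m : ℤ) {δ : ℝ} (hδ : 0 < δ) :
    ∃ C, 0 ≤ C ∧ ∀ x : E3, δ ≤ ‖x‖ → ‖hankelWave ℓ m z x‖ ≤ C * ((1 + ‖x‖) ^ 2)⁻¹ ∧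
      ‖fderiv ℝ (hankelWave ℓ m z) x‖ ≤ C * ((1 + ‖x‖) ^ 2)⁻¹ := by
  obtain ⟨C, hC0, hC⟩ := exists_norm_fderiv_radialWave_le ℓ m
  obtain ⟨C₁, h₁0, h₁⟩ := exists_norm_sphericalHankel_le hz ℓ hδ
  obtain ⟨C₂, h₂0, h₂⟩ := exists_norm_deriv_hankel_le hz ℓ hδ
  refine ⟨C * (C₁ + C₁ / δ + C₂), by positivity, fun x hx => ?_⟩
  have hx0 : 0 < ‖x‖ := hδ.trans_le hx
  have hp : 0 ≤ ((1 + ‖x‖) ^ 2)⁻¹ := by positivity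
  obtain ⟨h3, h4⟩ := hC (fun r => sphericalHankel ℓ (energyRoot z * r)) x
  have h5 := h4 _ (norm_pos_iff.1 hx0) (hasDerivAt_hankel_radial hz ℓ hx0)
  rw [hankelWave_eq_radialWave, mul_assoc]
  constructor
  · refine h3.trans (mul_le_mul_of_nonneg_left ((h₁ _ hx).trans ?_) hC0)
    refine mul_le_mul_of_nonneg_right ?_ hp
    have : 0 ≤ C₁ / δ := by positivity
    linarith
  · refine h5.trans (mul_le_mul_of_nonneg_left ?_ hC0)
    have h6 : ‖sphericalHankel ℓ (energyRoot z * (‖x‖ : ℂ))‖ / ‖x‖ ≤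
        C₁ * ((1 + ‖x‖) ^ 2)⁻¹ / δ :=
      div_le_div₀ (by positivity) (h₁ _ hx) hδ hx
    have h7 := h₂ _ hx
    have h8 : 0 ≤ C₁ * ((1 + ‖x‖) ^ 2)⁻¹ := by positivity
    calc _ ≤ C₁ * ((1 + ‖x‖) ^ 2)⁻¹ / δ + C₂ * ((1 + ‖x‖) ^ 2)⁻¹ := add_le_add h6 h7
      _ ≤ C₁ * ((1 + ‖x‖) ^ 2)⁻¹ + (C₁ * ((1 + ‖x‖) ^ 2)⁻¹ / δ + C₂ * ((1 + ‖x‖) ^ 2)⁻¹) := by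
        linarith
      _ = _ := by ring

end HankelBounds

/-! ### Weak derivatives: classical functions, point singularities, uniqueness. -/

section WeakPartial

variable {U : Set E3} {i : Fin 3} {f h : E3 → ℂ}

theorem HasWeakPartialOn.congr (hU : IsOpen U) {f' h' : E3 → ℂ} (H : HasWeakPartialOn U i f h)
    (hf : ∀ᵐ x ∂volume.restrict U, f' x = f x) (hh : ∀ᵐ x ∂volume.restrict U, h' x = h x) :
    HasWeakPartialOn U i f' h' := by
  intro φ hφ hc hs
  rw [ae_restrict_iff' hU.measurableSet] at hf hh
  have e1 : ∫ x, f' x * ((fderiv ℝ φ x (EuclideanSpace.single i 1) : ℝ) : ℂ) =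
      ∫ x, f x * ((fderiv ℝ φ x (EuclideanSpace.single i 1) : ℝ) : ℂ) := by
    refine integral_congr_ae ?_
    filter_upwards [hf] with x hx
    by_cases hxU : x ∈ tsupport φ
    · rw [hx (hs hxU)]
    · have : fderiv ℝ φ x = 0 := image_eq_zero_of_notMem_tsupport fun h =>
        hxU (tsupport_fderiv_subset ℝ h)
      simp [this]
  have e2 : ∫ x, h' x * (φ x : ℂ) = ∫ x, h x * (φ x : ℂ) := by
    refine integral_congr_ae ?_
    filter_upwards [hh] with x hx
    by_cases hxU : x ∈ tsupport φ
    · rw [hx (hs hxU)]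
    · simp [image_eq_zero_of_notMem_tsupport hxU]
  rw [e1, e2]
  exact H φ hφ hc hs

theorem hasWeakPartialOn_of_contDiffOn (hU : IsOpen U) (hf : ContDiffOn ℝ 1 f U) (i : Fin 3) :
    HasWeakPartialOn U i f fun x => fderiv ℝ f x (EuclideanSpace.single i 1) := by
  intro φ hφ hc hs
  have := integral_smul_fderiv_eq_neg hU (hφ.of_le (by norm_num)) hc hs hf
    (EuclideanSpace.single i 1)
  simp only [Complex.real_smul] at this
  rw [eq_neg_iff_add_eq_zero] at this ⊢
  rw [add_comm] at this
  simpa only [mul_comm] using this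

theorem integrableOn_norm_inv (c : E3) (r : ℝ) :
    IntegrableOn (fun x => ‖x - c‖⁻¹) (Metric.ball c r) := by
  have h0 : IntegrableOn (fun x : E3 => ‖x‖⁻¹) (Metric.ball 0 r) := by
    rw [integrableOn_fun_norm_addHaar volume (f := fun y => y⁻¹), finrank_E3]
    refine IntegrableOn.congr_fun (f := fun y : ℝ => y)
      (continuous_id.integrableOn_Icc.mono_set Set.Ioo_subset_Icc_self) (fun y hy => ?_)
      measurableSet_Ioo
    have := hy.1.ne'
    simp only [smul_eq_mul]
    field_simp
  rw [← integrable_indicator_iff measurableSet_ball] at h0 ⊢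
  refine (h0.comp_sub_right c).congr (Eventually.of_forall fun x => ?_)
  simp only [Set.indicator, mem_ball_iff_norm, sub_zero]

/-- The cutoffs are `1 - g((k+1)(x - c))` for a fixed bump function `g`. As `|y| |∇g(y)|` is
bounded, scaling gives a gradient bound of order `1/|x - c|` that is uniform in `k`. -/
theorem exists_point_cutoff (c : E3) : ∃ (M : ℝ) (ψ : ℕ → E3 → ℝ), (∀ k, ContDiff ℝ ∞ (ψ k)) ∧
    (∀ k x, |ψ k x| ≤ 1) ∧ (∀ k x, x ≠ c → ‖fderiv ℝ (ψ k) x‖ ≤ M / ‖x - c‖) ∧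
    (∀ x, x ≠ c → ∀ᶠ k in atTop, ψ k x = 1 ∧ fderiv ℝ (ψ k) x = 0) ∧
    ∀ k, ∀ᶠ y in 𝓝 c, ψ k y = 0 := by
  obtain ⟨g, hgs, hgc, hg01, hg1, hg2⟩ : ∃ g : E3 → ℝ, ContDiff ℝ ∞ g ∧ HasCompactSupport g ∧
      (∀ y, 0 ≤ g y ∧ g y ≤ 1) ∧ (∀ y, ‖y‖ ≤ 1 → g y = 1) ∧
      tsupport g ⊆ Metric.closedBall 0 2 := by
    let b : ContDiffBump (0 : E3) := ⟨1, 2, one_pos, one_lt_two⟩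
    exact ⟨b, b.contDiff, b.hasCompactSupport, fun y => ⟨b.nonneg, b.le_one⟩,
      fun y hy => b.one_of_mem_closedBall (by simpa [b] using hy), b.tsupport_eq.subset⟩
  have hgd : Continuous (fderiv ℝ g) := hgs.continuous_fderiv (by norm_num)
  have hbd : ∃ M, ∀ y : E3, ‖y‖ * ‖fderiv ℝ g y‖ ≤ M := by
    have hc : HasCompactSupport fun y : E3 => ‖y‖ * ‖fderiv ℝ g y‖ :=
      (hgc.fderiv (𝕜 := ℝ)).norm.mul_left
    obtain ⟨M, hM⟩ := (continuous_norm.mul hgd.norm).bounded_above_of_compact_support hc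
    exact ⟨M, fun y => (le_abs_self _).trans (hM y)⟩
  obtain ⟨M, hM⟩ := hbd
  have hk0 : ∀ k : ℕ, (0 : ℝ) < k + 1 := fun k => by positivity
  have hψd : ∀ (k : ℕ) x, HasFDerivAt (fun x => 1 - g (((k : ℝ) + 1) • (x - c)))
      (-(((k : ℝ) + 1) • fderiv ℝ g (((k : ℝ) + 1) • (x - c)))) x := by
    intro k x
    have h1 : HasFDerivAt (fun x => g (((k : ℝ) + 1) • (x - c)))
        ((fderiv ℝ g (((k : ℝ) + 1) • (x - c))).comp
          (((k : ℝ) + 1) • ContinuousLinearMap.id ℝ E3)) x :=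
      HasFDerivAt.comp x (f := fun x : E3 => ((k : ℝ) + 1) • (x - c))
        (hgs.differentiable (by norm_num) _).hasFDerivAt
        (((hasFDerivAt_id (𝕜 := ℝ) x).sub_const c).const_smul ((k : ℝ) + 1) :)
    refine (h1.const_sub 1).congr_fderiv ?_
    rw [ContinuousLinearMap.comp_smul, ContinuousLinearMap.comp_id]
  refine ⟨M, fun k x => 1 - g (((k : ℝ) + 1) • (x - c)), fun k => ?_, fun k x => ?_,
    fun k x hx => ?_, fun x hx => ?_, fun k => ?_⟩
  · refine contDiff_const.sub (hgs.comp ?_)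
    fun_prop
  · obtain ⟨h1, h2⟩ := hg01 (((k : ℝ) + 1) • (x - c))
    rw [abs_le]
    constructor <;> linarith
  · have hx0 : 0 < ‖x - c‖ := norm_pos_iff.2 (sub_ne_zero.2 hx)
    have h1 := hM (((k : ℝ) + 1) • (x - c))
    rw [norm_smul, Real.norm_of_nonneg (hk0 k).le] at h1
    rw [(hψd k x).fderiv, norm_neg, norm_smul, Real.norm_of_nonneg (hk0 k).le, le_div_iff₀ hx0]
    linarith
  · have hx0 : 0 < ‖x - c‖ := norm_pos_iff.2 (sub_ne_zero.2 hx)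
    filter_upwards [tendsto_natCast_atTop_atTop.eventually_gt_atTop (2 / ‖x - c‖)] with k hk
    have h1 : ((k : ℝ) + 1) • (x - c) ∉ tsupport g := fun h => by
      have h2 := hg2 h
      rw [mem_closedBall_zero_iff, norm_smul, Real.norm_of_nonneg (hk0 k).le] at h2
      rw [div_lt_iff₀ hx0] at hk
      nlinarith
    constructor
    · rw [image_eq_zero_of_notMem_tsupport h1, sub_zero]
    · rw [(hψd k x).fderiv, image_eq_zero_of_notMem_tsupport fun h =>
        h1 (tsupport_fderiv_subset ℝ h), smul_zero, neg_zero]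
  · filter_upwards [Metric.ball_mem_nhds c (inv_pos.2 (hk0 k))] with y hy
    have : g (((k : ℝ) + 1) • (y - c)) = 1 := hg1 _ (by
      rw [norm_smul, Real.norm_of_nonneg (hk0 k).le]
      rw [mem_ball_iff_norm] at hy
      calc ((k : ℝ) + 1) * ‖y - c‖ ≤ (k + 1) * (k + 1 : ℝ)⁻¹ :=
            mul_le_mul_of_nonneg_left hy.le (hk0 k).le
        _ = 1 := mul_inv_cancel₀ (hk0 k).ne')
    rw [this, sub_self]

/-- Point singularities of order `1/|x|` of the gradient do not contribute to weak derivatives. -/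
theorem hasWeakPartialOn_of_punctured (hU : IsOpen U) {c : E3} (hf : ContDiffOn ℝ 1 f (U \ {c}))
    {C : ℝ} (hb : ∀ x ∈ U \ {c}, ‖f x‖ ≤ C)
    (hb' : ∀ x ∈ U \ {c}, ‖fderiv ℝ f x‖ ≤ C / ‖x - c‖) (i : Fin 3) :
    HasWeakPartialOn U i f fun x => fderiv ℝ f x (EuclideanSpace.single i 1) := by
  intro φ hφ hc hs
  set v : E3 := EuclideanSpace.single i 1 with hv
  have hv1 : ‖v‖ = 1 := by simp [hv]
  obtain ⟨M, ψ, hψs, hψ01, hψb, hev, hψ0⟩ := exists_point_cutoff c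
  obtain ⟨K, hK⟩ := (hφ.continuous.bounded_above_of_compact_support hc)
  obtain ⟨K', hK'⟩ := ((hφ.continuous_fderiv (by norm_num)).bounded_above_of_compact_support
    (hc.fderiv (𝕜 := ℝ)))
  obtain ⟨ρ, hρ⟩ := hc.isCompact.isBounded.subset_ball c
  have hUc : IsOpen (U \ {c}) := hU.sdiff isClosed_singleton
  have hcut : ∀ k, tsupport (fun x => φ x * ψ k x) ⊆ U \ {c} := by
    intro k x hx
    refine ⟨hs (tsupport_mul_subset_left hx), ?_⟩
    rintro rfl
    refine hx |> notMem_tsupport_iff_eventuallyEq.2 ?_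
    filter_upwards [hψ0 k] with y hy
    simp [hy]
  have hφψ : ∀ k, ContDiff ℝ 1 (fun x => φ x * ψ k x) := fun k =>
    (hφ.mul (hψs k)).of_le (by norm_num)
  have hcc : ∀ k, HasCompactSupport (fun x => φ x * ψ k x) := fun k => hc.mul_right
  -- The product with the cutoff is a test function supported away from `c`, where `f` is `C¹`. The
  -- limit `k → ∞` is taken on both sides by dominated convergence with a multiple of `1/|x - c|`,
  -- including the term with the gradient of the cutoff, which tends to zero pointwise.
  have key : ∀ k, ∫ x, (φ x * ψ k x) • fderiv ℝ f x v =
      -∫ x, fderiv ℝ (fun x => φ x * ψ k x) x v • f x := fun k =>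
    integral_smul_fderiv_eq_neg hUc (hφψ k) (hcc k) (hcut k) hf v
  have hae : ∀ᵐ x : E3, x ≠ c := by
    rw [ae_iff]
    simp
  have hfd : ContinuousOn (fun x => fderiv ℝ f x v) (U \ {c}) :=
    (hf.continuousOn_fderiv_of_isOpen hUc (by norm_num)).clm_apply continuousOn_const
  have hbound : Integrable ((Metric.ball c ρ).indicator fun x => ‖x - c‖⁻¹) :=
    (integrable_indicator_iff measurableSet_ball).2 (integrableOn_norm_inv c ρ)
  have lim1 : Tendsto (fun k => ∫ x, (φ x * ψ k x) • fderiv ℝ f x v) atTop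
      (𝓝 (∫ x, φ x • fderiv ℝ f x v)) := by
    refine tendsto_integral_of_dominated_convergence (fun x =>
      (|K| * |C|) * (Metric.ball c ρ).indicator (fun x => ‖x - c‖⁻¹) x) (fun k =>
      (integrable_smul_of_tsupport_subset hUc (hφψ k).continuous (hcc k) (hcut k)
        hfd).aestronglyMeasurable) (hbound.const_mul _) (fun k => ?_) ?_
    · filter_upwards [hae] with x hx
      by_cases hxs : x ∈ tsupport φ
      · rw [Set.indicator_of_mem (hρ hxs), norm_smul, norm_mul]
        have h1 : ‖φ x‖ * ‖ψ k x‖ ≤ |K| :=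
          (mul_le_of_le_one_right (norm_nonneg _) (hψ01 k x)).trans ((hK x).trans (le_abs_self K))
        have h2 : ‖fderiv ℝ f x v‖ ≤ |C| * ‖x - c‖⁻¹ := by
          refine ((fderiv ℝ f x).le_opNorm v).trans ?_
          rw [hv1, mul_one]
          refine (hb' x ⟨hs hxs, hx⟩).trans ?_
          rw [div_eq_mul_inv]
          exact mul_le_mul_of_nonneg_right (le_abs_self C) (by positivity)
        calc _ ≤ |K| * (|C| * ‖x - c‖⁻¹) := mul_le_mul h1 h2 (norm_nonneg _) (abs_nonneg _)
          _ = _ := by ring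
      · rw [image_eq_zero_of_notMem_tsupport hxs, zero_mul, zero_smul, norm_zero]
        exact mul_nonneg (by positivity) (Set.indicator_nonneg (fun y _ => by positivity) x)
    · filter_upwards [hae] with x hx
      refine tendsto_const_nhds.congr' ?_
      filter_upwards [hev x hx] with k hk
      rw [hk.1, mul_one]
  have hder : ∀ k x, fderiv ℝ (fun x => φ x * ψ k x) x v =
      φ x * fderiv ℝ (ψ k) x v + ψ k x * fderiv ℝ φ x v := fun k x => by
    have h1 := ((hφ.differentiable (by norm_num) x).hasFDerivAt.mul
      ((hψs k).differentiable (by norm_num) x).hasFDerivAt)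
    rw [show (fun x => φ x * ψ k x) = φ * ψ k from rfl, h1.fderiv]
    simp
  have lim2 : Tendsto (fun k => ∫ x, fderiv ℝ (fun x => φ x * ψ k x) x v • f x) atTop
      (𝓝 (∫ x, fderiv ℝ φ x v • f x)) := by
    refine tendsto_integral_of_dominated_convergence (fun x =>
      ((|K| * |M| + |K'| * |ρ|) * |C|) * (Metric.ball c ρ).indicator (fun x => ‖x - c‖⁻¹) x)
      (fun k => ?_) (hbound.const_mul _) (fun k => ?_) ?_
    · refine (integrable_smul_of_tsupport_subset hUc
        (((hφψ k).continuous_fderiv (by norm_num)).clm_apply continuous_const) ?_ ?_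
        hf.continuousOn).aestronglyMeasurable
      · exact (hcc k).fderiv_apply ℝ v
      · exact (tsupport_fderiv_apply_subset ℝ v).trans (hcut k)
    · filter_upwards [hae] with x hx
      have hx0 : 0 < ‖x - c‖ := norm_pos_iff.2 (sub_ne_zero.2 hx)
      by_cases hxs : x ∈ tsupport φ
      · rw [Set.indicator_of_mem (hρ hxs), norm_smul, hder]
        have h1 : ‖φ x * fderiv ℝ (ψ k) x v‖ ≤ |K| * |M| * ‖x - c‖⁻¹ := by
          rw [norm_mul, mul_assoc]
          refine mul_le_mul ((hK x).trans (le_abs_self K)) ?_ (norm_nonneg _) (abs_nonneg _)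
          refine ((fderiv ℝ (ψ k) x).le_opNorm v).trans ?_
          rw [hv1, mul_one]
          refine (hψb k x hx).trans ?_
          rw [div_eq_mul_inv]
          exact mul_le_mul_of_nonneg_right (le_abs_self M) (by positivity)
        have h2 : ‖ψ k x * fderiv ℝ φ x v‖ ≤ |K'| * |ρ| * ‖x - c‖⁻¹ := by
          rw [norm_mul]
          have h3 : ‖fderiv ℝ φ x v‖ ≤ |K'| := by
            refine ((fderiv ℝ φ x).le_opNorm v).trans ?_
            rw [hv1, mul_one]
            exact (hK' x).trans (le_abs_self _)
          -- On the support of `φ` the distance to `c` is less than `ρ`, so the constant `1` is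
          -- dominated by `|ρ|/|x - c|` and the bounded term fits under the same majorant.
          have h4 : 1 ≤ |ρ| * ‖x - c‖⁻¹ := by
            rw [← div_eq_mul_inv, one_le_div hx0]
            exact (mem_ball_iff_norm.1 (hρ hxs)).le.trans (le_abs_self ρ)
          calc ‖ψ k x‖ * ‖fderiv ℝ φ x v‖ ≤ 1 * |K'| :=
                mul_le_mul (hψ01 k x) h3 (norm_nonneg _) zero_le_one
            _ ≤ |K'| * (|ρ| * ‖x - c‖⁻¹) := by
                rw [one_mul]; exact le_mul_of_one_le_right (abs_nonneg _) h4
            _ = _ := by ring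
        calc _ ≤ (|K| * |M| * ‖x - c‖⁻¹ + |K'| * |ρ| * ‖x - c‖⁻¹) * |C| :=
              mul_le_mul ((norm_add_le _ _).trans (add_le_add h1 h2))
                ((hb x ⟨hs hxs, hx⟩).trans (le_abs_self C)) (norm_nonneg _) (by positivity)
          _ = _ := by ring
      · have h1 : fderiv ℝ φ x = 0 := image_eq_zero_of_notMem_tsupport fun h =>
          hxs (tsupport_fderiv_subset ℝ h)
        rw [hder, image_eq_zero_of_notMem_tsupport hxs, h1]
        simp only [zero_mul, ContinuousLinearMap.zero_apply, mul_zero, add_zero, zero_smul,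
          norm_zero]
        exact mul_nonneg (by positivity) (Set.indicator_nonneg (fun y _ => by positivity) x)
    · filter_upwards [hae] with x hx
      refine tendsto_const_nhds.congr' ?_
      filter_upwards [hev x hx] with k hk
      rw [hder, hk.1, hk.2]
      simp
  have hfin := tendsto_nhds_unique (lim1.congr key) lim2.neg
  simp only [Complex.real_smul] at hfin
  rw [eq_neg_iff_add_eq_zero] at hfin ⊢
  rw [add_comm] at hfin
  simpa only [mul_comm] using hfin

/-- Weak derivatives are unique. -/
theorem HasWeakPartialOn.ae_eq (hU : IsOpen U) {h' : E3 → ℂ} (H : HasWeakPartialOn U i f h)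
    (H' : HasWeakPartialOn U i f h') (hh : MemLp h 2 volume) (hh' : MemLp h' 2 volume) :
    ∀ᵐ x ∂volume.restrict U, h x = h' x := by
  rw [ae_restrict_iff' hU.measurableSet]
  have hloc : LocallyIntegrable (fun x => h x - h' x) :=
    (hh.sub hh').locallyIntegrable (by norm_num)
  have := hU.ae_eq_zero_of_integral_contDiff_smul_eq_zero (hloc.locallyIntegrableOn U)
    fun φ hφ hc hs => by
      have hφ2 : MemLp (fun x => (φ x : ℂ)) 2 volume :=
        (Complex.continuous_ofReal.comp hφ.continuous).memLp_of_hasCompactSupport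
          (hc.comp_left Complex.ofReal_zero)
      have h1 : Integrable (fun x => h x * (φ x : ℂ)) := hh.integrable_mul hφ2
      have h2 : Integrable (fun x => h' x * (φ x : ℂ)) := hh'.integrable_mul hφ2
      have h3 := H φ hφ hc hs
      have h4 := H' φ hφ hc hs
      have e : ∀ x, φ x • (h x - h' x) = h x * (φ x : ℂ) - h' x * (φ x : ℂ) := fun x => by
        rw [Complex.real_smul]; ring
      simp only [e]
      rw [integral_sub h1 h2]
      linear_combination h3 - h4
  filter_upwards [this] with x hx hxU using sub_eq_zero.1 (hx hxU)

end WeakPartial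

/-! ### Traces on spheres: existence and uniqueness. -/

section Traces

variable {A : Set E3} {c : E3} {R : ℝ}

theorem volume_shell_le (c : E3) {ε : ℝ} (hε : 0 < ε) (hεR : ε ≤ R) :
    volume {x : E3 | |‖x - c‖ - R| < ε} ≤ ENNReal.ofReal (8 * R ^ 2 * ε * (Real.pi * 4 / 3)) := by
  have hsub : {x : E3 | |‖x - c‖ - R| < ε} ⊆ Metric.ball c (R + ε) \ Metric.ball c (R - ε) := by
    intro x hx
    have h := abs_lt.1 (show |‖x - c‖ - R| < ε from hx)
    rw [Set.mem_diff, mem_ball_iff_norm, mem_ball_iff_norm]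
    constructor <;> linarith [h.1, h.2]
  refine (measure_mono hsub).trans ?_
  rw [measure_diff (Metric.ball_subset_ball (by linarith)) measurableSet_ball.nullMeasurableSet
    measure_ball_lt_top.ne, EuclideanSpace.volume_ball_fin_three,
    EuclideanSpace.volume_ball_fin_three, ← ENNReal.ofReal_pow (by linarith),
    ← ENNReal.ofReal_pow (by linarith), ← ENNReal.ofReal_mul (pow_nonneg (by linarith) 3),
    ← ENNReal.ofReal_mul (pow_nonneg (by linarith) 3), ← ENNReal.ofReal_sub _
      (mul_nonneg (pow_nonneg (by linarith) 3) (by positivity)), ← sub_mul]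
  refine ENNReal.ofReal_le_ofReal (mul_le_mul_of_nonneg_right ?_ (by positivity))
  -- The volume difference is proportional to `(R + ε)³ - (R - ε)³ = 6R²ε + 2ε³`, and `ε ≤ R` bounds
  -- this by `8R²ε`.
  have : ε ^ 2 ≤ R ^ 2 := pow_le_pow_left₀ hε.le hεR 2
  nlinarith

/-- A function which is uniformly close to `w (x/|x|)` near the sphere has the trace `w`. -/
theorem hasTraceFrom_of_approx (hR : 0 < R) (hA : MeasurableSet A) {f w : E3 → ℂ}
    (hw : Continuous fun θ : Sph => w θ)
    (h : ∀ η > 0, ∃ ε > 0, ∀ᵐ x ∂volume.restrict A, |‖x - c‖ - R| < ε →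
      ‖f x - w (direction (x - c))‖ ≤ η) : HasTraceFrom A c R f w := by
  refine ⟨hw.memLp_of_hasCompactSupport (HasCompactSupport.of_compactSpace _), ?_⟩
  rw [ENNReal.tendsto_nhds_zero]
  intro δ hδ
  obtain ⟨d, hd0, hd1, hd2⟩ := ENNReal.lt_iff_exists_real_btwn.1 hδ
  have hd : 0 < d := ENNReal.ofReal_pos.1 hd1
  set K : ℝ := 8 * R ^ 2 * (Real.pi * 4 / 3) with hK
  have hK0 : 0 < K := by positivity
  -- The tolerance is chosen such that its square times the bound `Kε` for the volume of the shell
  -- is `dε`, which is below the target after division by `ε`.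
  obtain ⟨ε₀, hε₀, hbd⟩ := h (Real.sqrt (d / K)) (by positivity)
  filter_upwards [Ioo_mem_nhdsGT (lt_min hε₀ hR)] with ε hε
  have hε1 : ε < ε₀ := hε.2.trans_le (min_le_left _ _)
  have hε2 : ε < R := hε.2.trans_le (min_le_right _ _)
  have hm : MeasurableSet {x : E3 | |‖x - c‖ - R| < ε} :=
    measurableSet_lt (by fun_prop) measurable_const
  have h1 : ∫⁻ x in A ∩ {x | |‖x - c‖ - R| < ε}, ‖f x - w (direction (x - c))‖ₑ ^ 2 ≤
      ENNReal.ofReal (d / K) * ENNReal.ofReal (K * ε) := by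
    calc ∫⁻ x in A ∩ {x | |‖x - c‖ - R| < ε}, ‖f x - w (direction (x - c))‖ₑ ^ 2
        ≤ ∫⁻ _ in A ∩ {x | |‖x - c‖ - R| < ε}, ENNReal.ofReal (d / K) := by
          refine lintegral_mono_ae ?_
          rw [ae_restrict_iff' (hA.inter hm)]
          rw [ae_restrict_iff' hA] at hbd
          filter_upwards [hbd] with x hx hxA
          have h2 := hx hxA.1 (lt_trans hxA.2 hε1)
          rw [← ofReal_norm_eq_enorm, ← ENNReal.ofReal_pow (norm_nonneg _)]
          refine ENNReal.ofReal_le_ofReal ?_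
          calc _ ≤ Real.sqrt (d / K) ^ 2 := pow_le_pow_left₀ (norm_nonneg _) h2 2
            _ = d / K := Real.sq_sqrt (by positivity)
      _ = ENNReal.ofReal (d / K) * volume (A ∩ {x | |‖x - c‖ - R| < ε}) := setLIntegral_const _ _
      _ ≤ ENNReal.ofReal (d / K) * ENNReal.ofReal (K * ε) := by
          gcongr
          refine (measure_mono Set.inter_subset_right).trans
            ((volume_shell_le c hε.1 hε2.le).trans (ENNReal.ofReal_le_ofReal (le_of_eq ?_)))
          rw [hK]; ring
  refine (ENNReal.div_le_div_right h1 _).trans ?_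
  rw [← ENNReal.ofReal_mul (by positivity), ← ENNReal.ofReal_div_of_pos hε.1]
  refine le_trans (ENNReal.ofReal_le_ofReal (le_of_eq ?_)) hd2.le
  have := hε.1
  field_simp

/-- Continuous functions have their restrictions as traces. -/
theorem hasTraceFrom_of_continuousOn (hR : 0 < R) (hA : MeasurableSet A) {f F : E3 → ℂ}
    (hfF : ∀ᵐ x ∂volume.restrict A, f x = F x) {U : Set E3} (hU : IsOpen U)
    (hsub : Metric.sphere c R ⊆ U) (hF : ContinuousOn F U) :
    HasTraceFrom A c R f fun θ => F (c + R • θ) := by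
  have hmem : ∀ y : E3, ‖y‖ = 1 → c + R • y ∈ Metric.sphere c R := fun y hy => by
    rw [mem_sphere_iff_norm, add_sub_cancel_left, norm_smul, hy, mul_one,
      Real.norm_of_nonneg hR.le]
  refine hasTraceFrom_of_approx hR hA ?_ fun η hη => ?_
  · exact hF.comp_continuous (by fun_prop) fun θ => hsub (hmem _ (norm_sph θ))
  · obtain ⟨δ, hδ, hδU⟩ := (isCompact_sphere c R).exists_cthickening_subset_open hU hsub
    have hK : IsCompact (Metric.cthickening δ (Metric.sphere c R)) :=
      (isCompact_sphere c R).cthickening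
    have huc := hK.uniformContinuousOn_of_continuous (hF.mono hδU)
    rw [Metric.uniformContinuousOn_iff] at huc
    obtain ⟨ε, hε, hun⟩ := huc η hη
    refine ⟨min R (min δ ε), lt_min hR (lt_min hδ hε), ?_⟩
    filter_upwards [hfF] with x hx hxε
    have hε1 : |‖x - c‖ - R| < R := hxε.trans_le (min_le_left _ _)
    have hε2 : |‖x - c‖ - R| < δ := hxε.trans_le ((min_le_right _ _).trans (min_le_left _ _))
    have hε3 : |‖x - c‖ - R| < ε := hxε.trans_le ((min_le_right _ _).trans (min_le_right _ _))
    have hx0 : x - c ≠ 0 := fun h => by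
      rw [h, norm_zero, zero_sub, abs_neg, abs_of_pos hR] at hε1
      exact lt_irrefl _ hε1
    set y := c + R • direction (x - c) with hy
    have hys : y ∈ Metric.sphere c R := hmem _ (norm_direction hx0)
    have hxy : dist x y = |‖x - c‖ - R| := by
      have : x - y = (‖x - c‖ - R) • direction (x - c) := by
        rw [hy, sub_smul, norm_smul_direction]
        abel
      rw [dist_eq_norm, this, norm_smul, norm_direction hx0, mul_one, Real.norm_eq_abs]
    rw [hx, ← dist_eq_norm]
    refine (hun x ?_ y (Metric.self_subset_cthickening _ hys) (hxy.trans_lt hε3)).le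
    exact Metric.mem_cthickening_of_dist_le _ y _ _ hys (hxy.trans_lt hε2).le

/-- A measurable representative of the direction, as a point of the sphere. -/
def directionSph (x : E3) : Sph :=
  if h : x = 0 then ⟨EuclideanSpace.single 0 1, by simp⟩
  else ⟨direction x, by rw [mem_sphere_zero_iff_norm, norm_direction h]⟩

theorem coe_directionSph {x : E3} (hx : x ≠ 0) : (directionSph x : E3) = direction x := by
  rw [directionSph, dif_neg hx]

theorem directionSph_smul {r : ℝ} (hr : 0 < r) (θ : Sph) : directionSph (r • (θ : E3)) = θ := by
  apply Subtype.ext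
  rw [coe_directionSph, direction_smul_sph hr]
  rw [← norm_pos_iff, norm_smul_sph hr]
  exact hr

theorem measurable_directionSph : Measurable directionSph := by
  have h : Measurable fun x : E3 => (directionSph x : E3) := by
    have e : (fun x : E3 => (directionSph x : E3)) =
        fun x => if x = 0 then EuclideanSpace.single 0 1 else direction x := by
      funext x
      by_cases hx : x = 0
      · simp [directionSph, hx]
      · simp [directionSph, hx]
    rw [e]
    refine Measurable.ite (measurableSet_singleton _) measurable_const ?_
    unfold direction
    fun_prop
  exact h.subtype_mk

/-- Integration of a product of a radial and an angular function over a shell. -/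
theorem lintegral_shell_mul {g : Sph → ℝ≥0∞} (hg : Measurable g) (p q : ℝ) (hp : 0 ≤ p) :
    ∫⁻ x in {x : E3 | ‖x - c‖ ∈ Set.Ioo p q}, g (directionSph (x - c)) =
      (∫⁻ r in Set.Ioo p q, ENNReal.ofReal (r ^ 2)) * ∫⁻ θ, g θ ∂surf := by
  have hm0 : MeasurableSet {x : E3 | ‖x‖ ∈ Set.Ioo p q} := measurableSet_Ioo.preimage measurable_norm
  have hm : MeasurableSet {x : E3 | ‖x - c‖ ∈ Set.Ioo p q} :=
    measurableSet_Ioo.preimage (by fun_prop)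
  have hgm : Measurable fun x : E3 => g (directionSph x) := hg.comp measurable_directionSph
  rw [← lintegral_indicator hm]
  have e : ∀ x, {x : E3 | ‖x - c‖ ∈ Set.Ioo p q}.indicator (fun x => g (directionSph (x - c))) x =
      {x : E3 | ‖x‖ ∈ Set.Ioo p q}.indicator (fun x => g (directionSph x)) (x - c) := fun x => rfl
  simp only [e]
  rw [lintegral_sub_right_eq_self ({x : E3 | ‖x‖ ∈ Set.Ioo p q}.indicator
    fun x => g (directionSph x)) c, lintegral_polar (hgm.indicator hm0),
    ← lintegral_mul_const _ (by fun_prop), ← lintegral_indicator measurableSet_Ioi,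
    ← lintegral_indicator measurableSet_Ioo]
  refine lintegral_congr fun r => ?_
  by_cases hr : r ∈ Set.Ioo p q
  · have hr0 : 0 < r := hp.trans_lt hr.1
    rw [Set.indicator_of_mem (Set.mem_Ioi.2 hr0), Set.indicator_of_mem hr]
    congr 1
    refine lintegral_congr fun θ => ?_
    rw [Set.indicator_of_mem, directionSph_smul hr0]
    rw [Set.mem_ofPred_eq, norm_smul_sph hr0]
    exact hr
  · rw [Set.indicator_of_notMem hr]
    by_cases hr0 : 0 < r
    · rw [Set.indicator_of_mem (Set.mem_Ioi.2 hr0)]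
      have : ∀ θ : Sph, {x : E3 | ‖x‖ ∈ Set.Ioo p q}.indicator (fun x => g (directionSph x))
          (r • (θ : E3)) = 0 := fun θ => by
        rw [Set.indicator_of_notMem]
        rw [Set.mem_ofPred_eq, norm_smul_sph hr0]
        exact hr
      simp only [this, lintegral_zero, mul_zero]
    · rw [Set.indicator_of_notMem (show r ∉ Set.Ioi 0 from hr0)]

/-- The cone over a null set of the sphere is a null set of the space, by integration in polar
coordinates. -/
theorem ae_directionSph {p : Sph → Prop} (hp : ∀ᵐ θ ∂surf, p θ) (c : E3) :
    ∀ᵐ x : E3, p (directionSph (x - c)) := by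
  obtain ⟨s, hs, hsm, hs0⟩ := exists_measurable_superset_of_null (ae_iff.1 hp)
  rw [ae_iff]
  have hm : MeasurableSet ((fun x : E3 => directionSph (x - c)) ⁻¹' s) :=
    hsm.preimage (measurable_directionSph.comp (by fun_prop))
  refine measure_mono_null (t := (fun x : E3 => directionSph (x - c)) ⁻¹' s)
    (fun x hx => hs hx) ?_
  have hN : volume ((fun x : E3 => directionSph x) ⁻¹' s) = 0 := by
    have hm' := hsm.preimage measurable_directionSph
    rw [← lintegral_indicator_one hm', lintegral_polar (measurable_one.indicator hm')]
    rw [setLIntegral_congr_fun measurableSet_Ioi (g := fun _ => 0) fun r hr => ?_]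
    · simp
    · have : ∀ θ : Sph, ((fun x : E3 => directionSph x) ⁻¹' s).indicator (1 : E3 → ℝ≥0∞)
          (r • (θ : E3)) = s.indicator 1 θ := fun θ => by
        have hmem : r • (θ : E3) ∈ (fun x : E3 => directionSph x) ⁻¹' s ↔ θ ∈ s := by
          rw [Set.mem_preimage, directionSph_smul hr]
        by_cases hθ : θ ∈ s
        · rw [Set.indicator_of_mem (hmem.2 hθ), Set.indicator_of_mem hθ]
          rfl
        · rw [Set.indicator_of_notMem (mt hmem.1 hθ), Set.indicator_of_notMem hθ]
      simp only [this]
      rw [lintegral_indicator_one hsm, hs0, mul_zero]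
  have h := measure_preimage_add_right volume (-c) ((fun x : E3 => directionSph x) ⁻¹' s)
  rw [hN] at h
  simp only [sub_eq_add_neg]
  exact h

/-- Traces are unique on the part of the sphere along which a uniform one-sided shell is contained
in the region. -/
theorem HasTraceFrom.ae_eq_of_segment (hR : 0 < R) (hA : MeasurableSet A) {f w₁ w₂ : E3 → ℂ}
    (hf : AEStronglyMeasurable f (volume.restrict A)) (h₁ : HasTraceFrom A c R f w₁)
    (h₂ : HasTraceFrom A c R f w₂) {s : Set Sph} (hs : MeasurableSet s) {ε₁ : ℝ} (hε₁ : 0 < ε₁)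
    (hseg : ∀ ε ∈ Set.Ioo 0 ε₁, ∃ p, R - ε ≤ p ∧ p ≤ R ∧ ∀ θ ∈ s, ∀ r ∈ Set.Ioo p (p + ε),
      c + r • (θ : E3) ∈ A) :
    ∀ᵐ θ : Sph ∂(surf.restrict s), w₁ (θ : E3) = w₂ (θ : E3) := by
  obtain ⟨⟨hm₁, -⟩, ht₁⟩ := h₁
  obtain ⟨⟨hm₂, -⟩, ht₂⟩ := h₂
  -- A trace is only almost everywhere measurable on the sphere, so both traces are replaced by
  -- measurable versions, which agree with them along almost every direction in space.
  set u₁ : Sph → ℂ := hm₁.mk _ with hu₁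
  set u₂ : Sph → ℂ := hm₂.mk _ with hu₂
  have hum₁ : Measurable u₁ := hm₁.stronglyMeasurable_mk.measurable
  have hum₂ : Measurable u₂ := hm₂.stronglyMeasurable_mk.measurable
  have hx0 : ∀ᵐ x : E3, x ≠ c := by
    rw [ae_iff]; simp
  have he₁ : ∀ᵐ x : E3, w₁ (direction (x - c)) = u₁ (directionSph (x - c)) := by
    filter_upwards [ae_directionSph hm₁.ae_eq_mk c, hx0] with x hx hxc
    rw [← coe_directionSph (sub_ne_zero.2 hxc)]
    exact hx
  have he₂ : ∀ᵐ x : E3, w₂ (direction (x - c)) = u₂ (directionSph (x - c)) := by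
    filter_upwards [ae_directionSph hm₂.ae_eq_mk c, hx0] with x hx hxc
    rw [← coe_directionSph (sub_ne_zero.2 hxc)]
    exact hx
  set g : Sph → ℝ≥0∞ := s.indicator fun θ => ‖u₁ θ - u₂ θ‖ₑ ^ 2 with hg
  have hgm : Measurable g := ((hum₁.sub hum₂).enorm.pow_const 2).indicator hs
  set T : (E3 → ℂ) → ℝ → ℝ≥0∞ := fun w ε =>
    (∫⁻ x in A ∩ {x | |‖x - c‖ - R| < ε}, ‖f x - w (direction (x - c))‖ₑ ^ 2) / ENNReal.ofReal ε
    with hT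
  -- The half shell `p < |x - c| < p + ε` over `s` lies both in `A` and in the shell `| |x - c| - R
  -- | < ε`. The integral of `|w₁ - w₂|²` over it is at least `(R/2)² ε` times the integral over
  -- `s`, and by the parallelogram inequality at most twice the sum of the deviations of `f` from
  -- the two traces. After division by `ε` the latter tends to zero.
  have key : ∀ᶠ ε in 𝓝[>] (0 : ℝ), ENNReal.ofReal ((R / 2) ^ 2) * ∫⁻ θ, g θ ∂surf ≤
      2 * (T w₁ ε + T w₂ ε) := by
    filter_upwards [Ioo_mem_nhdsGT (lt_min hε₁ (half_pos hR))] with ε hε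
    have hεR : ε < R / 2 := hε.2.trans_le (min_le_right _ _)
    obtain ⟨p, hp1, hp2, hp3⟩ := hseg ε ⟨hε.1, hε.2.trans_le (min_le_left _ _)⟩
    have hp0 : R / 2 ≤ p := by linarith
    set B := A ∩ {x : E3 | |‖x - c‖ - R| < ε} with hB
    have hBm : MeasurableSet B := hA.inter (measurableSet_lt (by fun_prop) measurable_const)
    have hfB : AEMeasurable f (volume.restrict B) :=
      (hf.mono_measure (Measure.restrict_mono Set.inter_subset_left le_rfl)).aemeasurable
    have hd₁ : AEMeasurable (fun x => u₁ (directionSph (x - c))) (volume.restrict B) :=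
      (hum₁.comp (measurable_directionSph.comp (by fun_prop))).aemeasurable
    have h3 : ∫⁻ x in {x : E3 | ‖x - c‖ ∈ Set.Ioo p (p + ε)}, g (directionSph (x - c)) ≤
        2 * ((∫⁻ x in B, ‖f x - w₁ (direction (x - c))‖ₑ ^ 2) +
          ∫⁻ x in B, ‖f x - w₂ (direction (x - c))‖ₑ ^ 2) := by
      calc ∫⁻ x in {x : E3 | ‖x - c‖ ∈ Set.Ioo p (p + ε)}, g (directionSph (x - c))
          ≤ ∫⁻ x in B, ‖u₁ (directionSph (x - c)) - u₂ (directionSph (x - c))‖ₑ ^ 2 := by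
            have hm : MeasurableSet {x : E3 | ‖x - c‖ ∈ Set.Ioo p (p + ε)} :=
              measurableSet_Ioo.preimage (by fun_prop)
            rw [← lintegral_indicator hm,
              ← lintegral_indicator hBm]
            refine lintegral_mono fun x => ?_
            by_cases hx : ‖x - c‖ ∈ Set.Ioo p (p + ε)
            · rw [Set.indicator_of_mem (show x ∈ {x : E3 | ‖x - c‖ ∈ Set.Ioo p (p + ε)} from hx)]
              by_cases hxs : directionSph (x - c) ∈ s
              · have hxc : x - c ≠ 0 := norm_pos_iff.1 (by linarith [hx.1])
                have hxB : x ∈ B := by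
                  have h4 := hx.1
                  have h5 := hx.2
                  have h6 : |‖x - c‖ - R| < ε := abs_lt.2 ⟨by linarith, by linarith⟩
                  refine ⟨?_, h6⟩
                  have := hp3 _ hxs _ hx
                  rwa [coe_directionSph hxc, norm_smul_direction, add_sub_cancel] at this
                rw [Set.indicator_of_mem hxB, hg, Set.indicator_of_mem hxs]
              · rw [hg, Set.indicator_of_notMem hxs]
                exact zero_le
            · rw [Set.indicator_of_notMem
                (show x ∉ {x : E3 | ‖x - c‖ ∈ Set.Ioo p (p + ε)} from hx)]
              exact zero_le
        _ ≤ ∫⁻ x in B, 2 * (‖f x - u₁ (directionSph (x - c))‖ₑ ^ 2 +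
              ‖f x - u₂ (directionSph (x - c))‖ₑ ^ 2) := by
            refine lintegral_mono fun x => ?_
            have e : u₁ (directionSph (x - c)) - u₂ (directionSph (x - c)) =
                (f x - u₂ (directionSph (x - c))) - (f x - u₁ (directionSph (x - c))) := by ring
            rw [e, ← ofReal_norm_eq_enorm, ← ofReal_norm_eq_enorm, ← ofReal_norm_eq_enorm,
              ← ENNReal.ofReal_pow (norm_nonneg _), ← ENNReal.ofReal_pow (norm_nonneg _),
              ← ENNReal.ofReal_pow (norm_nonneg _), ← ENNReal.ofReal_add (by positivity)
              (by positivity),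
              show ∀ y, 2 * ENNReal.ofReal y = ENNReal.ofReal (2 * y) from fun y => by
                rw [ENNReal.ofReal_mul (by norm_num), ENNReal.ofReal_ofNat]]
            refine ENNReal.ofReal_le_ofReal ?_
            have h4 := norm_sub_le (f x - u₂ (directionSph (x - c)))
              (f x - u₁ (directionSph (x - c)))
            have h5 := pow_le_pow_left₀ (norm_nonneg _) h4 2
            refine h5.trans ?_
            nlinarith [sq_nonneg (‖f x - u₂ (directionSph (x - c))‖ -
              ‖f x - u₁ (directionSph (x - c))‖)]
        _ = 2 * ((∫⁻ x in B, ‖f x - u₁ (directionSph (x - c))‖ₑ ^ 2) +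
              ∫⁻ x in B, ‖f x - u₂ (directionSph (x - c))‖ₑ ^ 2) := by
            have hae : AEMeasurable (fun x => ‖f x - u₁ (directionSph (x - c))‖ₑ ^ 2)
              (volume.restrict B) := (hfB.sub hd₁).enorm.pow_const 2
            rw [lintegral_const_mul' _ _ (by simp), lintegral_add_left' hae]
        _ = _ := by
            congr 2
            · refine lintegral_congr_ae (ae_restrict_of_ae ?_)
              filter_upwards [he₁] with x hx
              rw [hx]
            · refine lintegral_congr_ae (ae_restrict_of_ae ?_)
              filter_upwards [he₂] with x hx
              rw [hx]
    rw [lintegral_shell_mul hgm p (p + ε) (by linarith)] at h3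
    have h6 : ENNReal.ofReal ((R / 2) ^ 2) * ENNReal.ofReal ε ≤
        ∫⁻ r in Set.Ioo p (p + ε), ENNReal.ofReal (r ^ 2) := by
      calc _ = ∫⁻ _ in Set.Ioo p (p + ε), ENNReal.ofReal ((R / 2) ^ 2) := by
            rw [setLIntegral_const, Real.volume_Ioo, add_sub_cancel_left]
        _ ≤ _ := setLIntegral_mono (by fun_prop) fun r hr =>
            ENNReal.ofReal_le_ofReal (pow_le_pow_left₀ (by positivity) (hp0.trans hr.1.le) 2)
    have h7 := (mul_le_mul_left h6 (∫⁻ θ, g θ ∂surf)).trans h3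
    have hε0 : ENNReal.ofReal ε ≠ 0 := (ENNReal.ofReal_pos.2 hε.1).ne'
    simp only [hT]
    rw [← ENNReal.add_div, ← mul_div_assoc, ENNReal.le_div_iff_mul_le (Or.inl hε0)
      (Or.inl ENNReal.ofReal_ne_top)]
    refine le_trans (le_of_eq ?_) h7
    ring
  have hlim : Tendsto (fun ε => 2 * (T w₁ ε + T w₂ ε)) (𝓝[>] 0) (𝓝 0) := by
    have := ENNReal.Tendsto.const_mul (a := 2) (ht₁.add ht₂) (Or.inr (by simp))
    simpa using this
  have h0 : ENNReal.ofReal ((R / 2) ^ 2) * ∫⁻ θ, g θ ∂surf ≤ 0 := ge_of_tendsto hlim key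
  have h0' : ∫⁻ θ, g θ ∂surf = 0 := by
    rcases mul_eq_zero.1 (le_antisymm h0 zero_le) with h | h
    · exact absurd h (ENNReal.ofReal_pos.2 (by positivity)).ne'
    · exact h
  rw [lintegral_eq_zero_iff hgm] at h0'
  rw [ae_restrict_iff' hs]
  filter_upwards [h0', hm₁.ae_eq_mk, hm₂.ae_eq_mk] with θ hθ hθ₁ hθ₂ hθs
  rw [hg, Set.indicator_of_mem hθs] at hθ
  have h8 : u₁ θ - u₂ θ = 0 := by simpa using hθ
  rw [hθ₁, hθ₂]
  exact sub_eq_zero.1 h8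

open scoped Pointwise in
-- The surface measure of a set is proportional to the volume of the cone over it, and the cone over
-- a point lies in a line.
theorem surf_singleton (θ : Sph) : surf {θ} = 0 := by
  rw [Measure.toSphere_apply' _ (measurableSet_singleton θ)]
  have hsub : Set.Ioo (0 : ℝ) 1 • (Subtype.val '' ({θ} : Set Sph)) ⊆
      ((Submodule.span ℝ {(θ : E3)} : Submodule ℝ E3) : Set E3) := by
    rintro _ ⟨r, -, _, ⟨t, ht, rfl⟩, rfl⟩
    rw [Set.mem_singleton_iff.1 ht]
    exact Submodule.smul_mem _ _ (Submodule.mem_span_singleton_self _)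
  rw [measure_mono_null hsub, mul_zero]
  refine Measure.addHaar_submodule _ _ fun h => ?_
  have h1 := finrank_span_singleton (K := ℝ) (v := (θ : E3)) (by
    rw [← norm_ne_zero_iff, norm_sph]; exact one_ne_zero)
  rw [h, finrank_top, finrank_E3] at h1
  omega

end Traces

/-! ### Weighted bounds and square integrability. -/

/-- `f` is `C¹` on `U`, and on `A` it is dominated by `w₀` and its derivative by `w₁`. -/
structure C1Bound (U A : Set E3) (w₀ w₁ : E3 → ℝ) (f : E3 → ℂ) : Prop where
  contDiffOn : ContDiffOn ℝ 1 f U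
  bound : ∃ C : ℝ, ∀ x ∈ A, ‖f x‖ ≤ C * w₀ x ∧ ‖fderiv ℝ f x‖ ≤ C * w₁ x

section C1Bound

variable {U A : Set E3} {w₀ w₁ : E3 → ℝ}

theorem C1Bound.sum {ι : Type*} [Fintype ι] (hU : IsOpen U) (hA : A ⊆ U) {f : ι → E3 → ℂ}
    (h : ∀ i, C1Bound U A w₀ w₁ (f i)) (a : ι → ℂ) :
    C1Bound U A w₀ w₁ fun x => ∑ i, a i * f i x := by
  refine ⟨ContDiffOn.sum fun i _ => contDiffOn_const.mul (h i).contDiffOn, ?_⟩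
  choose C hC using fun i => (h i).bound
  refine ⟨∑ i, ‖a i‖ * C i, fun x hx => ⟨?_, ?_⟩⟩
  · refine (norm_sum_le _ _).trans ?_
    rw [Finset.sum_mul]
    refine Finset.sum_le_sum fun i _ => ?_
    rw [norm_mul, mul_assoc]
    exact mul_le_mul_of_nonneg_left (hC i x hx).1 (norm_nonneg _)
  · have hd : ∀ i, DifferentiableAt ℝ (f i) x := fun i =>
      ((h i).contDiffOn.contDiffAt (hU.mem_nhds (hA hx))).differentiableAt (by norm_num)
    have e : fderiv ℝ (fun x => ∑ i, a i * f i x) x = ∑ i, a i • fderiv ℝ (f i) x := by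
      rw [fderiv_fun_sum fun i _ => (hd i).const_mul (a i)]
      exact Finset.sum_congr rfl fun i _ => fderiv_const_mul (hd i) _
    rw [e]
    refine (norm_sum_le _ _).trans ?_
    rw [Finset.sum_mul]
    refine Finset.sum_le_sum fun i _ => ?_
    rw [norm_smul, mul_assoc]
    exact mul_le_mul_of_nonneg_left (hC i x hx).2 (norm_nonneg _)

theorem C1Bound.memLp (hA : A ⊆ U) (hAm : MeasurableSet A)
    (hw : MemLp w₀ 2 (volume.restrict A)) {f : E3 → ℂ} (h : C1Bound U A w₀ w₁ f) :
    MemLp f 2 (volume.restrict A) := by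
  obtain ⟨C, hC⟩ := h.bound
  refine (hw.const_mul C).mono' ((h.contDiffOn.continuousOn.mono hA).aestronglyMeasurable hAm) ?_
  exact ae_restrict_of_forall_mem hAm fun x hx => (hC x hx).1

theorem C1Bound.memLp_fderiv (hU : IsOpen U) (hA : A ⊆ U) (hAm : MeasurableSet A)
    (hw : MemLp w₁ 2 (volume.restrict A)) {f : E3 → ℂ} (h : C1Bound U A w₀ w₁ f) (i : Fin 3) :
    MemLp (fun x => fderiv ℝ f x (EuclideanSpace.single i 1)) 2 (volume.restrict A) := by
  obtain ⟨C, hC⟩ := h.bound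
  have hc : ContinuousOn (fun x => fderiv ℝ f x (EuclideanSpace.single i 1)) A :=
    ((h.contDiffOn.continuousOn_fderiv_of_isOpen hU (by norm_num)).clm_apply
      continuousOn_const).mono hA
  refine (hw.const_mul C).mono' (hc.aestronglyMeasurable hAm) ?_
  refine ae_restrict_of_forall_mem hAm fun x hx => ?_
  refine ((fderiv ℝ f x).le_opNorm _).trans ?_
  rw [EuclideanSpace.norm_single, norm_one, mul_one]
  exact (hC x hx).2

end C1Bound

theorem memLp_decay (A : Set E3) :
    MemLp (fun x : E3 => ((1 + ‖x‖) ^ 2)⁻¹) 2 (volume.restrict A) := by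
  refine MemLp.restrict _ ?_
  have hm : Continuous fun x : E3 => ((1 + ‖x‖) ^ 2)⁻¹ := by
    refine Continuous.inv₀ (by fun_prop) fun x => ?_
    positivity
  rw [memLp_two_iff_integrable_sq hm.aestronglyMeasurable]
  have h := integrable_one_add_norm (E := E3) (μ := volume) (r := 4) (by rw [finrank_E3]; norm_num)
  refine h.congr (Eventually.of_forall fun x => ?_)
  have h0 : (0 : ℝ) ≤ 1 + ‖x‖ := by positivity
  simp only
  rw [Real.rpow_neg h0, inv_pow, ← pow_mul, ← Real.rpow_natCast]
  norm_num

theorem memLp_norm_inv (c : E3) (r : ℝ) :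
    MemLp (fun x : E3 => ‖x - c‖⁻¹) 2 (volume.restrict (Metric.ball c r)) := by
  have hm : Measurable fun x : E3 => ‖x - c‖⁻¹ := by fun_prop
  rw [memLp_two_iff_integrable_sq hm.aestronglyMeasurable]
  have h0 : IntegrableOn (fun x : E3 => (‖x‖⁻¹) ^ 2) (Metric.ball 0 r) := by
    rw [integrableOn_fun_norm_addHaar volume (f := fun y => (y⁻¹) ^ 2), finrank_E3]
    refine IntegrableOn.congr_fun (f := fun y : ℝ => 1)
      (continuous_const.integrableOn_Icc.mono_set Set.Ioo_subset_Icc_self) (fun y hy => ?_)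
      measurableSet_Ioo
    have := hy.1.ne'
    simp only [smul_eq_mul]
    field_simp
  change IntegrableOn _ _ _
  rw [← integrable_indicator_iff measurableSet_ball] at h0 ⊢
  refine (h0.comp_sub_right c).congr (Eventually.of_forall fun x => ?_)
  simp only [Set.indicator, mem_ball_iff_norm, sub_zero]

theorem restrict_ball_diff (c : E3) (r : ℝ) : (volume : Measure E3).restrict (Metric.ball c r \ {c}) =
    volume.restrict (Metric.ball c r) :=
  Measure.restrict_congr_set (sdiff_null_ae_eq_self (measure_singleton c))

section RadialSite

variable {c : E3} {R : ℝ} {χ : ℝ → ℂ}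

theorem norm_sub_mem_Ioo {x : E3} (hx : x ∈ Metric.ball c R \ {c}) : ‖x - c‖ ∈ Set.Ioo 0 R :=
  ⟨norm_pos_iff.2 (sub_ne_zero.2 hx.2), mem_ball_iff_norm.1 hx.1⟩

/-- The weight `1/|x - c|` for the gradient arises twice, from the angular factor and from the bound
on `χ'`; it is square integrable near a point of three-space. -/
theorem c1Bound_radialWave (hχ : ContDiffOn ℝ 1 χ (Set.Ioo 0 R))
    (hb : ∃ C, ∀ r ∈ Set.Ioo 0 R, ‖χ r‖ ≤ C) (hd : ∃ C, ∀ r ∈ Set.Ioo 0 R, ‖deriv χ r‖ ≤ C / r)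
    (ℓ : ℕ) (m : ℤ) :
    C1Bound (Metric.ball c R \ {c}) (Metric.ball c R \ {c}) (fun _ => 1) (fun x => ‖x - c‖⁻¹)
      fun x => radialWave χ ℓ m (x - c) := by
  refine ⟨?_, ?_⟩
  · exact (contDiffOn_radialWave (fun r hr => hr.1) hχ).comp (by fun_prop) fun x hx =>
      norm_sub_mem_Ioo hx
  · obtain ⟨C, hC0, hC⟩ := exists_norm_fderiv_radialWave_le ℓ m
    obtain ⟨C₁, h₁⟩ := hb
    obtain ⟨C₂, h₂⟩ := hd
    refine ⟨C * (|C₁| + |C₂|), fun x hx => ?_⟩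
    have hr := norm_sub_mem_Ioo hx
    have hb1 : ‖χ ‖x - c‖‖ ≤ |C₁| := (h₁ _ hr).trans (le_abs_self _)
    refine ⟨((hC χ (x - c)).1).trans ?_, ?_⟩
    · rw [mul_one]
      exact mul_le_mul_of_nonneg_left (by linarith [abs_nonneg C₂]) hC0
    · have hder : HasDerivAt χ (deriv χ ‖x - c‖) ‖x - c‖ :=
        ((hχ.differentiableOn (by norm_num) _ hr).differentiableAt
          (Ioo_mem_nhds hr.1 hr.2)).hasDerivAt
      rw [fderiv_comp_sub (f := radialWave χ ℓ m)]
      refine ((hC χ (x - c)).2 _ (norm_pos_iff.1 hr.1) hder).trans ?_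
      rw [mul_assoc]
      refine mul_le_mul_of_nonneg_left ?_ hC0
      have h3 := h₂ _ hr
      rw [add_mul, ← div_eq_mul_inv, ← div_eq_mul_inv]
      refine add_le_add (div_le_div_of_nonneg_right hb1 hr.1.le) (h3.trans ?_)
      exact div_le_div_of_nonneg_right (le_abs_self _) hr.1.le

end RadialSite

section RegularSolution

variable {v : ℝ → ℝ} {R z : ℝ} {ℓ : ℕ} {χ : ℝ → ℂ}

theorem IsRegularRadialSolution.tendsto_left (hR : 0 < R) (h : IsRegularRadialSolution v R ℓ z χ) :
    Tendsto χ (𝓝[<] R) (𝓝 (χ R)) := by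
  have h1 := h.contDiffOn.continuousOn R ⟨hR, le_rfl⟩
  rw [← nhdsWithin_Ioo_eq_nhdsLT hR]
  exact h1.mono_left (nhdsWithin_mono _ Set.Ioo_subset_Ioc_self)

/-- Continuity of the derivative up to the end point makes the left derivative at `R` the boundary
value of `χ'`, which is what the trace of the radial derivative sees. -/
theorem IsRegularRadialSolution.tendsto_deriv_left (hR : 0 < R)
    (h : IsRegularRadialSolution v R ℓ z χ) :
    Tendsto (deriv χ) (𝓝[<] R) (𝓝 (leftDeriv χ R)) := by
  have h1 := h.contDiffOn.continuousOn_derivWithin (uniqueDiffOn_Ioc 0 R) le_rfl R ⟨hR, le_rfl⟩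
  have e : derivWithin χ (Set.Ioc 0 R) R = leftDeriv χ R := by
    refine derivWithin_congr_set ?_
    filter_upwards [Ioi_mem_nhds hR] with y hy
    exact propext ⟨fun h => h.2, fun h => ⟨hy, h⟩⟩
  rw [ContinuousWithinAt, e] at h1
  rw [← nhdsWithin_Ioo_eq_nhdsLT hR]
  refine (h1.mono_left (nhdsWithin_mono _ Set.Ioo_subset_Ioc_self)).congr' ?_
  filter_upwards [self_mem_nhdsWithin] with y hy
  exact derivWithin_of_mem_nhds (Ioc_mem_nhds hy.1 hy.2)

end RegularSolution

/-! ### Regions of a muffin-tin system and piecewise `C¹` functions. -/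

namespace MuffinTin

variable {N : ℕ} (T : MuffinTin N)

theorem radius_lt_dist_of_mem_atom {n n' : Fin N} (hn : n' ≠ n) {x : E3} (hx : x ∈ T.atom n) :
    T.radius n' < dist x (T.center n') := by
  have h1 := T.nonoverlapping n n' hn.symm
  have h2 := dist_triangle_left (T.center n) (T.center n') x
  have h3 : dist x (T.center n) < T.radius n := Metric.mem_ball.1 hx
  linarith

theorem isOpen_atom (n : Fin N) : IsOpen (T.atom n) := Metric.isOpen_ball

theorem isOpen_interstitial : IsOpen T.interstitial := by
  have e : T.interstitial = ⋂ n, {x : E3 | T.radius n < dist x (T.center n)} := by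
    ext x
    simp [interstitial]
  rw [e]
  exact isOpen_iInter_of_finite fun n => isOpen_lt continuous_const (by fun_prop)

theorem notMem_atom_of_mem_interstitial {x : E3} (hx : x ∈ T.interstitial) (n : Fin N) :
    x ∉ T.atom n := fun h => lt_asymm (hx n) (Metric.mem_ball.1 h)

theorem notMem_atom_of_ne {n n' : Fin N} (hn : n' ≠ n) {x : E3} (hx : x ∈ T.atom n) :
    x ∉ T.atom n' := fun h =>
  lt_asymm (T.radius_lt_dist_of_mem_atom hn hx) (Metric.mem_ball.1 h)

theorem ae_mem_region : ∀ᵐ x : E3, x ∈ T.interstitial ∨ ∃ n, x ∈ T.atom n := by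
  have h0 : volume (⋃ n, Metric.sphere (T.center n) (T.radius n)) = 0 :=
    measure_iUnion_null fun n => Measure.addHaar_sphere _ _ _
  refine measure_mono_null (fun x hx => ?_) h0
  by_contra hs
  refine hx ?_
  by_cases h : ∃ n, x ∈ T.atom n
  · exact Or.inr h
  · refine Or.inl fun n => ?_
    have h1 : ¬ dist x (T.center n) < T.radius n := fun h' => h ⟨n, Metric.mem_ball.2 h'⟩
    have h2 : dist x (T.center n) ≠ T.radius n := fun h' =>
      hs (Set.mem_iUnion.2 ⟨n, Metric.mem_sphere.2 h'⟩)
    exact lt_of_le_of_ne (not_lt.1 h1) h2.symm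

theorem continuousOn_pot (n : Fin N) : ContinuousOn (T.pot n) (Set.Ioo 0 (T.radius n)) :=
  (T.pot_smooth n).continuousOn

/-- Inside the `n`-th ball the total potential reduces to `vₙ`, so polar coordinates turn `V ∈ L²`
into integrability of `t² vₙ(t)²`, and `|t vₙ(t)| ≤ 1 + t² vₙ(t)²`. -/
theorem integrableOn_mul_pot (n : Fin N) :
    IntegrableOn (fun t => t * T.pot n t) (Set.Ioo 0 (T.radius n)) := by
  have h1 : IntegrableOn (fun x : E3 => (T.pot n ‖x - T.center n‖) ^ 2) (T.atom n) := by
    refine IntegrableOn.congr_fun T.pot_memLp.integrable_sq.integrableOn (fun x hx => ?_)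
      (T.isOpen_atom n).measurableSet
    rw [Finset.sum_eq_single n]
    · intro n' _ hn
      refine T.pot_support n' _ ?_
      rw [← dist_eq_norm]
      exact T.radius_lt_dist_of_mem_atom hn hx
    · exact fun h => absurd (Finset.mem_univ n) h
  have h2 : IntegrableOn (fun x : E3 => (T.pot n ‖x‖) ^ 2) (Metric.ball 0 (T.radius n)) := by
    rw [atom, ← integrable_indicator_iff measurableSet_ball] at h1
    rw [← integrable_indicator_iff measurableSet_ball]
    refine (h1.comp_add_right (T.center n)).congr (Eventually.of_forall fun x => ?_)
    simp only [Set.indicator, mem_ball_iff_norm, sub_zero, add_sub_cancel_right]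
  rw [integrableOn_fun_norm_addHaar volume (f := fun y => (T.pot n y) ^ 2), finrank_E3] at h2
  have h3 : IntegrableOn (fun _ : ℝ => (1 : ℝ)) (Set.Ioo 0 (T.radius n)) :=
    continuous_const.integrableOn_Icc.mono_set Set.Ioo_subset_Icc_self
  refine Integrable.mono' (h2.add h3)
    ((continuousOn_id.mul (T.continuousOn_pot n)).aestronglyMeasurable measurableSet_Ioo)
    (Eventually.of_forall fun t => ?_)
  rw [Real.norm_eq_abs]
  simp only [Pi.add_apply, smul_eq_mul]
  have := sq_nonneg (|t * T.pot n t| - 1)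
  have h4 := sq_abs (t * T.pot n t)
  have h5 : t ^ (3 - 1) * T.pot n t ^ 2 = (t * T.pot n t) ^ 2 := by ring
  rw [h5]
  nlinarith [abs_nonneg (t * T.pot n t)]

/-- The function given by `out` in the interstitial region and by `inn n` in the `n`-th atomic
sphere. -/
def glue (out : E3 → ℂ) (inn : Fin N → E3 → ℂ) (x : E3) : ℂ :=
  T.interstitial.indicator out x + ∑ n, (T.atom n).indicator (inn n) x

variable {T} in
theorem glue_of_mem_interstitial {out : E3 → ℂ} {inn : Fin N → E3 → ℂ} {x : E3}
    (hx : x ∈ T.interstitial) : T.glue out inn x = out x := by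
  rw [glue, Set.indicator_of_mem hx, Finset.sum_eq_zero, add_zero]
  exact fun n _ => Set.indicator_of_notMem (T.notMem_atom_of_mem_interstitial hx n) _

variable {T} in
theorem glue_of_mem_atom {out : E3 → ℂ} {inn : Fin N → E3 → ℂ} {n : Fin N} {x : E3}
    (hx : x ∈ T.atom n) : T.glue out inn x = inn n x := by
  rw [glue, Set.indicator_of_notMem fun h => T.notMem_atom_of_mem_interstitial h n hx,
    Finset.sum_eq_single n, Set.indicator_of_mem hx, zero_add]
  · exact fun n' _ hn => Set.indicator_of_notMem (T.notMem_atom_of_ne hn hx) _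
  · exact fun h => absurd (Finset.mem_univ n) h

theorem memLp_glue {out : E3 → ℂ} {inn : Fin N → E3 → ℂ}
    (ho : MemLp out 2 (volume.restrict T.interstitial))
    (hi : ∀ n, MemLp (inn n) 2 (volume.restrict (T.atom n))) : MemLp (T.glue out inn) 2 volume := by
  have h1 := (memLp_indicator_iff_restrict T.isOpen_interstitial.measurableSet).2 ho
  have h2 := memLp_finsetSum Finset.univ fun n _ =>
    (memLp_indicator_iff_restrict (T.isOpen_atom n).measurableSet).2 (hi n)
  exact h1.add h2

/-- The complement of the atomic positions. -/
def awayFromCenters : Set E3 := {x | ∀ n, x ≠ T.center n}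

theorem isOpen_awayFromCenters : IsOpen T.awayFromCenters := by
  have e : T.awayFromCenters = ⋂ n, {T.center n}ᶜ := by
    ext x
    simp [awayFromCenters]
  rw [e]
  exact isOpen_iInter_of_finite fun n => isOpen_compl_singleton

theorem interstitial_subset_awayFromCenters : T.interstitial ⊆ T.awayFromCenters := fun x hx n h => by
  have h1 := hx n
  rw [h, dist_self] at h1
  exact lt_asymm h1 (T.radius_pos n)

/-- Piecewise `C¹` functions which decay in the interstitial region and have at most a mild
singularity at the atomic positions. -/
structure IsPiecewise (out : E3 → ℂ) (inn : Fin N → E3 → ℂ) : Prop where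
  out : C1Bound T.awayFromCenters T.interstitial (fun x => ((1 + ‖x‖) ^ 2)⁻¹)
    (fun x => ((1 + ‖x‖) ^ 2)⁻¹) out
  inn : ∀ n, C1Bound (T.atom n \ {T.center n}) (T.atom n \ {T.center n}) (fun _ => 1)
    (fun x => ‖x - T.center n‖⁻¹) (inn n)

/-- The gradient of a piecewise `C¹` function. -/
def pieceGrad (out : E3 → ℂ) (inn : Fin N → E3 → ℂ) (x : E3) (i : Fin 3) : ℂ :=
  T.glue (fun x => fderiv ℝ out x (EuclideanSpace.single i 1))
    (fun n x => fderiv ℝ (inn n) x (EuclideanSpace.single i 1)) x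

variable {T}

theorem isOpen_atom_diff (n : Fin N) : IsOpen (T.atom n \ {T.center n}) :=
  (T.isOpen_atom n).sdiff isClosed_singleton

theorem IsPiecewise.memLp {out : E3 → ℂ} {inn : Fin N → E3 → ℂ} (h : T.IsPiecewise out inn) :
    MemLp (T.glue out inn) 2 volume := by
  refine T.memLp_glue (h.out.memLp T.interstitial_subset_awayFromCenters
    T.isOpen_interstitial.measurableSet (memLp_decay _)) fun n => ?_
  have := (h.inn n).memLp subset_rfl (isOpen_atom_diff n).measurableSet (by
    rw [atom, restrict_ball_diff]
    have : IsFiniteMeasure ((volume : Measure E3).restrict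
      (Metric.ball (T.center n) (T.radius n))) := ⟨by
        rw [Measure.restrict_apply_univ]; exact measure_ball_lt_top⟩
    exact memLp_const 1)
  rwa [atom, restrict_ball_diff] at this

theorem IsPiecewise.memLp_pieceGrad {out : E3 → ℂ} {inn : Fin N → E3 → ℂ}
    (h : T.IsPiecewise out inn) (i : Fin 3) :
    MemLp (fun x => T.pieceGrad out inn x i) 2 volume := by
  refine T.memLp_glue (h.out.memLp_fderiv T.isOpen_awayFromCenters
    T.interstitial_subset_awayFromCenters T.isOpen_interstitial.measurableSet (memLp_decay _) i)
    fun n => ?_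
  have := (h.inn n).memLp_fderiv (isOpen_atom_diff n) subset_rfl (isOpen_atom_diff n).measurableSet
    (by rw [atom, restrict_ball_diff]; exact memLp_norm_inv _ _) i
  rwa [atom, restrict_ball_diff] at this

/-- In the interstitial region the function is `C¹` and the derivative is classical. In an atom the
centre is removed, and the bounds of `IsPiecewise` are those under which a point singularity is
invisible to weak derivatives. -/
theorem IsPiecewise.isBrokenGradient {out : E3 → ℂ} {inn : Fin N → E3 → ℂ}
    (h : T.IsPiecewise out inn) {f : E3 → ℂ}
    (hfo : ∀ᵐ x ∂volume.restrict T.interstitial, f x = out x)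
    (hfi : ∀ n, ∀ᵐ x ∂volume.restrict (T.atom n), f x = inn n x) :
    T.IsBrokenGradient f (T.pieceGrad out inn) := by
  refine fun i => ⟨h.memLp_pieceGrad i, ?_, fun n => ?_⟩
  · refine HasWeakPartialOn.congr T.isOpen_interstitial (hasWeakPartialOn_of_contDiffOn
      T.isOpen_interstitial (h.out.contDiffOn.mono T.interstitial_subset_awayFromCenters) i) hfo ?_
    exact ae_restrict_of_forall_mem T.isOpen_interstitial.measurableSet fun x hx =>
      glue_of_mem_interstitial hx
  · obtain ⟨C, hC⟩ := (h.inn n).bound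
    refine HasWeakPartialOn.congr (T.isOpen_atom n) (hasWeakPartialOn_of_punctured
      (T.isOpen_atom n) (h.inn n).contDiffOn (C := C) (fun x hx => ?_) (fun x hx => ?_) i)
      (hfi n) ?_
    · simpa using (hC x hx).1
    · simpa [div_eq_mul_inv] using (hC x hx).2
    · exact ae_restrict_of_forall_mem (T.isOpen_atom n).measurableSet fun x hx =>
        glue_of_mem_atom hx

end MuffinTin

/-! ### Explicit traces and their uniqueness. -/

/-- Only one-sided limits of the radial factors are used: near the sphere the deviation from the
boundary value is the radial deviation times a bounded angular factor. This covers values as well as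
radial derivatives. -/
theorem hasTraceFrom_ball_radialWave {c : E3} {R : ℝ} (hR : 0 < R) {ι : Type*} [Fintype ι]
    (a : ι → ℂ) {χ : ι → ℝ → ℂ} {χ₀ : ι → ℂ} (hχ : ∀ i, Tendsto (χ i) (𝓝[<] R) (𝓝 (χ₀ i)))
    (ℓ : ι → ℕ) (m : ι → ℤ) {f : E3 → ℂ}
    (hf : ∀ᵐ x ∂volume.restrict (Metric.ball c R),
      f x = ∑ i, a i * radialWave (χ i) (ℓ i) (m i) (x - c)) :
    HasTraceFrom (Metric.ball c R) c R f
      fun θ => ∑ i, a i * (χ₀ i * (sphericalHarmonic (ℓ i) (m i) θ : ℂ)) := by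
  refine hasTraceFrom_of_approx hR measurableSet_ball ?_ fun η hη => ?_
  · exact continuous_finsetSum _ fun i _ =>
      continuous_const.mul (continuous_const.mul (continuous_sphericalHarmonic_sph _ _))
  · choose C hC0 hC using fun i => exists_angular_bound (ℓ i) (m i)
    have hlim : Tendsto (fun r => ∑ i, ‖a i‖ * (‖χ i r - χ₀ i‖ * C i)) (𝓝[<] R) (𝓝 0) := by
      have h1 : Tendsto (fun r => ∑ i, ‖a i‖ * (‖χ i r - χ₀ i‖ * C i)) (𝓝[<] R)
          (𝓝 (∑ i, ‖a i‖ * (‖χ₀ i - χ₀ i‖ * C i))) :=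
        tendsto_finsetSum _ fun i _ =>
          ((((hχ i).sub_const _).norm).mul_const _).const_mul _
      simpa using h1
    obtain ⟨l, hl, hlR⟩ := (mem_nhdsLT_iff_exists_Ioo_subset).1 (hlim.eventually (gt_mem_nhds hη))
    refine ⟨R - l, sub_pos.2 hl, ?_⟩
    filter_upwards [hf, ae_restrict_mem measurableSet_ball] with x hx hxb hxε
    have hr : ‖x - c‖ ∈ Set.Ioo l R :=
      ⟨by linarith [(abs_lt.1 hxε).1], mem_ball_iff_norm.1 hxb⟩
    refine le_trans ?_ (hlR hr).le
    rw [hx, ← Finset.sum_sub_distrib]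
    refine (norm_sum_le _ _).trans (Finset.sum_le_sum fun i _ => ?_)
    rw [radialWave, ← mul_sub, ← sub_mul, norm_mul, norm_mul]
    exact mul_le_mul_of_nonneg_left (mul_le_mul_of_nonneg_left (hC i _).1 (norm_nonneg _))
      (norm_nonneg _)

theorem sum_coord_mul_fderiv (D : E3 →L[ℝ] ℂ) (v : E3) :
    ∑ i, (v i : ℂ) * D (EuclideanSpace.single i 1) = D v := by
  have hv : v = ∑ i, v i • EuclideanSpace.single i (1 : ℝ) := by
    ext j
    simp [Fin.sum_univ_three]
    fin_cases j <;> simp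
  conv_rhs => rw [hv, map_sum]
  refine Finset.sum_congr rfl fun i _ => ?_
  rw [map_smul, Complex.real_smul]

theorem ae_ne_direction (d : E3) : ∀ᵐ θ : Sph ∂surf, (θ : E3) ≠ d := by
  by_cases hd : ∃ θ : Sph, (θ : E3) = d
  · obtain ⟨θ₀, rfl⟩ := hd
    refine measure_mono_null (fun θ hθ => ?_) (surf_singleton θ₀)
    exact Subtype.ext (not_not.1 hθ)
  · exact Eventually.of_forall fun θ h => hd ⟨θ, h⟩

/-- Two balls touch in at most one point. -/
theorem eq_direction_of_touching {R R' : ℝ} (hR : 0 < R) (hR' : 0 < R') {d : E3}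
    (hd : R + R' ≤ ‖d‖) {θ : E3} (hθ : ‖θ‖ = 1) (h : ‖R • θ - d‖ ≤ R') : θ = direction d := by
  have hd0 : 0 < ‖d‖ := by linarith
  have h1 : ‖R • θ - d‖ ^ 2 ≤ (‖d‖ - R) ^ 2 :=
    pow_le_pow_left₀ (norm_nonneg _) (h.trans (by linarith)) 2
  rw [norm_sub_sq_real, norm_smul, hθ, mul_one, Real.norm_of_nonneg hR.le, inner_smul_left] at h1
  simp only [conj_trivial] at h1
  have h2 : ‖d‖ ≤ inner ℝ θ d := by
    have : R * ‖d‖ ≤ R * inner ℝ θ d := by nlinarith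
    exact le_of_mul_le_mul_left this hR
  have h3 := real_inner_le_norm θ d
  rw [hθ, one_mul] at h3
  have h4 : inner ℝ θ d = ‖θ‖ * ‖d‖ := by rw [hθ, one_mul]; exact le_antisymm h3 h2
  rw [inner_eq_norm_mul_iff_real, hθ, one_smul] at h4
  rw [direction, ← h4, smul_smul, norm_smul, hθ, mul_one, norm_norm,
    inv_mul_cancel₀ hd0.ne', one_smul]

namespace MuffinTin

variable {N : ℕ} {T : MuffinTin N}

theorem ae_eq_of_hasTraceFrom_atom {n : Fin N} {f w₁ w₂ : E3 → ℂ}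
    (hf : AEStronglyMeasurable f volume)
    (h₁ : HasTraceFrom (T.atom n) (T.center n) (T.radius n) f w₁)
    (h₂ : HasTraceFrom (T.atom n) (T.center n) (T.radius n) f w₂) :
    ∀ᵐ θ : Sph ∂surf, w₁ (θ : E3) = w₂ (θ : E3) := by
  have h := h₁.ae_eq_of_segment (T.radius_pos n) (T.isOpen_atom n).measurableSet hf.restrict h₂
    MeasurableSet.univ (T.radius_pos n) (fun ε hε => ⟨T.radius n - ε, le_rfl,
      by linarith [hε.1], fun θ _ r hr => ?_⟩)
  · rwa [Measure.restrict_univ] at h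
  · have hr0 : 0 < r := by linarith [hr.1, hε.2]
    rw [atom, mem_ball_iff_norm, add_sub_cancel_left, norm_smul_sph hr0]
    linarith [hr.2]

/-- Where another atomic sphere touches the `n`-th one, no outer shell of uniform thickness lies in
the interstitial region. The sphere is therefore exhausted by the sets `s k` of points with distance
at least `1/(k+1)` from the other balls, on each of which such a shell exists. The points that are
missed are touching points, at most one for each other ball, and form a null set. -/
theorem ae_eq_of_hasTraceFrom_interstitial {n : Fin N} {f w₁ w₂ : E3 → ℂ}
    (hf : AEStronglyMeasurable f volume)
    (h₁ : HasTraceFrom T.interstitial (T.center n) (T.radius n) f w₁)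
    (h₂ : HasTraceFrom T.interstitial (T.center n) (T.radius n) f w₂) :
    ∀ᵐ θ : Sph ∂surf, w₁ (θ : E3) = w₂ (θ : E3) := by
  set R := T.radius n with hR
  set c := T.center n with hc
  have hRp : 0 < R := T.radius_pos n
  set s : ℕ → Set Sph := fun k => {θ | ∀ n', n' ≠ n →
    T.radius n' + 1 / ((k : ℝ) + 1) ≤ dist (c + R • (θ : E3)) (T.center n')} with hs
  have hsm : ∀ k, MeasurableSet (s k) := fun k => by
    have e : s k = ⋂ n', {θ : Sph | n' ≠ n →
        T.radius n' + 1 / ((k : ℝ) + 1) ≤ dist (c + R • (θ : E3)) (T.center n')} := by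
      ext θ
      simp [hs]
    rw [e]
    refine MeasurableSet.iInter fun n' => ?_
    by_cases hn : n' = n
    · simp [hn]
    · simp only [ne_eq, hn, not_false_eq_true, true_imp_iff]
      exact (isClosed_le continuous_const (by fun_prop)).measurableSet
  have hk : ∀ k, ∀ᵐ θ : Sph ∂surf, θ ∈ s k → w₁ (θ : E3) = w₂ (θ : E3) := fun k => by
    rw [← ae_restrict_iff' (hsm k)]
    refine h₁.ae_eq_of_segment hRp T.isOpen_interstitial.measurableSet hf.restrict h₂
      (hsm k) (ε₁ := 1 / ((k : ℝ) + 1)) (by positivity) (fun ε hε => ⟨R, by linarith [hε.1],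
        le_rfl, fun θ hθ r hr n' => ?_⟩)
    have hr0 : 0 < r := hRp.trans hr.1
    by_cases hn : n' = n
    · rw [hn, dist_eq_norm, add_sub_cancel_left, norm_smul_sph hr0]
      exact hr.1
    · have h3 := hθ n' hn
      have h4 := dist_triangle_left (c + R • (θ : E3)) (T.center n') (c + r • (θ : E3))
      have h5 : dist (c + r • (θ : E3)) (c + R • (θ : E3)) = r - R := by
        rw [dist_eq_norm, add_sub_add_left_eq_sub, ← sub_smul, norm_smul, norm_sph, mul_one,
          Real.norm_of_nonneg (by linarith [hr.1])]
      have h6 := hr.2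
      have h7 := hε.2
      linarith
  have hgood : ∀ᵐ θ : Sph ∂surf, ∀ n', (θ : E3) ≠ direction (T.center n' - c) :=
    ae_all_iff.2 fun n' => ae_ne_direction _
  filter_upwards [ae_all_iff.2 hk, hgood] with θ h3 h4
  have h5 : ∀ᶠ k : ℕ in atTop, ∀ n', n' ≠ n →
      T.radius n' + 1 / ((k : ℝ) + 1) ≤ dist (c + R • (θ : E3)) (T.center n') := by
    rw [eventually_all]
    intro n'
    by_cases hn : n' = n
    · exact Eventually.of_forall fun k h => absurd hn h
    · have h6 : T.radius n' < dist (c + R • (θ : E3)) (T.center n') := by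
        by_contra h7
        refine h4 n' (eq_direction_of_touching hRp (T.radius_pos n') ?_ (norm_sph θ) ?_)
        · rw [← dist_eq_norm, dist_comm]
          exact T.nonoverlapping n n' (Ne.symm hn)
        · have e : R • (θ : E3) - (T.center n' - c) = c + R • (θ : E3) - T.center n' := by abel
          rw [e, ← dist_eq_norm]
          exact not_lt.1 h7
      have h8 : Tendsto (fun k : ℕ => T.radius n' + 1 / ((k : ℝ) + 1)) atTop
          (𝓝 (T.radius n' + 0)) := tendsto_one_div_add_atTop_nhds_zero_nat.const_add _
      rw [add_zero] at h8
      filter_upwards [h8.eventually (gt_mem_nhds h6)] with k hk' _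
      exact hk'.le
  obtain ⟨k, hk'⟩ := h5.exists
  exact h3 k hk'

/-- The definition asks for some pair of traces; by uniqueness almost everywhere the orthogonality
relations can be tested on any pair, in particular on the explicit one. -/
theorem isWeaklyContinuous_iff {L : ℕ} {n : Fin N} {f wIn wOut : E3 → ℂ}
    (hf : AEStronglyMeasurable f volume)
    (h₁ : HasTraceFrom (T.atom n) (T.center n) (T.radius n) f wIn)
    (h₂ : HasTraceFrom T.interstitial (T.center n) (T.radius n) f wOut) :
    T.IsWeaklyContinuous L n f ↔ ∀ ℓ ≤ L, ∀ m ∈ Finset.Icc (-(ℓ : ℤ)) (ℓ : ℤ),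
      sphereIntegral (fun θ => (wIn θ - wOut θ) * (sphericalHarmonic ℓ m θ : ℂ)) = 0 := by
  refine ⟨?_, fun h => ⟨wIn, wOut, h₁, h₂, h⟩⟩
  rintro ⟨u₁, u₂, hu₁, hu₂, h⟩ ℓ hℓ m hm
  rw [← h ℓ hℓ m hm]
  refine integral_congr_ae ?_
  filter_upwards [ae_eq_of_hasTraceFrom_atom hf h₁ hu₁,
    ae_eq_of_hasTraceFrom_interstitial hf h₂ hu₂] with θ h3 h4
  rw [h3, h4]

/-- An arbitrary broken gradient `G` is admitted. By uniqueness of weak derivatives it coincides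
almost everywhere with the classical gradient of the expansion. -/
theorem IsPiecewise.radialDeriv_ae_eq_interstitial {out : E3 → ℂ} {inn : Fin N → E3 → ℂ}
    (h : T.IsPiecewise out inn) {f : E3 → ℂ}
    (hfo : ∀ᵐ x ∂volume.restrict T.interstitial, f x = out x)
    (hfi : ∀ n, ∀ᵐ x ∂volume.restrict (T.atom n), f x = inn n x) {G : E3 → Fin 3 → ℂ}
    (hG : T.IsBrokenGradient f G) (n : Fin N) :
    ∀ᵐ x ∂volume.restrict T.interstitial,
      T.radialDeriv n G x = fderiv ℝ out x (direction (x - T.center n)) := by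
  have hB := h.isBrokenGradient hfo hfi
  have h1 : ∀ i, ∀ᵐ x ∂volume.restrict T.interstitial, G x i = T.pieceGrad out inn x i := fun i =>
    (hG i).2.1.ae_eq T.isOpen_interstitial (hB i).2.1 (hG i).1 (hB i).1
  filter_upwards [ae_all_iff.2 h1, ae_restrict_mem T.isOpen_interstitial.measurableSet] with x hx hxI
  rw [radialDeriv, ← sum_coord_mul_fderiv]
  refine Finset.sum_congr rfl fun i _ => ?_
  rw [hx i, pieceGrad, glue_of_mem_interstitial hxI]

theorem IsPiecewise.radialDeriv_ae_eq_atom {out : E3 → ℂ} {inn : Fin N → E3 → ℂ}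
    (h : T.IsPiecewise out inn) {f : E3 → ℂ}
    (hfo : ∀ᵐ x ∂volume.restrict T.interstitial, f x = out x)
    (hfi : ∀ n, ∀ᵐ x ∂volume.restrict (T.atom n), f x = inn n x) {G : E3 → Fin 3 → ℂ}
    (hG : T.IsBrokenGradient f G) (n : Fin N) :
    ∀ᵐ x ∂volume.restrict (T.atom n),
      T.radialDeriv n G x = fderiv ℝ (inn n) x (direction (x - T.center n)) := by
  have hB := h.isBrokenGradient hfo hfi
  have h1 : ∀ i, ∀ᵐ x ∂volume.restrict (T.atom n), G x i = T.pieceGrad out inn x i := fun i =>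
    ((hG i).2.2 n).ae_eq (T.isOpen_atom n) ((hB i).2.2 n) (hG i).1 (hB i).1
  filter_upwards [ae_all_iff.2 h1, ae_restrict_mem (T.isOpen_atom n).measurableSet] with x hx hxI
  rw [radialDeriv, ← sum_coord_mul_fderiv]
  refine Finset.sum_congr rfl fun i _ => ?_
  rw [hx i, pieceGrad, glue_of_mem_atom hxI]

theorem IsBrokenGradient.aestronglyMeasurable_radialDeriv {f : E3 → ℂ} {G : E3 → Fin 3 → ℂ}
    (hG : T.IsBrokenGradient f G) (n : Fin N) :
    AEStronglyMeasurable (T.radialDeriv n G) volume := by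
  unfold radialDeriv
  refine Finset.aestronglyMeasurable_fun_sum _ fun i _ => ?_
  refine AEStronglyMeasurable.mul (Measurable.aestronglyMeasurable ?_) (hG i).1.1
  unfold direction
  fun_prop

theorem sphere_subset_awayFromCenters (n : Fin N) :
    Metric.sphere (T.center n) (T.radius n) ⊆ T.awayFromCenters := fun x hx n' h => by
  have h1 : dist x (T.center n) = T.radius n := hx
  by_cases hn : n' = n
  · rw [h, hn, dist_self] at h1
    exact (T.radius_pos n).ne h1
  · have h2 := T.nonoverlapping n' n hn
    rw [h] at h1
    linarith [T.radius_pos n']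

theorem IsPiecewise.hasTraceFrom_interstitial {out : E3 → ℂ} {inn : Fin N → E3 → ℂ}
    (h : T.IsPiecewise out inn) {f : E3 → ℂ}
    (hfo : ∀ᵐ x ∂volume.restrict T.interstitial, f x = out x) (n : Fin N) :
    HasTraceFrom T.interstitial (T.center n) (T.radius n) f
      fun θ => out (T.center n + T.radius n • θ) :=
  hasTraceFrom_of_continuousOn (T.radius_pos n) T.isOpen_interstitial.measurableSet hfo
    T.isOpen_awayFromCenters (sphere_subset_awayFromCenters n) h.out.contDiffOn.continuousOn

theorem IsPiecewise.hasTraceFrom_interstitial_fderiv {out : E3 → ℂ} {inn : Fin N → E3 → ℂ}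
    (h : T.IsPiecewise out inn) {f : E3 → ℂ} (n : Fin N)
    (hfo : ∀ᵐ x ∂volume.restrict T.interstitial,
      f x = fderiv ℝ out x (direction (x - T.center n))) :
    HasTraceFrom T.interstitial (T.center n) (T.radius n) f fun θ =>
      fderiv ℝ out (T.center n + T.radius n • θ)
        (direction (T.center n + T.radius n • θ - T.center n)) := by
  refine hasTraceFrom_of_continuousOn (F := fun x => fderiv ℝ out x (direction (x - T.center n)))
    (T.radius_pos n) T.isOpen_interstitial.measurableSet hfo
    T.isOpen_awayFromCenters (sphere_subset_awayFromCenters n) ?_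
  refine (h.out.contDiffOn.continuousOn_fderiv_of_isOpen T.isOpen_awayFromCenters
    (by norm_num)).clm_apply ?_
  exact contDiffOn_direction.continuousOn.comp (by fun_prop) fun x hx => sub_ne_zero.2 (hx n)

end MuffinTin

/-! ### Spherical components of the waves on the atomic spheres. -/

theorem angIdx_eq_iff {L : ℕ} {q q' : AngIdx L} :
    q = q' ↔ (q.1 : ℕ) = (q'.1 : ℕ) ∧ (q.2 : ℤ) = (q'.2 : ℤ) := by
  constructor
  · rintro rfl
    exact ⟨rfl, rfl⟩
  · obtain ⟨⟨l, hl⟩, ⟨m, hm⟩⟩ := q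
    obtain ⟨⟨l', hl'⟩, ⟨m', hm'⟩⟩ := q'
    rintro ⟨h1, h2⟩
    simp only at h1 h2
    subst h1
    subst h2
    rfl

theorem natAbs_angIdx_le {L : ℕ} (q : AngIdx L) : (q.2 : ℤ).natAbs ≤ (q.1 : ℕ) :=
  natAbs_le_of_mem_Icc q.2.2

theorem forall_angIdx {L : ℕ} {P : ℕ → ℤ → Prop} :
    (∀ ℓ ≤ L, ∀ m ∈ Finset.Icc (-(ℓ : ℤ)) (ℓ : ℤ), P ℓ m) ↔
      ∀ q : AngIdx L, P (q.1 : ℕ) (q.2 : ℤ) :=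
  ⟨fun h q => h _ (Nat.lt_succ_iff.1 q.1.2) _ q.2.2,
    fun h ℓ hℓ m hm => h ⟨⟨ℓ, Nat.lt_succ_iff.2 hℓ⟩, ⟨m, hm⟩⟩⟩

theorem integrable_sph {f : Sph → ℂ} (hf : Continuous f) : Integrable f surf :=
  hf.integrable_of_hasCompactSupport (HasCompactSupport.of_compactSpace _)

theorem integral_sum_mul_sph {ι : Type*} [Fintype ι] (a : ι → ℂ) {f : ι → Sph → ℂ}
    (hf : ∀ i, Continuous (f i)) {g : Sph → ℂ} (hg : Continuous g) :
    ∫ θ, (∑ i, a i * f i θ) * g θ ∂surf = ∑ i, a i * ∫ θ, f i θ * g θ ∂surf := by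
  simp only [Finset.sum_mul, mul_assoc]
  have hint : ∀ i ∈ Finset.univ, Integrable (fun θ => a i * (f i θ * g θ)) surf := fun i _ =>
    integrable_sph (continuous_const.mul ((hf i).mul hg))
  rw [integral_finsetSum _ hint]
  exact Finset.sum_congr rfl fun i _ => integral_const_mul _ _

section Hankel

variable {E : ℝ} {ℓ : ℕ} {m : ℤ}

theorem contDiffOn_hankelWave_sub (hE : E < 0) (ℓ : ℕ) (m : ℤ) (c : E3) :
    ContDiffOn ℝ 1 (fun x => hankelWave ℓ m E (x - c)) {c}ᶜ := by
  have h := contDiffOn_radialWave (ℓ := ℓ) (m := m) subset_rfl (contDiffOn_hankel_radial hE ℓ)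
  exact h.comp (by fun_prop) fun x hx => norm_pos_iff.2 (sub_ne_zero.2 hx)

/-- The addition theorem holds for all radii below `|d|` and may be differentiated with respect to
the radius. -/
theorem integral_fderiv_hankelWave_mul (hE : E < 0) {ℓ' : ℕ} {m' : ℤ} (hm : m.natAbs ≤ ℓ)
    (hm' : m'.natAbs ≤ ℓ') {d : E3} {r : ℝ} (hr : r ∈ Set.Ioo 0 ‖d‖) :
    ∫ θ : Sph, fderiv ℝ (fun x => hankelWave ℓ' m' E (x - d)) (r • (θ : E3)) θ *
        (sphericalHarmonic ℓ m θ : ℂ) ∂surf =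
      structureConstant ℓ m ℓ' m' E d *
        (energyRoot E * deriv (sphericalBessel ℓ) (energyRoot E * r)) := by
  have hf : ContDiffOn ℝ 1 (fun x => hankelWave ℓ' m' E (x - d)) (shell 0 ‖d‖) :=
    (contDiffOn_hankelWave_sub hE ℓ' m' d).mono fun x hx h => by
      rw [Set.mem_singleton_iff.1 h] at hx
      exact lt_irrefl _ hx.2
  have h1 := hasDerivAt_integral_comp_smul le_rfl hf (continuous_sphericalHarmonic_sph ℓ m) hr
  have h2 : HasDerivAt (fun s : ℝ => ∫ θ : Sph, (sphericalHarmonic ℓ m θ : ℂ) *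
      hankelWave ℓ' m' E (s • (θ : E3) - d) ∂surf) (structureConstant ℓ m ℓ' m' E d *
        (energyRoot E * deriv (sphericalBessel ℓ) (energyRoot E * r))) r := by
    refine ((hasDerivAt_bessel_radial hE ℓ hr.1).const_mul _).congr_of_eventuallyEq ?_
    filter_upwards [Ioo_mem_nhds hr.1 hr.2] with s hs
    rw [← integral_hankelWave_mul hE hm hm' hs]
    simp only [mul_comm]
  rw [← h1.unique h2]
  simp only [mul_comm]

end Hankel

namespace MuffinTin

variable {N : ℕ} (T : MuffinTin N) {L : ℕ} {E : ℝ}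

theorem isNormalized (hE : E < 0)
    (ht : ∀ n : Fin N, ∀ ℓ ≤ L, tDenominator (T.pot n) (T.radius n) ℓ E ≠ 0) (n : Fin N)
    (q : AngIdx L) : IsNormalizedRadialSolution (T.pot n) (T.radius n) q.1 E
      (normalizedSolution (T.pot n) (T.radius n) q.1 E) :=
  isNormalizedRadialSolution_normalizedSolution hE (T.radius_pos n) (T.continuousOn_pot n)
    (T.integrableOn_mul_pot n) (ht n q.1 (Nat.lt_succ_iff.1 q.1.2))

/-- The combination of Hankel waves with coefficients `b`. -/
def outerWave (E : ℝ) (b : Fin N × AngIdx L → ℂ) (x : E3) : ℂ :=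
  ∑ p : Fin N × AngIdx L, b p * hankelWave p.2.1 p.2.2 E (x - T.center p.1)

/-- The combination of regular waves at the `n`-th site with coefficients `a`. -/
def innerWave (E : ℝ) (a : Fin N × AngIdx L → ℂ) (n : Fin N) (x : E3) : ℂ :=
  ∑ q : AngIdx L, a (n, q) * T.zeta n q.1 q.2 E x

theorem isPiecewise_wave (hE : E < 0)
    (ht : ∀ n : Fin N, ∀ ℓ ≤ L, tDenominator (T.pot n) (T.radius n) ℓ E ≠ 0)
    (a b : Fin N × AngIdx L → ℂ) : T.IsPiecewise (T.outerWave E b) (T.innerWave E a) := by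
  refine ⟨?_, fun n => ?_⟩
  · refine C1Bound.sum T.isOpen_awayFromCenters T.interstitial_subset_awayFromCenters
      (f := fun p : Fin N × AngIdx L => fun x => hankelWave p.2.1 p.2.2 E (x - T.center p.1))
      (fun p => ⟨?_, ?_⟩) b
    · exact (contDiffOn_hankelWave_sub hE _ _ _).mono fun x hx => hx p.1
    · obtain ⟨C, hC0, hC⟩ := exists_hankelWave_bound hE p.2.1 p.2.2 (T.radius_pos p.1)
      set c := T.center p.1
      refine ⟨C * (1 + ‖c‖) ^ 2, fun x hx => ?_⟩
      have h1 : T.radius p.1 ≤ ‖x - c‖ := by rw [← dist_eq_norm]; exact (hx p.1).le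
      -- Moving the weight from the site to the origin costs a constant: `1 + |x| ≤ (1 + |c|)(1 + |x
      -- - c|)`.
      have h2 : C * ((1 + ‖x - c‖) ^ 2)⁻¹ ≤ C * (1 + ‖c‖) ^ 2 * ((1 + ‖x‖) ^ 2)⁻¹ := by
        rw [mul_assoc]
        refine mul_le_mul_of_nonneg_left ?_ hC0
        rw [← div_eq_mul_inv, inv_eq_one_div, div_le_div_iff₀ (by positivity) (by positivity),
          one_mul, ← mul_pow]
        refine pow_le_pow_left₀ (by positivity) ?_ 2
        have h3 : ‖x‖ ≤ ‖x - c‖ + ‖c‖ := norm_le_norm_sub_add x c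
        nlinarith [mul_nonneg (norm_nonneg c) (norm_nonneg (x - c))]
      refine ⟨(hC _ h1).1.trans h2, ?_⟩
      rw [fderiv_comp_sub (f := hankelWave p.2.1 p.2.2 E)]
      exact (hC _ h1).2.trans h2
  · refine C1Bound.sum (isOpen_atom_diff n) subset_rfl
      (f := fun q : AngIdx L => T.zeta n q.1 q.2 E) (fun q => ?_) fun q => a (n, q)
    have h := (T.isNormalized hE ht n q).regular
    refine c1Bound_radialWave (h.contDiffOn.mono Set.Ioo_subset_Ioc_self) ?_
      (h.exists_norm_deriv_le (T.continuousOn_pot n) (T.integrableOn_mul_pot n)) _ _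
    obtain ⟨C, hC⟩ := h.bounded
    exact ⟨C, fun r hr => hC r ⟨hr.1, hr.2.le⟩⟩

theorem fderiv_innerWave (hE : E < 0)
    (ht : ∀ n : Fin N, ∀ ℓ ≤ L, tDenominator (T.pot n) (T.radius n) ℓ E ≠ 0)
    (a : Fin N × AngIdx L → ℂ) {n : Fin N} {x : E3} (hx : x ∈ T.atom n \ {T.center n}) :
    fderiv ℝ (T.innerWave E a n) x (direction (x - T.center n)) =
      ∑ q : AngIdx L, a (n, q) * radialWave
        (deriv (normalizedSolution (T.pot n) (T.radius n) q.1 E)) q.1 q.2 (x - T.center n) := by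
  have hr := norm_sub_mem_Ioo hx
  have hder : ∀ q : AngIdx L, HasDerivAt (normalizedSolution (T.pot n) (T.radius n) q.1 E)
      (deriv (normalizedSolution (T.pot n) (T.radius n) q.1 E) ‖x - T.center n‖)
      ‖x - T.center n‖ := fun q =>
    (((T.isNormalized hE ht n q).regular.contDiffOn.differentiableOn (by norm_num) _
      ⟨hr.1, hr.2.le⟩).differentiableAt (Ioc_mem_nhds hr.1 hr.2)).hasDerivAt
  have hx0 := norm_pos_iff.1 hr.1
  have hd : ∀ q : AngIdx L, HasFDerivAt (T.zeta n q.1 q.2 E) (fderiv ℝ (radialWave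
      (normalizedSolution (T.pot n) (T.radius n) q.1 E) q.1 q.2) (x - T.center n)) x := fun q => by
    have h := (hasFDerivAt_radialWave (ℓ := q.1) (m := q.2) hx0 (hder q)).differentiableAt
    exact h.hasFDerivAt.comp x ((hasFDerivAt_id x).sub_const (T.center n))
  have hs : HasFDerivAt (T.innerWave E a n) (∑ q : AngIdx L, a (n, q) • fderiv ℝ (radialWave
      (normalizedSolution (T.pot n) (T.radius n) q.1 E) q.1 q.2) (x - T.center n)) x :=
    HasFDerivAt.fun_sum fun q _ => (hd q).const_mul (a (n, q))
  rw [hs.fderiv, ContinuousLinearMap.sum_apply]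
  refine Finset.sum_congr rfl fun q _ => ?_
  rw [ContinuousLinearMap.smul_apply, fderiv_radialWave_direction hx0 (hder q), smul_eq_mul]
  rfl

theorem fderiv_outerWave (hE : E < 0) (b : Fin N × AngIdx L → ℂ) {x : E3}
    (hx : x ∈ T.awayFromCenters) (v : E3) :
    fderiv ℝ (T.outerWave E b) x v = ∑ p : Fin N × AngIdx L,
      b p * fderiv ℝ (fun x => hankelWave p.2.1 p.2.2 E (x - T.center p.1)) x v := by
  have hd : ∀ p : Fin N × AngIdx L, HasFDerivAt
      (fun x => hankelWave p.2.1 p.2.2 E (x - T.center p.1))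
      (fderiv ℝ (fun x => hankelWave p.2.1 p.2.2 E (x - T.center p.1)) x) x := fun p =>
    (((contDiffOn_hankelWave_sub hE _ _ _).contDiffAt
      (isOpen_compl_singleton.mem_nhds (hx p.1))).differentiableAt (by norm_num)).hasFDerivAt
  have hs : HasFDerivAt (T.outerWave E b) (∑ p : Fin N × AngIdx L,
      b p • fderiv ℝ (fun x => hankelWave p.2.1 p.2.2 E (x - T.center p.1)) x) x :=
    HasFDerivAt.fun_sum fun p _ => (hd p).const_mul (b p)
  rw [hs.fderiv, ContinuousLinearMap.sum_apply]
  rfl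

theorem radius_mem_Ioo {n n' : Fin N} (hn : n' ≠ n) :
    T.radius n ∈ Set.Ioo 0 ‖T.center n' - T.center n‖ := by
  refine ⟨T.radius_pos n, ?_⟩
  have h := T.nonoverlapping n' n hn
  rw [dist_eq_norm] at h
  linarith [T.radius_pos n']

/-- A wave centred at the site itself is evaluated by orthonormality. A wave centred elsewhere falls
under the addition theorem, since the radius of the sphere is less than the distance of the two
centres. -/
theorem integral_hankelWave_sphere (hE : E < 0) (n : Fin N) (q : AngIdx L)
    (p : Fin N × AngIdx L) :
    ∫ θ : Sph, hankelWave p.2.1 p.2.2 E (T.center n + T.radius n • (θ : E3) - T.center p.1) *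
        (sphericalHarmonic q.1 q.2 θ : ℂ) ∂surf =
      (if p = (n, q) then sphericalHankel q.1 (energyRoot E * T.radius n) else 0) +
        T.g n p.1 q.1 q.2 p.2.1 p.2.2 E * sphericalBessel q.1 (energyRoot E * T.radius n) := by
  obtain ⟨n', q'⟩ := p
  by_cases hn : n' = n
  · subst hn
    rw [g, if_pos rfl, zero_mul, add_zero]
    simp only [add_sub_cancel_left, hankelWave_eq_radialWave,
      radialWave_smul_sph _ _ _ (T.radius_pos n'), mul_assoc]
    rw [integral_const_mul, integral_sphericalHarmonic_mul (natAbs_angIdx_le q')]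
    by_cases hq : q' = q
    · subst hq
      simp
    · rw [if_neg (mt angIdx_eq_iff.2 hq), if_neg (fun h => hq (Prod.ext_iff.1 h).2), mul_zero]
  · rw [if_neg (fun h => hn (Prod.ext_iff.1 h).1), zero_add, g, if_neg (Ne.symm hn),
      ← integral_hankelWave_mul hE (natAbs_angIdx_le q) (natAbs_angIdx_le q') (T.radius_mem_Ioo hn)]
    refine integral_congr_ae (Eventually.of_forall fun θ => ?_)
    have e : T.center n + T.radius n • (θ : E3) - T.center n' =
        T.radius n • (θ : E3) - (T.center n' - T.center n) := by abel
    simp only [e]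

theorem integral_fderiv_hankelWave_sphere (hE : E < 0) (n : Fin N) (q : AngIdx L)
    (p : Fin N × AngIdx L) :
    ∫ θ : Sph, fderiv ℝ (fun x => hankelWave p.2.1 p.2.2 E (x - T.center p.1))
        (T.center n + T.radius n • (θ : E3)) θ * (sphericalHarmonic q.1 q.2 θ : ℂ) ∂surf =
      (if p = (n, q) then energyRoot E * deriv (sphericalHankel q.1) (energyRoot E * T.radius n)
        else 0) + T.g n p.1 q.1 q.2 p.2.1 p.2.2 E *
          (energyRoot E * deriv (sphericalBessel q.1) (energyRoot E * T.radius n)) := by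
  obtain ⟨n', q'⟩ := p
  have hR := T.radius_pos n
  by_cases hn : n' = n
  · subst hn
    rw [g, if_pos rfl, zero_mul, add_zero]
    have e : ∀ θ : Sph, fderiv ℝ (fun x => hankelWave q'.1 q'.2 E (x - T.center n'))
        (T.center n' + T.radius n' • (θ : E3)) θ =
        energyRoot E * deriv (sphericalHankel q'.1) (energyRoot E * T.radius n') *
          (sphericalHarmonic q'.1 q'.2 θ : ℂ) := fun θ => by
      have hx : T.radius n' • (θ : E3) ≠ 0 := by
        rw [← norm_pos_iff, norm_smul_sph hR]; exact hR
      have hder := hasDerivAt_hankel_radial hE q'.1 hR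
      rw [← norm_smul_sph hR θ] at hder
      have h1 := fderiv_radialWave_direction (ℓ := q'.1) (m := q'.2) hx hder
      rw [direction_smul_sph hR, radialWave_smul_sph _ _ _ hR, norm_smul_sph hR] at h1
      rw [fderiv_comp_sub (f := hankelWave q'.1 q'.2 E), add_sub_cancel_left]
      exact h1
    simp only [e, mul_assoc]
    simp only [← mul_assoc (energyRoot E)]
    rw [integral_const_mul, integral_sphericalHarmonic_mul (natAbs_angIdx_le q')]
    by_cases hq : q' = q
    · subst hq
      simp
    · rw [if_neg (mt angIdx_eq_iff.2 hq), if_neg (fun h => hq (Prod.ext_iff.1 h).2), mul_zero]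
  · rw [if_neg (fun h => hn (Prod.ext_iff.1 h).1), zero_add, g, if_neg (Ne.symm hn),
      ← integral_fderiv_hankelWave_mul hE (natAbs_angIdx_le q) (natAbs_angIdx_le q')
        (T.radius_mem_Ioo hn)]
    refine integral_congr_ae (Eventually.of_forall fun θ => ?_)
    have e : T.center n + T.radius n • (θ : E3) - T.center n' =
        T.radius n • (θ : E3) - (T.center n' - T.center n) := by abel
    simp only
    rw [fderiv_comp_sub (f := hankelWave q'.1 q'.2 E), fderiv_comp_sub (f := hankelWave q'.1 q'.2 E),
      e]

end MuffinTin

/-! ### Matching on the spheres and the secular equation. -/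

theorem sphereIntegral_jump_mul {L : ℕ} {ι : Type*} [Fintype ι] (a : AngIdx L → ℂ)
    (χ₀ : AngIdx L → ℂ) (b : ι → ℂ) {F : ι → Sph → ℂ} (hF : ∀ i, Continuous (F i))
    (q : AngIdx L) :
    ∫ θ : Sph, ((∑ q' : AngIdx L, a q' * (χ₀ q' * (sphericalHarmonic q'.1 q'.2 θ : ℂ))) -
        ∑ i, b i * F i θ) * (sphericalHarmonic q.1 q.2 θ : ℂ) ∂surf =
      a q * χ₀ q - ∑ i, b i * ∫ θ : Sph, F i θ * (sphericalHarmonic q.1 q.2 θ : ℂ) ∂surf := by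
  have hY : ∀ q : AngIdx L, Continuous fun θ : Sph => (sphericalHarmonic q.1 q.2 θ : ℂ) :=
    fun q => continuous_sphericalHarmonic_sph _ _
  have hc : ∀ q' : AngIdx L, Continuous fun θ : Sph =>
      χ₀ q' * (sphericalHarmonic q'.1 q'.2 θ : ℂ) := fun q' => continuous_const.mul (hY q')
  simp only [sub_mul]
  rw [integral_sub, integral_sum_mul_sph a hc (hY q), integral_sum_mul_sph b hF (hY q)]
  · congr 1
    simp only [mul_assoc, integral_const_mul,
      integral_sphericalHarmonic_mul (natAbs_angIdx_le _), ← angIdx_eq_iff]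
    simp
  · exact integrable_sph ((continuous_finsetSum _ fun q' _ =>
      continuous_const.mul (hc q')).mul (hY q))
  · exact integrable_sph ((continuous_finsetSum _ fun i _ =>
      continuous_const.mul (hF i)).mul (hY q))

theorem sum_mul_ite_add {ι : Type*} [Fintype ι] [DecidableEq ι] (b g : ι → ℂ) (i : ι) (h j : ℂ) :
    ∑ p, b p * ((if p = i then h else 0) + g p * j) = b i * h + (∑ p, g p * b p) * j := by
  simp only [mul_add, Finset.sum_add_distrib, mul_ite, mul_zero, Finset.sum_ite_eq',
    Finset.mem_univ, if_true, Finset.sum_mul]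
  congr 1
  exact Finset.sum_congr rfl fun p _ => by ring

/-- Matching of value and slope, by the non-vanishing of the Wronskian. -/
theorem matching_iff {a b G j h j' h' t κ : ℂ} (hκ : κ ≠ 0) (hw : j * h' - j' * h ≠ 0) :
    (a * (j + t * h) = b * h + G * j ∧ a * (κ * (j' + t * h')) = b * (κ * h') + G * (κ * j')) ↔
      a = G ∧ b = t * a := by
  constructor
  · rintro ⟨h1, h2⟩
    have h3 : a * (j' + t * h') = b * h' + G * j' := by
      refine mul_left_cancel₀ hκ ?_
      linear_combination h2
    have h4 : a = G := by
      refine mul_right_cancel₀ hw ?_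
      -- Cramer's rule: eliminating `h` isolates the coefficient of `j`, and below eliminating `j`
      -- isolates that of `h`, in both cases multiplied by the Wronskian.
      linear_combination h' * h1 - h * h3
    refine ⟨h4, ?_⟩
    refine mul_right_cancel₀ hw ?_
    subst h4
    linear_combination j' * h1 - j * h3
  · rintro ⟨rfl, rfl⟩
    constructor <;> ring

namespace MuffinTin

variable {N : ℕ} {T : MuffinTin N} {L : ℕ} {E : ℝ}

theorem isWeaklyContinuous_wave_iff (hE : E < 0)
    (ht : ∀ n : Fin N, ∀ ℓ ≤ L, tDenominator (T.pot n) (T.radius n) ℓ E ≠ 0)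
    (a b : Fin N × AngIdx L → ℂ) {f : E3 → ℂ} (hf : AEStronglyMeasurable f volume)
    (hfo : ∀ᵐ x ∂volume.restrict T.interstitial, f x = T.outerWave E b x)
    (hfi : ∀ n, ∀ᵐ x ∂volume.restrict (T.atom n), f x = T.innerWave E a n x) (n : Fin N) :
    T.IsWeaklyContinuous L n f ↔ ∀ q : AngIdx L,
      a (n, q) * normalizedSolution (T.pot n) (T.radius n) q.1 E (T.radius n) =
        b (n, q) * sphericalHankel q.1 (energyRoot E * T.radius n) +
          (∑ p : Fin N × AngIdx L, T.g n p.1 q.1 q.2 p.2.1 p.2.2 E * b p) *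
            sphericalBessel q.1 (energyRoot E * T.radius n) := by
  have hp := T.isPiecewise_wave hE ht a b
  have hR := T.radius_pos n
  have h₁ := hasTraceFrom_ball_radialWave hR (fun q : AngIdx L => a (n, q))
    (fun q => (T.isNormalized hE ht n q).regular.tendsto_left hR) (fun q => q.1) (fun q => q.2)
    (hfi n)
  have hF : ∀ p : Fin N × AngIdx L, Continuous fun θ : Sph =>
      hankelWave p.2.1 p.2.2 E (T.center n + T.radius n • (θ : E3) - T.center p.1) := fun p =>
    (contDiffOn_hankelWave_sub hE _ _ _).continuousOn.comp_continuous (by fun_prop) fun θ =>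
      sphere_subset_awayFromCenters n (by
        rw [mem_sphere_iff_norm, add_sub_cancel_left, norm_smul_sph hR]) p.1
  rw [isWeaklyContinuous_iff hf h₁ (hp.hasTraceFrom_interstitial hfo n),
    forall_angIdx (P := fun ℓ m => sphereIntegral (fun θ => (_ - _) *
      (sphericalHarmonic ℓ m θ : ℂ)) = 0)]
  refine forall_congr' fun q => ?_
  have key := sphereIntegral_jump_mul (fun q : AngIdx L => a (n, q))
    (fun q => normalizedSolution (T.pot n) (T.radius n) q.1 E (T.radius n)) b hF q
  simp only [T.integral_hankelWave_sphere hE n q] at key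
  rw [sum_mul_ite_add] at key
  refine Iff.trans ?_ sub_eq_zero
  rw [← key]
  rfl

theorem isWeaklyContinuous_radialDeriv_wave_iff (hE : E < 0)
    (ht : ∀ n : Fin N, ∀ ℓ ≤ L, tDenominator (T.pot n) (T.radius n) ℓ E ≠ 0)
    (a b : Fin N × AngIdx L → ℂ) {f : E3 → ℂ}
    (hfo : ∀ᵐ x ∂volume.restrict T.interstitial, f x = T.outerWave E b x)
    (hfi : ∀ n, ∀ᵐ x ∂volume.restrict (T.atom n), f x = T.innerWave E a n x)
    {G : E3 → Fin 3 → ℂ} (hG : T.IsBrokenGradient f G) (n : Fin N) :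
    T.IsWeaklyContinuous L n (T.radialDeriv n G) ↔ ∀ q : AngIdx L,
      a (n, q) * leftDeriv (normalizedSolution (T.pot n) (T.radius n) q.1 E) (T.radius n) =
        b (n, q) * (energyRoot E * deriv (sphericalHankel q.1) (energyRoot E * T.radius n)) +
          (∑ p : Fin N × AngIdx L, T.g n p.1 q.1 q.2 p.2.1 p.2.2 E * b p) *
            (energyRoot E * deriv (sphericalBessel q.1) (energyRoot E * T.radius n)) := by
  have hp := T.isPiecewise_wave hE ht a b
  have hR := T.radius_pos n
  have hin : ∀ᵐ x ∂volume.restrict (T.atom n), T.radialDeriv n G x =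
      ∑ q : AngIdx L, a (n, q) * radialWave
        (deriv (normalizedSolution (T.pot n) (T.radius n) q.1 E)) q.1 q.2 (x - T.center n) := by
    have hne : ∀ᵐ x : E3, x ≠ T.center n := by
      rw [ae_iff]; simp
    filter_upwards [hp.radialDeriv_ae_eq_atom hfo hfi hG n,
      ae_restrict_mem (T.isOpen_atom n).measurableSet, ae_restrict_of_ae hne] with x hx hxa hxc
    rw [hx, T.fderiv_innerWave hE ht a ⟨hxa, hxc⟩]
  have h₁ := hasTraceFrom_ball_radialWave hR (fun q : AngIdx L => a (n, q))
    (fun q => (T.isNormalized hE ht n q).regular.tendsto_deriv_left hR) (fun q => q.1)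
    (fun q => q.2) hin
  have h₂ := hp.hasTraceFrom_interstitial_fderiv n
    (hp.radialDeriv_ae_eq_interstitial hfo hfi hG n)
  have hmem : ∀ θ : Sph, T.center n + T.radius n • (θ : E3) ∈ T.awayFromCenters := fun θ =>
    sphere_subset_awayFromCenters n (by
      rw [mem_sphere_iff_norm, add_sub_cancel_left, norm_smul_sph hR])
  have hF : ∀ p : Fin N × AngIdx L, Continuous fun θ : Sph =>
      fderiv ℝ (fun x => hankelWave p.2.1 p.2.2 E (x - T.center p.1))
        (T.center n + T.radius n • (θ : E3)) θ := fun p =>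
    (((contDiffOn_hankelWave_sub hE _ _ _).continuousOn_fderiv_of_isOpen isOpen_compl_singleton
      (by norm_num)).comp_continuous (by fun_prop) fun θ => hmem θ p.1).clm_apply
        continuous_subtype_val
  -- On the inside the trace is the left derivative of the radial factor, on the outside the
  -- classical radial derivative; projecting their difference on `Y_{ℓm}` gives the slope condition.
  rw [isWeaklyContinuous_iff (hG.aestronglyMeasurable_radialDeriv n) h₁ h₂,
    forall_angIdx (P := fun ℓ m => sphereIntegral (fun θ => (_ - _) *
      (sphericalHarmonic ℓ m θ : ℂ)) = 0)]
  refine forall_congr' fun q => ?_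
  have key := sphereIntegral_jump_mul (fun q : AngIdx L => a (n, q))
    (fun q => leftDeriv (normalizedSolution (T.pot n) (T.radius n) q.1 E) (T.radius n)) b hF q
  simp only [T.integral_fderiv_hankelWave_sphere hE n q] at key
  rw [sum_mul_ite_add] at key
  refine Iff.trans ?_ sub_eq_zero
  rw [← key, sphereIntegral]
  refine Eq.congr_left (integral_congr_ae (Eventually.of_forall fun θ => ?_))
  simp only [add_sub_cancel_left, direction_smul_sph hR, T.fderiv_outerWave hE b (hmem θ)]

theorem kkrMatrix_mulVec_apply (a : Fin N × AngIdx L → ℂ) (p : Fin N × AngIdx L) :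
    (T.kkrMatrix L E).mulVec a p = a p - ∑ q : Fin N × AngIdx L,
      T.g p.1 q.1 p.2.1 p.2.2 q.2.1 q.2.2 E * (T.t q.1 q.2.1 E * a q) := by
  simp only [Matrix.mulVec, dotProduct, kkrMatrix, sub_mul, Finset.sum_sub_distrib, ite_mul,
    one_mul, zero_mul, Finset.sum_ite_eq, Finset.mem_univ, if_true]
  congr 1
  exact Finset.sum_congr rfl fun q _ => by ring

/-- Weak continuity of value and radial derivative amounts to the KKR equations. -/
theorem isWeaklyContinuous_and_iff (hE : E < 0)
    (ht : ∀ n : Fin N, ∀ ℓ ≤ L, tDenominator (T.pot n) (T.radius n) ℓ E ≠ 0)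
    (a b : Fin N × AngIdx L → ℂ) {f : E3 → ℂ} (hf : AEStronglyMeasurable f volume)
    (hfo : ∀ᵐ x ∂volume.restrict T.interstitial, f x = T.outerWave E b x)
    (hfi : ∀ n, ∀ᵐ x ∂volume.restrict (T.atom n), f x = T.innerWave E a n x)
    {G : E3 → Fin 3 → ℂ} (hG : T.IsBrokenGradient f G) :
    ((∀ n, T.IsWeaklyContinuous L n f) ∧ ∀ n, T.IsWeaklyContinuous L n (T.radialDeriv n G)) ↔
      (T.kkrMatrix L E).mulVec a = 0 ∧ b = fun p => T.t p.1 p.2.1 E * a p := by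
  have key : ((∀ n, T.IsWeaklyContinuous L n f) ∧
      ∀ n, T.IsWeaklyContinuous L n (T.radialDeriv n G)) ↔ ∀ p : Fin N × AngIdx L,
      a p = (∑ q : Fin N × AngIdx L, T.g p.1 q.1 p.2.1 p.2.2 q.2.1 q.2.2 E * b q) ∧
        b p = T.t p.1 p.2.1 E * a p := by
    simp only [isWeaklyContinuous_wave_iff hE ht a b hf hfo hfi,
      isWeaklyContinuous_radialDeriv_wave_iff hE ht a b hfo hfi hG]
    rw [← forall_and, Prod.forall]
    refine forall_congr' fun n => ?_
    rw [← forall_and]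
    refine forall_congr' fun q => ?_
    -- For each site and each `(ℓ, m)` the two conditions form a `2 × 2` system, because `χ`
    -- continues as `j_ℓ + t h_ℓ` in value and slope.
    have hn := T.isNormalized hE ht n q
    rw [hn.value, hn.slope]
    exact matching_iff (energyRoot_ne_zero hE)
      (wronskian_ne_zero _ (energyRoot_mul_ne_zero hE (T.radius_pos n)))
  rw [key]
  constructor
  · intro h
    have hb : b = fun p => T.t p.1 p.2.1 E * a p := funext fun p => (h p).2
    refine ⟨funext fun p => ?_, hb⟩
    rw [kkrMatrix_mulVec_apply, Pi.zero_apply, sub_eq_zero, (h p).1, hb]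
  · rintro ⟨h, rfl⟩ p
    refine ⟨?_, rfl⟩
    have h1 := congrFun h p
    rw [kkrMatrix_mulVec_apply, Pi.zero_apply, sub_eq_zero] at h1
    exact h1

/-- Both sets consist of functions with the same kind of expansions, and weak continuity is
equivalent to the equations for the coefficients. The determinant plays no role: if `S(E)` is
invertible, both sets contain only zero. -/
theorem weakSpace_eq_waveFunctions (hE : E < 0)
    (ht : ∀ n : Fin N, ∀ ℓ ≤ L, tDenominator (T.pot n) (T.radius n) ℓ E ≠ 0) :
    T.weakSpace L E = T.waveFunctions L E := by
  ext ψ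
  have hm := (Lp.memLp ψ).1
  constructor
  · rintro ⟨⟨b, hb⟩, ⟨a, ha⟩, hw, G, hG, hw'⟩
    obtain ⟨hS, rfl⟩ := (isWeaklyContinuous_and_iff hE ht a b hm hb ha hG).1 ⟨hw, hw'⟩
    exact ⟨⟨G, hG⟩, a, hS, ha, hb⟩
  · rintro ⟨⟨G, hG⟩, a, hS, ha, hb⟩
    obtain ⟨hw, hw'⟩ := (isWeaklyContinuous_and_iff hE ht a _ hm hb ha hG).2 ⟨hS, rfl⟩
    exact ⟨⟨_, hb⟩, ⟨a, ha⟩, hw, G, hG, hw'⟩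

/-- A combination of regular waves which vanishes in all atomic spheres is trivial. -/
theorem eq_zero_of_innerWave_ae_eq_zero (hE : E < 0)
    (ht : ∀ n : Fin N, ∀ ℓ ≤ L, tDenominator (T.pot n) (T.radius n) ℓ E ≠ 0)
    {a : Fin N × AngIdx L → ℂ}
    (h : ∀ n, ∀ᵐ x ∂volume.restrict (T.atom n), T.innerWave E a n x = 0) : a = 0 := by
  have hp := T.isPiecewise_wave hE ht a 0
  funext ⟨n, q⟩
  have hR := T.radius_pos n
  have hreg := (T.isNormalized hE ht n q).regular
  have h0 : Set.EqOn (T.innerWave E a n) (fun _ => 0) (T.atom n \ {T.center n}) := by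
    refine Measure.eqOn_open_of_ae_eq (μ := volume) ?_ (isOpen_atom_diff n)
      (hp.inn n).contDiffOn.continuousOn continuousOn_const
    exact ae_restrict_of_ae_restrict_of_subset Set.sdiff_subset (h n)
  have h1 : ∀ r ∈ Set.Ioo 0 (T.radius n),
      a (n, q) * normalizedSolution (T.pot n) (T.radius n) q.1 E r = 0 := fun r hr => by
    -- Projection of the inner wave on a single harmonic at radius `r`; the outer sum is taken over
    -- the empty index type.
    have h2 := sphereIntegral_jump_mul (ι := Empty) (fun q : AngIdx L => a (n, q))
      (fun q => normalizedSolution (T.pot n) (T.radius n) q.1 E r) Empty.elim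
      (F := fun i _ => i.elim) (fun i => i.elim) q
    simp only [Finset.univ_eq_empty, Finset.sum_empty, sub_zero] at h2
    rw [← h2]
    refine integral_eq_zero_of_ae (Eventually.of_forall fun θ => ?_)
    have hx : T.center n + r • (θ : E3) ∈ T.atom n \ {T.center n} := by
      refine ⟨?_, fun h3 => ?_⟩
      · rw [atom, mem_ball_iff_norm, add_sub_cancel_left, norm_smul_sph hr.1]
        exact hr.2
      · have h4 := norm_smul_sph hr.1 θ
        rw [add_eq_left.1 (Set.mem_singleton_iff.1 h3), norm_zero] at h4
        exact hr.1.ne h4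
    have h5 := h0 hx
    simp only [innerWave, zeta, add_sub_cancel_left, norm_smul_sph hr.1,
      direction_smul_sph hr.1] at h5
    simp only [h5, zero_mul, Pi.zero_apply]
  by_contra ha
  have h6 : ∀ r ∈ Set.Ioo 0 (T.radius n),
      normalizedSolution (T.pot n) (T.radius n) q.1 E r = 0 := fun r hr =>
    (mul_eq_zero.1 (h1 r hr)).resolve_left ha
  obtain ⟨r, hr, hne⟩ := hreg.nontrivial
  -- The witness of non-triviality may be the end point `R`, which is outside the open ball; there
  -- the value is the limit of the values from the left.
  rcases hr.2.lt_or_eq with hlt | rfl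
  · exact hne (h6 r ⟨hr.1, hlt⟩)
  · refine hne (tendsto_nhds_unique (hreg.tendsto_left hR) ?_)
    refine tendsto_const_nhds.congr' ?_
    filter_upwards [Ioo_mem_nhdsLT hR] with s hs
    exact (h6 s hs).symm

theorem eq_zero_of_expansions {u : Lp ℂ 2 (volume : Measure E3)}
    (ha : T.AtomicExpansion L E 0 u) (hb : T.InterstitialExpansion L E 0 u) : u = 0 := by
  rw [Lp.eq_zero_iff_ae_eq_zero]
  have ha' : ∀ᵐ x : E3, ∀ n, x ∈ T.atom n → u x = 0 := by
    rw [ae_all_iff]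
    intro n
    have h := ha n
    rw [ae_restrict_iff' (T.isOpen_atom n).measurableSet] at h
    filter_upwards [h] with x hx hxn
    rw [hx hxn]
    simp
  rw [InterstitialExpansion, ae_restrict_iff' T.isOpen_interstitial.measurableSet] at hb
  filter_upwards [ha', hb, T.ae_mem_region] with x h1 h2 h3
  rcases h3 with h3 | ⟨n, h3⟩
  · rw [h2 h3]
    simp
  · rw [h1 n h3, Pi.zero_apply]

/-- Membership in the broken Sobolev space puts no condition on the spheres, so the inner and outer
coefficients may be prescribed independently. -/
theorem exists_waveFunction (hE : E < 0)
    (ht : ∀ n : Fin N, ∀ ℓ ≤ L, tDenominator (T.pot n) (T.radius n) ℓ E ≠ 0)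
    (a b : Fin N × AngIdx L → ℂ) : ∃ u ∈ T.brokenH1,
      T.AtomicExpansion L E a u ∧ T.InterstitialExpansion L E b u := by
  have hp := T.isPiecewise_wave hE ht a b
  have hu := hp.memLp.coeFn_toLp
  have hb : T.InterstitialExpansion L E b (hp.memLp.toLp _) := by
    filter_upwards [ae_restrict_of_ae hu, ae_restrict_mem T.isOpen_interstitial.measurableSet]
      with x hx hxI
    rw [hx, glue_of_mem_interstitial hxI]
    rfl
  have ha : T.AtomicExpansion L E a (hp.memLp.toLp _) := fun n => by
    filter_upwards [ae_restrict_of_ae hu, ae_restrict_mem (T.isOpen_atom n).measurableSet]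
      with x hx hxn
    rw [hx, glue_of_mem_atom hxn]
    rfl
  exact ⟨_, ⟨_, hp.isBrokenGradient hb ha⟩, ha, hb⟩

/-- A vanishing determinant means a non-zero kernel vector `a`. Its wave function is non-zero, as it
already determines `a` inside the atoms. Conversely a non-zero function cannot have `a = 0`, because
then the outer coefficients `t a` vanish as well. -/
theorem solvesKKR_iff_nonempty (hE : E < 0)
    (ht : ∀ n : Fin N, ∀ ℓ ≤ L, tDenominator (T.pot n) (T.radius n) ℓ E ≠ 0) :
    T.SolvesKKR L E ↔ (T.weakSpace L E \ {0}).Nonempty := by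
  rw [SolvesKKR, ← Matrix.exists_mulVec_eq_zero_iff, weakSpace_eq_waveFunctions hE ht]
  constructor
  · rintro ⟨a, ha, hS⟩
    obtain ⟨u, hu, hua, hub⟩ := exists_waveFunction hE ht a fun p => T.t p.1 p.2.1 E * a p
    refine ⟨u, ⟨hu, a, hS, hua, hub⟩, fun h0 => ha ?_⟩
    refine eq_zero_of_innerWave_ae_eq_zero hE ht fun n => ?_
    filter_upwards [hua n, ae_restrict_of_ae (Lp.eq_zero_iff_ae_eq_zero.1
      (Set.mem_singleton_iff.1 h0))] with x h1 h2
    rw [innerWave, ← h1, h2, Pi.zero_apply]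
  · rintro ⟨u, ⟨-, a, hS, hua, hub⟩, hne⟩
    refine ⟨a, fun h0 => hne ?_, hS⟩
    subst h0
    refine eq_zero_of_expansions hua ?_
    convert hub using 1
    funext p
    simp

end MuffinTin

end KKR

end

theorem mainTheorem3 {N : ℕ} (T : KKR.MuffinTin N) (L : ℕ) (E : ℝ) (hE : E < 0)
    (ht : ∀ n : Fin N, ∀ ℓ ≤ L, KKR.tDenominator (T.pot n) (T.radius n) ℓ E ≠ 0) :
    (T.SolvesKKR L E ↔ (T.weakSpace L E \ {0}).Nonempty) ∧
      (T.SolvesKKR L E → T.weakSpace L E = T.waveFunctions L E) := by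
  exact ⟨KKR.MuffinTin.solvesKKR_iff_nonempty hE ht,
    fun _ => KKR.MuffinTin.weakSpace_eq_waveFunctions hE ht⟩
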